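/- Let $k$ be a field of characteristic $0$. Algebras are not assumed associative, commutative or unital. For a $k$-algebra $A$ that is finite-dimensional over $k$, an $A$-lattice is a $k$-subalgebra $W\subseteq A((z))$ such that $h_0(W)=\dim_k(A[[z]]\cap W)$ and $h_1(W)=\dim_k A((z))/(A[[z]]+W)$ are finite; the pair $(h_0(W),h_1(W))$ is the index of $W$. For an integer $n$ put $W_n=W\cap z^{-n}A[[z]]$. Let $O\subseteq k((z))$ be a unital $k$-lattice, let $\mathrm{gr}(O)=\bigoplus_{n\ge 0}t^nO_n\subseteq O[t]$ (a graded unital $k$-algebra), and let $X=\mathrm{Proj}(\mathrm{gr}(O))$. Then the following hold. (1) $O$ has Krull dimension $1$ and $O\cap k[[z]]=k$; in particular $h_0(O)=1$. (2) $X$ is an integral projective curve over $k$ of arithmetic genus $1-\chi(\mathcal O_X)=h^1(\mathcal O_X)=h_1(O)$. (3) The ideal $(t)\subseteq\mathrm{gr}(O)$ is a point $p$ of $X$, and $p$ is $k$-rational and smooth. There is a $k$-algebra isomorphism $c\colon\widehat{\mathcal O}_{X,p}\to k[[z]]$ whose extension $c\colon \mathrm{Q}(\widehat{\mathcal O}_{X,p})\to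 k((z))$ to fields of fractions maps $\Gamma(X\setminus\{p\},\mathcal O_X)$ bijectively onto $O$, mapping the function $(t^nf)/t^n$ to $f$ for all $n\ge 0$ and $f\in O_n$, and which thereby induces an isomorphism of $k$-schemes $\mathrm{Spec}(O)\cong X\setminus\{p\}$. Moreover, $p$ and $c$ can be chosen such that the following holds for every finite-dimensional $k$-algebra $A$ and every $A$-lattice $W$ with $OW\subseteq W$. (4) $\mathrm{gr}(W)=\bigoplus_{n\in\mathbb Z}t^nW_n\subseteq W[t,t^{-1}]$ is a graded algebra over $\mathrm{gr}(O)$, and the associated sheaf of algebras $\mathcal A$ on $X$ is coherent and torsion-free. (5) There is a $c$-equivariant isomorphism of algebras $\zeta\colon\widehat{\mathcal A}_p\to A[[z]]$ from the completed stalk of $\mathcal A$ at $p$ (that is, $\zeta$ is additive and multiplicative and $\zeta(rm)=c(r)\zeta(m)$ for $r\in\widehat{\mathcal O}_{X,p}$), such that the induced map $\widehat{\mathcal A}_p\otimes\mathrm{Q}(\widehat{\mathcal O}_{X,p})\to A((z))$, $a\otimes b^{-1}\mapsto c(b)^{-1}\zeta(a)$, maps $\Gamma(X\setminus\{p\},\mathcal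 A)$ bijectively onto $W$ and maps the section $(t^nw)/t^n$ to $w$ for all $n\ge 0$ and $w\in W_n$. (6) $h^0(\mathcal A)=h_0(W)$ and $h^1(\mathcal A)=h_1(W)$. -/

import Mathlib

universe u
-- Mathlib has a second `k`-algebra structure on `k((z))`, through `k[[z]]`; use the coefficientwise one.
attribute [local instance 2000] HahnSeries.instAlgebra

namespace GeomLattice

section Laurent
open Finset HahnSeries
open scoped Pointwise
variable {k A : Type u} [Field k] [NonUnitalNonAssocRing A] [Module k A]

/-- The action of `k((z))` on `A((z))` by multiplication of series. -/
noncomputable def act (f : HahnSeries ℤ k) (a : HahnSeries ℤ A) : HahnSeries ℤ A :=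
  (HahnModule.of k).symm (f • HahnModule.of k a)

theorem coeff_act (f : HahnSeries ℤ k) (a : HahnSeries ℤ A) (n : ℤ) {s t : Set ℤ}
    (hs : s.IsPWO) (ht : t.IsPWO) (hfs : f.support ⊆ s) (hat : a.support ⊆ t) :
    (act f a).coeff n = ∑ ij ∈ Finset.antidiagonal hs ht n, f.coeff ij.1 • a.coeff ij.2 := by
  change ∑ ij ∈ _, _ = _
  apply Finset.sum_subset
  · intro ij h
    simp only [mem_vaddAntidiagonal, Finset.mem_antidiagonal] at h ⊢
    exact ⟨hfs h.1, hat h.2.1, h.2.2⟩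
  · intro ij h h'
    simp only [mem_vaddAntidiagonal, Finset.mem_antidiagonal] at h h'
    by_cases h1 : f.coeff ij.1 = 0
    · simp [h1]
    by_cases h2 : a.coeff ij.2 = 0
    · simp [h2]
    exact absurd ⟨h1, h2, h.2.2⟩ h'

theorem coeff_mul'' (a b : HahnSeries ℤ A) (n : ℤ) {s t : Set ℤ}
    (hs : s.IsPWO) (ht : t.IsPWO) (has : a.support ⊆ s) (hbt : b.support ⊆ t) :
    (a * b).coeff n = ∑ ij ∈ Finset.antidiagonal hs ht n, a.coeff ij.1 * b.coeff ij.2 := by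
  rw [coeff_mul]
  apply Finset.sum_subset
  · intro ij h
    simp only [Finset.mem_antidiagonal] at h ⊢
    exact ⟨has h.1, hbt h.2.1, h.2.2⟩
  · intro ij h h'
    simp only [Finset.mem_antidiagonal] at h h'
    by_cases h1 : a.coeff ij.1 = 0
    · simp [h1]
    by_cases h2 : b.coeff ij.2 = 0
    · simp [h2]
    exact absurd ⟨h1, h2, h.2.2⟩ h'

theorem support_act_subset (f : HahnSeries ℤ k) (a : HahnSeries ℤ A) :
    (act f a).support ⊆ f.support + a.support :=
  HahnModule.support_smul_subset_vadd_support

theorem act_mul [IsScalarTower k A A] (f : HahnSeries ℤ k) (a b : HahnSeries ℤ A) :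
    act f a * b = act f (a * b) := by
  ext n
  rw [coeff_mul'' _ _ n (f.isPWO_support.add a.isPWO_support) b.isPWO_support
      (support_act_subset f a) subset_rfl,
    coeff_act _ _ n f.isPWO_support (a.isPWO_support.add b.isPWO_support) subset_rfl
      support_mul_subset]
  simp_rw [coeff_act f a _ f.isPWO_support a.isPWO_support subset_rfl subset_rfl,
    coeff_mul'' a b _ a.isPWO_support b.isPWO_support subset_rfl subset_rfl,
    sum_mul, smul_sum, sum_sigma']
  apply Finset.sum_nbij' (fun ⟨⟨_i, j⟩, ⟨k, l⟩⟩ ↦ ⟨(k, l + j), (l, j)⟩)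
    (fun ⟨⟨i, _j⟩, ⟨k, l⟩⟩ ↦ ⟨(i + k, l), (i, k)⟩)
  · rintro ⟨⟨i, j⟩, ⟨p, q⟩⟩ h
    simp only [mem_sigma, Finset.mem_antidiagonal] at h ⊢
    obtain ⟨⟨h1, h2, h3⟩, h4, h5, h6⟩ := h
    exact ⟨⟨h4, Set.add_mem_add h5 h2, by omega⟩, h5, h2, trivial⟩
  · rintro ⟨⟨i, j⟩, ⟨p, q⟩⟩ h
    simp only [mem_sigma, Finset.mem_antidiagonal] at h ⊢
    obtain ⟨⟨h1, h2, h3⟩, h4, h5, h6⟩ := h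
    exact ⟨⟨Set.add_mem_add h1 h4, h5, by omega⟩, h1, h4, trivial⟩
  · rintro ⟨⟨i, j⟩, ⟨p, q⟩⟩ h
    simp only [mem_sigma, Finset.mem_antidiagonal] at h
    obtain ⟨⟨h1, h2, h3⟩, h4, h5, rfl⟩ := h
    rfl
  · rintro ⟨⟨i, j⟩, ⟨p, q⟩⟩ h
    simp only [mem_sigma, Finset.mem_antidiagonal] at h
    obtain ⟨⟨h1, h2, h3⟩, h4, h5, rfl⟩ := h
    rfl
  · rintro ⟨⟨i, j⟩, ⟨p, q⟩⟩ h
    exact smul_mul_assoc _ _ _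

theorem mul_act [SMulCommClass k A A] (f : HahnSeries ℤ k) (a b : HahnSeries ℤ A) :
    a * act f b = act f (a * b) := by
  ext n
  rw [coeff_mul'' _ _ n a.isPWO_support (f.isPWO_support.add b.isPWO_support) subset_rfl
      (support_act_subset f b),
    coeff_act _ _ n f.isPWO_support (a.isPWO_support.add b.isPWO_support) subset_rfl
      support_mul_subset]
  simp_rw [coeff_act f b _ f.isPWO_support b.isPWO_support subset_rfl subset_rfl,
    coeff_mul'' a b _ a.isPWO_support b.isPWO_support subset_rfl subset_rfl,
    mul_sum, smul_sum, sum_sigma']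
  apply Finset.sum_nbij' (fun ⟨⟨i, _j⟩, ⟨p, q⟩⟩ ↦ ⟨(p, i + q), (i, q)⟩)
    (fun ⟨⟨i, _j⟩, ⟨p, q⟩⟩ ↦ ⟨(p, i + q), (i, q)⟩)
  · rintro ⟨⟨i, j⟩, ⟨p, q⟩⟩ h
    simp only [mem_sigma, Finset.mem_antidiagonal] at h ⊢
    obtain ⟨⟨h1, h2, h3⟩, h4, h5, h6⟩ := h
    exact ⟨⟨h4, Set.add_mem_add h1 h5, by omega⟩, h1, h5, trivial⟩
  · rintro ⟨⟨i, j⟩, ⟨p, q⟩⟩ h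
    simp only [mem_sigma, Finset.mem_antidiagonal] at h ⊢
    obtain ⟨⟨h1, h2, h3⟩, h4, h5, h6⟩ := h
    exact ⟨⟨h4, Set.add_mem_add h1 h5, by omega⟩, h1, h5, trivial⟩
  · rintro ⟨⟨i, j⟩, ⟨p, q⟩⟩ h
    simp only [mem_sigma, Finset.mem_antidiagonal] at h
    obtain ⟨⟨h1, h2, h3⟩, h4, h5, rfl⟩ := h
    rfl
  · rintro ⟨⟨i, j⟩, ⟨p, q⟩⟩ h
    simp only [mem_sigma, Finset.mem_antidiagonal] at h
    obtain ⟨⟨h1, h2, h3⟩, h4, h5, rfl⟩ := h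
    rfl
  · rintro ⟨⟨i, j⟩, ⟨p, q⟩⟩ h
    exact mul_smul_comm _ _ _

end Laurent

section Lattice
open HahnSeries
variable (k A : Type u) [Field k] [NonUnitalNonAssocRing A] [Module k A]

/-- `z⁻ⁿ A[[z]]` inside `A((z))`. -/
def poleLE (n : ℤ) : Submodule k (HahnSeries ℤ A) where
  carrier := {a | ∀ i < -n, a.coeff i = 0}
  zero_mem' _ _ := rfl
  add_mem' ha hb i hi := by rw [coeff_add, ha i hi, hb i hi, add_zero]
  smul_mem' c a ha i hi := by rw [coeff_smul, ha i hi, smul_zero]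

/-- `A[[z]]` inside `A((z))`. -/
abbrev integralPart : Submodule k (HahnSeries ℤ A) := poleLE k A 0

variable {k A}

/-- An `A`-lattice: a `k`-subalgebra `W` of `A((z))` such that `A[[z]] ∩ W` and
`A((z)) / (A[[z]] + W)` are finite-dimensional. -/
structure IsLattice (W : Submodule k (HahnSeries ℤ A)) : Prop where
  mul_mem : ∀ a ∈ W, ∀ b ∈ W, a * b ∈ W
  finite_inter : FiniteDimensional k ↥(integralPart k A ⊓ W)
  finite_quotient : FiniteDimensional k (HahnSeries ℤ A ⧸ (integralPart k A ⊔ W))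

/-- `dim (A[[z]] ∩ W)`, the first entry of the index of `W`. -/
noncomputable def index₀ (W : Submodule k (HahnSeries ℤ A)) : ℕ :=
  Module.finrank k ↥(integralPart k A ⊓ W)

/-- `dim A((z)) / (A[[z]] + W)`, the second entry of the index of `W`. -/
noncomputable def index₁ (W : Submodule k (HahnSeries ℤ A)) : ℕ :=
  Module.finrank k (HahnSeries ℤ A ⧸ (integralPart k A ⊔ W))

theorem act_mem_poleLE {f : HahnSeries ℤ k} {a : HahnSeries ℤ A} {m n : ℤ}
    (hf : f ∈ poleLE k k m) (ha : a ∈ poleLE k A n) : act f a ∈ poleLE k A (m + n) := by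
  intro i hi
  rw [coeff_act f a i f.isPWO_support a.isPWO_support subset_rfl subset_rfl]
  refine Finset.sum_eq_zero fun ij h ↦ ?_
  simp only [Finset.mem_antidiagonal] at h
  by_cases h1 : ij.1 < -m
  · rw [hf _ h1, zero_smul]
  · rw [ha ij.2 (by omega), smul_zero]

theorem mul_mem_poleLE {a b : HahnSeries ℤ A} {m n : ℤ}
    (ha : a ∈ poleLE k A m) (hb : b ∈ poleLE k A n) : a * b ∈ poleLE k A (m + n) := by
  intro i hi
  rw [coeff_mul]
  refine Finset.sum_eq_zero fun ij h ↦ ?_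
  simp only [Finset.mem_antidiagonal] at h
  by_cases h1 : ij.1 < -m
  · rw [ha _ h1, zero_mul]
  · rw [hb ij.2 (by omega), mul_zero]

theorem poleLE_mono {m n : ℤ} (h : m ≤ n) : poleLE k A m ≤ poleLE k A n :=
  fun _ ha i hi ↦ ha i (by omega)

theorem one_mem_poleLE {n : ℤ} (hn : 0 ≤ n) : (1 : HahnSeries ℤ k) ∈ poleLE k k n :=
  fun i hi ↦ by rw [coeff_one, if_neg (by omega)]

end Lattice

section GradedRing
open Polynomial
variable {k : Type u} [Field k] (O : Subalgebra k (HahnSeries ℤ k))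

/-- The graded algebra `gr(O) = ⨁ₙ tⁿ Oₙ ⊆ O[t]`, with `Oₙ = O ∩ z⁻ⁿ k[[z]]`. -/
def gr : Subalgebra k (Polynomial (HahnSeries ℤ k)) where
  carrier := {p | ∀ n : ℕ, p.coeff n ∈ O ∧ p.coeff n ∈ poleLE k k n}
  mul_mem' {p q} hp hq n := by
    rw [Polynomial.coeff_mul]
    constructor
    · exact sum_mem fun ij _ ↦ mul_mem (hp _).1 (hq _).1
    · refine sum_mem fun ij h ↦ ?_
      have := mul_mem_poleLE (hp ij.1).2 (hq ij.2).2
      rw [Finset.HasAntidiagonal.mem_antidiagonal] at h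
      rwa [← Nat.cast_add, h] at this
  add_mem' {p q} hp hq n := by
    rw [Polynomial.coeff_add]
    exact ⟨add_mem (hp n).1 (hq n).1, add_mem (hp n).2 (hq n).2⟩
  algebraMap_mem' r n := by
    rw [Polynomial.algebraMap_apply, Polynomial.coeff_C]
    split_ifs with h
    · subst h
      refine ⟨O.algebraMap_mem r, ?_⟩
      rw [Algebra.algebraMap_eq_smul_one]
      exact Submodule.smul_mem _ _ (one_mem_poleLE (k := k) le_rfl)
    · exact ⟨O.zero_mem, Submodule.zero_mem _⟩

/-- `gr(O)` as a ring. -/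
def GrRing : Type u := gr O

noncomputable instance : CommRing (GrRing O) := inferInstanceAs (CommRing (gr O))

noncomputable instance : Algebra k (GrRing O) := inferInstanceAs (Algebra k (gr O))

/-- The inclusion of `gr(O)` in `k((z))[t]`. -/
noncomputable def grVal : GrRing O →ₐ[k] Polynomial (HahnSeries ℤ k) := (gr O).val

variable {O}

/-- The coefficient of `tⁿ`. -/
noncomputable def GrRing.coeff (p : GrRing O) (n : ℕ) : HahnSeries ℤ k := (grVal O p).coeff n

theorem GrRing.ext {p q : GrRing O} (h : ∀ n, p.coeff n = q.coeff n) : p = q :=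
  Subtype.ext (Polynomial.ext h)

theorem GrRing.coeff_zero (n : ℕ) : (0 : GrRing O).coeff n = 0 := by
  rw [GrRing.coeff, map_zero, Polynomial.coeff_zero]

theorem GrRing.coeff_add (p q : GrRing O) (n : ℕ) : (p + q).coeff n = p.coeff n + q.coeff n := by
  rw [GrRing.coeff, map_add, Polynomial.coeff_add]
  rfl

theorem GrRing.coeff_smul (c : k) (p : GrRing O) (n : ℕ) : (c • p).coeff n = c • p.coeff n := by
  rw [GrRing.coeff, map_smul, Polynomial.coeff_smul]
  rfl

variable (O)

/-- The homogeneous part `tⁿ Oₙ` of `gr(O)`. -/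
def grPiece (n : ℕ) : Submodule k (GrRing O) where
  carrier := {p | ∀ m ≠ n, p.coeff m = 0}
  zero_mem' m _ := GrRing.coeff_zero m
  add_mem' {p q} hp hq m hm := by
    rw [GrRing.coeff_add, hp m hm, hq m hm, add_zero]
  smul_mem' c p hp m hm := by
    rw [GrRing.coeff_smul, hp m hm, smul_zero]

/-- The homogeneous element `tⁿ f` of `gr(O)`, for `f ∈ Oₙ`. -/
noncomputable def grMonomial (n : ℕ) (f : HahnSeries ℤ k) (hf : f ∈ O) (hn : f ∈ poleLE k k n) :
    GrRing O :=
  ⟨Polynomial.monomial n f, fun m ↦ by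
    rw [Polynomial.coeff_monomial]
    split_ifs with h
    · exact h ▸ ⟨hf, hn⟩
    · exact ⟨O.zero_mem, Submodule.zero_mem _⟩⟩

theorem coeff_grMonomial (n : ℕ) (f : HahnSeries ℤ k) (hf : f ∈ O) (hn : f ∈ poleLE k k n) (m : ℕ) :
    (grMonomial O n f hf hn).coeff m = if n = m then f else 0 :=
  Polynomial.coeff_monomial

theorem grMonomial_mem (n : ℕ) (f : HahnSeries ℤ k) (hf : f ∈ O) (hn : f ∈ poleLE k k n) :
    grMonomial O n f hf hn ∈ grPiece O n := fun m hm ↦ by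
  rw [coeff_grMonomial, if_neg hm.symm]

instance : SetLike.GradedMonoid (grPiece O) where
  one_mem m hm := by
    rw [GrRing.coeff, map_one, Polynomial.coeff_one, if_neg hm]
  mul_mem i j p q hp hq m hm := by
    rw [GrRing.coeff, map_mul, Polynomial.coeff_mul]
    refine Finset.sum_eq_zero fun ab h ↦ ?_
    rw [Finset.HasAntidiagonal.mem_antidiagonal] at h
    by_cases h1 : ab.1 = i
    · have h2 : (grVal O q).coeff ab.2 = 0 := hq ab.2 (by omega)
      rw [h2, mul_zero]
    · have h2 : (grVal O p).coeff ab.1 = 0 := hp _ h1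
      rw [h2, zero_mul]

/-- The homogeneous component of degree `n` of an element of `gr(O)`. -/
noncomputable def grComponent (p : GrRing O) (n : ℕ) : grPiece O n :=
  ⟨grMonomial O n _ (p.2 n).1 (p.2 n).2, grMonomial_mem O n _ (p.2 n).1 (p.2 n).2⟩

theorem coeff_grComponent (p : GrRing O) (n m : ℕ) :
    (grComponent O p n : GrRing O).coeff m = if n = m then p.coeff n else 0 :=
  coeff_grMonomial O n _ (p.2 n).1 (p.2 n).2 m

/-- The homogeneous components of an element of `gr(O)`. -/
noncomputable def grDecompose (p : GrRing O) : DirectSum ℕ fun n ↦ grPiece O n :=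
  DirectSum.mk (fun n ↦ grPiece O n) (grVal O p).support fun n ↦ grComponent O p n

theorem grDecompose_apply (p : GrRing O) (n : ℕ) : grDecompose O p n = grComponent O p n := by
  by_cases h : n ∈ (grVal O p).support
  · exact DirectSum.mk_apply_of_mem h
  · rw [grDecompose, DirectSum.mk_apply_of_notMem h]
    rw [Polynomial.notMem_support_iff] at h
    refine Subtype.ext (GrRing.ext fun m ↦ ?_)
    rw [coeff_grComponent, show p.coeff n = 0 from h, ite_self]
    exact GrRing.coeff_zero m

theorem coeff_coeAddMonoidHom (x : DirectSum ℕ fun n ↦ grPiece O n) (n : ℕ) :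
    (DirectSum.coeAddMonoidHom (grPiece O) x).coeff n = (x n : GrRing O).coeff n := by
  induction x using DirectSum.induction_on with
  | zero => simp
  | of m p =>
    rw [DirectSum.coeAddMonoidHom_of]
    by_cases h : n = m
    · subst h
      rw [DirectSum.of_eq_same]
    · rw [DirectSum.of_eq_of_ne _ _ _ h, p.2 n h]
      exact (GrRing.coeff_zero n).symm
  | add x y hx hy =>
    rw [map_add, GrRing.coeff_add, hx, hy, DirectSum.add_apply, AddMemClass.coe_add,
      GrRing.coeff_add]

noncomputable instance : GradedAlgebra (grPiece O) where
  decompose' := grDecompose O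
  left_inv p := by
    refine GrRing.ext fun n ↦ ?_
    rw [coeff_coeAddMonoidHom, grDecompose_apply, coeff_grComponent, if_pos rfl]
  right_inv x := by
    refine DFinsupp.ext fun n ↦ Subtype.ext (GrRing.ext fun m ↦ ?_)
    rw [grDecompose_apply, coeff_grComponent, coeff_coeAddMonoidHom]
    split_ifs with h
    · rw [h]
    · exact ((x n).2 m (Ne.symm h)).symm
end GradedRing

section GradedModule
open Polynomial
variable (k A : Type u) [Field k] [NonUnitalNonAssocRing A] [Module k A]

/-- The space `A((z))[t, t⁻¹]` of Laurent polynomials in `t` with coefficients in `A((z))`. -/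
def LaurentPoly : Type u := ℤ →₀ HahnModule ℤ k A

noncomputable instance : AddCommGroup (LaurentPoly k A) :=
  inferInstanceAs (AddCommGroup (ℤ →₀ HahnModule ℤ k A))

noncomputable instance : Module (HahnSeries ℤ k) (LaurentPoly k A) :=
  inferInstanceAs (Module (HahnSeries ℤ k) (ℤ →₀ HahnModule ℤ k A))

variable {k A}

/-- The coefficient of `tʲ`. -/
noncomputable def LaurentPoly.coeff (m : LaurentPoly k A) (j : ℤ) : HahnSeries ℤ A :=
  (HahnModule.of k).symm (Finsupp.lapply (R := HahnSeries ℤ k) j m)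

/-- The monomial `tʲ a`. -/
noncomputable def LaurentPoly.monomial (j : ℤ) (a : HahnSeries ℤ A) : LaurentPoly k A :=
  Finsupp.single j (HahnModule.of k a)

variable (k A)

/-- Multiplication by `t`. -/
noncomputable def LaurentPoly.shift : Module.End (HahnSeries ℤ k) (LaurentPoly k A) :=
  Finsupp.lmapDomain (HahnModule ℤ k A) (HahnSeries ℤ k) (fun j : ℤ ↦ j + 1)

/-- `A((z))[t, t⁻¹]` as a module over `k((z))[t]`. -/
noncomputable instance : Module (Polynomial (HahnSeries ℤ k)) (LaurentPoly k A) :=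
  Module.compHom _ (Polynomial.aeval (LaurentPoly.shift k A)).toRingHom

variable {k A}

theorem LaurentPoly.ext {m n : LaurentPoly k A} (h : ∀ j, m.coeff j = n.coeff j) : m = n :=
  Finsupp.ext fun j ↦ (HahnModule.of k).symm.injective (h j)

theorem LaurentPoly.coeff_add (m n : LaurentPoly k A) (j : ℤ) :
    (m + n).coeff j = m.coeff j + n.coeff j := rfl

theorem LaurentPoly.C_smul (f : HahnSeries ℤ k) (m : LaurentPoly k A) :
    (Polynomial.C f) • m = f • m := by
  change Polynomial.aeval (LaurentPoly.shift k A) (Polynomial.C f) m = f • m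
  rw [Polynomial.aeval_C]
  rfl

theorem LaurentPoly.X_smul (m : LaurentPoly k A) :
    (Polynomial.X : Polynomial (HahnSeries ℤ k)) • m = LaurentPoly.shift k A m := by
  change Polynomial.aeval (LaurentPoly.shift k A) Polynomial.X m = _
  rw [Polynomial.aeval_X]

theorem LaurentPoly.coeff_C_smul (f : HahnSeries ℤ k) (m : LaurentPoly k A) (j : ℤ) :
    (Polynomial.C f • m).coeff j = act f (m.coeff j) := by
  rw [LaurentPoly.C_smul]
  rfl

theorem LaurentPoly.coeff_X_smul (m : LaurentPoly k A) (j : ℤ) :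
    ((Polynomial.X : Polynomial (HahnSeries ℤ k)) • m).coeff j = m.coeff (j - 1) := by
  rw [LaurentPoly.X_smul]
  have h (m : ℤ →₀ HahnModule ℤ k A) :
      Finsupp.mapDomain (fun j : ℤ ↦ j + 1) m (j - 1 + 1) = m (j - 1) :=
    Finsupp.mapDomain_apply (add_left_injective 1) _ _
  specialize h m
  rw [sub_add_cancel] at h
  exact congrArg (HahnModule.of k).symm h

theorem LaurentPoly.coeff_monomial_smul (n : ℕ) (f : HahnSeries ℤ k) (m : LaurentPoly k A) (j : ℤ) :
    (Polynomial.monomial n f • m).coeff j = act f (m.coeff (j - n)) := by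
  induction n generalizing j with
  | zero => simpa using LaurentPoly.coeff_C_smul f m j
  | succ n ih =>
    rw [← Polynomial.X_mul_monomial, mul_smul, LaurentPoly.coeff_X_smul, ih]
    congr 2
    push_cast
    ring

/-- The multiplication of `A((z))` as a bilinear map over `k((z))`. -/
noncomputable def seriesMul [SMulCommClass k A A] [IsScalarTower k A A] :
    HahnModule ℤ k A →ₗ[HahnSeries ℤ k] HahnModule ℤ k A →ₗ[HahnSeries ℤ k] HahnModule ℤ k A :=
  LinearMap.mk₂ _
    (fun a b ↦ HahnModule.of k ((HahnModule.of k).symm a * (HahnModule.of k).symm b))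
    (fun _ _ _ ↦ congrArg (HahnModule.of k) (add_mul _ _ _))
    (fun f _ _ ↦ congrArg (HahnModule.of k) (act_mul f _ _))
    (fun _ _ _ ↦ congrArg (HahnModule.of k) (mul_add _ _ _))
    (fun f _ _ ↦ congrArg (HahnModule.of k) (mul_act f _ _))

/-- The multiplication of `A((z))[t, t⁻¹]`. -/
noncomputable def LaurentPoly.mul [SMulCommClass k A A] [IsScalarTower k A A] :
    LaurentPoly k A →ₗ[HahnSeries ℤ k] LaurentPoly k A →ₗ[HahnSeries ℤ k] LaurentPoly k A :=
  Finsupp.lsum (HahnSeries ℤ k) fun i : ℤ ↦ LinearMap.flip <|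
    Finsupp.lsum (HahnSeries ℤ k) fun j : ℤ ↦ LinearMap.flip <|
      (seriesMul (k := k) (A := A)).compr₂
        (Finsupp.lsingle (i + j) : HahnModule ℤ k A →ₗ[HahnSeries ℤ k] ℤ →₀ HahnModule ℤ k A)

theorem LaurentPoly.induction {P : LaurentPoly k A → Prop} (h0 : P 0)
    (ha : ∀ m n, P m → P n → P (m + n)) (hm : ∀ j a, P (LaurentPoly.monomial j a))
    (m : LaurentPoly k A) : P m :=
  Finsupp.induction_linear (motive := P) m h0 (fun m n ↦ ha m n)
    fun j a ↦ hm j ((HahnModule.of k).symm a)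

theorem LaurentPoly.shift_monomial (j : ℤ) (a : HahnSeries ℤ A) :
    LaurentPoly.shift k A (LaurentPoly.monomial j a) = LaurentPoly.monomial (j + 1) a :=
  Finsupp.mapDomain_single

variable [SMulCommClass k A A] [IsScalarTower k A A]

theorem LaurentPoly.monomial_mul_monomial (i j : ℤ) (a b : HahnSeries ℤ A) :
    LaurentPoly.mul (LaurentPoly.monomial (k := k) i a) (LaurentPoly.monomial j b) =
      LaurentPoly.monomial (i + j) (a * b) := by
  have h1 := Finsupp.lsum_single (M := HahnModule ℤ k A) (HahnSeries ℤ k)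
    (fun i : ℤ ↦ LinearMap.flip <|
    Finsupp.lsum (HahnSeries ℤ k) fun j : ℤ ↦ LinearMap.flip <|
      (seriesMul (k := k) (A := A)).compr₂
        (Finsupp.lsingle (i + j) : HahnModule ℤ k A →ₗ[HahnSeries ℤ k] ℤ →₀ HahnModule ℤ k A))
    i (HahnModule.of k a)
  refine (LinearMap.congr_fun h1 _).trans ?_
  have h2 := Finsupp.lsum_single (M := HahnModule ℤ k A) (HahnSeries ℤ k)
    (fun j : ℤ ↦ LinearMap.flip <|
      (seriesMul (k := k) (A := A)).compr₂
        (Finsupp.lsingle (i + j) : HahnModule ℤ k A →ₗ[HahnSeries ℤ k] ℤ →₀ HahnModule ℤ k A))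
    j (HahnModule.of k b)
  exact LinearMap.congr_fun h2 _

theorem LaurentPoly.shift_mul (m n : LaurentPoly k A) :
    LaurentPoly.mul (LaurentPoly.shift k A m) n = LaurentPoly.shift k A (LaurentPoly.mul m n) := by
  induction m using LaurentPoly.induction with
  | h0 => simp
  | ha m m' h h' => simp [h, h']
  | hm i a =>
    induction n using LaurentPoly.induction with
    | h0 => simp
    | ha m m' h h' => simp [h, h']
    | hm j b =>
      rw [shift_monomial, monomial_mul_monomial, monomial_mul_monomial, shift_monomial]
      congr 1
      ring

theorem LaurentPoly.mul_shift (m n : LaurentPoly k A) :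
    LaurentPoly.mul m (LaurentPoly.shift k A n) = LaurentPoly.shift k A (LaurentPoly.mul m n) := by
  induction m using LaurentPoly.induction with
  | h0 => simp
  | ha m m' h h' => simp [h, h']
  | hm i a =>
    induction n using LaurentPoly.induction with
    | h0 => simp
    | ha m m' h h' => simp [h, h']
    | hm j b =>
      rw [shift_monomial, monomial_mul_monomial, monomial_mul_monomial, shift_monomial]
      congr 1
      ring

theorem LaurentPoly.smul_mul (p : Polynomial (HahnSeries ℤ k)) (m n : LaurentPoly k A) :
    LaurentPoly.mul (p • m) n = p • LaurentPoly.mul m n := by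
  induction p using Polynomial.induction_on' generalizing m with
  | add p q hp hq => rw [add_smul, map_add, LinearMap.add_apply, hp, hq, add_smul]
  | monomial i f =>
    induction i generalizing m with
    | zero => simp [C_smul]
    | succ i ih =>
      rw [← Polynomial.X_mul_monomial, mul_smul, mul_smul, ← ih, X_smul, X_smul, shift_mul]

theorem LaurentPoly.mul_smul' (p : Polynomial (HahnSeries ℤ k)) (m n : LaurentPoly k A) :
    LaurentPoly.mul m (p • n) = p • LaurentPoly.mul m n := by
  induction p using Polynomial.induction_on' generalizing n with
  | add p q hp hq => rw [add_smul, map_add, hp, hq, add_smul]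
  | monomial i f =>
    induction i generalizing n with
    | zero => simp [C_smul]
    | succ i ih =>
      rw [← Polynomial.X_mul_monomial, mul_smul, mul_smul, ← ih, X_smul, X_smul, mul_shift]

end GradedModule

section GradedLattice
variable {k A : Type u} [Field k] [NonUnitalNonAssocRing A] [Module k A]
variable {O : Subalgebra k (HahnSeries ℤ k)} {W : Submodule k (HahnSeries ℤ A)}

/-- `W` is stable under multiplication by `O`, that is, `O W ⊆ W`. -/
def Stabilizes (O : Subalgebra k (HahnSeries ℤ k)) (W : Submodule k (HahnSeries ℤ A)) : Prop :=
  ∀ f ∈ O, ∀ w ∈ W, act f w ∈ W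

/-- `A((z))[t, t⁻¹]` as a module over `gr(O) ⊆ k((z))[t]`. -/
noncomputable instance : Module (GrRing O) (LaurentPoly k A) :=
  Module.compHom _ (grVal O).toRingHom

/-- The graded module `gr(W) = ⨁ⱼ tʲ Wⱼ ⊆ W[t, t⁻¹]` over `gr(O)`, where `j` runs over the integers
and `Wⱼ = W ∩ z⁻ʲ A[[z]]`. -/
noncomputable def grMod (h : Stabilizes O W) : Submodule (GrRing O) (LaurentPoly k A) where
  carrier := {m | ∀ j : ℤ, m.coeff j ∈ W ∧ m.coeff j ∈ poleLE k A j}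
  zero_mem' j := ⟨W.zero_mem, (poleLE k A j).zero_mem⟩
  add_mem' {m n} hm hn j := ⟨W.add_mem (hm j).1 (hn j).1, (poleLE k A j).add_mem (hm j).2 (hn j).2⟩
  smul_mem' p m hm j := by
    have key (n : ℕ) : (Polynomial.monomial n (p.coeff n) • m).coeff j ∈
        W ⊓ poleLE k A j := by
      rw [LaurentPoly.coeff_monomial_smul]
      refine ⟨h _ (p.2 n).1 _ (hm _).1, ?_⟩
      have := act_mem_poleLE (p.2 n).2 (hm (j - n)).2
      rwa [add_sub_cancel] at this
    let φ : LaurentPoly k A →+ HahnSeries ℤ A :=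
      ⟨⟨fun m ↦ m.coeff j, rfl⟩, fun m n ↦ LaurentPoly.coeff_add m n j⟩
    change φ (grVal O p • m) ∈ W ⊓ poleLE k A j
    rw [(grVal O p).as_sum_support, Finset.sum_smul, map_sum]
    exact sum_mem fun n _ ↦ key n

/-- `gr(W)` as a module. -/
def GrMod (h : Stabilizes O W) : Type u := grMod h

noncomputable instance (h : Stabilizes O W) : AddCommGroup (GrMod h) :=
  inferInstanceAs (AddCommGroup (grMod h).toAddSubgroup)

noncomputable instance (h : Stabilizes O W) : Module (GrRing O) (GrMod h) :=
  inferInstanceAs (Module (GrRing O) (grMod h))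

/-- The inclusion of `gr(W)` in `A((z))[t, t⁻¹]`. -/
noncomputable def grModVal (h : Stabilizes O W) : GrMod h →ₗ[GrRing O] LaurentPoly k A :=
  (grMod h).subtype

/-- The coefficient of `tʲ`. -/
noncomputable def GrMod.coeff {h : Stabilizes O W} (m : GrMod h) (j : ℤ) : HahnSeries ℤ A :=
  (grModVal h m).coeff j

theorem GrMod.ext {h : Stabilizes O W} {m n : GrMod h} (hmn : ∀ j, m.coeff j = n.coeff j) : m = n :=
  Subtype.ext (LaurentPoly.ext hmn)

theorem GrMod.coeff_mem {h : Stabilizes O W} (m : GrMod h) (j : ℤ) :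
    m.coeff j ∈ W ∧ m.coeff j ∈ poleLE k A j :=
  m.2 j

theorem GrMod.coeff_zero {h : Stabilizes O W} (j : ℤ) : (0 : GrMod h).coeff j = 0 := rfl

theorem GrMod.coeff_add {h : Stabilizes O W} (m n : GrMod h) (j : ℤ) :
    (m + n).coeff j = m.coeff j + n.coeff j := rfl

theorem GrMod.coeff_smul {h : Stabilizes O W} (p : GrRing O) (m : GrMod h) (j : ℤ) :
    (p • m).coeff j = (grVal O p • grModVal h m).coeff j := rfl

/-- The homogeneous part `tʲ Wⱼ` of `gr(W)`. -/
noncomputable def grModPiece (h : Stabilizes O W) (j : ℤ) : AddSubgroup (GrMod h) where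
  carrier := {m | ∀ i ≠ j, m.coeff i = 0}
  zero_mem' i _ := GrMod.coeff_zero i
  add_mem' {m n} hm hn i hi := by
    rw [GrMod.coeff_add, hm i hi, hn i hi, add_zero]
  neg_mem' {m} hm i hi := by
    have h0 : m.coeff i + (-m).coeff i = 0 := by
      rw [← GrMod.coeff_add, add_neg_cancel, GrMod.coeff_zero]
    rwa [hm i hi, zero_add] at h0

theorem LaurentPoly.coeff_monomial (i j : ℤ) (a : HahnSeries ℤ A) :
    (LaurentPoly.monomial (k := k) i a).coeff j = if i = j then a else 0 := by
  change (HahnModule.of k).symm (Finsupp.single i (HahnModule.of k a) j) = _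
  rw [Finsupp.single_apply]
  split_ifs
  · rfl
  · rfl

/-- The homogeneous element `tʲ w` of `gr(W)`, for `w ∈ Wⱼ`. -/
noncomputable def grModMonomial (h : Stabilizes O W) (j : ℤ) (w : HahnSeries ℤ A) (hw : w ∈ W)
    (hj : w ∈ poleLE k A j) : GrMod h :=
  ⟨LaurentPoly.monomial j w, fun i ↦ by
    rw [LaurentPoly.coeff_monomial]
    split_ifs with hij
    · exact hij ▸ ⟨hw, hj⟩
    · exact ⟨W.zero_mem, (poleLE k A i).zero_mem⟩⟩

theorem coeff_grModMonomial (h : Stabilizes O W) (j : ℤ) (w : HahnSeries ℤ A) (hw : w ∈ W)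
    (hj : w ∈ poleLE k A j) (i : ℤ) :
    (grModMonomial h j w hw hj).coeff i = if j = i then w else 0 :=
  LaurentPoly.coeff_monomial j i w

theorem grModMonomial_mem (h : Stabilizes O W) (j : ℤ) (w : HahnSeries ℤ A) (hw : w ∈ W)
    (hj : w ∈ poleLE k A j) : grModMonomial h j w hw hj ∈ grModPiece h j := fun i hi ↦ by
  rw [coeff_grModMonomial, if_neg hi.symm]

theorem grModPiece_eq (h : Stabilizes O W) (j : ℤ) (m : GrMod h) (hm : m ∈ grModPiece h j) :
    grModVal h m = LaurentPoly.monomial j (m.coeff j) :=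
  LaurentPoly.ext fun i ↦ by
    rw [LaurentPoly.coeff_monomial]
    split_ifs with hij
    · rw [← hij]
      rfl
    · exact hm i (Ne.symm hij)

theorem grPiece_eq (i : ℕ) (p : GrRing O) (hp : p ∈ grPiece O i) :
    grVal O p = Polynomial.monomial i (p.coeff i) := by
  ext1 n
  rw [Polynomial.coeff_monomial]
  split_ifs with h
  · rw [← h]
    rfl
  · exact hp n (Ne.symm h)

theorem act_zero (f : HahnSeries ℤ k) : act f (0 : HahnSeries ℤ A) = 0 :=
  smul_zero (A := HahnModule ℤ k A) f

theorem grPiece_smul_mem (h : Stabilizes O W) {i : ℕ} {j : ℤ} {p : GrRing O} {m : GrMod h}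
    (hp : p ∈ grPiece O i) (hm : m ∈ grModPiece h j) : p • m ∈ grModPiece h (i + j) := by
  intro l hl
  rw [GrMod.coeff_smul, grPiece_eq i p hp, LaurentPoly.coeff_monomial_smul]
  have h0 : (grModVal h m).coeff (l - i) = 0 := hm _ (by omega)
  rw [h0, act_zero]

variable [SMulCommClass k A A] [IsScalarTower k A A]

theorem LaurentPoly.mul_coeff_mem (hW : ∀ a ∈ W, ∀ b ∈ W, a * b ∈ W) {m n : LaurentPoly k A}
    (hm : ∀ j : ℤ, m.coeff j ∈ W ∧ m.coeff j ∈ poleLE k A j)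
    (hn : ∀ j : ℤ, n.coeff j ∈ W ∧ n.coeff j ∈ poleLE k A j) (j : ℤ) :
    (LaurentPoly.mul m n).coeff j ∈ W ∧ (LaurentPoly.mul m n).coeff j ∈ poleLE k A j := by
  have hsum (m : LaurentPoly k A) :
      m = ∑ i ∈ Finsupp.support (M := HahnModule ℤ k A) m, LaurentPoly.monomial i (m.coeff i) :=
    (Finsupp.sum_single (M := HahnModule ℤ k A) m).symm
  let φ : LaurentPoly k A →+ HahnSeries ℤ A :=
    ⟨⟨fun m ↦ m.coeff j, rfl⟩, fun m n ↦ LaurentPoly.coeff_add m n j⟩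
  change φ (LaurentPoly.mul m n) ∈ W ⊓ poleLE k A j
  rw [hsum m, map_sum, LinearMap.sum_apply, map_sum]
  refine sum_mem fun a _ ↦ ?_
  rw [hsum n, map_sum, map_sum]
  refine sum_mem fun b _ ↦ ?_
  rw [LaurentPoly.monomial_mul_monomial]
  change (LaurentPoly.monomial (a + b) (m.coeff a * n.coeff b)).coeff j ∈ W ⊓ poleLE k A j
  rw [LaurentPoly.coeff_monomial]
  split_ifs with h
  · exact h ▸ ⟨hW _ (hm a).1 _ (hn b).1, mul_mem_poleLE (hm a).2 (hn b).2⟩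
  · exact zero_mem _

/-- The multiplication of `gr(W)`. -/
noncomputable def grModMul (h : Stabilizes O W) (hW : ∀ a ∈ W, ∀ b ∈ W, a * b ∈ W) :
    GrMod h →ₗ[GrRing O] GrMod h →ₗ[GrRing O] GrMod h :=
  LinearMap.mk₂ _
    (fun m n ↦ ⟨LaurentPoly.mul (grModVal h m) (grModVal h n),
      LaurentPoly.mul_coeff_mem hW m.2 n.2⟩)
    (fun _ _ _ ↦ Subtype.ext (LinearMap.map_add₂ LaurentPoly.mul _ _ _))
    (fun _ _ _ ↦ Subtype.ext (LaurentPoly.smul_mul _ _ _))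
    (fun m _ _ ↦ Subtype.ext (map_add (LaurentPoly.mul (grModVal h m)) _ _))
    (fun _ _ _ ↦ Subtype.ext (LaurentPoly.mul_smul' _ _ _))

theorem grModMul_mem (h : Stabilizes O W) (hW : ∀ a ∈ W, ∀ b ∈ W, a * b ∈ W) {i j : ℤ}
    {m n : GrMod h} (hm : m ∈ grModPiece h i) (hn : n ∈ grModPiece h j) :
    grModMul h hW m n ∈ grModPiece h (i + j) := by
  intro l hl
  change (LaurentPoly.mul (grModVal h m) (grModVal h n)).coeff l = 0
  rw [grModPiece_eq h i m hm, grModPiece_eq h j n hn, LaurentPoly.monomial_mul_monomial,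
    LaurentPoly.coeff_monomial, if_neg hl.symm]

end GradedLattice

section LocMul
variable {S M : Type u} [CommRing S] [AddCommGroup M] [Module S M] (N : Submonoid S)
  (μ : M →ₗ[S] M →ₗ[S] M)

/-- The localization `(m / s) (n / t) = μ(m, n) / st` of a bilinear multiplication. -/
noncomputable def locMul (x y : LocalizedModule N M) : LocalizedModule N M :=
  LocalizedModule.liftOn₂ x y (fun p q ↦ LocalizedModule.mk (μ p.1 q.1) (p.2 * q.2)) <| by
    rintro ⟨a₁, s₁⟩ ⟨a₂, s₂⟩ ⟨b₁, t₁⟩ ⟨b₂, t₂⟩ ⟨u₁, e₁⟩ ⟨u₂, e₂⟩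
    rw [LocalizedModule.mk_eq]
    use u₁ * u₂
    simp only [Submonoid.smul_def, Submonoid.coe_mul] at *
    have e : μ ((u₁ : S) • (t₁ : S) • a₁) ((u₂ : S) • (t₂ : S) • a₂) =
        μ ((u₁ : S) • (s₁ : S) • b₁) ((u₂ : S) • (s₂ : S) • b₂) := by rw [e₁, e₂]
    simp only [map_smul, LinearMap.smul_apply] at e
    convert e using 1 <;> module

theorem locMul_mk (m n : M) (s t : N) :
    locMul N μ (LocalizedModule.mk m s) (LocalizedModule.mk n t) =
      LocalizedModule.mk (μ m n) (s * t) :=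
  LocalizedModule.liftOn₂_mk _ _ _ _ _ _

theorem locMul_add (x y y' : LocalizedModule N M) :
    locMul N μ x (y + y') = locMul N μ x y + locMul N μ x y' := by
  induction x with | h m s
  induction y with | h n t
  induction y' with | h n' t'
  rw [LocalizedModule.mk_add_mk, locMul_mk, locMul_mk, locMul_mk, LocalizedModule.mk_add_mk,
    LocalizedModule.mk_eq]
  use 1
  simp only [Submonoid.smul_def, Submonoid.coe_mul, Submonoid.coe_one, map_add, map_smul]
  module

theorem add_locMul (x x' y : LocalizedModule N M) :
    locMul N μ (x + x') y = locMul N μ x y + locMul N μ x' y := by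
  induction x with | h m s
  induction x' with | h m' s'
  induction y with | h n t
  rw [LocalizedModule.mk_add_mk, locMul_mk, locMul_mk, locMul_mk, LocalizedModule.mk_add_mk,
    LocalizedModule.mk_eq]
  use 1
  simp only [Submonoid.smul_def, Submonoid.coe_mul, Submonoid.coe_one, map_add, map_smul,
    LinearMap.add_apply, LinearMap.smul_apply]
  module

theorem smul_locMul (r : Localization N) (x y : LocalizedModule N M) :
    locMul N μ (r • x) y = r • locMul N μ x y := by
  induction r using Localization.induction_on with | H r
  obtain ⟨r, u⟩ := r
  induction x with | h m s
  induction y with | h n t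
  rw [LocalizedModule.mk_smul_mk, locMul_mk, locMul_mk, LocalizedModule.mk_smul_mk, map_smul,
    LinearMap.smul_apply, mul_assoc]

theorem locMul_smul (r : Localization N) (x y : LocalizedModule N M) :
    locMul N μ x (r • y) = r • locMul N μ x y := by
  induction r using Localization.induction_on with | H r
  obtain ⟨r, u⟩ := r
  induction x with | h m s
  induction y with | h n t
  rw [LocalizedModule.mk_smul_mk, locMul_mk, locMul_mk, LocalizedModule.mk_smul_mk, map_smul,
    mul_left_comm]

end LocMul

section ProjModule
open AlgebraicGeometry CategoryTheory TopologicalSpace Opposite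
variable {k S : Type u} [CommRing k] [CommRing S] [Algebra k S] (𝒮 : ℕ → Submodule k S)
  [GradedAlgebra 𝒮] {M : Type u} [AddCommGroup M] [Module S M]

/-- The complement of a homogeneous prime ideal. -/
abbrev complAt (x : ProjectiveSpectrum 𝒮) : Submonoid S :=
  x.asHomogeneousIdeal.toIdeal.primeCompl

variable (M) in
/-- The localization of a module at a homogeneous prime ideal. -/
abbrev LocMod (x : ProjectiveSpectrum.top 𝒮) : Type u :=
  LocalizedModule (complAt 𝒮 x) M

variable (ℳ : ℤ → AddSubgroup M)

/-- A function with values in the localizations is a fraction `m / s` with `m` and `s` homogeneous of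
the same degree. -/
def IsModFraction {U : Opens (ProjectiveSpectrum.top 𝒮)} (f : ∀ x : U, LocMod 𝒮 M x.1) : Prop :=
  ∃ (i : ℕ) (m : M) (s : S) (_ : m ∈ ℳ i) (_ : s ∈ 𝒮 i)
    (hs : ∀ x : U, s ∈ complAt 𝒮 x.1),
    ∀ x : U, f x = LocalizedModule.mk m ⟨s, hs x⟩

/-- The prelocal predicate of being a fraction. -/
def isModFractionPrelocal : TopCat.PrelocalPredicate (LocMod 𝒮 M) where
  pred f := IsModFraction 𝒮 ℳ f
  res := by
    rintro V U i f ⟨n, m, s, hm, hs, h, w⟩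
    exact ⟨n, m, s, hm, hs, fun x ↦ h (i x), fun x ↦ w (i x)⟩

/-- The local predicate of being locally a fraction. -/
def isLocallyModFraction : TopCat.LocalPredicate (LocMod 𝒮 M) :=
  (isModFractionPrelocal 𝒮 ℳ).sheafify

theorem isLocallyModFraction_iff {U : Opens (ProjectiveSpectrum.top 𝒮)} (f : ∀ x : U, LocMod 𝒮 M x.1) :
    (isLocallyModFraction 𝒮 ℳ).pred f ↔ ∀ x : U, ∃ (V : Opens (ProjectiveSpectrum.top 𝒮)) (_ : x.1 ∈ V)
      (i : V ≤ U) (n : ℕ) (m : M) (s : S) (_ : m ∈ ℳ n) (_ : s ∈ 𝒮 n)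
      (hs : ∀ y : V, s ∈ complAt 𝒮 y.1),
      ∀ y : V, f ⟨y.1, i y.2⟩ = LocalizedModule.mk m ⟨s, hs y⟩ := by
  constructor
  · intro h x
    obtain ⟨V, hV, i, n, m, s, hm, hs, h1, h2⟩ := h x
    exact ⟨V, hV, i.le, n, m, s, hm, hs, h1, h2⟩
  · intro h x
    obtain ⟨V, hV, i, n, m, s, hm, hs, h1, h2⟩ := h x
    exact ⟨V, hV, homOfLE i, n, m, s, hm, hs, h1, h2⟩

/-- `M` is a graded module: `𝒮 i • ℳ j ⊆ ℳ (i + j)`. -/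
def IsGradedModule : Prop :=
  ∀ (i : ℕ) (j : ℤ) (s : S) (m : M), s ∈ 𝒮 i → m ∈ ℳ j → s • m ∈ ℳ (i + j)

variable {ℳ} {𝒮} (hℳ : IsGradedModule 𝒮 ℳ)

/-- The sections over `U` of the sheaf on `Proj` attached to a graded module. -/
def projSections (U : Opens (ProjectiveSpectrum.top 𝒮)) : AddSubgroup (∀ x : U, LocMod 𝒮 M x.1) where
  carrier := {f | (isLocallyModFraction 𝒮 ℳ).pred f}
  zero_mem' := by
    refine (isLocallyModFraction_iff 𝒮 ℳ _).2 fun x ↦ ⟨U, x.2, le_rfl, 0, 0, 1, zero_mem _,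
      SetLike.GradedOne.one_mem, fun y ↦ Submonoid.one_mem _, fun y ↦ ?_⟩
    exact (LocalizedModule.zero_mk _).symm
  add_mem' {f g} hf hg := by
    refine (isLocallyModFraction_iff 𝒮 ℳ _).2 fun x ↦ ?_
    obtain ⟨V, hV, i, n, m, s, hm, hs, h1, h2⟩ := (isLocallyModFraction_iff 𝒮 ℳ f).1 hf x
    obtain ⟨V', hV', i', n', m', s', hm', hs', h1', h2'⟩ := (isLocallyModFraction_iff 𝒮 ℳ g).1 hg x
    refine ⟨V ⊓ V', ⟨hV, hV'⟩, inf_le_left.trans i, n + n', s' • m + s • m', s * s', ?_,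
      SetLike.GradedMul.mul_mem hs hs',
      fun y ↦ mul_mem (h1 ⟨y.1, y.2.1⟩) (h1' ⟨y.1, y.2.2⟩), fun y ↦ ?_⟩
    · push_cast
      refine add_mem ?_ (hℳ n n' s m' hs hm')
      rw [add_comm]
      exact hℳ n' n s' m hs' hm
    · rw [Pi.add_apply, h2 ⟨y.1, y.2.1⟩, h2' ⟨y.1, y.2.2⟩, LocalizedModule.mk_add_mk]
      rfl
  neg_mem' {f} hf := by
    refine (isLocallyModFraction_iff 𝒮 ℳ _).2 fun x ↦ ?_
    obtain ⟨V, hV, i, n, m, s, hm, hs, h1, h2⟩ := (isLocallyModFraction_iff 𝒮 ℳ f).1 hf x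
    refine ⟨V, hV, i, n, -m, s, neg_mem hm, hs, h1, fun y ↦ ?_⟩
    rw [Pi.neg_apply, h2 y]
    exact LocalizedModule.mk_neg.symm

theorem isFraction_smul (hℳ : IsGradedModule 𝒮 ℳ) (U : Opens (ProjectiveSpectrum.top 𝒮)) (r : (ProjectiveSpectrum.Proj.structureSheaf 𝒮).1.obj (op U))
    (f : ∀ x : U, LocMod 𝒮 M x.1) (hf : (isLocallyModFraction 𝒮 ℳ).pred f) :
    (isLocallyModFraction 𝒮 ℳ).pred
      (fun x ↦ ((r.1 x).val • f x : LocMod 𝒮 M x.1)) := by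
  refine (isLocallyModFraction_iff 𝒮 ℳ _).2 fun x ↦ ?_
  obtain ⟨V, hV, i, n, m, s, hm, hs, h1, h2⟩ := (isLocallyModFraction_iff 𝒮 ℳ f).1 hf x
  obtain ⟨V', hV', i', n', ⟨a, ha⟩, ⟨b, hb⟩, h1', h2'⟩ := r.2 x
  refine ⟨V ⊓ V', ⟨hV, hV'⟩, inf_le_left.trans i, n' + n, a • m, b * s, ?_,
    SetLike.GradedMul.mul_mem hb hs,
    fun y ↦ mul_mem (h1' ⟨y.1, y.2.2⟩) (h1 ⟨y.1, y.2.1⟩), fun y ↦ ?_⟩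
  · push_cast
    exact hℳ n' n a m ha hm
  · have h3 : r.1 ⟨y.1, i y.2.1⟩ = _ := h2' ⟨y.1, y.2.2⟩
    dsimp only
    rw [h2 ⟨y.1, y.2.1⟩, h3]
    rw [HomogeneousLocalization.val_mk, LocalizedModule.mk_smul_mk]
    rfl

variable (𝒮) in
/-- The value in the localization at `x` of a section of the structure sheaf of `Proj`. -/
noncomputable def evalAt {U : (Proj 𝒮).Opens} (x : U) :
    Γ(Proj 𝒮, U) →+* Localization (complAt 𝒮 x.1) where
  toFun r := (HomogeneousLocalization.val (Subtype.val r x : _) : Localization (complAt 𝒮 x.1))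
  map_one' := HomogeneousLocalization.val_one
  map_zero' := HomogeneousLocalization.val_zero
  map_add' _ _ := HomogeneousLocalization.val_add _ _
  map_mul' _ _ := HomogeneousLocalization.val_mul _ _

/-- The action of functions on sections. -/
noncomputable instance (U : (Proj 𝒮).Opens) : Module Γ(Proj 𝒮, U) (projSections hℳ U) where
  smul r f := ⟨fun x ↦ evalAt 𝒮 x r • f.1 x, isFraction_smul hℳ U r f.1 f.2⟩
  one_smul f := Subtype.ext <| funext fun x ↦ by
    change evalAt 𝒮 x 1 • f.1 x = f.1 x
    rw [map_one, one_smul]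
  mul_smul r s f := Subtype.ext <| funext fun x ↦ by
    change evalAt 𝒮 x (r * s) • f.1 x = evalAt 𝒮 x r • evalAt 𝒮 x s • f.1 x
    rw [map_mul, mul_smul]
  smul_zero r := Subtype.ext <| funext fun x ↦ smul_zero (evalAt 𝒮 x r)
  smul_add r f g := Subtype.ext <| funext fun x ↦ smul_add (evalAt 𝒮 x r) (f.1 x) (g.1 x)
  add_smul r s f := Subtype.ext <| funext fun x ↦ by
    change evalAt 𝒮 x (r + s) • f.1 x = evalAt 𝒮 x r • f.1 x + evalAt 𝒮 x s • f.1 x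
    rw [map_add, add_smul]
  zero_smul f := Subtype.ext <| funext fun x ↦ by
    change evalAt 𝒮 x 0 • f.1 x = 0
    rw [map_zero, zero_smul]

/-- The presheaf of sections, as a presheaf of abelian groups. -/
noncomputable def sectionsPresheaf : TopCat.Presheaf Ab.{u} (Proj 𝒮) where
  obj U := AddCommGrpCat.of (projSections hℳ U.unop)
  map {U V} i := AddCommGrpCat.ofHom
    { toFun := fun f ↦ ⟨fun x ↦ f.1 ⟨x.1, i.unop.le x.2⟩,
        (isLocallyModFraction 𝒮 ℳ).res i.unop f.1 f.2⟩
      map_zero' := rfl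
      map_add' := fun _ _ ↦ rfl }

noncomputable instance (U : (Proj 𝒮).Opensᵒᵖ) :
    Module ((Proj 𝒮).ringCatSheaf.obj.obj U) ((sectionsPresheaf hℳ).obj U) :=
  inferInstanceAs (Module Γ(Proj 𝒮, U.unop) (projSections hℳ U.unop))

/-- The sheaf of modules on `Proj` attached to a graded module. -/
noncomputable def projTilde : (Proj 𝒮).Modules where
  val := PresheafOfModules.ofPresheaf (sectionsPresheaf hℳ) (fun _ _ _ _ _ ↦ rfl)
  isSheaf := (TopCat.Presheaf.isSheaf_iff_isSheaf_comp (forget AddCommGrpCat) _).2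
    (TopCat.subsheafToTypes (isLocallyModFraction 𝒮 ℳ)).2

end ProjModule

section AlgebraSheaf
open AlgebraicGeometry CategoryTheory TopologicalSpace Opposite

/-- A sheaf of (not necessarily unital or associative) algebras on a scheme: a sheaf of modules with
a bilinear multiplication of sections that is compatible with restriction. -/
structure AlgebraSheaf (X : Scheme.{u}) where
  /-- The underlying sheaf of modules. -/
  toModules : X.Modules
  /-- The multiplication of sections. -/
  mul : ∀ U : X.Opens,
    Γ(toModules, U) →ₗ[Γ(X, U)] Γ(toModules, U) →ₗ[Γ(X, U)] Γ(toModules, U)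
  map_mul : ∀ {U V : X.Opens} (i : U ⟶ V) (a b : Γ(toModules, V)),
    toModules.presheaf.map i.op (mul V a b) =
      mul U (toModules.presheaf.map i.op a) (toModules.presheaf.map i.op b)

variable {k S : Type u} [CommRing k] [CommRing S] [Algebra k S] {𝒮 : ℕ → Submodule k S}
  [GradedAlgebra 𝒮] {M : Type u} [AddCommGroup M] [Module S M] {ℳ : ℤ → AddSubgroup M}
  (hℳ : IsGradedModule 𝒮 ℳ) (μ : M →ₗ[S] M →ₗ[S] M)

theorem isFraction_mul (hμ : ∀ i j : ℤ, ∀ m ∈ ℳ i, ∀ n ∈ ℳ j, μ m n ∈ ℳ (i + j))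
    {U : Opens (ProjectiveSpectrum.top 𝒮)} (f g : ∀ x : U, LocMod 𝒮 M x.1)
    (hf : (isLocallyModFraction 𝒮 ℳ).pred f) (hg : (isLocallyModFraction 𝒮 ℳ).pred g) :
    (isLocallyModFraction 𝒮 ℳ).pred (fun x ↦ locMul (complAt 𝒮 x.1) μ (f x) (g x)) := by
  refine (isLocallyModFraction_iff 𝒮 ℳ _).2 fun x ↦ ?_
  obtain ⟨V, hV, i, n, m, s, hm, hs, h1, h2⟩ := (isLocallyModFraction_iff 𝒮 ℳ f).1 hf x
  obtain ⟨V', hV', i', n', m', s', hm', hs', h1', h2'⟩ := (isLocallyModFraction_iff 𝒮 ℳ g).1 hg x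
  refine ⟨V ⊓ V', ⟨hV, hV'⟩, inf_le_left.trans i, n + n', μ m m', s * s', ?_,
    SetLike.GradedMul.mul_mem hs hs',
    fun y ↦ mul_mem (h1 ⟨y.1, y.2.1⟩) (h1' ⟨y.1, y.2.2⟩), fun y ↦ ?_⟩
  · push_cast
    exact hμ n n' m hm m' hm'
  · dsimp only
    rw [h2 ⟨y.1, y.2.1⟩, h2' ⟨y.1, y.2.2⟩, locMul_mk]
    rfl

variable (hμ : ∀ i j : ℤ, ∀ m ∈ ℳ i, ∀ n ∈ ℳ j, μ m n ∈ ℳ (i + j))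

/-- The multiplication of sections. -/
noncomputable def sectionsMul (U : (Proj 𝒮).Opens) :
    projSections hℳ U →ₗ[Γ(Proj 𝒮, U)] projSections hℳ U →ₗ[Γ(Proj 𝒮, U)] projSections hℳ U :=
  LinearMap.mk₂ _
    (fun f g ↦ ⟨fun x ↦ locMul (complAt 𝒮 x.1) μ (f.1 x) (g.1 x),
      isFraction_mul μ hμ f.1 g.1 f.2 g.2⟩)
    (fun _ _ _ ↦ Subtype.ext <| funext fun _ ↦ add_locMul _ _ _ _ _)
    (fun _ _ _ ↦ Subtype.ext <| funext fun _ ↦ smul_locMul _ _ _ _ _)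
    (fun _ _ _ ↦ Subtype.ext <| funext fun _ ↦ locMul_add _ _ _ _ _)
    (fun _ _ _ ↦ Subtype.ext <| funext fun _ ↦ locMul_smul _ _ _ _ _)

/-- The sheaf of algebras on `Proj` attached to a graded algebra over the homogeneous coordinate
ring. -/
noncomputable def projTildeAlgebra : AlgebraSheaf (Proj 𝒮) where
  toModules := projTilde hℳ
  mul U := sectionsMul hℳ μ hμ U
  map_mul _ _ _ := rfl

end AlgebraSheaf

section Stalk
open AlgebraicGeometry CategoryTheory TopologicalSpace Opposite
variable {X : Scheme.{u}}

/-- The stalk of a sheaf of modules. -/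
noncomputable def stalkAb (F : X.Modules) (x : X) : Type u :=
  ↑(TopCat.Presheaf.stalk F.presheaf x : Ab.{u})

noncomputable instance (F : X.Modules) (x : X) : AddCommGroup (stalkAb F x) :=
  inferInstanceAs (AddCommGroup ↑(TopCat.Presheaf.stalk F.presheaf x : Ab.{u}))

noncomputable instance (F : X.Modules) (x : X) :
    Module (TopCat.Presheaf.stalk X.presheaf x : CommRingCat.{u}) (stalkAb F x) :=
  PresheafOfModules.instModuleCarrierStalkCommRingCatCarrierAbPresheafOpensCarrier
    (R := X.presheaf) F.val x

/-- The germ of a section. -/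
noncomputable def germAt (F : X.Modules) {U : X.Opens} {x : X} (hx : x ∈ U) : Γ(F, U) →+ stalkAb F x :=
  (TopCat.Presheaf.germ F.presheaf U x hx).hom

theorem germAt_smul (F : X.Modules) {U : X.Opens} {x : X} (hx : x ∈ U) (r : Γ(X, U)) (m : Γ(F, U)) :
    germAt F hx (r • m) = (X.presheaf.germ U x hx r) • germAt F hx m := by
  exact PresheafOfModules.germ_smul (R := X.presheaf) F.val x U hx r m

theorem germAt_res (F : X.Modules) {U V : X.Opens} {x : X} (i : U ⟶ V) (hx : x ∈ U) (m : Γ(F, V)) :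
    germAt F hx (F.presheaf.map i.op m) = germAt F (i.le hx) m :=
  TopCat.Presheaf.germ_res_apply F.presheaf i x hx m

theorem exists_germAt_eq (F : X.Modules) {x : X} (t : stalkAb F x) :
    ∃ (U : X.Opens) (hx : x ∈ U) (s : Γ(F, U)), germAt F hx s = t :=
  TopCat.Presheaf.exists_germ_eq F.presheaf t

theorem germAt_eq (F : X.Modules) {U V : X.Opens} {x : X} (hU : x ∈ U) (hV : x ∈ V) (s : Γ(F, U))
    (t : Γ(F, V)) (h : germAt F hU s = germAt F hV t) :
    ∃ (W : X.Opens) (_ : x ∈ W) (i : W ⟶ U) (j : W ⟶ V),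
      F.presheaf.map i.op s = F.presheaf.map j.op t :=
  TopCat.Presheaf.germ_eq F.presheaf x hU hV s t h

end Stalk

section StalkMul
open AlgebraicGeometry CategoryTheory TopologicalSpace Opposite
variable {X : Scheme.{u}}

theorem exists_germAt_eq₂ (F : X.Modules) {x : X} (a b : stalkAb F x) :
    ∃ (U : X.Opens) (hx : x ∈ U) (s t : Γ(F, U)), germAt F hx s = a ∧ germAt F hx t = b := by
  obtain ⟨U, hU, s, rfl⟩ := exists_germAt_eq F a
  obtain ⟨V, hV, t, rfl⟩ := exists_germAt_eq F b
  exact ⟨U ⊓ V, ⟨hU, hV⟩, F.presheaf.map (homOfLE inf_le_left : U ⊓ V ⟶ U).op s,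
    F.presheaf.map (homOfLE inf_le_right : U ⊓ V ⟶ V).op t, germAt_res F _ _ s, germAt_res F _ _ t⟩

theorem exists_germAt_eq₃ (F : X.Modules) {x : X} (a b c : stalkAb F x) :
    ∃ (U : X.Opens) (hx : x ∈ U) (s t r : Γ(F, U)),
      germAt F hx s = a ∧ germAt F hx t = b ∧ germAt F hx r = c := by
  obtain ⟨U, hU, s, t, rfl, rfl⟩ := exists_germAt_eq₂ F a b
  obtain ⟨V, hV, r, rfl⟩ := exists_germAt_eq F c
  exact ⟨U ⊓ V, ⟨hU, hV⟩, F.presheaf.map (homOfLE inf_le_left : U ⊓ V ⟶ U).op s,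
    F.presheaf.map (homOfLE inf_le_left : U ⊓ V ⟶ U).op t,
    F.presheaf.map (homOfLE inf_le_right : U ⊓ V ⟶ V).op r, germAt_res F _ _ s, germAt_res F _ _ t,
    germAt_res F _ _ r⟩

theorem exists_germ_eq_germAt_eq₂ (F : X.Modules) {x : X} (r : X.presheaf.stalk x)
    (a b : stalkAb F x) :
    ∃ (U : X.Opens) (hx : x ∈ U) (f : Γ(X, U)) (s t : Γ(F, U)),
      X.presheaf.germ U x hx f = r ∧ germAt F hx s = a ∧ germAt F hx t = b := by
  obtain ⟨U, hU, s, t, rfl, rfl⟩ := exists_germAt_eq₂ F a b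
  obtain ⟨V, hV, f, rfl⟩ := TopCat.Presheaf.exists_germ_eq X.presheaf r
  exact ⟨U ⊓ V, ⟨hU, hV⟩, X.presheaf.map (homOfLE inf_le_right : U ⊓ V ⟶ V).op f,
    F.presheaf.map (homOfLE inf_le_left : U ⊓ V ⟶ U).op s,
    F.presheaf.map (homOfLE inf_le_left : U ⊓ V ⟶ U).op t,
    TopCat.Presheaf.germ_res_apply X.presheaf _ _ _ f, germAt_res F _ _ s, germAt_res F _ _ t⟩

variable (𝒜 : AlgebraSheaf X)

theorem germAt_mul_congr {U V : X.Opens} {x : X} (hU : x ∈ U) (hV : x ∈ V)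
    (s t : Γ(𝒜.toModules, U)) (s' t' : Γ(𝒜.toModules, V))
    (hs : germAt 𝒜.toModules hU s = germAt 𝒜.toModules hV s')
    (ht : germAt 𝒜.toModules hU t = germAt 𝒜.toModules hV t') :
    germAt 𝒜.toModules hU (𝒜.mul U s t) = germAt 𝒜.toModules hV (𝒜.mul V s' t') := by
  obtain ⟨W, hW, i, j, e⟩ := germAt_eq _ _ _ _ _ hs
  obtain ⟨W', hW', i', j', e'⟩ := germAt_eq _ _ _ _ _ ht
  have e1 := congrArg (𝒜.toModules.presheaf.map (homOfLE inf_le_left : W ⊓ W' ⟶ W).op) e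
  have e2 := congrArg (𝒜.toModules.presheaf.map (homOfLE inf_le_right : W ⊓ W' ⟶ W').op) e'
  rw [← ConcreteCategory.comp_apply, ← ConcreteCategory.comp_apply, ← Functor.map_comp,
    ← Functor.map_comp, ← op_comp, ← op_comp] at e1 e2
  rw [← germAt_res 𝒜.toModules (homOfLE inf_le_left ≫ i : W ⊓ W' ⟶ U) ⟨hW, hW'⟩,
    ← germAt_res 𝒜.toModules (homOfLE inf_le_left ≫ j : W ⊓ W' ⟶ V) ⟨hW, hW'⟩,
    𝒜.map_mul, 𝒜.map_mul, e1]
  have h1 : (homOfLE inf_le_right ≫ i' : W ⊓ W' ⟶ U) = homOfLE inf_le_left ≫ i :=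
    Subsingleton.elim _ _
  have h2 : (homOfLE inf_le_right ≫ j' : W ⊓ W' ⟶ V) = homOfLE inf_le_left ≫ j :=
    Subsingleton.elim _ _
  rw [h1, h2] at e2
  rw [e2]

/-- The multiplication of germs. -/
noncomputable def stalkMulFun {x : X} (a b : stalkAb 𝒜.toModules x) : stalkAb 𝒜.toModules x :=
  germAt 𝒜.toModules (exists_germAt_eq₂ 𝒜.toModules a b).choose_spec.choose
    (𝒜.mul _ (exists_germAt_eq₂ 𝒜.toModules a b).choose_spec.choose_spec.choose
      (exists_germAt_eq₂ 𝒜.toModules a b).choose_spec.choose_spec.choose_spec.choose)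

theorem stalkMulFun_germAt {U : X.Opens} {x : X} (hU : x ∈ U) (s t : Γ(𝒜.toModules, U)) :
    stalkMulFun 𝒜 (germAt 𝒜.toModules hU s) (germAt 𝒜.toModules hU t) =
      germAt 𝒜.toModules hU (𝒜.mul U s t) :=
  germAt_mul_congr 𝒜 _ _ _ _ _ _
    (exists_germAt_eq₂ 𝒜.toModules _ _).choose_spec.choose_spec.choose_spec.choose_spec.1
    (exists_germAt_eq₂ 𝒜.toModules _ _).choose_spec.choose_spec.choose_spec.choose_spec.2

theorem stalkMulFun_smul_left {x : X} (r : X.presheaf.stalk x) (a b : stalkAb 𝒜.toModules x) :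
    stalkMulFun 𝒜 (r • a) b = r • stalkMulFun 𝒜 a b := by
  obtain ⟨U, hU, f, s, t, rfl, rfl, rfl⟩ := exists_germ_eq_germAt_eq₂ 𝒜.toModules r a b
  rw [← germAt_smul, stalkMulFun_germAt, stalkMulFun_germAt, map_smul, LinearMap.smul_apply,
    ← germAt_smul]

theorem stalkMulFun_smul_right {x : X} (r : X.presheaf.stalk x) (a b : stalkAb 𝒜.toModules x) :
    stalkMulFun 𝒜 a (r • b) = r • stalkMulFun 𝒜 a b := by
  obtain ⟨U, hU, f, s, t, rfl, rfl, rfl⟩ := exists_germ_eq_germAt_eq₂ 𝒜.toModules r a b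
  rw [← germAt_smul, stalkMulFun_germAt, stalkMulFun_germAt, map_smul, ← germAt_smul]

theorem stalkMulFun_add_left {x : X} (a a' b : stalkAb 𝒜.toModules x) :
    stalkMulFun 𝒜 (a + a') b = stalkMulFun 𝒜 a b + stalkMulFun 𝒜 a' b := by
  obtain ⟨U, hU, s, s', t, rfl, rfl, rfl⟩ := exists_germAt_eq₃ 𝒜.toModules a a' b
  rw [← map_add, stalkMulFun_germAt, stalkMulFun_germAt, stalkMulFun_germAt, map_add,
    LinearMap.add_apply, map_add]

theorem stalkMulFun_add_right {x : X} (a b b' : stalkAb 𝒜.toModules x) :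
    stalkMulFun 𝒜 a (b + b') = stalkMulFun 𝒜 a b + stalkMulFun 𝒜 a b' := by
  obtain ⟨U, hU, s, t, t', rfl, rfl, rfl⟩ := exists_germAt_eq₃ 𝒜.toModules a b b'
  rw [← map_add, stalkMulFun_germAt, stalkMulFun_germAt, stalkMulFun_germAt, map_add, map_add]

/-- The multiplication of the stalk of a sheaf of algebras. -/
noncomputable def stalkMul (x : X) :
    stalkAb 𝒜.toModules x →ₗ[X.presheaf.stalk x] stalkAb 𝒜.toModules x →ₗ[X.presheaf.stalk x]
      stalkAb 𝒜.toModules x :=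
  LinearMap.mk₂ _ (stalkMulFun 𝒜) (stalkMulFun_add_left 𝒜) (stalkMulFun_smul_left 𝒜)
    (stalkMulFun_add_right 𝒜) (stalkMulFun_smul_right 𝒜)

end StalkMul

section Completion
variable {R N : Type u} [CommRing R] [AddCommGroup N] [Module R N] (I : Ideal R)
  (β : N →ₗ[R] N →ₗ[R] N)

/-- The multiplication induced on the quotient by `J N`. -/
def quotMul (J : Ideal R) : (N ⧸ (J • ⊤ : Submodule R N)) →ₗ[R] (N ⧸ (J • ⊤ : Submodule R N)) →ₗ[R]
    (N ⧸ (J • ⊤ : Submodule R N)) :=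
  Submodule.liftQ _ (LinearMap.flip <| Submodule.liftQ _
    (LinearMap.flip (β.compr₂ (Submodule.mkQ (J • ⊤)))) <| by
      intro n hn
      induction hn using Submodule.smul_induction_on' with
      | smul r hr n _ =>
        refine LinearMap.mem_ker.2 (LinearMap.ext fun m ↦ ?_)
        simp only [map_smul, LinearMap.smul_apply, LinearMap.flip_apply, LinearMap.compr₂_apply,
          LinearMap.zero_apply]
        rw [← map_smul, Submodule.mkQ_apply, Submodule.Quotient.mk_eq_zero]
        exact Submodule.smul_mem_smul hr trivial
      | add n _ n' _ h h' => exact add_mem h h') <| by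
    intro m hm
    induction hm using Submodule.smul_induction_on' with
    | smul r hr m _ =>
      refine LinearMap.mem_ker.2 (LinearMap.ext fun n ↦ ?_)
      obtain ⟨n, rfl⟩ := Submodule.Quotient.mk_surjective _ n
      simp only [map_smul, LinearMap.smul_apply, LinearMap.flip_apply, LinearMap.compr₂_apply,
        LinearMap.zero_apply, Submodule.liftQ_apply]
      rw [← map_smul, Submodule.mkQ_apply, Submodule.Quotient.mk_eq_zero]
      exact Submodule.smul_mem_smul hr trivial
    | add n _ n' _ h h' => exact add_mem h h'

theorem quotMul_mk (J : Ideal R) (m n : N) :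
    quotMul β J (Submodule.Quotient.mk m) (Submodule.Quotient.mk n) = Submodule.Quotient.mk (β m n) :=
  rfl

/-- The multiplication of the completion: multiply the representatives modulo every power of `I`. -/
noncomputable def completionMul (x y : AdicCompletion I N) : AdicCompletion I N :=
  ⟨fun n ↦ quotMul β (I ^ n) (x.1 n) (y.1 n), fun {m n} hmn ↦ by
    have hx := x.2 hmn
    have hy := y.2 hmn
    obtain ⟨a, ha⟩ := Submodule.Quotient.mk_surjective _ (x.1 n)
    obtain ⟨b, hb⟩ := Submodule.Quotient.mk_surjective _ (y.1 n)
    rw [← ha] at hx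
    rw [← hb] at hy
    change AdicCompletion.transitionMap I N hmn (quotMul β (I ^ n) (x.1 n) (y.1 n)) =
      quotMul β (I ^ m) (x.1 m) (y.1 m)
    rw [← hx, ← hy, ← ha, ← hb]
    rfl⟩

theorem completionMul_of (m n : N) :
    completionMul I β (AdicCompletion.of I N m) (AdicCompletion.of I N n) =
      AdicCompletion.of I N (β m n) := rfl

end Completion

section Geometry
open AlgebraicGeometry CategoryTheory TopologicalSpace Opposite
variable {k : Type u} [CommRing k]

/-- The structure morphism of `Proj` of a graded `k`-algebra. -/
noncomputable def projToSpec {S : Type u} [CommRing S] [Algebra k S] (𝒮 : ℕ → Submodule k S)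
    [GradedAlgebra 𝒮] : Proj 𝒮 ⟶ Spec (.of k) :=
  Proj.toSpecZero 𝒮 ≫ Spec.map (CommRingCat.ofHom (algebraMap k (𝒮 0)))

attribute [local instance] MvPolynomial.gradedAlgebra

/-- Projective space over `k`. -/
noncomputable abbrev projectiveSpace (k : Type u) [CommRing k] (n : ℕ) : Scheme.{u} :=
  Proj (MvPolynomial.homogeneousSubmodule (Fin (n + 1)) k)

variable {X : Scheme.{u}} (f : X ⟶ Spec (.of k))

/-- `X` is projective over `k`: a closed subscheme of some projective space. -/
def IsProjective : Prop :=
  ∃ (n : ℕ) (i : X ⟶ projectiveSpace k n), IsClosedImmersion i ∧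
    i ≫ projToSpec (MvPolynomial.homogeneousSubmodule (Fin (n + 1)) k) = f

/-- The constants in the ring of functions on an open subset of a `k`-scheme. -/
noncomputable def scalars (U : X.Opens) : k →+* Γ(X, U) :=
  ((Scheme.ΓSpecIso (.of k)).inv ≫ f.appTop ≫ X.presheaf.map (homOfLE le_top : U ⟶ ⊤).op).hom

theorem map_scalars {U V : X.Opens} (i : U ⟶ V) (c : k) :
    X.presheaf.map i.op (scalars f V c) = scalars f U c := by
  simp only [scalars]
  rw [← CommRingCat.comp_apply, Category.assoc, Category.assoc, ← X.presheaf.map_comp]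
  rfl

/-- A point of a `k`-scheme is rational if its residue field is `k`. -/
def IsRationalPoint (p : X) : Prop :=
  Function.Bijective fun c : k ↦ X.Γevaluation p (scalars f ⊤ c)

/-- A `k`-scheme is smooth at a point. -/
def IsSmoothAt (p : X) : Prop :=
  ∃ U : X.Opens, p ∈ U ∧ Smooth (U.ι ≫ f)

/-- The abelian sheaf underlying a sheaf of modules. -/
noncomputable def abSheaf (F : X.Modules) : Sheaf (Opens.grothendieckTopology X) AddCommGrpCat.{u} :=
  ⟨F.presheaf, F.isSheaf⟩

/-- Multiplication by a constant. -/
noncomputable def scalarEnd (F : X.Modules) (c : k) : abSheaf F ⟶ abSheaf F :=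
  ⟨{ app U := F.smul (scalars f U.unop c)
     naturality {U V} i := by
        have h := F.map_comp_smul i.unop (scalars f U.unop c)
        rw [map_scalars] at h
        exact h.symm }⟩

/-- The cohomology of a sheaf of modules on a `k`-scheme. -/
def Cohomology (_ : X ⟶ Spec (.of k)) (F : X.Modules) (n : ℕ) : Type u :=
  (abSheaf F).H n

noncomputable instance (F : X.Modules) (n : ℕ) : AddCommGroup (Cohomology f F n) :=
  inferInstanceAs (AddCommGroup ((abSheaf F).H n))

theorem scalarEnd_app (F : X.Modules) (c : k) (U : X.Opensᵒᵖ) (x : Γ(F, U.unop)) :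
    (scalarEnd f F c).hom.app U x = (scalars f U.unop c • x : Γ(F, U.unop)) := rfl

theorem scalarEnd_one (F : X.Modules) : scalarEnd f F 1 = 𝟙 _ := by
  ext U x
  refine (scalarEnd_app f F 1 U x).trans ?_
  rw [map_one]
  exact one_smul Γ(X, U.unop) (show Γ(F, U.unop) from x)

theorem scalarEnd_mul (F : X.Modules) (c d : k) :
    scalarEnd f F (c * d) = scalarEnd f F d ≫ scalarEnd f F c := by
  ext U x
  refine (scalarEnd_app f F (c * d) U x).trans ?_
  rw [map_mul]
  exact mul_smul _ _ (show Γ(F, U.unop) from x)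

theorem scalarEnd_add (F : X.Modules) (c d : k) :
    scalarEnd f F (c + d) = scalarEnd f F c + scalarEnd f F d := by
  ext U x
  refine (scalarEnd_app f F (c + d) U x).trans ?_
  rw [map_add]
  exact add_smul _ _ (show Γ(F, U.unop) from x)

/-- `k` acts on cohomology by functoriality. -/
noncomputable def scalarEndCohomology (F : X.Modules) (n : ℕ) : k →+* AddMonoid.End ((abSheaf F).H n) :=
  RingHom.mk'
    { toFun := fun c ↦ Sheaf.H.map (scalarEnd f F c) n
      map_one' := by
        rw [scalarEnd_one]
        ext a
        exact Sheaf.H.map_id_apply a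
      map_mul' := fun c d ↦ by
        rw [scalarEnd_mul]
        ext a
        exact Sheaf.H.map_comp_apply _ _ a }
    fun c d ↦ by
      refine AddMonoidHom.ext fun a ↦ ?_
      refine (congrArg (fun φ ↦ Sheaf.H.map φ n a) (scalarEnd_add f F c d)).trans ?_
      exact Sheaf.H.map_add_apply _ _ a

noncomputable instance (F : X.Modules) (n : ℕ) : Module k (Cohomology f F n) :=
  Module.compHom ((abSheaf F).H n) (scalarEndCohomology f F n)

end Geometry

section Properties
open AlgebraicGeometry CategoryTheory TopologicalSpace Opposite
variable {X : Scheme.{u}}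

/-- The structure sheaf as a sheaf of modules. -/
noncomputable def structureModule (X : Scheme.{u}) : X.Modules :=
  SheafOfModules.unit X.ringCatSheaf

/-- A sheaf of modules is coherent if, on the members of an affine open cover, it is the sheaf
attached to a finitely generated module over the ring of functions. -/
def IsCoherent (F : X.Modules) : Prop :=
  ∀ x : X, ∃ (U : X.Opens) (_ : x ∈ U) (hU : IsAffineOpen U) (M : ModuleCat.{u} Γ(X, U)),
    Module.Finite Γ(X, U) M ∧ Nonempty (F.restrict hU.fromSpec ≅ tilde M)

/-- A sheaf of modules is torsion-free if all its stalks are. -/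
def IsTorsionFree (F : X.Modules) : Prop :=
  ∀ (x : X) (r : X.presheaf.stalk x) (m : stalkAb F x),
    r ∈ nonZeroDivisors (X.presheaf.stalk x) → r • m = 0 → m = 0

/-- The arithmetic genus `1 - χ(𝒪_X)` of a projective curve, where `χ = h⁰ - h¹`. -/
noncomputable def arithmeticGenus {k : Type u} [Field k] (f : X ⟶ Spec (.of k)) : ℤ :=
  1 - ((Module.finrank k (Cohomology f (structureModule X) 0) : ℤ) -
    Module.finrank k (Cohomology f (structureModule X) 1))

/-- The completed local ring of a scheme at a point. -/
abbrev CompletedLocalRing (x : X) : Type u :=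
  AdicCompletion (IsLocalRing.maximalIdeal (X.presheaf.stalk x)) (X.presheaf.stalk x)

/-- The completed stalk of a sheaf of modules. -/
abbrev CompletedStalk (F : X.Modules) (x : X) : Type u :=
  AdicCompletion (IsLocalRing.maximalIdeal (X.presheaf.stalk x)) (stalkAb F x)

/-- The germ of a function in the completed local ring. -/
noncomputable def completedGerm {U : X.Opens} {x : X} (hx : x ∈ U) (r : Γ(X, U)) :
    CompletedLocalRing x :=
  AdicCompletion.of _ _ (X.presheaf.germ U x hx r)

/-- The germ of a section in the completed stalk. -/
noncomputable def completedGermAt (F : X.Modules) {U : X.Opens} {x : X} (hx : x ∈ U) (m : Γ(F, U)) :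
    CompletedStalk F x :=
  AdicCompletion.of _ _ (germAt F hx m)

/-- The multiplication of the completed stalk of a sheaf of algebras. -/
noncomputable def completedMul (𝒜 : AlgebraSheaf X) {x : X} (a b : CompletedStalk 𝒜.toModules x) :
    CompletedStalk 𝒜.toModules x :=
  completionMul _ (stalkMul 𝒜 x) a b

variable {k : Type u} [Field k] {p : X} (c : CompletedLocalRing p ≃+* PowerSeries k)

/-- `φ` is the image of the function `s` under the extension of `c` to fields of fractions: near `p`,
`s` is a quotient `a / b` of functions that are regular at `p`, and `φ = c(a) / c(b)`. -/
def IsExpansion {U : X.Opens} (s : Γ(X, U)) (φ : HahnSeries ℤ k) : Prop :=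
  ∃ (V : X.Opens) (hp : p ∈ V) (a b : Γ(X, V)),
    X.presheaf.map (homOfLE inf_le_right : U ⊓ V ⟶ V).op a =
      X.presheaf.map (homOfLE inf_le_right : U ⊓ V ⟶ V).op b *
        X.presheaf.map (homOfLE inf_le_left : U ⊓ V ⟶ U).op s ∧
    c (completedGerm hp b) ≠ 0 ∧
    HahnSeries.ofPowerSeries ℤ k (c (completedGerm hp b)) * φ =
      HahnSeries.ofPowerSeries ℤ k (c (completedGerm hp a))

variable {A : Type u} [NonUnitalNonAssocRing A] [Module k A] {F : X.Modules}
  (ζ : CompletedStalk F p ≃+ integralPart k A)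

/-- `φ` is the image of the section `s` under the extension of `ζ` to the localization of the
completed stalk at the nonzero elements of the completed local ring: near `p`, `s` is a quotient
`a / b` of a section `a` and a function `b` that are regular at `p`, and `φ = ζ(a) / c(b)`. -/
def IsModExpansion {U : X.Opens} (s : Γ(F, U)) (φ : HahnSeries ℤ A) : Prop :=
  ∃ (V : X.Opens) (hp : p ∈ V) (a : Γ(F, V)) (b : Γ(X, V)),
    F.presheaf.map (homOfLE inf_le_right : U ⊓ V ⟶ V).op a =
      X.presheaf.map (homOfLE inf_le_right : U ⊓ V ⟶ V).op b •
        F.presheaf.map (homOfLE inf_le_left : U ⊓ V ⟶ U).op s ∧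
    c (completedGerm hp b) ≠ 0 ∧
    act (HahnSeries.ofPowerSeries ℤ k (c (completedGerm hp b))) φ = ζ (completedGermAt F hp a)

end Properties

section Datum
open AlgebraicGeometry CategoryTheory
variable {k A : Type u} [Field k] (O : Subalgebra k (HahnSeries ℤ k))

/-- The element `t` of `gr(O)`. -/
noncomputable def grT : GrRing O :=
  grMonomial O 1 1 O.one_mem (one_mem_poleLE (Int.natCast_nonneg 1))

/-- The curve `Proj(gr(O))`. -/
noncomputable abbrev latticeCurve : Scheme.{u} := Proj (grPiece O)

/-- The structure morphism of `Proj(gr(O))`. -/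
noncomputable abbrev latticeCurveHom : latticeCurve O ⟶ Spec (.of k) := projToSpec (grPiece O)

variable {O} [NonUnitalNonAssocRing A] [Module k A] [SMulCommClass k A A] [IsScalarTower k A A]
  {W : Submodule k (HahnSeries ℤ A)}

/-- The sheaf of algebras on `Proj(gr(O))` attached to `gr(W)`. -/
noncomputable def latticeSheaf (h : Stabilizes O W) (hW : IsLattice W) :
    AlgebraSheaf (latticeCurve O) :=
  projTildeAlgebra (𝒮 := grPiece O) (ℳ := grModPiece h)
    (fun _ _ _ _ ↦ grPiece_smul_mem h) (grModMul h hW.mul_mem)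
    (fun _ _ _ hm _ hn ↦ grModMul_mem h hW.mul_mem hm hn)

end Datum

end GeomLattice

open AlgebraicGeometry CategoryTheory GeomLattice

/-!
The curve `X = Proj(gr(O))` is irreducible, and all of its geometry takes place inside `k((z))` and `A((z))`.
A homogeneous fraction `(tⁿ w) / (tⁿ α)` is recorded by the series `w / α`, which determines it. Therefore a
section of the structure sheaf or of the sheaf attached to `gr(W)` over a nonempty open subset is one Laurent
series (`functionValue`, `sectionValue`), and the two sheaves become sheaves of subspaces of `k((z))` and
`A((z))`: the sections over `V` are the series that are regular, that is, such a fraction, at each point of `V`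
(`regularOn`, `LatticeModel`). Over `D₊(tᵈ f)`, the sections are the fractions whose denominators are powers of
`f` (`mem_regularOn_basicOpenOf`).

Two pieces cover the curve. Over `D₊(t)` the sections are `W`, and `D₊(t)` is the spectrum of `O`
(`regularOn_affinePart`, `specIsoAffinePart`). The complement of `D₊(t)` is the single point `(t)`
(`eq_infinityPt_of_notMem`); there a series is regular if and only if it is a power series and a fraction
(`isRegularAt_infinityPt_iff`).

The finiteness conditions on a lattice are used in one form: every leading coefficient occurs at every large
pole order (`IsLattice.exists_leading`). Subtracting leading terms then gives the following.

* `O` is finite-dimensional modulo each nonzero principal ideal, so that nonzero primes are maximal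
  (`IsLattice.finite_quotient_span`).
* For large `N`, the Veronese subalgebra of degree `2N` of `gr(O)` is generated in degree one, by finitely many
  elements (`exists_aeval_eq`). This gives a closed immersion in a projective space (`isClosedImmersion_toProj`).
* A quotient of elements of `O` of consecutive pole orders is a uniformizer at infinity (`exists_uniformizer`).
  It identifies the adic filtrations of the local ring and of the stalk with the filtrations by order of
  vanishing, so that the completions are `k[[z]]` and `A[[z]]` (`IsAdicModel`). The point at infinity is smooth
  because a uniformizer is an étale coordinate (`exists_smooth_of_maximalIdeal_eq_span`).
* The sections over `D₊(t)` and near infinity are generated by elements of bounded pole order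
  (`IsLattice.exists_generators`). Together with the extension of sections from a basic open subset after
  multiplication by a power of a function (`exists_pow_act_mem_regularOn`) this is coherence.

For the cohomology, embed the sheaf in the sheaf that has the value `A((z))` on each nonempty open subset. That
sheaf is flasque, so `H¹` consists of the global principal parts modulo `A((z))`. Over the affine open subset
`D₊(t)` a principal part lifts to `A((z))`, by a partition of unity (`exists_glue_affinePart`); the difference
between such a lift and a lift near infinity identifies `H¹` with `A((z)) / (A[[z]] + W)`
(`SubspaceModel.exists_H_one_equiv`). The global sections are the power series in `W` (`regularOn_top`).
-/

namespace GeomLattice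

/-! ### Laurent series and lattices -/

section Series
open HahnSeries
variable {k A : Type u} [Field k] [NonUnitalNonAssocRing A] [Module k A]

theorem act_add (f : HahnSeries ℤ k) (a b : HahnSeries ℤ A) : act f (a + b) = act f a + act f b :=
  smul_add (A := HahnModule ℤ k A) f _ _

theorem add_act (f g : HahnSeries ℤ k) (a : HahnSeries ℤ A) : act (f + g) a = act f a + act g a :=
  add_smul (M := HahnModule ℤ k A) f g _

theorem act_act (f g : HahnSeries ℤ k) (a : HahnSeries ℤ A) : act f (act g a) = act (f * g) a :=
  (mul_smul (α := HahnSeries ℤ k) (β := HahnModule ℤ k A) f g _).symm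

theorem one_act (a : HahnSeries ℤ A) : act (1 : HahnSeries ℤ k) a = a :=
  one_smul (HahnSeries ℤ k) (HahnModule.of k a)

theorem zero_act (a : HahnSeries ℤ A) : act (0 : HahnSeries ℤ k) a = 0 :=
  zero_smul (HahnSeries ℤ k) (HahnModule.of k a)

theorem act_sub (f : HahnSeries ℤ k) (a b : HahnSeries ℤ A) : act f (a - b) = act f a - act f b :=
  smul_sub (A := HahnModule ℤ k A) f _ _

theorem act_sum {ι : Type*} (f : HahnSeries ℤ k) (s : Finset ι) (a : ι → HahnSeries ℤ A) :
    act f (∑ i ∈ s, a i) = ∑ i ∈ s, act f (a i) :=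
  map_sum (⟨⟨act f, act_zero f⟩, act_add f⟩ : HahnSeries ℤ A →+ HahnSeries ℤ A) _ _

theorem sum_act {ι : Type*} (s : Finset ι) (f : ι → HahnSeries ℤ k) (a : HahnSeries ℤ A) :
    act (∑ i ∈ s, f i) a = ∑ i ∈ s, act (f i) a :=
  map_sum (⟨⟨fun f ↦ act f a, zero_act a⟩, fun f g ↦ add_act f g a⟩ :
    HahnSeries ℤ k →+ HahnSeries ℤ A) _ _

theorem act_inv_act {f : HahnSeries ℤ k} (hf : f ≠ 0) (a : HahnSeries ℤ A) :
    act f⁻¹ (act f a) = a := by rw [act_act, inv_mul_cancel₀ hf, one_act]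

theorem act_act_inv {f : HahnSeries ℤ k} (hf : f ≠ 0) (a : HahnSeries ℤ A) :
    act f (act f⁻¹ a) = a := by rw [act_act, mul_inv_cancel₀ hf, one_act]

theorem act_injective {f : HahnSeries ℤ k} (hf : f ≠ 0) :
    Function.Injective (act f : HahnSeries ℤ A → HahnSeries ℤ A) := fun a b h ↦ by
  rw [← act_inv_act hf a, h, act_inv_act hf]

theorem act_eq_mul (f g : HahnSeries ℤ k) : act f g = f * g := rfl

theorem act_C (c : k) (a : HahnSeries ℤ A) : act (C c) a = c • a := by
  ext n
  have := HahnModule.coeff_single_zero_smul (Γ := ℤ) (R:=k) (V := A) (r:=c) (x := HahnModule.of k a) (a := n)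
  exact this

theorem exists_mem_poleLE (a : HahnSeries ℤ A) : ∃ n : ℕ, a ∈ poleLE k A n := by
  refine ⟨a.order.natAbs, fun i hi ↦ coeff_eq_zero_of_lt_order (lt_of_lt_of_le hi ?_)⟩
  omega

theorem inv_mem_poleLE {f : HahnSeries ℤ k} {n : ℤ} (hf : f ∈ poleLE k k n)
    (h0 : f.coeff (-n) ≠ 0) : f⁻¹ ∈ poleLE k k (-n) := by
  have hne : f ≠ 0 := by rintro rfl; exact h0 rfl
  have ho : f.order = -n := by
    refine le_antisymm (order_le_of_coeff_ne_zero h0) ?_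
    by_contra! h
    exact hne (coeff_order_eq_zero.1 (hf _ h))
  intro i hi
  refine coeff_eq_zero_of_lt_order ?_
  have : (f * f⁻¹).order = f.order + f⁻¹.order := order_mul hne (inv_ne_zero hne)
  rw [mul_inv_cancel₀ hne, order_one] at this
  omega

theorem mem_poleLE_of_order {f : HahnSeries ℤ k} {n : ℤ} (h : -n ≤ f.order) : f ∈ poleLE k k n :=
  fun _ hi ↦ coeff_eq_zero_of_lt_order (lt_of_lt_of_le hi h)

/-- The leading coefficient of a product is the product of the leading coefficients. -/
theorem coeff_act_leading {f : HahnSeries ℤ k} {a : HahnSeries ℤ A} {m n : ℤ}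
    (hf : f ∈ poleLE k k m) (ha : a ∈ poleLE k A n) :
    (act f a).coeff (-(m + n)) = f.coeff (-m) • a.coeff (-n) := by
  rw [coeff_act f a _ f.isPWO_support a.isPWO_support subset_rfl subset_rfl]
  by_cases h : f.coeff (-m) • a.coeff (-n) = 0
  · rw [h]
    refine Finset.sum_eq_zero fun ij hij ↦ ?_
    simp only [Finset.mem_antidiagonal] at hij
    rcases lt_trichotomy ij.1 (-m) with h1 | h1 | h1
    · rw [hf _ h1, zero_smul]
    · have h2 : ij.2 = -n := by omega
      rw [h1, h2, h]
    · rw [ha ij.2 (by omega), smul_zero]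
  · refine Finset.sum_eq_single (-m, -n) (fun ij hij hne ↦ ?_) fun h1 ↦ ?_
    · simp only [Finset.mem_antidiagonal] at hij
      rcases lt_trichotomy ij.1 (-m) with h1 | h1 | h1
      · rw [hf _ h1, zero_smul]
      · exact absurd (Prod.ext h1 (by dsimp only; omega)) hne
      · rw [ha ij.2 (by omega), smul_zero]
    · refine absurd (Finset.mem_antidiagonal.2 ⟨?_, ?_, by ring⟩) h1
      · rw [mem_support]
        intro h0
        rw [h0, zero_smul] at h
        exact h rfl
      · rw [mem_support]
        intro h0
        rw [h0, smul_zero] at h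
        exact h rfl

theorem mem_poleLE_pred {a : HahnSeries ℤ A} {n : ℤ} (ha : a ∈ poleLE k A n)
    (h0 : a.coeff (-n) = 0) : a ∈ poleLE k A (n - 1) := fun i hi ↦ by
  rcases lt_or_eq_of_le (show i ≤ -n by omega) with h | h
  · exact ha i h
  · rw [h, h0]

theorem single_mem_poleLE (n : ℤ) (a : A) : single (-n) a ∈ poleLE k A n := fun i hi ↦
  coeff_single_of_ne (by omega)

/-- Multiplication by a series of exact pole order `m` shifts pole orders by exactly `m`. -/
theorem act_mem_iff {f : HahnSeries ℤ k} {a : HahnSeries ℤ A} {m n : ℤ}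
    (hf : f ∈ poleLE k k m) (h0 : f.coeff (-m) ≠ 0) :
    act f a ∈ poleLE k A (m + n) ↔ a ∈ poleLE k A n := by
  refine ⟨fun h ↦ ?_, act_mem_poleLE hf⟩
  have hne : f ≠ 0 := by rintro rfl; exact h0 rfl
  have := act_mem_poleLE (inv_mem_poleLE hf h0) h
  rwa [act_inv_act hne, neg_add_cancel_left] at this

end Series

section LatticeDim
open HahnSeries
variable {k A : Type u} [Field k] [NonUnitalNonAssocRing A] [Module k A]
  {W : Submodule k (HahnSeries ℤ A)}

/-- The series in `A((z))` have bounded poles modulo a lattice. -/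
theorem IsLattice.exists_sup_poleLE_eq_top (hW : IsLattice W) : ∃ N : ℕ, W ⊔ poleLE k A N = ⊤ := by
  have := hW.finite_quotient
  obtain ⟨s, hs⟩ := Module.Finite.fg_top (R := k) (M := HahnSeries ℤ A ⧸ (integralPart k A ⊔ W))
  choose g hg using fun q : HahnSeries ℤ A ⧸ (integralPart k A ⊔ W) ↦
    Submodule.Quotient.mk_surjective _ q
  choose n hn using exists_mem_poleLE (k := k) (A := A)
  refine ⟨s.sup fun q ↦ n (g q), ?_⟩
  set N := s.sup fun q ↦ n (g q)
  have h1 : integralPart k A ⊔ W ≤ W ⊔ poleLE k A N := by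
    rw [sup_comm]
    exact sup_le_sup_left (poleLE_mono (by positivity)) _
  rw [eq_top_iff]
  rintro a -
  have ha : (Submodule.Quotient.mk a : HahnSeries ℤ A ⧸ (integralPart k A ⊔ W)) ∈
      Submodule.map (Submodule.mkQ _) (W ⊔ poleLE k A N) := by
    have : Submodule.span k (s : Set _) ≤
        Submodule.map (Submodule.mkQ (integralPart k A ⊔ W)) (W ⊔ poleLE k A N) := by
      refine Submodule.span_le.2 fun q hq ↦ ⟨g q, ?_, hg q⟩
      refine Submodule.mem_sup_right (poleLE_mono ?_ (hn (g q)))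
      exact_mod_cast Finset.le_sup (f := fun q ↦ n (g q)) hq
    exact this (hs ▸ Submodule.mem_top)
  obtain ⟨b, hb, hab⟩ := ha
  have h2 : b - a ∈ integralPart k A ⊔ W := (Submodule.Quotient.eq _).1 hab
  rw [← sub_sub_cancel b a]
  exact sub_mem hb (h1 h2)

/-- Every large pole order, with every leading coefficient, occurs in a lattice. -/
theorem IsLattice.exists_leading (hW : IsLattice W) :
    ∃ N : ℕ, ∀ e : ℤ, N ≤ e → ∀ a : A, ∃ w ∈ W, w ∈ poleLE k A e ∧ w.coeff (-e) = a := by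
  obtain ⟨N, hN⟩ := hW.exists_sup_poleLE_eq_top
  refine ⟨N + 1, fun e he a ↦ ?_⟩
  obtain ⟨w, hw, b, hb, h⟩ := Submodule.mem_sup.1 (hN ▸ Submodule.mem_top : single (-e) a ∈ W ⊔ poleLE k A N)
  rw [← eq_sub_iff_add_eq] at h
  refine ⟨w, hw, ?_, ?_⟩
  · rw [h]
    exact sub_mem (single_mem_poleLE e a) (poleLE_mono (by push_cast at he; omega) hb)
  · rw [h, coeff_sub, coeff_single_same, hb _ (by push_cast at he; omega), sub_zero]

/-- Passing from pole order `n` to `n + 1` adds at most the space `A` of leading coefficients, and the elements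
without pole are finite-dimensional by definition. -/
theorem IsLattice.finite_poleLE [FiniteDimensional k A] (hW : IsLattice W) (n : ℕ) :
    FiniteDimensional k ↥(W ⊓ poleLE k A n) := by
  induction n with
  | zero =>
    have := hW.finite_inter
    rwa [inf_comm] at this
  | succ n ih =>
    let φ : ↥(W ⊓ poleLE k A (n + 1 : ℕ)) →ₗ[k] A :=
      { toFun := fun a ↦ a.1.coeff (-(n + 1 : ℕ))
        map_add' := fun _ _ ↦ rfl
        map_smul' := fun _ _ ↦ rfl }
    have h1 : LinearMap.ker φ = (W ⊓ poleLE k A n).comap (W ⊓ poleLE k A (n + 1 : ℕ)).subtype := by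
      ext a
      refine ⟨fun h ↦ ⟨a.2.1, ?_⟩, fun h ↦ h.2 _ (by push_cast; omega)⟩
      have := mem_poleLE_pred a.2.2 h
      simpa using this
    have h2 : Module.Finite k (LinearMap.ker φ) := by
      rw [h1]
      exact Module.Finite.equiv (Submodule.comapSubtypeEquivOfLe (inf_le_inf_left W
        (poleLE_mono (by push_cast; omega)))).symm
    have h3 : Module.Finite k (LinearMap.range φ) := inferInstance
    refine ⟨Submodule.fg_of_fg_map_of_fg_inf_ker φ ?_ ?_⟩
    · rw [← LinearMap.range_eq_map]
      exact Module.Finite.iff_fg.1 h3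
    · rw [top_inf_eq]
      exact Module.Finite.iff_fg.1 h2

end LatticeDim

/-! ### Unital lattices and their Krull dimension -/

section Leading
open HahnSeries
variable {k A : Type u} [Field k] [NonUnitalNonAssocRing A] [Module k A]

/-- If every leading coefficient of large pole order in `W` is attained in `T ≤ W`, then `W` is the sum of
`T` and its elements of small pole order, with control of the pole orders. -/
theorem mem_sup_of_leading {W T : Submodule k (HahnSeries ℤ A)} (hT : T ≤ W) (E : ℕ)
    (h : ∀ e : ℕ, E < e → ∀ w ∈ W, w ∈ poleLE k A e →
      ∃ t ∈ T, t ∈ poleLE k A e ∧ t.coeff (-e) = w.coeff (-e))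
    (e : ℕ) (he : E ≤ e) {w : HahnSeries ℤ A} (hw : w ∈ W) (hwe : w ∈ poleLE k A e) :
    w ∈ (T ⊓ poleLE k A e) ⊔ (W ⊓ poleLE k A E) := by
  induction e, he using Nat.le_induction generalizing w with
  | base => exact Submodule.mem_sup_right ⟨hw, hwe⟩
  | succ e he ih =>
    obtain ⟨t, ht, hte, hc⟩ := h (e + 1) (by omega) w hw hwe
    have h1 : w - t ∈ poleLE k A e := by
      have := mem_poleLE_pred (sub_mem hwe hte) (by rw [coeff_sub, hc, sub_self])
      simpa using this
    have h2 := ih (sub_mem hw (hT ht)) h1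
    rw [← sub_add_cancel w t]
    exact add_mem (sup_le_sup_right (inf_le_inf_left T (poleLE_mono (by push_cast; omega))) _ h2)
      (Submodule.mem_sup_left ⟨ht, hte⟩)

theorem le_sup_of_leading {W T : Submodule k (HahnSeries ℤ A)} (hT : T ≤ W) (E : ℕ)
    (h : ∀ e : ℕ, E < e → ∀ w ∈ W, w ∈ poleLE k A e →
      ∃ t ∈ T, t ∈ poleLE k A e ∧ t.coeff (-e) = w.coeff (-e)) :
    W ≤ T ⊔ (W ⊓ poleLE k A E) := fun w hw ↦ by
  obtain ⟨n, hn⟩ := exists_mem_poleLE (k := k) w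
  have := mem_sup_of_leading hT E h (max n E) (le_max_right _ _) hw
    (poleLE_mono (by exact_mod_cast le_max_left _ _) hn)
  exact (sup_le_sup_right (inf_le_left : T ⊓ poleLE k A (max n E : ℕ) ≤ T) _) this

end Leading

section UnitalLattice
open HahnSeries
variable {k : Type u} [Field k] {O : Subalgebra k (HahnSeries ℤ k)}

variable (k) in
/-- `k[[z]]` as a subalgebra of `k((z))`. -/
def integralSubalgebra : Subalgebra k (HahnSeries ℤ k) where
  __ := integralPart k k
  mul_mem' ha hb := by simpa using mul_mem_poleLE (k := k) (n := 0) (m := 0) ha hb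
  algebraMap_mem' r := by
    rw [Algebra.algebraMap_eq_smul_one]
    exact Submodule.smul_mem _ _ (one_mem_poleLE (k := k) le_rfl)

theorem coeff_mul_leading {f g : HahnSeries ℤ k} {m n : ℤ}
    (hf : f ∈ poleLE k k m) (hg : g ∈ poleLE k k n) :
    (f * g).coeff (-(m + n)) = f.coeff (-m) * g.coeff (-n) :=
  coeff_act_leading hf hg

theorem coeff_zero_mul_of_integral {f g : HahnSeries ℤ k} (hf : f ∈ integralPart k k)
    (hg : g ∈ integralPart k k) : (f * g).coeff 0 = f.coeff 0 * g.coeff 0 := by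
  simpa using coeff_mul_leading (m := 0) (n := 0) hf hg

/-- A unital lattice has no regular elements but the constants: they form a finite-dimensional domain,
hence a field, on which taking the constant term is injective. -/
theorem IsLattice.eq_C_of_mem_integralPart (hO : IsLattice (Subalgebra.toSubmodule O))
    {f : HahnSeries ℤ k} (hf : f ∈ O) (hf0 : f ∈ integralPart k k) : f = C (f.coeff 0) := by
  let B : Subalgebra k (HahnSeries ℤ k) := integralSubalgebra k ⊓ O
  have hB : FiniteDimensional k B := hO.finite_inter
  have hCB (c : k) : (C c : HahnSeries ℤ k) ∈ B := B.algebraMap_mem c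
  by_contra hne
  let y : B := ⟨f - C (f.coeff 0), sub_mem ⟨hf0, hf⟩ (hCB _)⟩
  have hy0 : (y : HahnSeries ℤ k) ≠ 0 := sub_ne_zero.2 hne
  have hy : (y : HahnSeries ℤ k).coeff 0 = 0 := by
    change (f - C (f.coeff 0)).coeff 0 = 0
    rw [coeff_sub, C_apply, coeff_single_same, sub_self]
  have hinv : (y : HahnSeries ℤ k)⁻¹ ∈ B := B.inv_mem_of_algebraic
    ((Algebra.IsAlgebraic.isAlgebraic (R := k) y).algebraMap (A := HahnSeries ℤ k))
  have h1 := coeff_zero_mul_of_integral y.2.1 hinv.1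
  rw [mul_inv_cancel₀ hy0, hy, zero_mul, coeff_one, if_pos rfl] at h1
  exact one_ne_zero h1

theorem IsLattice.inf_eq_bot (hO : IsLattice (Subalgebra.toSubmodule O)) :
    integralPart k k ⊓ Subalgebra.toSubmodule O = Subalgebra.toSubmodule ⊥ := by
  ext f
  refine ⟨fun h ↦ ?_, fun h ↦ ?_⟩
  · rw [hO.eq_C_of_mem_integralPart h.2 h.1]
    exact (⊥ : Subalgebra k _).algebraMap_mem (f.coeff 0)
  · obtain ⟨c, rfl⟩ := Algebra.mem_bot.1 (show f ∈ (⊥ : Subalgebra k _) from h)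
    exact ⟨(integralSubalgebra k).algebraMap_mem c, O.algebraMap_mem c⟩

theorem IsLattice.index₀_eq_one (hO : IsLattice (Subalgebra.toSubmodule O)) :
    index₀ (Subalgebra.toSubmodule O) = 1 := by
  rw [index₀, hO.inf_eq_bot]
  exact Subalgebra.finrank_bot

/-- Every large pole order occurs in a unital lattice. -/
theorem IsLattice.exists_pole (hO : IsLattice (Subalgebra.toSubmodule O)) :
    ∃ N : ℕ, ∀ e : ℕ, N ≤ e → ∃ f ∈ O, f ∈ poleLE k k e ∧ f.coeff (-e) = 1 := by
  obtain ⟨N, hN⟩ := hO.exists_leading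
  exact ⟨N, fun e he ↦ hN e (by exact_mod_cast he) 1⟩

theorem exists_pole_order {f : HahnSeries ℤ k} (hf : f ≠ 0) :
    ∃ n : ℤ, f ∈ poleLE k k n ∧ f.coeff (-n) ≠ 0 :=
  ⟨-f.order, mem_poleLE_of_order (by simp), by simpa [coeff_order_eq_zero] using hf⟩

theorem IsLattice.exists_pole_order (hO : IsLattice (Subalgebra.toSubmodule O))
    {f : HahnSeries ℤ k} (hfO : f ∈ O) (hf : f ≠ 0) :
    ∃ n : ℕ, f ∈ poleLE k k n ∧ f.coeff (-n) ≠ 0 := by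
  obtain ⟨n, h1, h2⟩ := GeomLattice.exists_pole_order hf
  have hn : 0 ≤ n := by
    by_contra! hn
    have h3 := hO.eq_C_of_mem_integralPart hfO (poleLE_mono hn.le h1)
    rw [h1 0 (by omega)] at h3
    rw [map_zero] at h3
    exact hf h3
  lift n to ℕ using hn
  exact ⟨n, h1, h2⟩

/-- If `h` has pole order `n`, the multiples of `h` attain every leading coefficient of large pole order, since
`O` does. So `O` is spanned modulo `h` by elements of small pole order. -/
theorem IsLattice.finite_quotient_span (hO : IsLattice (Subalgebra.toSubmodule O)) {h : O}
    (hh : h ≠ 0) : FiniteDimensional k (O ⧸ Ideal.span {h}) := by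
  obtain ⟨N, hN⟩ := hO.exists_pole
  obtain ⟨n, hn, hn0⟩ := hO.exists_pole_order h.2 (by simpa using hh)
  let T : Submodule k (HahnSeries ℤ k) :=
    (Subalgebra.toSubmodule O).map (LinearMap.mulLeft k (h : HahnSeries ℤ k))
  have hT : T ≤ Subalgebra.toSubmodule O := by
    rintro _ ⟨g, hg, rfl⟩
    exact O.mul_mem h.2 hg
  have key := le_sup_of_leading hT (N + n) fun e he w hw hwe ↦ by
    obtain ⟨g, hg, hge, hg1⟩ := hN (e - n) (by omega)
    have hen : (n : ℤ) + ((e - n : ℕ) : ℤ) = e := by omega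
    refine ⟨(w.coeff (-e) / h.1.coeff (-n)) • (h.1 * g), T.smul_mem _ ⟨g, hg, rfl⟩,
      Submodule.smul_mem _ _ ?_, ?_⟩
    · have := mul_mem_poleLE (k := k) hn hge
      rwa [hen] at this
    · have := coeff_mul_leading hn hge
      rw [hen, hg1, mul_one] at this
      rw [coeff_smul, this, smul_eq_mul, div_mul_cancel₀ _ hn0]
  have := hO.finite_poleLE (N + n)
  let ψ : ↥(Subalgebra.toSubmodule O ⊓ poleLE k k (N + n : ℕ)) →ₗ[k] O ⧸ Ideal.span {h} :=
    (Ideal.Quotient.mkₐ k (Ideal.span {h})).toLinearMap ∘ₗ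
      (Submodule.inclusion (inf_le_left : Subalgebra.toSubmodule O ⊓ poleLE k k (N + n : ℕ) ≤ _))
  refine Module.Finite.of_surjective ψ fun q ↦ ?_
  obtain ⟨g, rfl⟩ := Ideal.Quotient.mk_surjective q
  obtain ⟨_, ⟨a, ha, rfl⟩, b, hb, hab⟩ := Submodule.mem_sup.1 (key g.2)
  refine ⟨⟨b, hb⟩, ?_⟩
  change Ideal.Quotient.mk _ (⟨b, hb.1⟩ : O) = _
  rw [Ideal.Quotient.eq, Ideal.mem_span_singleton]
  refine ⟨⟨-a, neg_mem ha⟩, Subtype.ext ?_⟩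
  change b - g.1 = h.1 * -a
  rw [← hab]
  simp

/-- The quotient by a nonzero prime ideal is a domain of finite dimension over `k`, hence a field. -/
theorem IsLattice.isMaximal_of_isPrime (hO : IsLattice (Subalgebra.toSubmodule O)) {P : Ideal O}
    [hP : P.IsPrime] (h : P ≠ ⊥) : P.IsMaximal := by
  obtain ⟨f, hf, hf0⟩ := Submodule.exists_mem_ne_zero_of_ne_bot h
  have := hO.finite_quotient_span hf0
  have hle : Ideal.span {f} ≤ P := (Ideal.span_singleton_le_iff_mem _).2 hf
  have : FiniteDimensional k (O ⧸ P) :=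
    Module.Finite.of_surjective (Ideal.Quotient.factorₐ k hle).toLinearMap
      (Ideal.Quotient.factor_surjective hle)
  have : Algebra.IsIntegral k (O ⧸ P) := Algebra.IsIntegral.of_finite k (O ⧸ P)
  have h1 : IsField (O ⧸ P) :=
    isField_of_isIntegral_of_isField' (R := k) (S := O ⧸ P) (Field.toIsField k)
  exact Ideal.Quotient.maximal_of_isField _ h1

/-- The ring is not a field: the inverse of an element with a pole would be a power series without constant
term, but the only power series in `O` are the constants. -/
theorem IsLattice.ringKrullDim_eq_one (hO : IsLattice (Subalgebra.toSubmodule O)) :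
    ringKrullDim O = 1 := by
  refine le_antisymm ?_ ?_
  · have : Ring.KrullDimLE 1 O := Ring.krullDimLE_one_iff_of_isPrime_bot.2
      fun I h hI ↦ hO.isMaximal_of_isPrime h
    exact Ring.krullDimLE_iff.1 this
  · rw [← not_lt]
    intro hlt
    have h0 : ringKrullDim O ≤ 0 := ENat.WithBot.lt_add_one_iff.1 (by simpa using hlt)
    have h1 : Ring.KrullDimLE 0 O := Ring.krullDimLE_iff.2 h0
    have h2 : IsField O := Ring.KrullDimLE.isField_of_isDomain
    obtain ⟨N, hN⟩ := hO.exists_pole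
    obtain ⟨f, hf, hfe, hf1⟩ := hN (N + 1) (by omega)
    have hf0 : f ≠ 0 := by
      rintro rfl
      simp at hf1
    obtain ⟨g, hg⟩ := h2.mul_inv_cancel (a := ⟨f, hf⟩) (fun h ↦ hf0 (congrArg Subtype.val h))
    have hg' : f * g.1 = 1 := congrArg Subtype.val hg
    have hg2 : g.1 = f⁻¹ := eq_inv_of_mul_eq_one_right hg'
    have h3 : g.1 ∈ poleLE k k (-(N + 1 : ℕ)) := by
      rw [hg2]
      exact inv_mem_poleLE hfe (by rw [hf1]; exact one_ne_zero)
    have h4 := hO.eq_C_of_mem_integralPart g.2 (poleLE_mono (by omega) h3)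
    rw [h3 0 (by push_cast; omega), map_zero] at h4
    rw [h4, mul_zero] at hg'
    exact zero_ne_one hg'

end UnitalLattice

/-! ### Points of `Proj(gr(O))` -/

section Points
open HahnSeries TopologicalSpace
variable {k : Type u} [Field k] {O : Subalgebra k (HahnSeries ℤ k)}

instance : IsDomain (GrRing O) := inferInstanceAs (IsDomain (gr O))

theorem grMonomial_mul (m n : ℕ) (f g : HahnSeries ℤ k) (hf : f ∈ O) (hm : f ∈ poleLE k k m)
    (hg : g ∈ O) (hn : g ∈ poleLE k k n) (hfg : f * g ∈ O) (hmn : f * g ∈ poleLE k k (m + n : ℕ)) :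
    grMonomial O m f hf hm * grMonomial O n g hg hn = grMonomial O (m + n) (f * g) hfg hmn :=
  Subtype.ext (Polynomial.monomial_mul_monomial m n f g)

theorem grMonomial_congr {m n : ℕ} {f g : HahnSeries ℤ k} (h : m = n) (hfg : f = g) (hf : f ∈ O)
    (hm : f ∈ poleLE k k m) (hg : g ∈ O) (hn : g ∈ poleLE k k n) :
    grMonomial O m f hf hm = grMonomial O n g hg hn := by
  subst h hfg
  rfl

theorem grMonomial_ne_zero {n : ℕ} {f : HahnSeries ℤ k} {hf : f ∈ O} {hn : f ∈ poleLE k k n}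
    (h : f ≠ 0) : grMonomial O n f hf hn ≠ 0 := fun h0 ↦ h <| by
  have := congrArg (fun p : GrRing O ↦ p.coeff n) h0
  simpa [coeff_grMonomial, GrRing.coeff_zero] using this

theorem GrRing.coeff_mem (a : GrRing O) (n : ℕ) : a.coeff n ∈ O ∧ a.coeff n ∈ poleLE k k n := a.2 n

theorem eq_grMonomial {n : ℕ} {a : GrRing O} (ha : a ∈ grPiece O n) :
    a = grMonomial O n (a.coeff n) (a.coeff_mem n).1 (a.coeff_mem n).2 := by
  refine GrRing.ext fun m ↦ ?_
  rw [coeff_grMonomial]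
  split_ifs with h
  · rw [h]
  · exact ha m (Ne.symm h)

theorem grMonomial_pow (m : ℕ) (n : ℕ) (f : HahnSeries ℤ k) (hf : f ∈ O) (hm : f ∈ poleLE k k m)
    (hfn : f ^ n ∈ O) (hmn : f ^ n ∈ poleLE k k (m * n : ℕ)) :
    grMonomial O m f hf hm ^ n = grMonomial O (m * n) (f ^ n) hfn hmn :=
  Subtype.ext (Polynomial.monomial_pow m f n)

theorem pow_mem_poleLE {f : HahnSeries ℤ k} {m : ℕ} (hf : f ∈ poleLE k k m) (n : ℕ) :
    f ^ n ∈ poleLE k k (m * n : ℕ) := by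
  induction n with
  | zero => simpa using one_mem_poleLE (k := k) (n := 0) le_rfl
  | succ n ih =>
    rw [pow_succ]
    have := mul_mem_poleLE ih hf
    convert this using 2
    push_cast
    ring

/-- `α` is the coefficient of a homogeneous element `tⁿ α` of `gr(O)` that does not vanish at `x`. -/
def IsDenom (x : latticeCurve O) (n : ℕ) (α : HahnSeries ℤ k) : Prop :=
  ∃ (hα : α ∈ O) (hn : α ∈ poleLE k k n),
    grMonomial O n α hα hn ∈ complAt (grPiece O) x

theorem IsDenom.mul {x : latticeCurve O} {m n : ℕ} {α β : HahnSeries ℤ k} (hα : IsDenom x m α)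
    (hβ : IsDenom x n β) : IsDenom x (m + n) (α * β) := by
  obtain ⟨h1, h2, h3⟩ := hα
  obtain ⟨h4, h5, h6⟩ := hβ
  have h7 : α * β ∈ poleLE k k (m + n : ℕ) := by
    push_cast
    exact mul_mem_poleLE h2 h5
  refine ⟨O.mul_mem h1 h4, h7, ?_⟩
  rw [← grMonomial_mul m n α β h1 h2 h4 h5]
  exact mul_mem h3 h6

theorem IsDenom.pow {x : latticeCurve O} {m : ℕ} {α : HahnSeries ℤ k} (hα : IsDenom x m α)
    (n : ℕ) : IsDenom x (m * n) (α ^ n) := by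
  obtain ⟨h1, h2, h3⟩ := hα
  refine ⟨O.pow_mem h1 n, pow_mem_poleLE h2 n, ?_⟩
  rw [← grMonomial_pow m n α h1 h2]
  exact pow_mem h3 n

theorem IsDenom.ne_zero {x : latticeCurve O} {n : ℕ} {α : HahnSeries ℤ k} (hα : IsDenom x n α) :
    α ≠ 0 := by
  rintro rfl
  obtain ⟨h1, h2, h3⟩ := hα
  have h4 : grMonomial O n 0 h1 h2 = 0 := GrRing.ext fun m ↦ by
    rw [coeff_grMonomial, ite_self, GrRing.coeff_zero]
  refine h3 ?_
  rw [h4]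
  exact zero_mem x.asHomogeneousIdeal.toIdeal

theorem gradedRing_proj_eq (n : ℕ) (a : GrRing O) : GradedRing.proj (grPiece O) n a =
    grMonomial O n (a.coeff n) (a.coeff_mem n).1 (a.coeff_mem n).2 :=
  congrArg Subtype.val (grDecompose_apply O a n)

theorem isDenom_one (x : latticeCurve O) : IsDenom x 0 (1 : HahnSeries ℤ k) := by
  refine ⟨O.one_mem, one_mem_poleLE (k := k) (Int.natCast_nonneg 0), ?_⟩
  convert one_mem (complAt (grPiece O) x)
  exact Subtype.ext (Polynomial.monomial_zero_one (R := HahnSeries ℤ k))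

/-- The open subset `D₊(tⁿ f)`. -/
noncomputable def basicOpenOf (n : ℕ) (f : HahnSeries ℤ k) (hf : f ∈ O) (hn : f ∈ poleLE k k n) :
    (latticeCurve O).Opens := Proj.basicOpen (grPiece O) (grMonomial O n f hf hn)

theorem mem_basicOpenOf {n : ℕ} {f : HahnSeries ℤ k} {hf : f ∈ O} {hn : f ∈ poleLE k k n}
    {x : latticeCurve O} : x ∈ basicOpenOf n f hf hn ↔ IsDenom x n f :=
  ⟨fun h ↦ ⟨hf, hn, h⟩, fun h ↦ h.2.2⟩

/-- The sets `D₊(tⁿ f)` form a basis of the topology. -/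
theorem exists_basicOpenOf_le {x : latticeCurve O} {V : (latticeCurve O).Opens} (hx : x ∈ V) :
    ∃ (n : ℕ) (f : HahnSeries ℤ k) (hf : f ∈ O) (hn : f ∈ poleLE k k n),
      x ∈ basicOpenOf n f hf hn ∧ basicOpenOf n f hf hn ≤ V := by
  obtain ⟨_, ⟨a, rfl⟩, hxa, haV⟩ :=
    (ProjectiveSpectrum.isTopologicalBasis_basic_opens (grPiece O)).exists_subset_of_mem_open hx V.2
  have h1 : x ∈ ProjectiveSpectrum.basicOpen (grPiece O) a := hxa
  rw [ProjectiveSpectrum.basicOpen_eq_union_of_projection] at h1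
  obtain ⟨n, hn⟩ := Opens.mem_iSup.1 h1
  replace hn : x ∈ ProjectiveSpectrum.basicOpen (grPiece O)
      (grMonomial O n (a.coeff n) (a.coeff_mem n).1 (a.coeff_mem n).2) := by
    rw [← gradedRing_proj_eq]
    exact hn
  refine ⟨n, a.coeff n, (a.2 n).1, (a.2 n).2, hn, ?_⟩
  refine le_trans ?_ (show ProjectiveSpectrum.basicOpen (grPiece O) a ≤ V from haV)
  rw [ProjectiveSpectrum.basicOpen_eq_union_of_projection]
  refine le_trans (le_of_eq ?_) (le_iSup (fun i ↦ ProjectiveSpectrum.basicOpen (grPiece O)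
    (GradedRing.proj (grPiece O) i a)) n)
  rw [gradedRing_proj_eq]
  rfl

variable (O) in
/-- The generic point of `Proj(gr(O))`: the zero ideal. -/
noncomputable def genericPt : latticeCurve O where
  asHomogeneousIdeal := ⊥
  isPrime := by
    rw [HomogeneousIdeal.toIdeal_bot]
    exact Ideal.isPrime_bot
  not_irrelevant_le h := by
    have h1 : grT O ∈ (HomogeneousIdeal.irrelevant (grPiece O)) := by
      rw [HomogeneousIdeal.mem_irrelevant_iff]
      have := DirectSum.decompose_of_mem_ne (grPiece O)
        (grMonomial_mem O 1 1 O.one_mem (one_mem_poleLE (Int.natCast_nonneg 1))) one_ne_zero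
      exact this
    have h2 : grT O ∈ (⊥ : Ideal (GrRing O)) := by
      rw [← HomogeneousIdeal.toIdeal_bot (𝒜 := grPiece O)]
      exact h h1
    exact grMonomial_ne_zero one_ne_zero h2

theorem isDenom_genericPt {n : ℕ} {α : HahnSeries ℤ k} (hα : α ∈ O) (hn : α ∈ poleLE k k n)
    (h0 : α ≠ 0) : IsDenom (genericPt O) n α := by
  refine ⟨hα, hn, fun h ↦ grMonomial_ne_zero (hf := hα) (hn := hn) h0 ?_⟩
  have : grMonomial O n α hα hn ∈ (⊥ : HomogeneousIdeal (grPiece O)).toIdeal := h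
  rw [HomogeneousIdeal.toIdeal_bot] at this
  exact this

theorem IsDenom.generic {x : latticeCurve O} {n : ℕ} {α : HahnSeries ℤ k} (hα : IsDenom x n α) :
    IsDenom (genericPt O) n α := isDenom_genericPt hα.1 hα.2.1 hα.ne_zero

theorem genericPt_mem {x : latticeCurve O} {V : (latticeCurve O).Opens} (hx : x ∈ V) :
    genericPt O ∈ V := by
  obtain ⟨n, f, hf, hn, h1, h2⟩ := exists_basicOpenOf_le hx
  exact h2 (mem_basicOpenOf.2 (mem_basicOpenOf.1 h1).generic)

end Points

/-! ### Sections as Laurent series -/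

section Values
open HahnSeries TopologicalSpace
variable {k A : Type u} [Field k] [NonUnitalNonAssocRing A] [Module k A]
  {O : Subalgebra k (HahnSeries ℤ k)} {W : Submodule k (HahnSeries ℤ A)}

theorem LaurentPoly.coeff_smul_monomial (p : Polynomial (HahnSeries ℤ k)) (j : ℤ)
    (a : HahnSeries ℤ A) (n : ℕ) :
    (p • LaurentPoly.monomial (k := k) j a).coeff (n + j) = act (p.coeff n) a := by
  induction p using Polynomial.induction_on' with
  | add p q hp hq => rw [add_smul, LaurentPoly.coeff_add, hp, hq, Polynomial.coeff_add, add_act]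
  | monomial i f =>
    rw [LaurentPoly.coeff_monomial_smul, LaurentPoly.coeff_monomial, Polynomial.coeff_monomial]
    by_cases h : i = n
    · rw [if_pos h, if_pos (by omega)]
    · rw [if_neg h, if_neg (by omega), act_zero, zero_act]

variable (hOW : Stabilizes O W)

theorem grMonomial_smul_grModMonomial (m : ℕ) (f : HahnSeries ℤ k) (hf : f ∈ O)
    (hm : f ∈ poleLE k k m) (n : ℤ) (w : HahnSeries ℤ A) (hw : w ∈ W) (hn : w ∈ poleLE k A n)
    (hfw : act f w ∈ W) (hmn : act f w ∈ poleLE k A (m + n)) :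
    grMonomial O m f hf hm • grModMonomial hOW n w hw hn =
      grModMonomial hOW (m + n) (act f w) hfw hmn := by
  refine GrMod.ext fun j ↦ ?_
  rw [coeff_grModMonomial]
  refine (LaurentPoly.coeff_monomial_smul m f (LaurentPoly.monomial n w) j).trans ?_
  rw [LaurentPoly.coeff_monomial]
  split_ifs with h1 h2
  · rfl
  · omega
  · omega
  · rw [act_zero]

theorem grModMonomial_congr {m n : ℤ} {v w : HahnSeries ℤ A} (h : m = n) (hvw : v = w) (hv : v ∈ W)
    (hm : v ∈ poleLE k A m) (hw : w ∈ W) (hn : w ∈ poleLE k A n) :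
    grModMonomial hOW m v hv hm = grModMonomial hOW n w hw hn := by
  subst h hvw
  rfl

theorem grModMonomial_sub (n : ℤ) (v w : HahnSeries ℤ A) (hv : v ∈ W) (hvn : v ∈ poleLE k A n)
    (hw : w ∈ W) (hwn : w ∈ poleLE k A n) :
    grModMonomial hOW n v hv hvn - grModMonomial hOW n w hw hwn =
      grModMonomial hOW n (v - w) (sub_mem hv hw) (sub_mem hvn hwn) := by
  rw [sub_eq_iff_eq_add]
  refine GrMod.ext fun j ↦ ?_
  rw [GrMod.coeff_add, coeff_grModMonomial, coeff_grModMonomial, coeff_grModMonomial]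
  split_ifs
  · rw [sub_add_cancel]
  · rw [add_zero]

theorem eq_grModMonomial {n : ℤ} {m : GrMod hOW} (hm : m ∈ grModPiece hOW n) :
    m = grModMonomial hOW n (m.coeff n) (m.coeff_mem n).1 (m.coeff_mem n).2 := by
  refine GrMod.ext fun j ↦ ?_
  rw [coeff_grModMonomial]
  split_ifs with h
  · rw [h]
  · exact hm j (Ne.symm h)

/-- A homogeneous element of `gr(W)` is not a torsion element. -/
theorem grModMonomial_eq_zero_of_smul {p : GrRing O} (hp : p ≠ 0) {n : ℤ} {w : HahnSeries ℤ A}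
    {hw : w ∈ W} {hn : w ∈ poleLE k A n} (h : p • grModMonomial hOW n w hw hn = 0) : w = 0 := by
  obtain ⟨i, hi⟩ : ∃ i, p.coeff i ≠ 0 := by
    by_contra! h0
    exact hp (GrRing.ext fun n ↦ by rw [h0, GrRing.coeff_zero])
  have h1 : (p • grModMonomial hOW n w hw hn).coeff (i + n) = act (p.coeff i) w :=
    LaurentPoly.coeff_smul_monomial (grVal O p) n w i
  rw [h, GrMod.coeff_zero] at h1
  exact act_injective hi (by rw [← h1, act_zero])

/-- The relation between an element of the localization of `gr(W)` at a point `x` and the series that it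
represents: a fraction `(tⁿ w) / (tⁿ α)` represents `w / α`. -/
def IsValueAt (x : latticeCurve O) (ξ : LocMod (grPiece O) (GrMod hOW) x) (φ : HahnSeries ℤ A) : Prop :=
  ∃ (n : ℕ) (α : HahnSeries ℤ k) (h : IsDenom x n α) (hw : act α φ ∈ W)
    (hn : act α φ ∈ poleLE k A n),
    ξ = LocalizedModule.mk (grModMonomial hOW n (act α φ) hw hn)
      ⟨grMonomial O n α h.1 h.2.1, h.2.2⟩

variable {hOW} {x : latticeCurve O} {ξ η : LocMod (grPiece O) (GrMod hOW) x} {φ ψ : HahnSeries ℤ A}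

theorem IsValueAt.add (hξ : IsValueAt hOW x ξ φ) (hη : IsValueAt hOW x η ψ) :
    IsValueAt hOW x (ξ + η) (φ + ψ) := by
  obtain ⟨m, α, hα, hw, hm, rfl⟩ := hξ
  obtain ⟨n, β, hβ, hv, hn, rfl⟩ := hη
  have e1 : act (α * β) (φ + ψ) = act β (act α φ) + act α (act β ψ) := by
    rw [act_act, act_act, mul_comm β, act_add]
  have m1 : act β (act α φ) ∈ W := hOW _ hβ.1 _ hw
  have m2 : act α (act β ψ) ∈ W := hOW _ hα.1 _ hv
  have p1 : act β (act α φ) ∈ poleLE k A (n + m) := act_mem_poleLE hβ.2.1 hm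
  have p2 : act α (act β ψ) ∈ poleLE k A (m + n) := act_mem_poleLE hα.2.1 hn
  refine ⟨m + n, α * β, hα.mul hβ, e1 ▸ add_mem m1 m2, ?_, ?_⟩
  · rw [e1]
    push_cast
    exact add_mem (by rwa [add_comm (m : ℤ)]) p2
  · rw [LocalizedModule.mk_add_mk]
    congr 1
    · rw [Submonoid.smul_def, Submonoid.smul_def,
        grMonomial_smul_grModMonomial hOW _ _ _ _ _ _ _ _ m1 p1,
        grMonomial_smul_grModMonomial hOW _ _ _ _ _ _ _ _ m2 p2]
      refine GrMod.ext fun j ↦ ?_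
      rw [GrMod.coeff_add, coeff_grModMonomial, coeff_grModMonomial, coeff_grModMonomial]
      by_cases h : (m : ℤ) + n = j
      · rw [if_pos h, if_pos (by omega), if_pos (by push_cast; omega), e1]
      · rw [if_neg h, if_neg (by omega), if_neg (by push_cast; omega), add_zero]
    · exact Subtype.ext (grMonomial_mul m n α β hα.1 hα.2.1 hβ.1 hβ.2.1 (hα.mul hβ).1 (hα.mul hβ).2.1)

/-- A series is determined by the fraction that represents it. -/
theorem IsValueAt.unique (hξ : IsValueAt hOW x ξ φ) (hη : IsValueAt hOW x ξ ψ) : φ = ψ := by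
  obtain ⟨m, α, hα, hw, hm, rfl⟩ := hξ
  obtain ⟨n, β, hβ, hv, hn, h⟩ := hη
  obtain ⟨u, hu⟩ := LocalizedModule.mk_eq.1 h
  have p1 : act β (act α φ) ∈ poleLE k A (n + m) := act_mem_poleLE hβ.2.1 hm
  have p2 : act α (act β ψ) ∈ poleLE k A (m + n) := act_mem_poleLE hα.2.1 hn
  rw [Submonoid.smul_def, Submonoid.smul_def, Submonoid.smul_def, Submonoid.smul_def,
    grMonomial_smul_grModMonomial hOW _ _ _ _ _ _ _ _ (hOW _ hβ.1 _ hw) p1,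
    grMonomial_smul_grModMonomial hOW _ _ _ _ _ _ _ _ (hOW _ hα.1 _ hv) p2] at hu
  have m1 : act (α * β) (φ - ψ) ∈ W := by
    rw [act_sub, mul_comm, ← act_act, mul_comm, ← act_act]
    exact sub_mem (hOW _ hβ.1 _ hw) (hOW _ hα.1 _ hv)
  have p3 : act (α * β) (φ - ψ) ∈ poleLE k A (m + n : ℤ) := by
    rw [act_sub, mul_comm, ← act_act, mul_comm, ← act_act]
    exact sub_mem (by rwa [add_comm (m : ℤ)]) p2
  have h0 : (u : GrRing O) • grModMonomial hOW (m + n : ℤ) (act (α * β) (φ - ψ)) m1 p3 = 0 := by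
    rw [← sub_eq_zero, ← smul_sub] at hu
    rw [← hu]
    congr 1
    rw [grModMonomial_congr hOW (add_comm (n : ℤ) m) rfl _ _ (hOW _ hβ.1 _ hw)
      (by rwa [add_comm (m : ℤ)]), grModMonomial_sub]
    exact grModMonomial_congr hOW rfl (by rw [act_sub, act_act, act_act, mul_comm β]) _ _ _ _
  have h1 := grModMonomial_eq_zero_of_smul hOW
    (p := u) (fun h ↦ u.2 (by rw [h]; exact zero_mem x.asHomogeneousIdeal.toIdeal)) h0
  rw [← sub_eq_zero]
  exact act_injective (mul_ne_zero hα.ne_zero hβ.ne_zero) (by rw [h1, act_zero])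

/-- A fraction is determined by the series that it represents. -/
theorem IsValueAt.eq (hξ : IsValueAt hOW x ξ φ) (hη : IsValueAt hOW x η φ) : ξ = η := by
  obtain ⟨m, α, hα, hw, hm, rfl⟩ := hξ
  obtain ⟨n, β, hβ, hv, hn, rfl⟩ := hη
  rw [LocalizedModule.mk_eq]
  refine ⟨1, ?_⟩
  have p1 : act β (act α φ) ∈ poleLE k A (n + m) := act_mem_poleLE hβ.2.1 hm
  have p2 : act α (act β φ) ∈ poleLE k A (m + n) := act_mem_poleLE hα.2.1 hn
  rw [one_smul, one_smul, Submonoid.smul_def, Submonoid.smul_def,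
    grMonomial_smul_grModMonomial hOW _ _ _ _ _ _ _ _ (hOW _ hβ.1 _ hw) p1,
    grMonomial_smul_grModMonomial hOW _ _ _ _ _ _ _ _ (hOW _ hα.1 _ hv) p2]
  exact grModMonomial_congr hOW (add_comm _ _) (by rw [act_act, act_act, mul_comm]) _ _ _ _

theorem isValueAt_mk {n : ℕ} {α : HahnSeries ℤ k} (h : IsDenom x n α) {w : HahnSeries ℤ A}
    (hw : w ∈ W) (hn : w ∈ poleLE k A n) :
    IsValueAt hOW x (LocalizedModule.mk (grModMonomial hOW n w hw hn)
      ⟨grMonomial O n α h.1 h.2.1, h.2.2⟩) (act α⁻¹ w) := by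
  have e : act α (act α⁻¹ w) = w := act_act_inv h.ne_zero w
  refine ⟨n, α, h, by rwa [e], by rwa [e], ?_⟩
  congr 1
  exact grModMonomial_congr hOW rfl e.symm _ _ _ _

variable (O W) in
/-- The series `φ` lies in the stalk at `x` of the sheaf attached to `gr(W)`: it is a fraction `w / α` with
`tⁿ w ∈ gr(W)` and `tⁿ α ∈ gr(O)` not vanishing at `x`. -/
def IsRegularAt (x : latticeCurve O) (φ : HahnSeries ℤ A) : Prop :=
  ∃ (n : ℕ) (α : HahnSeries ℤ k), IsDenom x n α ∧ act α φ ∈ W ∧ act α φ ∈ poleLE k A n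

theorem IsValueAt.isRegularAt (h : IsValueAt hOW x ξ φ) : IsRegularAt O W x φ :=
  let ⟨n, α, hα, hw, hn, _⟩ := h
  ⟨n, α, hα, hw, hn⟩

variable (hOW) in
theorem IsRegularAt.exists_value (h : IsRegularAt O W x φ) : ∃ ξ, IsValueAt hOW x ξ φ :=
  let ⟨n, α, hα, hw, hn⟩ := h
  ⟨_, n, α, hα, hw, hn, rfl⟩

variable (hOW) in
/-- The sections over `V` of the sheaf attached to `gr(W)`. -/
abbrev LatticeSections (V : (latticeCurve O).Opens) : Type u :=
  projSections (𝒮 := grPiece O) (ℳ := grModPiece hOW) (fun _ _ _ _ ↦ grPiece_smul_mem hOW) V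

/-- The series `φ` represents the section `s` at every point. -/
def HasValue {V : (latticeCurve O).Opens} (s : LatticeSections hOW V) (φ : HahnSeries ℤ A) : Prop :=
  ∀ x : V, IsValueAt hOW x.1 (s.1 x) φ

variable {V : (latticeCurve O).Opens}

/-- A section is represented by one series, because the curve is irreducible. -/
theorem exists_hasValue (hV : genericPt O ∈ V) (s : LatticeSections hOW V) : ∃ φ, HasValue s φ := by
  have key (x : V) : ∃ φ, IsValueAt hOW x.1 (s.1 x) φ ∧
      IsValueAt hOW (genericPt O) (s.1 ⟨genericPt O, hV⟩) φ := by
    obtain ⟨V', hV', i, n, m, a, hm, ha, h1, h2⟩ := (isLocallyModFraction_iff _ _ s.1).1 s.2 x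
    have ha' := eq_grMonomial ha
    have hm' := eq_grModMonomial hOW hm
    have key2 (y : V') : IsValueAt hOW y.1 (s.1 ⟨y.1, i y.2⟩)
        (act (a.coeff n)⁻¹ (m.coeff n)) := by
      have hd : IsDenom y.1 n (a.coeff n) :=
        ⟨(a.coeff_mem n).1, (a.coeff_mem n).2, by rw [← ha']; exact h1 y⟩
      rw [h2 y]
      have := isValueAt_mk (hOW := hOW) hd (m.coeff_mem n).1 (m.coeff_mem n).2
      convert this using 2
      exact Subtype.ext ha'
    exact ⟨_, key2 ⟨x.1, hV'⟩, key2 ⟨_, genericPt_mem hV'⟩⟩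
  choose φ hφ using key
  refine ⟨φ ⟨_, hV⟩, fun x ↦ ?_⟩
  rw [(hφ ⟨_, hV⟩).2.unique (hφ x).2]
  exact (hφ x).1

variable (hOW) in
/-- A series is the value of a section if it is a fraction at every point: the fractions at the points are
locally equal because a fraction is determined by its series. -/
theorem exists_section (h : ∀ x ∈ V, IsRegularAt O W x φ) : ∃ s : LatticeSections hOW V, HasValue s φ := by
  choose ξ hξ using fun x : V ↦ (h x.1 x.2).exists_value hOW
  refine ⟨⟨ξ, (isLocallyModFraction_iff _ _ _).2 fun x ↦ ?_⟩, hξ⟩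
  obtain ⟨n, α, hα, hw, hn⟩ := h x.1 x.2
  refine ⟨V ⊓ basicOpenOf n α hα.1 hα.2.1, ⟨x.2, mem_basicOpenOf.2 hα⟩, inf_le_left, n,
    grModMonomial hOW n (act α φ) hw hn, grMonomial O n α hα.1 hα.2.1, grModMonomial_mem hOW _ _ _ _,
    grMonomial_mem O _ _ _ _, fun y ↦ y.2.2, fun y ↦ ?_⟩
  exact (hξ ⟨y.1, y.2.1⟩).eq ⟨n, α, ⟨hα.1, hα.2.1, y.2.2⟩, hw, hn, rfl⟩

theorem HasValue.ext {s s' : LatticeSections hOW V} (h : HasValue s φ) (h' : HasValue s' φ) : s = s' :=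
  Subtype.ext (funext fun x ↦ (h x).eq (h' x))

theorem HasValue.add {s s' : LatticeSections hOW V} (h : HasValue s φ) (h' : HasValue s' ψ) :
    HasValue (s + s') (φ + ψ) := fun x ↦ (h x).add (h' x)

theorem HasValue.unique (hV : genericPt O ∈ V) {s : LatticeSections hOW V} (h : HasValue s φ)
    (h' : HasValue s ψ) : φ = ψ := (h ⟨_, hV⟩).unique (h' ⟨_, hV⟩)

variable (hOW) in
/-- The series that represents a section. -/
noncomputable def sectionValue (hV : genericPt O ∈ V) : LatticeSections hOW V →+ HahnSeries ℤ A :=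
  AddMonoidHom.mk' (fun s ↦ (exists_hasValue hV s).choose) fun s s' ↦
    (exists_hasValue hV (s + s')).choose_spec.unique hV
      ((exists_hasValue hV s).choose_spec.add (exists_hasValue hV s').choose_spec)

theorem hasValue_sectionValue (hV : genericPt O ∈ V) (s : LatticeSections hOW V) :
    HasValue s (sectionValue hOW hV s) := (exists_hasValue hV s).choose_spec

theorem sectionValue_eq_iff (hV : genericPt O ∈ V) (s : LatticeSections hOW V) :
    sectionValue hOW hV s = φ ↔ HasValue s φ :=
  ⟨fun h ↦ h ▸ hasValue_sectionValue hV s, fun h ↦ (hasValue_sectionValue hV s).unique hV h⟩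

theorem sectionValue_injective (hV : genericPt O ∈ V) : Function.Injective (sectionValue hOW hV) :=
  fun s s' h ↦ (hasValue_sectionValue hV s).ext (h ▸ hasValue_sectionValue hV s')

/-- The series that come from sections over `V` are those that are regular at each point of `V`. -/
theorem exists_sectionValue_eq_iff (hV : genericPt O ∈ V) :
    (∃ s, sectionValue hOW hV s = φ) ↔ ∀ x ∈ V, IsRegularAt O W x φ := by
  refine ⟨?_, fun h ↦ ?_⟩
  · rintro ⟨s, rfl⟩ x hx
    exact (hasValue_sectionValue hV s ⟨x, hx⟩).isRegularAt
  · obtain ⟨s, hs⟩ := exists_section hOW h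
    exact ⟨s, (sectionValue_eq_iff hV s).2 hs⟩

end Values

section Functions
open HahnSeries TopologicalSpace
variable {k A : Type u} [Field k] [NonUnitalNonAssocRing A] [Module k A]
  {O : Subalgebra k (HahnSeries ℤ k)} {W : Submodule k (HahnSeries ℤ A)}

variable (O) in
theorem stabilizes_toSubmodule : Stabilizes O (Subalgebra.toSubmodule O) :=
  fun _ hf _ hw ↦ O.mul_mem hf hw

/-- The relation between an element of the localization of `gr(O)` at a point `x` and the series that it
represents: a fraction `(tⁿ β) / (tⁿ α)` represents `β / α`. -/
def IsFunctionValueAt (x : latticeCurve O) (ρ : Localization (complAt (grPiece O) x))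
    (φ : HahnSeries ℤ k) : Prop :=
  ∃ (n : ℕ) (α : HahnSeries ℤ k) (h : IsDenom x n α) (hw : α * φ ∈ O) (hn : α * φ ∈ poleLE k k n),
    ρ = Localization.mk (grMonomial O n (α * φ) hw hn) ⟨grMonomial O n α h.1 h.2.1, h.2.2⟩

variable {hOW : Stabilizes O W} {x : latticeCurve O} {ρ σ : Localization (complAt (grPiece O) x)}
  {ξ : LocMod (grPiece O) (GrMod hOW) x} {φ ψ : HahnSeries ℤ k} {χ : HahnSeries ℤ A}

theorem isFunctionValueAt_mk {n : ℕ} {α β : HahnSeries ℤ k} (h : IsDenom x n α)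
    (hβ : β ∈ O) (hn : β ∈ poleLE k k n) :
    IsFunctionValueAt x (Localization.mk (grMonomial O n β hβ hn)
      ⟨grMonomial O n α h.1 h.2.1, h.2.2⟩) (α⁻¹ * β) := by
  have e : α * (α⁻¹ * β) = β := mul_inv_cancel_left₀ h.ne_zero β
  refine ⟨n, α, h, by rwa [e], by rwa [e], ?_⟩
  congr 1
  exact grMonomial_congr rfl e.symm _ _ _ _

theorem IsFunctionValueAt.smul (hρ : IsFunctionValueAt x ρ φ) (hξ : IsValueAt hOW x ξ χ) :
    IsValueAt hOW x (ρ • ξ) (act φ χ) := by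
  obtain ⟨m, α, hα, hw, hm, rfl⟩ := hρ
  obtain ⟨n, β, hβ, hv, hn, rfl⟩ := hξ
  have e : act (α * β) (act φ χ) = act (α * φ) (act β χ) := by
    rw [act_act, act_act]
    congr 1
    ring
  have p : act (α * φ) (act β χ) ∈ poleLE k A (m + n) := act_mem_poleLE hm hn
  refine ⟨m + n, α * β, hα.mul hβ, e ▸ hOW _ hw _ hv, ?_, ?_⟩
  · rw [e]
    push_cast
    exact p
  · rw [LocalizedModule.mk_smul_mk]
    congr 1
    · rw [grMonomial_smul_grModMonomial hOW _ _ _ _ _ _ _ _ (hOW _ hw _ hv) p]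
      exact grModMonomial_congr hOW (by push_cast; rfl) e.symm _ _ _ _
    · exact Subtype.ext (grMonomial_mul m n α β hα.1 hα.2.1 hβ.1 hβ.2.1 (hα.mul hβ).1 (hα.mul hβ).2.1)

theorem IsFunctionValueAt.mul (hρ : IsFunctionValueAt x ρ φ) (hσ : IsFunctionValueAt x σ ψ) :
    IsFunctionValueAt x (ρ * σ) (φ * ψ) := by
  obtain ⟨m, α, hα, hw, hm, rfl⟩ := hρ
  obtain ⟨n, β, hβ, hv, hn, rfl⟩ := hσ
  have e : α * β * (φ * ψ) = α * φ * (β * ψ) := by ring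
  have p : α * φ * (β * ψ) ∈ poleLE k k (m + n : ℕ) := by
    push_cast
    exact mul_mem_poleLE hm hn
  refine ⟨m + n, α * β, hα.mul hβ, e ▸ O.mul_mem hw hv, e ▸ p, ?_⟩
  rw [Localization.mk_mul]
  congr 1
  · rw [grMonomial_mul m n _ _ hw hm hv hn (O.mul_mem hw hv) p]
    exact grMonomial_congr rfl e.symm _ _ _ _
  · exact Subtype.ext (grMonomial_mul m n α β hα.1 hα.2.1 hβ.1 hβ.2.1 (hα.mul hβ).1 (hα.mul hβ).2.1)

theorem isValueAt_one (x : latticeCurve O) : IsValueAt (stabilizes_toSubmodule O) x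
    (LocalizedModule.mk (grModMonomial (stabilizes_toSubmodule O) 0 1 O.one_mem
      (one_mem_poleLE le_rfl)) 1) 1 := by
  have := isValueAt_mk (hOW := stabilizes_toSubmodule O) (isDenom_one x) (w := 1) O.one_mem
    (one_mem_poleLE le_rfl)
  rw [inv_one, one_act] at this
  have e : (⟨grMonomial O 0 1 (isDenom_one x).1 (isDenom_one x).2.1, (isDenom_one x).2.2⟩ :
      complAt (grPiece O) x) = 1 :=
    Subtype.ext (Subtype.ext (Polynomial.monomial_zero_one (R := HahnSeries ℤ k)))
  rw [e] at this
  exact this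

/-- Localizations of `gr(O)` act on those of `gr(W)` compatibly with the action of `k((z))` on `A((z))`. Taking
`W = O` and acting on `1` reduces the uniqueness for functions to that for sections. -/
theorem IsFunctionValueAt.unique (hρ : IsFunctionValueAt x ρ φ) (hσ : IsFunctionValueAt x ρ ψ) :
    φ = ψ := by
  have := (hρ.smul (isValueAt_one x)).unique (hσ.smul (isValueAt_one x))
  simpa only [act_eq_mul, mul_one] using this

theorem IsFunctionValueAt.eq (hρ : IsFunctionValueAt x ρ φ) (hσ : IsFunctionValueAt x σ φ) :
    ρ = σ := by
  obtain ⟨m, α, hα, hw, hm, rfl⟩ := hρ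
  obtain ⟨n, β, hβ, hv, hn, rfl⟩ := hσ
  rw [Localization.mk_eq_mk_iff, Localization.r_iff_exists]
  refine ⟨1, ?_⟩
  have e : β * (α * φ) = α * (β * φ) := by ring
  have p : α * (β * φ) ∈ poleLE k k (m + n : ℕ) := by
    push_cast
    exact mul_mem_poleLE hα.2.1 hn
  have q := O.mul_mem hα.1 hv
  rw [Submonoid.coe_one, one_mul, one_mul, grMonomial_mul m n _ _ hα.1 hα.2.1 hv hn q p,
    grMonomial_mul n m _ _ hβ.1 hβ.2.1 hw hm (e ▸ q) (by rw [e, add_comm]; exact p)]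
  exact grMonomial_congr (add_comm _ _) e _ _ _ _

theorem IsFunctionValueAt.add (hρ : IsFunctionValueAt x ρ φ) (hσ : IsFunctionValueAt x σ ψ) :
    IsFunctionValueAt x (ρ + σ) (φ + ψ) := by
  obtain ⟨m, α, hα, hw, hm, rfl⟩ := hρ
  obtain ⟨n, β, hβ, hv, hn, rfl⟩ := hσ
  have e : α * β * (φ + ψ) = α * (β * ψ) + β * (α * φ) := by ring
  have p1 : α * (β * ψ) ∈ poleLE k k (m + n : ℕ) := by
    push_cast
    exact mul_mem_poleLE hα.2.1 hn
  have p2 : β * (α * φ) ∈ poleLE k k (n + m : ℕ) := by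
    push_cast
    exact mul_mem_poleLE hβ.2.1 hm
  have q1 := O.mul_mem hα.1 hv
  have q2 := O.mul_mem hβ.1 hw
  refine ⟨m + n, α * β, hα.mul hβ, e ▸ O.add_mem q1 q2,
    e ▸ add_mem p1 (by rwa [add_comm m]), ?_⟩
  rw [Localization.add_mk]
  congr 1
  · rw [grMonomial_mul m n _ _ hα.1 hα.2.1 hv hn q1 p1, grMonomial_mul n m _ _ hβ.1 hβ.2.1 hw hm q2 p2]
    refine GrRing.ext fun j ↦ ?_
    rw [GrRing.coeff_add, coeff_grMonomial, coeff_grMonomial, coeff_grMonomial]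
    by_cases h : m + n = j
    · rw [if_pos h, if_pos (by omega), if_pos h, e]
    · rw [if_neg h, if_neg (by omega), if_neg h, add_zero]
  · exact Subtype.ext (grMonomial_mul m n α β hα.1 hα.2.1 hβ.1 hβ.2.1 (hα.mul hβ).1 (hα.mul hβ).2.1)

/-- The series `φ` represents the function `r` at every point. -/
def HasFunctionValue {V : (latticeCurve O).Opens} (r : Γ(latticeCurve O, V))
    (φ : HahnSeries ℤ k) : Prop :=
  ∀ x : V, IsFunctionValueAt x.1 (evalAt (grPiece O) x r) φ

variable {V : (latticeCurve O).Opens}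

/-- A function is represented by one series: its series at any two points agree with the one at the generic
point. -/
theorem exists_hasFunctionValue (hV : genericPt O ∈ V) (r : Γ(latticeCurve O, V)) :
    ∃ φ, HasFunctionValue r φ := by
  have key (x : V) : ∃ φ, IsFunctionValueAt x.1 (evalAt (grPiece O) x r) φ ∧
      IsFunctionValueAt (genericPt O) (evalAt (grPiece O) (⟨genericPt O, hV⟩ : V) r) φ := by
    obtain ⟨V', hV', i, n, ⟨a, ha⟩, ⟨b, hb⟩, h1, h2⟩ := r.2 x
    have key2 (y : V') : IsFunctionValueAt y.1
        (evalAt (grPiece O) (⟨y.1, i.le y.2⟩ : V) r) ((b.coeff n)⁻¹ * a.coeff n) := by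
      have hd : IsDenom y.1 n (b.coeff n) :=
        ⟨(b.coeff_mem n).1, (b.coeff_mem n).2, by rw [← eq_grMonomial hb]; exact h1 y⟩
      have h3 : evalAt (grPiece O) (⟨y.1, i.le y.2⟩ : V) r = Localization.mk a ⟨b, h1 y⟩ :=
        congrArg HomogeneousLocalization.val (h2 y)
      rw [h3]
      have := isFunctionValueAt_mk hd (a.coeff_mem n).1 (a.coeff_mem n).2
      convert this using 2
      · exact eq_grMonomial ha
      · exact Subtype.ext (eq_grMonomial hb)
    exact ⟨_, key2 ⟨x.1, hV'⟩, key2 ⟨_, genericPt_mem hV'⟩⟩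
  choose φ hφ using key
  refine ⟨φ ⟨_, hV⟩, fun x ↦ ?_⟩
  rw [(hφ ⟨_, hV⟩).2.unique (hφ x).2]
  exact (hφ x).1

theorem evalAt_injective {r s : Γ(latticeCurve O, V)}
    (h : ∀ x : V, evalAt (grPiece O) x r = evalAt (grPiece O) x s) : r = s :=
  Subtype.ext (funext fun x ↦ HomogeneousLocalization.val_injective _ (h x))

/-- The analogue of `exists_section` for the structure sheaf. -/
theorem exists_function (h : ∀ x ∈ V, IsRegularAt O (Subalgebra.toSubmodule O) x φ) :
    ∃ r : Γ(latticeCurve O, V), HasFunctionValue r φ := by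
  choose n α hα hw hn using h
  refine ⟨⟨fun x ↦ HomogeneousLocalization.mk ⟨n x.1 x.2,
    ⟨_, grMonomial_mem O (n x.1 x.2) (α x.1 x.2 * φ) (hw x.1 x.2) (hn x.1 x.2)⟩,
    ⟨_, grMonomial_mem O (n x.1 x.2) (α x.1 x.2) (hα x.1 x.2).1 (hα x.1 x.2).2.1⟩,
    (hα x.1 x.2).2.2⟩, fun x ↦ ?_⟩, fun x ↦ ?_⟩
  · refine ⟨V ⊓ basicOpenOf _ _ (hα x.1 x.2).1 (hα x.1 x.2).2.1,
      ⟨x.2, mem_basicOpenOf.2 (hα x.1 x.2)⟩, homOfLE inf_le_left, n x.1 x.2,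
      ⟨_, grMonomial_mem O (n x.1 x.2) (α x.1 x.2 * φ) (hw x.1 x.2) (hn x.1 x.2)⟩,
      ⟨_, grMonomial_mem O (n x.1 x.2) (α x.1 x.2) (hα x.1 x.2).1 (hα x.1 x.2).2.1⟩,
      fun y ↦ y.2.2, fun y ↦ HomogeneousLocalization.val_injective _ ?_⟩
    rw [HomogeneousLocalization.val_mk]
    refine (IsFunctionValueAt.eq (φ := φ) (x := y.1) ?_ ?_ : _)
    · exact ⟨_, _, hα y.1 y.2.1, hw y.1 y.2.1, hn y.1 y.2.1, HomogeneousLocalization.val_mk _⟩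
    · exact ⟨n x.1 x.2, α x.1 x.2, ⟨(hα x.1 x.2).1, (hα x.1 x.2).2.1, y.2.2⟩, hw x.1 x.2,
        hn x.1 x.2, rfl⟩
  · exact ⟨_, _, hα x.1 x.2, hw x.1 x.2, hn x.1 x.2, HomogeneousLocalization.val_mk _⟩

theorem HasFunctionValue.ext {r s : Γ(latticeCurve O, V)} (hr : HasFunctionValue r φ)
    (hs : HasFunctionValue s φ) : r = s := evalAt_injective fun x ↦ (hr x).eq (hs x)

theorem HasFunctionValue.unique (hV : genericPt O ∈ V) {r : Γ(latticeCurve O, V)}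
    (hr : HasFunctionValue r φ) (hs : HasFunctionValue r ψ) : φ = ψ :=
  (hr ⟨_, hV⟩).unique (hs ⟨_, hV⟩)

theorem HasFunctionValue.add {r s : Γ(latticeCurve O, V)} (hr : HasFunctionValue r φ)
    (hs : HasFunctionValue s ψ) : HasFunctionValue (r + s) (φ + ψ) := fun x ↦ by
  rw [map_add]
  exact (hr x).add (hs x)

theorem HasFunctionValue.mul {r s : Γ(latticeCurve O, V)} (hr : HasFunctionValue r φ)
    (hs : HasFunctionValue s ψ) : HasFunctionValue (r * s) (φ * ψ) := fun x ↦ by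
  rw [map_mul]
  exact (hr x).mul (hs x)

theorem hasFunctionValue_one : HasFunctionValue (1 : Γ(latticeCurve O, V)) 1 := fun x ↦ by
  rw [map_one]
  have := isFunctionValueAt_mk (isDenom_one x.1) (β := 1) O.one_mem (one_mem_poleLE le_rfl)
  rw [inv_one, one_mul] at this
  convert this using 1
  rw [← Localization.mk_one]
  have e : grMonomial O 0 1 O.one_mem (one_mem_poleLE le_rfl) = 1 :=
    Subtype.ext (Polynomial.monomial_zero_one (R := HahnSeries ℤ k))
  exact congrArg₂ Localization.mk e.symm (Subtype.ext e.symm)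

/-- The series that represents a function. -/
noncomputable def functionValue (hV : genericPt O ∈ V) :
    Γ(latticeCurve O, V) →+* HahnSeries ℤ k :=
  RingHom.mk'
    { toFun := fun r ↦ (exists_hasFunctionValue hV r).choose
      map_one' := (exists_hasFunctionValue hV 1).choose_spec.unique hV hasFunctionValue_one
      map_mul' := fun r s ↦ (exists_hasFunctionValue hV (r * s)).choose_spec.unique hV
        ((exists_hasFunctionValue hV r).choose_spec.mul (exists_hasFunctionValue hV s).choose_spec) }
    fun r s ↦ (exists_hasFunctionValue hV (r + s)).choose_spec.unique hV
        ((exists_hasFunctionValue hV r).choose_spec.add (exists_hasFunctionValue hV s).choose_spec)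

theorem hasFunctionValue_functionValue (hV : genericPt O ∈ V) (r : Γ(latticeCurve O, V)) :
    HasFunctionValue r (functionValue hV r) := (exists_hasFunctionValue hV r).choose_spec

theorem functionValue_eq_iff (hV : genericPt O ∈ V) {r : Γ(latticeCurve O, V)} :
    functionValue hV r = φ ↔ HasFunctionValue r φ :=
  ⟨fun h ↦ h ▸ hasFunctionValue_functionValue hV r,
    fun h ↦ (hasFunctionValue_functionValue hV r).unique hV h⟩

theorem functionValue_injective (hV : genericPt O ∈ V) : Function.Injective (functionValue hV) :=
  fun r s h ↦ (hasFunctionValue_functionValue hV r).ext (h ▸ hasFunctionValue_functionValue hV s)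

theorem IsFunctionValueAt.isRegularAt (h : IsFunctionValueAt x ρ φ) :
    IsRegularAt O (Subalgebra.toSubmodule O) x φ :=
  let ⟨n, α, hα, hw, hn, _⟩ := h
  ⟨n, α, hα, hw, hn⟩

theorem exists_functionValue_eq_iff (hV : genericPt O ∈ V) :
    (∃ r, functionValue hV r = φ) ↔ ∀ x ∈ V, IsRegularAt O (Subalgebra.toSubmodule O) x φ := by
  refine ⟨?_, fun h ↦ ?_⟩
  · rintro ⟨r, rfl⟩ x hx
    exact (hasFunctionValue_functionValue hV r ⟨x, hx⟩).isRegularAt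
  · obtain ⟨r, hr⟩ := exists_function h
    exact ⟨r, (functionValue_eq_iff hV).2 hr⟩

theorem functionValue_res {V' : (latticeCurve O).Opens} (i : V' ⟶ V) (hV' : genericPt O ∈ V')
    (hV : genericPt O ∈ V) (r : Γ(latticeCurve O, V)) :
    functionValue hV' ((latticeCurve O).presheaf.map i.op r) = functionValue hV r :=
  (functionValue_eq_iff hV').2 fun x ↦ hasFunctionValue_functionValue hV r ⟨x.1, i.le x.2⟩

/-- The action of functions on sections, stated for `LatticeSections` so that instance resolution finds it. -/
noncomputable instance : Module Γ(latticeCurve O, V) (LatticeSections hOW V) :=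
  instModuleCarrierObjOppositeOpensCarrierCarrierCommRingCatProjSubmodulePresheafOpOpensSubtypeForallLocModValTopMemAddSubgroupProjSections
    (𝒮 := grPiece O) (ℳ := grModPiece hOW) (fun _ _ _ _ ↦ grPiece_smul_mem hOW) V

theorem sectionValue_smul (hV : genericPt O ∈ V) (r : Γ(latticeCurve O, V))
    (s : LatticeSections hOW V) :
    sectionValue hOW hV (r • s) = act (functionValue hV r) (sectionValue hOW hV s) :=
  (sectionValue_eq_iff hV _).2 fun x ↦
    (hasFunctionValue_functionValue hV r x).smul (hasValue_sectionValue hV s x)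

theorem sectionValue_res {V' : (latticeCurve O).Opens} (i : V' ⟶ V) (hV' : genericPt O ∈ V')
    (hV : genericPt O ∈ V) (s : LatticeSections hOW V) :
    sectionValue hOW hV' ((sectionsPresheaf (𝒮 := grPiece O) (ℳ := grModPiece hOW)
      fun _ _ _ _ ↦ grPiece_smul_mem hOW).map i.op s) = sectionValue hOW hV s :=
  (sectionValue_eq_iff hV' _).2 fun x ↦ hasValue_sectionValue hV s ⟨x.1, i.le x.2⟩

theorem IsValueAt.mul [SMulCommClass k A A] [IsScalarTower k A A]
    (hW : ∀ a ∈ W, ∀ b ∈ W, a * b ∈ W) {η : LocMod (grPiece O) (GrMod hOW) x} {ω : HahnSeries ℤ A}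
    (hξ : IsValueAt hOW x ξ χ) (hη : IsValueAt hOW x η ω) :
    IsValueAt hOW x (locMul (complAt (grPiece O) x) (grModMul hOW hW) ξ η) (χ * ω) := by
  obtain ⟨m, α, hα, hw, hm, rfl⟩ := hξ
  obtain ⟨n, β, hβ, hv, hn, rfl⟩ := hη
  have e : act (α * β) (χ * ω) = act α χ * act β ω := by
    rw [act_mul, mul_act, act_act]
  have p : act α χ * act β ω ∈ poleLE k A (m + n : ℕ) := by
    push_cast
    exact mul_mem_poleLE hm hn
  refine ⟨m + n, α * β, hα.mul hβ, e ▸ hW _ hw _ hv, e ▸ p, ?_⟩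
  rw [locMul_mk]
  congr 1
  · refine Subtype.ext ((LaurentPoly.monomial_mul_monomial _ _ _ _).trans ?_)
    exact congrArg₂ LaurentPoly.monomial (Nat.cast_add m n).symm e.symm
  · exact Subtype.ext (grMonomial_mul m n α β hα.1 hα.2.1 hβ.1 hβ.2.1 (hα.mul hβ).1 (hα.mul hβ).2.1)

theorem sectionValue_mul [SMulCommClass k A A] [IsScalarTower k A A]
    (hW : ∀ a ∈ W, ∀ b ∈ W, a * b ∈ W) (hV : genericPt O ∈ V) (s t : LatticeSections hOW V) :
    sectionValue hOW hV (sectionsMul (fun _ _ _ _ ↦ grPiece_smul_mem hOW) (grModMul hOW hW)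
      (fun _ _ _ hm _ hn ↦ grModMul_mem hOW hW hm hn) V s t) =
      sectionValue hOW hV s * sectionValue hOW hV t :=
  (sectionValue_eq_iff hV _).2 fun x ↦
    (hasValue_sectionValue hV s x).mul hW (hasValue_sectionValue hV t x)

end Functions

/-! ### Regular series and the point at infinity -/

section Regular
open HahnSeries TopologicalSpace
variable {k A : Type u} [Field k] [NonUnitalNonAssocRing A] [Module k A]
  {O : Subalgebra k (HahnSeries ℤ k)} {W : Submodule k (HahnSeries ℤ A)}

theorem IsRegularAt.add (hOW : Stabilizes O W) {x : latticeCurve O} {φ ψ : HahnSeries ℤ A}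
    (hφ : IsRegularAt O W x φ) (hψ : IsRegularAt O W x ψ) : IsRegularAt O W x (φ + ψ) := by
  obtain ⟨ξ, hξ⟩ := hφ.exists_value hOW
  obtain ⟨η, hη⟩ := hψ.exists_value hOW
  exact (hξ.add hη).isRegularAt

theorem isRegularAt_of_mem {x : latticeCurve O} {w : HahnSeries ℤ A} (hw : w ∈ W)
    (h : w ∈ integralPart k A) : IsRegularAt O W x w :=
  ⟨0, 1, isDenom_one x, by rwa [one_act], by rw [one_act]; exact h⟩

/-- The values of the sections over `V` of the sheaf attached to `gr(W)`. -/
def regularOn (hOW : Stabilizes O W) (V : (latticeCurve O).Opens) : Submodule k (HahnSeries ℤ A) where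
  carrier := {φ | ∀ x ∈ V, IsRegularAt O W x φ}
  zero_mem' x _ := isRegularAt_of_mem W.zero_mem (Submodule.zero_mem _)
  add_mem' h h' x hx := (h x hx).add hOW (h' x hx)
  smul_mem' c φ h x hx := by
    obtain ⟨n, α, h1, h2, h3⟩ := h x hx
    have e : GeomLattice.act α (c • φ) = c • GeomLattice.act α φ := by
      rw [← act_C, ← act_C, act_act, act_act, mul_comm]
    exact ⟨n, α, h1, e ▸ W.smul_mem c h2, e ▸ Submodule.smul_mem _ c h3⟩

theorem regularOn_anti (hOW : Stabilizes O W) {U V : (latticeCurve O).Opens} (h : U ≤ V) :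
    regularOn hOW V ≤ regularOn hOW U := fun _ hφ x hx ↦ hφ x (h hx)

/-- The homogeneous ideal of the denominators of `φ` as a fraction with numerator in `gr(W)`. -/
noncomputable def colonIdeal (hOW : Stabilizes O W) (φ : HahnSeries ℤ A) : Ideal (GrRing O) where
  carrier := {a | ∀ n : ℕ, act (a.coeff n) φ ∈ W ⊓ poleLE k A n}
  zero_mem' n := by
    rw [GrRing.coeff_zero, zero_act]
    exact zero_mem _
  add_mem' ha hb n := by
    rw [GrRing.coeff_add, add_act]
    exact add_mem (ha n) (hb n)
  smul_mem' a b hb n := by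
    have e : (a • b).coeff n = ∑ ij ∈ Finset.HasAntidiagonal.antidiagonal n, a.coeff ij.1 * b.coeff ij.2 := by
      change (grVal O (a * b)).coeff n = _
      rw [map_mul, Polynomial.coeff_mul]
      rfl
    rw [e, sum_act]
    refine sum_mem fun ij h ↦ ?_
    rw [← act_act]
    refine ⟨hOW _ (a.coeff_mem _).1 _ (hb _).1, ?_⟩
    have := act_mem_poleLE (a.coeff_mem ij.1).2 (hb ij.2).2
    rwa [← Nat.cast_add, Finset.HasAntidiagonal.mem_antidiagonal.1 h] at this

theorem grMonomial_mem_colonIdeal {hOW : Stabilizes O W} {φ : HahnSeries ℤ A} {n : ℕ}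
    {f : HahnSeries ℤ k} {hf : f ∈ O} {hn : f ∈ poleLE k k n} :
    grMonomial O n f hf hn ∈ colonIdeal hOW φ ↔ act f φ ∈ W ⊓ poleLE k A n := by
  refine ⟨fun h ↦ ?_, fun h m ↦ ?_⟩
  · have := h n
    rwa [coeff_grMonomial, if_pos rfl] at this
  · rw [coeff_grMonomial]
    split_ifs with h1
    · exact h1 ▸ h
    · rw [zero_act]
      exact zero_mem _

theorem decompose_eq (a : GrRing O) (n : ℕ) :
    (DirectSum.decompose (grPiece O) a n : GrRing O) =
      grMonomial O n (a.coeff n) (a.coeff_mem n).1 (a.coeff_mem n).2 :=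
  congrArg Subtype.val (grDecompose_apply O a n)

theorem isHomogeneous_colonIdeal (hOW : Stabilizes O W) (φ : HahnSeries ℤ A) :
    (colonIdeal hOW φ).IsHomogeneous (grPiece O) := fun n a ha ↦ by
  rw [decompose_eq, grMonomial_mem_colonIdeal]
  exact ha n

theorem mem_irrelevant_of_pos {n : ℕ} (hn0 : 0 < n) {a : GrRing O} (ha : a ∈ grPiece O n) :
    a ∈ HomogeneousIdeal.irrelevant (grPiece O) := by
  rw [HomogeneousIdeal.mem_irrelevant_iff]
  exact DirectSum.decompose_of_mem_ne (grPiece O) ha hn0.ne'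

/-- The sections over `D₊(tᵈ f)` are the fractions with denominator a power of `tᵈ f`: the ideal of
denominators of a section has no zero in `D₊(tᵈ f)`, so its radical contains `tᵈ f`. -/
theorem mem_regularOn_basicOpenOf (hOW : Stabilizes O W) {d : ℕ} (hd : 0 < d) {f : HahnSeries ℤ k}
    (hf : f ∈ O) (hfd : f ∈ poleLE k k d) {φ : HahnSeries ℤ A} :
    φ ∈ regularOn hOW (basicOpenOf d f hf hfd) ↔
      ∃ m : ℕ, act (f ^ m) φ ∈ W ∧ act (f ^ m) φ ∈ poleLE k A (d * m : ℕ) := by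
  constructor
  · intro h
    have h1 : grMonomial O d f hf hfd ∈ (colonIdeal hOW φ).radical := by
      rw [(isHomogeneous_colonIdeal hOW φ).radical_eq, Ideal.mem_sInf]
      rintro J ⟨hJ1, hJ2, hJ3⟩
      by_contra hJ
      let x : latticeCurve O := ⟨⟨J, hJ1⟩, hJ3, fun hirr ↦ hJ (hirr
        (mem_irrelevant_of_pos hd (grMonomial_mem O d f hf hfd)))⟩
      obtain ⟨n, α, hα, hw, hn⟩ := h x (mem_basicOpenOf.2 ⟨hf, hfd, hJ⟩)
      exact hα.2.2 (hJ2 (grMonomial_mem_colonIdeal.2 ⟨hw, hn⟩))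
    obtain ⟨m, hm⟩ := h1
    rw [grMonomial_pow d m f hf hfd (O.pow_mem hf m) (pow_mem_poleLE hfd m),
      grMonomial_mem_colonIdeal] at hm
    exact ⟨m, hm⟩
  · rintro ⟨m, h1, h2⟩ x hx
    exact ⟨d * m, f ^ m, (mem_basicOpenOf.1 hx).pow m, h1, h2⟩

variable (O) in
/-- The open subset `D₊(t)`, the complement of the point at infinity. -/
noncomputable abbrev affinePart : (latticeCurve O).Opens :=
  basicOpenOf 1 1 O.one_mem (one_mem_poleLE (Int.natCast_nonneg 1))

/-- Any series has bounded pole order, so with denominators `tᵐ` the pole condition is no restriction. -/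
theorem regularOn_affinePart (hOW : Stabilizes O W) : regularOn hOW (affinePart O) = W := by
  ext φ
  rw [mem_regularOn_basicOpenOf hOW one_pos]
  simp only [one_pow, one_act, one_mul]
  refine ⟨fun ⟨_, h, _⟩ ↦ h, fun h ↦ ?_⟩
  obtain ⟨m, hm⟩ := exists_mem_poleLE (k := k) φ
  exact ⟨m, h, hm⟩

theorem act_pow_mem_iff {f : HahnSeries ℤ k} {d : ℕ} (hf : f ∈ poleLE k k d) (h0 : f.coeff (-d) ≠ 0)
    (m : ℕ) {φ : HahnSeries ℤ A} :
    act (f ^ m) φ ∈ poleLE k A (d * m : ℕ) ↔ φ ∈ integralPart k A := by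
  induction m with
  | zero => simp [one_act]
  | succ m ih =>
    rw [pow_succ', ← act_act, mul_add_one, add_comm (d * m), Nat.cast_add, act_mem_iff hf h0, ih]

/-- Near the point at infinity, sections are the power series among the fractions. -/
theorem mem_regularOn_of_leading (hOW : Stabilizes O W) {d : ℕ} (hd : 0 < d) {f : HahnSeries ℤ k}
    (hf : f ∈ O) (hfd : f ∈ poleLE k k d) (h0 : f.coeff (-d) ≠ 0) {φ : HahnSeries ℤ A} :
    φ ∈ regularOn hOW (basicOpenOf d f hf hfd) ↔
      (∃ m : ℕ, act (f ^ m) φ ∈ W) ∧ φ ∈ integralPart k A := by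
  rw [mem_regularOn_basicOpenOf hOW hd]
  simp only [act_pow_mem_iff hfd h0]
  exact exists_and_right

end Regular

section PointAtInfinity
open HahnSeries TopologicalSpace
variable {k A : Type u} [Field k] [NonUnitalNonAssocRing A] [Module k A]
  {O : Subalgebra k (HahnSeries ℤ k)} {W : Submodule k (HahnSeries ℤ A)}

/-- If the coefficient of `f` at the pole order `n` vanishes, then `tⁿ f = t · tⁿ⁻¹ f`; for `n = 0` the lattice
condition forces `f = 0`. -/
theorem grMonomial_mem_span_grT {n : ℕ} {f : HahnSeries ℤ k} (hf : f ∈ O) (hn : f ∈ poleLE k k n)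
    (h0 : f.coeff (-n) = 0) (hO : IsLattice (Subalgebra.toSubmodule O)) :
    grMonomial O n f hf hn ∈ Ideal.span {grT O} := by
  rcases n with _ | n
  · have h1 := hO.eq_C_of_mem_integralPart hf hn
    have h2 : f = 0 := by
      rw [h1, show f.coeff 0 = 0 by simpa using h0, map_zero]
    subst h2
    have e : grMonomial O 0 0 hf hn = 0 := GrRing.ext fun m ↦ by
      rw [coeff_grMonomial, ite_self, GrRing.coeff_zero]
    rw [e]
    exact zero_mem (Ideal.span {grT O})
  · have h1 : f ∈ poleLE k k n := by
      have := mem_poleLE_pred hn h0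
      rwa [Nat.cast_add, Nat.cast_one, add_sub_cancel_right] at this
    rw [Ideal.mem_span_singleton']
    refine ⟨grMonomial O n f hf h1, ?_⟩
    refine (grMonomial_mul n 1 f 1 hf h1 O.one_mem _ (by rwa [mul_one]) (by rwa [mul_one])).trans ?_
    exact grMonomial_congr rfl (mul_one f) _ _ _ _

variable (O) in
/-- The ideal `(t)`, described by the vanishing of the leading coefficients. -/
noncomputable def infinityIdeal : Ideal (GrRing O) where
  carrier := {a | ∀ n : ℕ, (a.coeff n).coeff (-n) = 0}
  zero_mem' n := by rw [GrRing.coeff_zero, HahnSeries.coeff_zero]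
  add_mem' ha hb n := by rw [GrRing.coeff_add, HahnSeries.coeff_add, ha n, hb n, add_zero]
  smul_mem' a b hb n := by
    have e : (a • b).coeff n = ∑ ij ∈ Finset.HasAntidiagonal.antidiagonal n, a.coeff ij.1 * b.coeff ij.2 := by
      change (grVal O (a * b)).coeff n = _
      rw [map_mul, Polynomial.coeff_mul]
      rfl
    rw [e, HahnSeries.coeff_sum]
    refine Finset.sum_eq_zero fun ij h ↦ ?_
    rw [← Finset.HasAntidiagonal.mem_antidiagonal.1 h, Nat.cast_add,
      coeff_mul_leading (a.coeff_mem _).2 (b.coeff_mem _).2, hb, mul_zero]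

theorem grMonomial_mem_infinityIdeal {n : ℕ} {f : HahnSeries ℤ k} {hf : f ∈ O}
    {hn : f ∈ poleLE k k n} : grMonomial O n f hf hn ∈ infinityIdeal O ↔ f.coeff (-n) = 0 := by
  refine ⟨fun h ↦ ?_, fun h m ↦ ?_⟩
  · have := h n
    rwa [coeff_grMonomial, if_pos rfl] at this
  · rw [coeff_grMonomial]
    split_ifs with h1
    · exact h1 ▸ h
    · rfl

theorem sum_grMonomial (a : GrRing O) : a = ∑ n ∈ (grVal O a).support,
    grMonomial O n (a.coeff n) (a.coeff_mem n).1 (a.coeff_mem n).2 := by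
  apply Subtype.val_injective
  have := (grVal O a).as_sum_support
  refine this.trans ?_
  change _ = grVal O _
  rw [map_sum]
  rfl

theorem infinityIdeal_eq (hO : IsLattice (Subalgebra.toSubmodule O)) :
    infinityIdeal O = Ideal.span {grT O} := by
  refine le_antisymm (fun a ha ↦ ?_) ?_
  · rw [sum_grMonomial a]
    exact sum_mem fun n _ ↦ grMonomial_mem_span_grT _ _ (ha n) hO
  · rw [Ideal.span_singleton_le_iff_mem, grT, grMonomial_mem_infinityIdeal]
    rw [coeff_one, if_neg (by simp)]

theorem isHomogeneous_infinityIdeal : (infinityIdeal O).IsHomogeneous (grPiece O) := fun n a ha ↦ by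
  rw [decompose_eq, grMonomial_mem_infinityIdeal]
  exact ha n

/-- The point at infinity `(t)` of `Proj(gr(O))`. -/
noncomputable def infinityPt (hO : IsLattice (Subalgebra.toSubmodule O)) : latticeCurve O where
  asHomogeneousIdeal := ⟨infinityIdeal O, isHomogeneous_infinityIdeal⟩
  isPrime := by
    refine isHomogeneous_infinityIdeal.isPrime_of_homogeneous_mem_or_mem ?_ ?_
    · rw [Ne, Ideal.eq_top_iff_one]
      intro h
      have h1 := h 0
      have e : (1 : GrRing O).coeff 0 = 1 := by
        rw [GrRing.coeff, map_one, Polynomial.coeff_one_zero]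
      rw [e] at h1
      simp at h1
    · rintro a b ⟨m, ha⟩ ⟨n, hb⟩ hab
      rw [eq_grMonomial ha, eq_grMonomial hb] at hab ⊢
      have p : a.coeff m * b.coeff n ∈ poleLE k k (m + n : ℕ) := by
        push_cast
        exact mul_mem_poleLE (a.coeff_mem m).2 (b.coeff_mem n).2
      rw [grMonomial_mul m n _ _ _ _ _ _ (O.mul_mem (a.coeff_mem m).1 (b.coeff_mem n).1) p,
        grMonomial_mem_infinityIdeal, Nat.cast_add,
        coeff_mul_leading (a.coeff_mem m).2 (b.coeff_mem n).2] at hab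
      rw [grMonomial_mem_infinityIdeal, grMonomial_mem_infinityIdeal]
      exact mul_eq_zero.1 hab
  not_irrelevant_le h := by
    obtain ⟨N, hN⟩ := hO.exists_pole
    obtain ⟨f, hf, hfN, h1⟩ := hN (N + 1) (by omega)
    have := h (mem_irrelevant_of_pos (by omega) (grMonomial_mem O (N + 1) f hf hfN))
    have h2 : grMonomial O (N + 1) f hf hfN ∈ infinityIdeal O := this
    rw [grMonomial_mem_infinityIdeal, h1] at h2
    exact one_ne_zero h2

variable {hO : IsLattice (Subalgebra.toSubmodule O)}

/-- An element `tⁿ α` does not vanish at infinity if and only if `α` has a pole of order exactly `n`. -/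
theorem isDenom_infinityPt {n : ℕ} {α : HahnSeries ℤ k} :
    IsDenom (infinityPt hO) n α ↔ α ∈ O ∧ α ∈ poleLE k k n ∧ α.coeff (-n) ≠ 0 := by
  refine ⟨fun h ↦ ⟨h.1, h.2.1, fun h0 ↦ h.2.2 ?_⟩, fun h ↦ ⟨h.1, h.2.1, fun h0 ↦ h.2.2 ?_⟩⟩
  · exact grMonomial_mem_infinityIdeal.2 h0
  · exact grMonomial_mem_infinityIdeal.1 h0

theorem IsRegularAt.mem_integralPart {φ : HahnSeries ℤ A} (h : IsRegularAt O W (infinityPt hO) φ) :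
    φ ∈ integralPart k A := by
  obtain ⟨n, α, hα, -, hn⟩ := h
  rw [isDenom_infinityPt] at hα
  rwa [← add_zero (n : ℤ), act_mem_iff hα.2.1 hα.2.2] at hn

theorem infinityPt_notMem_affinePart : infinityPt hO ∉ affinePart O := fun h ↦ by
  have := (isDenom_infinityPt.1 (mem_basicOpenOf.1 h)).2.2
  rw [coeff_one, if_neg (by simp)] at this
  exact this rfl

/-- The only point outside `D₊(t)` is the point at infinity: modulo `t`, every homogeneous element of
positive degree has a power that is a multiple of a given element that does not vanish at infinity. -/
theorem eq_infinityPt_of_notMem {x : latticeCurve O} (hx : x ∉ affinePart O) : x = infinityPt hO := by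
  have ht : grT O ∈ x.asHomogeneousIdeal.toIdeal := by
    by_contra h
    exact hx (mem_basicOpenOf.2 ⟨_, _, h⟩)
  have hle : infinityIdeal O ≤ x.asHomogeneousIdeal.toIdeal := by
    rwa [infinityIdeal_eq hO, Ideal.span_singleton_le_iff_mem]
  refine ProjectiveSpectrum.ext (HomogeneousIdeal.toIdeal_injective (le_antisymm ?_ hle))
  by_contra hne
  obtain ⟨a, hax, ha⟩ := Set.not_subset.1 hne
  -- a homogeneous element of `x` that does not vanish at infinity
  obtain ⟨n, f, hf, hfn, hn0, hfx⟩ : ∃ (n : ℕ) (f : HahnSeries ℤ k) (hf : f ∈ O)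
      (hfn : f ∈ poleLE k k n), f.coeff (-n) ≠ 0 ∧
        grMonomial O n f hf hfn ∈ x.asHomogeneousIdeal.toIdeal := by
    by_contra! h
    refine ha fun n ↦ ?_
    by_contra h0
    refine h n _ (a.coeff_mem n).1 (a.coeff_mem n).2 h0 ?_
    rw [← decompose_eq]
    exact x.asHomogeneousIdeal.isHomogeneous n hax
  -- `gⁿ` and a multiple of `fᵉ` have the same leading term, so that they agree modulo `t`
  have key : ∀ (e : ℕ), 0 < e → ∀ (g : HahnSeries ℤ k) (hg : g ∈ O) (hge : g ∈ poleLE k k e),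
      grMonomial O e g hg hge ∈ x.asHomogeneousIdeal.toIdeal := by
    intro e he g hg hge
    rcases Nat.eq_zero_or_pos n with rfl | hn
    · -- then `f` is a nonzero constant
      exfalso
      refine x.isPrime.ne_top (Ideal.eq_top_of_isUnit_mem _ hfx ?_)
      have h1 := hO.eq_C_of_mem_integralPart hf hfn
      have hc : f.coeff 0 ≠ 0 := by simpa using hn0
      have h2 : (C (f.coeff 0)⁻¹ : HahnSeries ℤ k) ∈ O := O.algebraMap_mem _
      have h3 : (C (f.coeff 0)⁻¹ : HahnSeries ℤ k) ∈ poleLE k k (0 : ℕ) :=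
        (integralSubalgebra k).algebraMap_mem _
      have h4 : f * C (f.coeff 0)⁻¹ = 1 :=
        (congrArg (· * C (f.coeff 0)⁻¹) h1).trans
          (by simp only [← map_mul, mul_inv_cancel₀ hc, map_one])
      refine IsUnit.of_mul_eq_one (grMonomial O 0 _ h2 h3) ?_
      rw [grMonomial_mul 0 0 _ _ hf hfn h2 h3 (h4 ▸ O.one_mem)
        (h4 ▸ one_mem_poleLE (Int.natCast_nonneg _))]
      refine Subtype.ext ?_
      change Polynomial.monomial 0 (f * C (f.coeff 0)⁻¹) = 1
      rw [h4, Polynomial.monomial_zero_one]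
    · refine x.isPrime.mem_of_pow_mem n ?_
      have hgn := pow_mem_poleLE hge n
      have hfe := pow_mem_poleLE hfn e
      rw [mul_comm] at hfe
      have hc : (f ^ e).coeff (-(e * n : ℕ)) ≠ 0 := by
        have := (isDenom_infinityPt (hO := hO)).1 ((isDenom_infinityPt (hO := hO)).2 ⟨hf, hfn, hn0⟩ |>.pow e)
        rw [mul_comm e]
        exact this.2.2
      set c := (g ^ n).coeff (-(e * n : ℕ)) / (f ^ e).coeff (-(e * n : ℕ))
      have hcf : c • f ^ e ∈ O := O.smul_mem (O.pow_mem hf e) c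
      have hcf' : c • f ^ e ∈ poleLE k k (e * n : ℕ) := Submodule.smul_mem _ c hfe
      have hd : g ^ n - c • f ^ e ∈ O := sub_mem (O.pow_mem hg n) hcf
      have hd' : g ^ n - c • f ^ e ∈ poleLE k k (e * n : ℕ) := sub_mem hgn hcf'
      have e1 : grMonomial O e g hg hge ^ n = grMonomial O (e * n) _ hd hd' +
          c • grMonomial O n f hf hfn ^ e := by
        rw [grMonomial_pow e n g hg hge (O.pow_mem hg n) hgn,
          grMonomial_pow n e f hf hfn (O.pow_mem hf e) (by rw [mul_comm]; exact hfe)]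
        refine GrRing.ext fun j ↦ ?_
        rw [GrRing.coeff_add, GrRing.coeff_smul, coeff_grMonomial, coeff_grMonomial, coeff_grMonomial,
          mul_comm n e]
        split_ifs
        · rw [sub_add_cancel]
        · rw [smul_zero, add_zero]
      rw [e1]
      refine add_mem (hle (grMonomial_mem_infinityIdeal.2 ?_)) ?_
      · rw [coeff_sub, HahnSeries.coeff_smul, smul_eq_mul, div_mul_cancel₀ _ hc, sub_self]
      · rw [← algebraMap_smul (GrRing O)]
        exact Ideal.mul_mem_left _ _ (Ideal.pow_mem_of_mem _ hfx _ he)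
  refine x.not_irrelevant_le fun b hb ↦ ?_
  change b ∈ x.asHomogeneousIdeal.toIdeal
  rw [sum_grMonomial b]
  refine sum_mem fun m _ ↦ ?_
  rcases Nat.eq_zero_or_pos m with rfl | hm
  · rw [HomogeneousIdeal.mem_irrelevant_iff] at hb
    rw [← decompose_eq]
    have h0 : ((DirectSum.decompose (grPiece O) b 0 : grPiece O 0) : GrRing O) = 0 := hb
    rw [h0]
    exact zero_mem _
  · exact key m hm _ _ _

theorem coe_affinePart : (affinePart O : Set (latticeCurve O)) = {infinityPt hO}ᶜ := by
  ext x
  refine ⟨fun h h' ↦ infinityPt_notMem_affinePart (hO := hO) ?_, fun h ↦ ?_⟩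
  · rwa [← Set.mem_singleton_iff.1 h']
  · by_contra h'
    exact h (eq_infinityPt_of_notMem h')

/-- The global sections. -/
theorem regularOn_top (hO : IsLattice (Subalgebra.toSubmodule O)) (hOW : Stabilizes O W) :
    regularOn hOW ⊤ = integralPart k A ⊓ W := by
  refine le_antisymm (fun φ h ↦ ⟨?_, ?_⟩) fun φ h x _ ↦ isRegularAt_of_mem h.2 h.1
  · exact (h (infinityPt hO) trivial).mem_integralPart
  · exact (regularOn_affinePart hOW).le (regularOn_anti hOW le_top h)

end PointAtInfinity

/-! ### First cohomology of a sheaf of subspaces -/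

section Cohomology
open TopologicalSpace Opposite TopCat
variable {X : TopCat.{u}}

/-- Sheaves of abelian groups on `X`. -/
abbrev AbSheaf (X : TopCat.{u}) := CategoryTheory.Sheaf (Opens.grothendieckTopology X) AddCommGrpCat.{u}

/-- In degree zero, the map on cohomology is the map on global sections. -/
theorem mk₀_comp_surjective_of_sections {F G : AbSheaf X} (f : F ⟶ G)
    (hf : Function.Surjective (f.hom.app (op ⊤))) :
    Function.Surjective (Sheaf.H.map f 0) := fun y ↦ by
  obtain ⟨s, hs⟩ := hf (Sheaf.H.equiv₀ G Limits.isTerminalTop y)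
  refine ⟨(Sheaf.H.equiv₀ F Limits.isTerminalTop).symm s, ?_⟩
  rw [Sheaf.H.equiv₀_symm_naturality, hs, AddEquiv.symm_apply_apply]

/-- The first cohomology of a flasque sheaf vanishes: embed the sheaf in an injective one; global sections of
the quotient lift, because the kernel is flasque. -/
theorem subsingleton_H_one_of_flasque (G : AbSheaf X) [h : TopCat.Presheaf.IsFlasque G.obj] :
    Subsingleton (G.H 1) := by
  let S : ShortComplex (AbSheaf X) :=
    ShortComplex.mk (Injective.ι G) (Limits.cokernel.π (Injective.ι G)) (Limits.cokernel.condition _)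
  have hS : S.ShortExact :=
    { exact := ShortComplex.exact_cokernel _
      mono_f := inferInstanceAs (Mono (Injective.ι G))
      epi_g := inferInstanceAs (Epi (Limits.cokernel.π _)) }
  refine subsingleton_of_forall_eq 0 fun x ↦ ?_
  obtain ⟨y, rfl⟩ := Abelian.Ext.covariant_sequence_exact₁ _ hS x
    (Abelian.Ext.eq_zero_of_injective (n := 0) (I := Injective.under G) _) (zero_add 1)
  have h1 := @TopCat.Sheaf.IsFlasque.epi_of_shortExact X ⊤ S hS h
  obtain ⟨z, rfl⟩ := mk₀_comp_surjective_of_sections S.g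
    ((AddCommGrpCat.epi_iff_surjective _).1 h1) y
  rw [Sheaf.H.map_apply, Abelian.Ext.comp_assoc_of_second_deg_zero, hS.comp_extClass, Abelian.Ext.comp_zero]

variable {S : ShortComplex (AbSheaf X)} (hS : S.ShortExact)

/-- The connecting homomorphism from the global sections of the quotient. -/
noncomputable def connecting : S.X₃.obj.obj (op ⊤) →+ S.X₁.H 1 :=
  (hS.extClass.postcomp _ (zero_add 1)).comp
    (Sheaf.H.equiv₀ S.X₃ Limits.isTerminalTop).symm.toAddMonoidHom

/-- The part `H⁰(X₃) → H¹(X₁) → H¹(X₂)` of the long exact sequence, when the last group vanishes. -/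
theorem connecting_surjective [Subsingleton (S.X₂.H 1)] : Function.Surjective (connecting hS) := fun x ↦ by
  obtain ⟨y, rfl⟩ := Abelian.Ext.covariant_sequence_exact₁ _ hS x
    (Subsingleton.elim (α := S.X₂.H 1) _ _) (zero_add 1)
  refine ⟨Sheaf.H.equiv₀ S.X₃ Limits.isTerminalTop y, ?_⟩
  change ((Sheaf.H.equiv₀ S.X₃ _).symm _).comp hS.extClass (zero_add 1) = _
  rw [AddEquiv.symm_apply_apply]

/-- The part `H⁰(X₂) → H⁰(X₃) → H¹(X₁)` of the long exact sequence. -/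
theorem connecting_eq_zero_iff {q : S.X₃.obj.obj (op ⊤)} :
    connecting hS q = 0 ↔ ∃ s, S.g.hom.app (op ⊤) s = q := by
  constructor
  · intro h
    obtain ⟨y, hy⟩ := Abelian.Ext.covariant_sequence_exact₃ _ hS
      ((Sheaf.H.equiv₀ S.X₃ Limits.isTerminalTop).symm q) (zero_add 1) h
    refine ⟨Sheaf.H.equiv₀ S.X₂ Limits.isTerminalTop y, ?_⟩
    rw [Sheaf.H.equiv₀_naturality]
    exact (congrArg _ hy).trans (AddEquiv.apply_symm_apply _ _)
  · rintro ⟨s, rfl⟩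
    change ((Sheaf.H.equiv₀ S.X₃ _).symm _).comp hS.extClass (zero_add 1) = 0
    rw [← Sheaf.H.equiv₀_symm_naturality, Sheaf.H.map_apply,
      Abelian.Ext.comp_assoc_of_second_deg_zero, hS.comp_extClass, Abelian.Ext.comp_zero]

theorem connecting_naturality (f : S ⟶ S) (q : S.X₃.obj.obj (op ⊤)) :
    connecting hS (f.τ₃.hom.app (op ⊤) q) = Sheaf.H.map f.τ₁ 1 (connecting hS q) := by
  change ((Sheaf.H.equiv₀ S.X₃ _).symm _).comp hS.extClass (zero_add 1) =
    (((Sheaf.H.equiv₀ S.X₃ _).symm q).comp hS.extClass (zero_add 1)).comp (Abelian.Ext.mk₀ f.τ₁)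
      (add_zero 1)
  rw [← Sheaf.H.equiv₀_symm_naturality, Sheaf.H.map_apply,
      Abelian.Ext.comp_assoc_of_second_deg_zero, ← hS.extClass_naturality hS f,
      Abelian.Ext.comp_assoc_of_third_deg_zero]

end Cohomology

section GenericSheaf
open TopologicalSpace Opposite TopCat
variable {X : TopCat.{u}} (η : X) (M : Type u) [AddCommGroup M]

/-- The presheaf of abelian groups with value `M` on the neighbourhoods of `η` and `0` elsewhere. -/
def genericPresheaf : TopCat.Presheaf AddCommGrpCat.{u} X where
  obj V := AddCommGrpCat.of (PLift (η ∈ V.unop) → M)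
  map {U V} i := AddCommGrpCat.ofHom
    { toFun := fun s h ↦ s ⟨i.unop.le h.down⟩
      map_zero' := rfl
      map_add' := fun _ _ ↦ rfl }

/-- Compatible local sections are glued by the value on any member of the cover that contains `η`. -/
theorem isSheaf_genericPresheaf : (genericPresheaf η M).IsSheaf := by
  refine (TopCat.Presheaf.isSheaf_iff_isSheaf_comp (forget AddCommGrpCat) _).2
    (TopCat.Presheaf.isSheaf_of_isSheafUniqueGluing_types _ fun ι U sf hsf ↦ ?_)
  classical
  have hs : ∀ h : η ∈ iSup U, ∃ i, η ∈ U i := fun h ↦ Opens.mem_iSup.1 h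
  refine ⟨fun h ↦ (show PLift (η ∈ U (hs h.down).choose) → M from sf (hs h.down).choose)
    ⟨(hs h.down).choose_spec⟩, fun i ↦ ?_, fun s' hs' ↦ ?_⟩
  · funext h
    have := hsf (hs ((le_iSup U i) h.down)).choose i
    exact congrFun (show (_ : PLift (η ∈ U _ ⊓ U i) → M) = _ from this)
      ⟨⟨(hs ((le_iSup U i) h.down)).choose_spec, h.down⟩⟩
  · funext h
    exact congrFun (show (_ : PLift (η ∈ U (hs h.down).choose) → M) = _ from hs' (hs h.down).choose)
      ⟨(hs h.down).choose_spec⟩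

/-- The sheaf of abelian groups with value `M` on the neighbourhoods of `η` and `0` elsewhere. -/
def genericSheaf : AbSheaf X := ⟨genericPresheaf η M, isSheaf_genericPresheaf η M⟩

instance : TopCat.Presheaf.IsFlasque (genericSheaf η M).obj where
  epi {U V} i := by
    rw [AddCommGrpCat.epi_iff_surjective]
    intro s
    by_cases h : η ∈ V.unop
    · exact ⟨fun _ ↦ (show PLift (η ∈ V.unop) → M from s) ⟨h⟩, rfl⟩
    · exact ⟨fun _ ↦ 0, funext fun h' ↦ absurd h'.down h⟩

variable {M} in
/-- The endomorphism of the generic sheaf induced by an endomorphism of its value. -/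
def genericSheafMap (f : M →+ M) : genericSheaf η M ⟶ genericSheaf η M :=
  ⟨{ app _ := AddCommGrpCat.ofHom (f.compLeft _)
     naturality := fun _ _ _ ↦ rfl }⟩

end GenericSheaf

section Subsheaf
open TopologicalSpace Opposite TopCat
variable {X : TopCat.{u}} {k M : Type u} [Field k] [AddCommGroup M] [Module k M]

/-- The sheaf `F` is identified with the sheaf `V ↦ T V` of subspaces of `M`, on an irreducible space with
generic point `η`. Irreducibility enters as the condition that every nonempty open subset contains `η`. -/
structure SubspaceModel (F : AbSheaf X) (η : X) (T : Opens X → Submodule k M) where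
  /-- The element of `M` given by a section over a nonempty open subset. -/
  val (V : Opens X) (hV : η ∈ V) : F.obj.obj (op V) →+ M
  injective (V : Opens X) (hV : η ∈ V) : Function.Injective (val V hV)
  res {U V : Opens X} (i : U ⟶ V) (hU : η ∈ U) (hV : η ∈ V) (s : F.obj.obj (op V)) :
    val U hU (F.obj.map i.op s) = val V hV s
  range (V : Opens X) (hV : η ∈ V) (φ : M) : (∃ s, val V hV s = φ) ↔ φ ∈ T V
  generic (V : Opens X) (x : X) (hx : x ∈ V) : η ∈ V

namespace SubspaceModel
variable {F : AbSheaf X} {η : X} {T : Opens X → Submodule k M} (D : SubspaceModel F η T)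

/-- The inclusion of `F` in the sheaf of germs at the generic point. -/
def toGeneric : F ⟶ genericSheaf η M :=
  ⟨{ app V := AddCommGrpCat.ofHom
      { toFun := fun s h ↦ D.val V.unop h.down s
        map_zero' := funext fun _ ↦ map_zero _
        map_add' := fun _ _ ↦ funext fun _ ↦ map_add _ _ _ }
     naturality := fun U V i ↦ by
      ext s
      exact funext fun h ↦ D.res i.unop h.down (i.unop.le h.down) s }⟩

instance : Mono D.toGeneric := by
  apply (sheafToPresheaf _ _).mono_of_mono_map
  refine @NatTrans.mono_of_mono_app _ _ _ _ _ _ _ fun V ↦ ?_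
  rw [AddCommGrpCat.mono_iff_injective]
  intro s t hst
  by_cases h : η ∈ V.unop
  · exact D.injective V.unop h (congrFun (show (_ : PLift (η ∈ V.unop) → M) = _ from hst) ⟨h⟩)
  · refine TopCat.Sheaf.eq_of_locally_eq' (F := F) (fun i : PEmpty.{u + 1} ↦ i.elim) V.unop (fun i ↦ i.elim)
      (fun x hx ↦ absurd (D.generic _ x hx) h) s t fun i ↦ i.elim

/-- The resolution of `F` by the generic sheaf. -/
noncomputable def resolution : ShortComplex (AbSheaf X) :=
  ShortComplex.mk D.toGeneric (Limits.cokernel.π D.toGeneric) (Limits.cokernel.condition _)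

theorem shortExact_resolution : D.resolution.ShortExact :=
  { exact := ShortComplex.exact_cokernel _
    mono_f := inferInstanceAs (Mono D.toGeneric)
    epi_g := Limits.coequalizer.π_epi }

/-- The sheaf of principal parts: elements of `M` modulo sections of `F`. -/
noncomputable abbrev principal : AbSheaf X := D.resolution.X₃

/-- The section of the sheaf of principal parts given by an element of `M`. -/
noncomputable def part (V : Opens X) : M →+ D.principal.obj.obj (op V) :=
  (D.resolution.g.hom.app (op V)).hom.comp
    { toFun := fun φ ↦ (show (genericSheaf η M).obj.obj (op V) from fun _ : PLift (η ∈ V) ↦ φ)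
      map_zero' := rfl
      map_add' := fun _ _ ↦ rfl }

theorem res_part {U V : Opens X} (i : U ⟶ V) (φ : M) :
    D.principal.obj.map i.op (D.part V φ) = D.part U φ :=
  (NatTrans.naturality_apply D.resolution.g.hom i.op _).symm

theorem part_eq_zero_iff {V : Opens X} (hV : η ∈ V) {φ : M} : D.part V φ = 0 ↔ φ ∈ T V := by
  rw [← D.range V hV]
  constructor
  · intro h
    obtain ⟨s, hs⟩ := TopCat.Sheaf.sections_exact_of_left_exact D.shortExact_resolution.exact
      D.shortExact_resolution.mono_f _ h
    exact ⟨s, congrFun (show (_ : PLift (η ∈ V) → M) = _ from hs) ⟨hV⟩⟩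
  · rintro ⟨s, rfl⟩
    have h1 : D.resolution.f.hom.app (op V) ≫ D.resolution.g.hom.app (op V) = 0 := by
      rw [← NatTrans.comp_app, ← ObjectProperty.FullSubcategory.comp_hom, D.resolution.zero]
      rfl
    exact congrArg (fun f ↦ f.hom s) h1

theorem exists_part {V : Opens X} (q : D.principal.obj.obj (op V)) {x : X} (hx : x ∈ V) :
    ∃ (U : Opens X) (i : U ⟶ V) (φ : M), x ∈ U ∧ D.part U φ = D.principal.obj.map i.op q := by
  obtain ⟨U, hU, ⟨s, hs⟩, hxU⟩ := (TopCat.Presheaf.isLocallySurjective_iff D.resolution.g.hom).1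
    ((TopCat.Sheaf.isLocallySurjective_iff_epi D.resolution.g).2 D.shortExact_resolution.epi_g) V q x hx
  refine ⟨U, homOfLE hU, (show PLift (η ∈ U) → M from s) ⟨D.generic _ x hxU⟩, hxU, ?_⟩
  exact hs

theorem part_eq_iff {V : Opens X} (hV : η ∈ V) {φ ψ : M} :
    D.part V φ = D.part V ψ ↔ φ - ψ ∈ T V := by
  rw [← sub_eq_zero, ← map_sub, D.part_eq_zero_iff hV]

theorem map_map {U V N : Opens X} (i : U ⟶ V) (j : V ⟶ N) (q : D.principal.obj.obj (op N)) :
    D.principal.obj.map i.op (D.principal.obj.map j.op q) = D.principal.obj.map (i ≫ j).op q := by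
  rw [op_comp, Functor.map_comp_apply]

/-- The restriction of a global section of the sheaf of principal parts. -/
noncomputable abbrev resTop (V : Opens X) : D.principal.obj.obj (op ⊤) →+ D.principal.obj.obj (op V) :=
  (D.principal.obj.map (homOfLE le_top : V ⟶ ⊤).op).hom

theorem res_resTop {U V : Opens X} (i : U ⟶ V) (q : D.principal.obj.obj (op ⊤)) :
    D.principal.obj.map i.op (D.resTop V q) = D.resTop U q := D.map_map _ _ q

/-- Equality of sections of the sheaf of principal parts is local. -/
theorem part_eq_of_locally {V : Opens X} (q : D.principal.obj.obj (op ⊤)) (φ : M)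
    (h : ∀ x ∈ V, ∃ N : Opens X, x ∈ N ∧ D.part N φ = D.resTop N q) :
    D.part V φ = D.resTop V q := by
  choose N hN hφ using fun x : V ↦ h x.1 x.2
  refine TopCat.Sheaf.eq_of_locally_eq' (F := D.principal) (fun x : V ↦ N x ⊓ V) V
    (fun x ↦ homOfLE inf_le_right) (fun x hx ↦ Opens.mem_iSup.2 ⟨⟨x, hx⟩, hN ⟨x, hx⟩, hx⟩) _ _ fun x ↦ ?_
  have := congrArg (D.principal.obj.map (homOfLE inf_le_left : N x ⊓ V ⟶ N x).op) (hφ x)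
  rw [D.res_part] at this
  rw [D.res_part, this, D.res_resTop, D.res_resTop]

-- The space is the union of `U` and a point `p`. By `h1`, `F` has no first Čech cohomology on `U`. By `h2` and
-- `h3`, the sections near `p` are the sections on a punctured neighbourhood of `p` that lie in `P`. By `h4`,
-- each element of `M` is, modulo `P`, a section on a fixed punctured neighbourhood of `p`.
variable {U : Opens X} (hU : η ∈ U) {p : X} (hcover : ∀ x, x ∈ U ∨ x = p) {P : Submodule k M}
  (h1 : ∀ (N : U → Opens X) (φ : U → M), (∀ x, x.1 ∈ N x) → (∀ x, N x ≤ U) →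
    (∀ x y, φ x - φ y ∈ T (N x ⊓ N y)) → ∃ φ₀, ∀ x, φ₀ - φ x ∈ T (N x))
  (h2 : ∀ V, p ∈ V → T V ≤ P)
  (h3 : ∀ V, p ∈ V → ∀ φ ∈ P, φ ∈ T (V ⊓ U) → ∃ V', p ∈ V' ∧ φ ∈ T V')
  (h4 : ∃ V, p ∈ V ∧ ∀ φ, ∃ a ∈ P, φ - a ∈ T (U ⊓ V))

include h1 in
/-- On `U`, a section of the sheaf of principal parts lifts to an element of `M`. -/
theorem exists_part_eq (q : D.principal.obj.obj (op ⊤)) : ∃ φ, D.part U φ = D.resTop U q := by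
  choose N i φ hN hφ using fun x : U ↦ D.exists_part q (x := x.1) trivial
  have key (x : U) (N' : Opens X) (h : N' ≤ N x) : D.part N' (φ x) = D.resTop N' q := by
    rw [← D.res_part (homOfLE h), hφ x]
    exact D.map_map _ _ q
  obtain ⟨φ₀, h₀⟩ := h1 (fun x ↦ N x ⊓ U) φ (fun x ↦ ⟨hN x, x.2⟩) (fun x ↦ inf_le_right) fun x y ↦ by
    have hη := D.generic (N x ⊓ U) x.1 ⟨hN x, x.2⟩
    have hη' := D.generic (N y ⊓ U) y.1 ⟨hN y, y.2⟩
    rw [← D.part_eq_iff (show η ∈ N x ⊓ U ⊓ (N y ⊓ U) from ⟨hη, hη'⟩), key x _ (inf_le_left.trans inf_le_left),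
      key y _ (inf_le_right.trans inf_le_left)]
  refine ⟨φ₀, D.part_eq_of_locally q φ₀ fun x hx ↦ ⟨N ⟨x, hx⟩ ⊓ U, ⟨hN ⟨x, hx⟩, hx⟩, ?_⟩⟩
  rw [← key ⟨x, hx⟩ _ inf_le_left]
  exact (D.part_eq_iff (D.generic (N ⟨x, hx⟩ ⊓ U) x ⟨hN ⟨x, hx⟩, hx⟩)).2 (h₀ ⟨x, hx⟩)

variable (U p) in
/-- The element `s` is the difference between a lift of `q` on `U` and a lift of `q` near `p`. -/
def IsDifference (q : D.principal.obj.obj (op ⊤)) (s : M) : Prop :=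
  ∃ (N : Opens X) (_ : p ∈ N) (φ ψ : M), D.part U φ = D.resTop U q ∧ D.part N ψ = D.resTop N q ∧ s = φ - ψ

theorem IsDifference.add {q q' : D.principal.obj.obj (op ⊤)} {s s' : M} (h : D.IsDifference U p q s)
    (h' : D.IsDifference U p q' s') : D.IsDifference U p (q + q') (s + s') := by
  obtain ⟨N, hN, φ, ψ, e1, e2, rfl⟩ := h
  obtain ⟨N', hN', φ', ψ', e1', e2', rfl⟩ := h'
  refine ⟨N ⊓ N', ⟨hN, hN'⟩, φ + φ', ψ + ψ', ?_, ?_, by abel⟩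
  · rw [map_add, map_add, e1, e1']
  · rw [map_add, map_add, ← D.res_part (homOfLE inf_le_left : N ⊓ N' ⟶ N), e2,
      ← D.res_part (homOfLE inf_le_right : N ⊓ N' ⟶ N'), e2',
      D.res_resTop, D.res_resTop]

include h1 in
theorem exists_isDifference (q : D.principal.obj.obj (op ⊤)) : ∃ s, D.IsDifference U p q s := by
  obtain ⟨φ, hφ⟩ := D.exists_part_eq h1 q
  obtain ⟨N, i, ψ, hN, hψ⟩ := D.exists_part q (x := p) trivial
  exact ⟨_, N, hN, φ, ψ, hφ, hψ, rfl⟩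

include hU hcover h2 h3 in
/-- A section of the sheaf of principal parts is globally the class of an element of `M` if and only if
its differences vanish modulo sections on `U` and regular elements at `p`. -/
theorem IsDifference.mem_iff {q : D.principal.obj.obj (op ⊤)} {s : M} (h : D.IsDifference U p q s) :
    s ∈ T U ⊔ P ↔ ∃ φ, D.part ⊤ φ = q := by
  obtain ⟨N, hN, φ, ψ, e1, e2, rfl⟩ := h
  constructor
  · intro h
    obtain ⟨w, hw, a, ha, e⟩ := Submodule.mem_sup.1 h
    have e3 : D.part U (φ - w) = D.resTop U q := by
      rw [map_sub, (D.part_eq_zero_iff hU).2 hw, sub_zero, e1]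
    have e4 : a ∈ T (N ⊓ U) := by
      have e5 : a = φ - w - ψ := by rw [sub_right_comm, ← e, add_sub_cancel_left]
      rw [e5, ← D.part_eq_iff (show η ∈ N ⊓ U from ⟨D.generic N p hN, hU⟩),
        ← D.res_part (homOfLE inf_le_right : N ⊓ U ⟶ U), e3,
        ← D.res_part (homOfLE inf_le_left : N ⊓ U ⟶ N), e2, D.res_resTop, D.res_resTop]
    obtain ⟨N', hN', ha'⟩ := h3 N hN a ha e4
    refine ⟨φ - w, (D.part_eq_of_locally (V := ⊤) q (φ - w) fun x _ ↦ ?_).trans ?_⟩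
    · rcases hcover x with hx | rfl
      · exact ⟨U, hx, e3⟩
      · refine ⟨N ⊓ N', ⟨hN, hN'⟩, ?_⟩
        have e5 : φ - w = ψ + a := by
          rw [← sub_eq_iff_eq_add', sub_right_comm, ← e, add_sub_cancel_left]
        rw [e5, map_add, ← D.res_part (homOfLE inf_le_left : N ⊓ N' ⟶ N), e2,
          ← D.res_part (homOfLE inf_le_right : N ⊓ N' ⟶ N') a,
          (D.part_eq_zero_iff (D.generic N' x hN')).2 ha', map_zero, add_zero, D.res_resTop]
    · exact congrArg (fun f ↦ f.hom q) (D.principal.obj.map_id (op ⊤))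
  · rintro ⟨θ, rfl⟩
    rw [D.res_part, D.part_eq_iff hU] at e1
    rw [D.res_part, D.part_eq_iff (D.generic N p hN)] at e2
    have : φ - ψ = (φ - θ) - (ψ - θ) := by abel
    rw [this]
    exact sub_mem (Submodule.mem_sup_left e1) (Submodule.mem_sup_right (h2 N hN e2))

include hcover h4 in
/-- Modulo `P`, every element of `M` is a difference: it is a section on `U ∩ V` for a neighbourhood `V` of
`p`, so that its class on `U` and the zero class on `V` can be glued. -/
theorem exists_isDifference_of_mem (s : M) :
    ∃ (q : D.principal.obj.obj (op ⊤)) (a : M), a ∈ P ∧ D.IsDifference U p q (s - a) := by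
  obtain ⟨V, hV, h⟩ := h4
  obtain ⟨a, ha, hs⟩ := h s
  have hη := D.generic V p hV
  let N : Bool → Opens X := fun b ↦ if b then U else V
  let f : Bool → M := fun b ↦ if b then s - a else 0
  obtain ⟨q, hq, -⟩ := TopCat.Sheaf.existsUnique_gluing' (F := D.principal) N ⊤ (fun b ↦ homOfLE le_top)
    (fun x _ ↦ Opens.mem_iSup.2 <| (hcover x).elim (fun h ↦ ⟨true, h⟩) fun h ↦ ⟨false, h ▸ hV⟩)
    (fun b ↦ D.part (N b) (f b)) fun b c ↦ by
      rw [D.res_part, D.res_part]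
      by_cases hη : η ∈ N b ⊓ N c
      · rw [D.part_eq_iff hη]
        cases b <;> cases c
        · exact (sub_self (0 : M)).symm ▸ zero_mem _
        · change 0 - (s - a) ∈ T (V ⊓ U)
          rw [zero_sub, inf_comm]
          exact neg_mem hs
        · change s - a - 0 ∈ T (U ⊓ V)
          rwa [sub_zero]
        · exact (sub_self (s - a)).symm ▸ zero_mem _
      · refine TopCat.Sheaf.eq_of_locally_eq' (F := D.principal) (fun i : PEmpty.{u + 1} ↦ i.elim) _
          (fun i ↦ i.elim) (fun x hx ↦ absurd (D.generic _ x hx) hη) _ _ fun i ↦ i.elim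
  exact ⟨q, a, ha, V, hV, s - a, 0, (hq true).symm, (hq false).symm, (sub_zero _).symm⟩

include hU hcover h1 h2 h3 h4 in
/-- The first cohomology of a sheaf of subspaces of `M` on `U ∪ {p}` is the quotient of `M` by the sections on
`U` and the regular elements `P` at `p`. By the flasque resolution it is the group of global sections of the
sheaf of principal parts modulo those that lift to `M`; such a section is sent to the difference of its lift on
`U` and its lift near `p`. Endomorphisms that act on values as a scalar `c` act on the quotient as `c`. -/
theorem exists_H_one_equiv : ∃ E : F.H 1 ≃+ M ⧸ (T U ⊔ P), ∀ (c : k) (γ : F ⟶ F),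
    (∀ (V : Opens X) (hV : η ∈ V) (s : F.obj.obj (op V)),
      D.val V hV (γ.hom.app (op V) s) = c • D.val V hV s) →
    ∀ y, E (Sheaf.H.map γ 1 y) = c • E y := by
  choose d hd using D.exists_isDifference (p := p) h1
  -- the difference is well defined up to sections on `U` and elements of `P`
  have huniq {q : D.principal.obj.obj (op ⊤)} {s s' : M} (h : D.IsDifference U p q s)
      (h' : D.IsDifference U p q s') : (T U ⊔ P).mkQ s = (T U ⊔ P).mkQ s' := by
    have h0 : D.IsDifference U p (0 : D.principal.obj.obj (op ⊤)) (s - s') := by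
      have hneg : D.IsDifference U p (-q) (-s') := by
        obtain ⟨N, hN, φ, ψ, e1, e2, rfl⟩ := h'
        exact ⟨N, hN, -φ, -ψ, by rw [map_neg, map_neg, e1], by rw [map_neg, map_neg, e2], by abel⟩
      rw [sub_eq_add_neg, ← add_neg_cancel q]
      exact h.add D hneg
    rw [Submodule.mkQ_apply, Submodule.mkQ_apply, Submodule.Quotient.eq]
    exact (h0.mem_iff D hU hcover h2 h3).2 ⟨0, map_zero _⟩
  let Φ : D.principal.obj.obj (op ⊤) →+ M ⧸ (T U ⊔ P) :=
    AddMonoidHom.mk' (fun q ↦ (T U ⊔ P).mkQ (d q)) fun q q' ↦ by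
      rw [← map_add]
      exact huniq (hd _) ((hd q).add D (hd q'))
  have hΦ (q) (s) (h : D.IsDifference U p q s) : Φ q = (T U ⊔ P).mkQ s := huniq (hd q) h
  have hΦsurj : Function.Surjective Φ := fun y ↦ by
    obtain ⟨s, rfl⟩ := (T U ⊔ P).mkQ_surjective y
    obtain ⟨q, a, ha, hq⟩ := D.exists_isDifference_of_mem hcover h4 s
    refine ⟨q, (hΦ q _ hq).trans ?_⟩
    rw [Submodule.mkQ_apply, Submodule.mkQ_apply, Submodule.Quotient.eq, sub_sub_cancel_left]
    exact neg_mem (Submodule.mem_sup_right ha)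
  have hker (q) : Φ q = 0 ↔ connecting D.shortExact_resolution q = 0 := by
    rw [connecting_eq_zero_iff]
    change (T U ⊔ P).mkQ (d q) = 0 ↔ _
    rw [Submodule.mkQ_apply, Submodule.Quotient.mk_eq_zero, (hd q).mem_iff D hU hcover h2 h3]
    exact ⟨fun ⟨φ, h⟩ ↦ ⟨_, h⟩, fun ⟨s, h⟩ ↦
      ⟨(show PLift (η ∈ (⊤ : Opens X)) → M from s) ⟨trivial⟩, h⟩⟩
  have : Subsingleton (D.resolution.X₂.H 1) := subsingleton_H_one_of_flasque (genericSheaf η M)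
  let δ := connecting D.shortExact_resolution
  have hδ : Function.Surjective δ := connecting_surjective D.shortExact_resolution
  let E' : (D.principal.obj.obj (op ⊤) ⧸ δ.ker) ≃+ M ⧸ (T U ⊔ P) :=
    (QuotientAddGroup.quotientAddEquivOfEq (by
        ext q
        exact (hker q).symm)).trans
      (QuotientAddGroup.quotientKerEquivOfSurjective Φ hΦsurj)
  let E : F.H 1 ≃+ M ⧸ (T U ⊔ P) :=
    (QuotientAddGroup.quotientKerEquivOfSurjective δ hδ).symm.trans E'
  have hE (q) : E (δ q) = Φ q := by
    have : (QuotientAddGroup.quotientKerEquivOfSurjective δ hδ).symm (δ q) = (q : _ ⧸ δ.ker) := by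
      rw [AddEquiv.symm_apply_eq]
      rfl
    exact congrArg E' this
  refine ⟨E, fun c γ hγ y ↦ ?_⟩
  obtain ⟨q, rfl⟩ := hδ y
  -- multiplication by `c` on `M` extends `γ` to an endomorphism of the resolution
  let m : M →+ M := DistribSMul.toAddMonoidHom M c
  have hcomm : D.toGeneric ≫ genericSheafMap η m = γ ≫ D.toGeneric := by
    ext V s
    exact funext fun h ↦ (hγ V.unop h.down s).symm
  let τ : D.resolution ⟶ D.resolution :=
    { τ₁ := γ
      τ₂ := genericSheafMap η m
      τ₃ := Limits.cokernel.map _ _ γ (genericSheafMap η m) hcomm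
      comm₁₂ := hcomm.symm
      comm₂₃ := (Limits.cokernel.π_desc _ _ _).symm }
  have hτ (V : Opens X) (φ : M) : τ.τ₃.hom.app (op V) (D.part V φ) = D.part V (c • φ) := by
    have := congrArg (fun f ↦ f.hom.app (op V)) τ.comm₂₃
    exact (congrArg (fun f ↦ f.hom
      (show (genericSheaf η M).obj.obj (op V) from fun _ : PLift (η ∈ V) ↦ φ)) this).symm
  have hnat := connecting_naturality D.shortExact_resolution τ q
  change δ _ = Sheaf.H.map γ 1 (δ q) at hnat
  rw [← hnat, hE, hE]
  obtain ⟨N, hN, φ, ψ, e1, e2, e3⟩ := hd q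
  have hτr (V : Opens X) : D.resTop V (τ.τ₃.hom.app (op ⊤) q) = τ.τ₃.hom.app (op V) (D.resTop V q) :=
    (NatTrans.naturality_apply τ.τ₃.hom _ q).symm
  rw [hΦ _ (c • d q) ⟨N, hN, c • φ, c • ψ, by rw [hτr, ← e1, hτ], by rw [hτr, ← e2, hτ],
    by rw [e3, smul_sub]⟩, map_smul]
  rfl

end SubspaceModel

end Subsheaf

/-! ### Cohomology in terms of the index -/

section Scalars
open TopologicalSpace Opposite
variable {k S : Type u} [CommRing k] [CommRing S] [Algebra k S] (𝒮 : ℕ → Submodule k S)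
  [GradedAlgebra 𝒮]

theorem ι_toSpecZero : (Proj.basicOpen 𝒮 1).ι ≫ Proj.toSpecZero 𝒮 = Proj.basicOpenToSpec 𝒮 1 ≫
    Spec.map (CommRingCat.ofHom (HomogeneousLocalization.fromZeroRingHom 𝒮 _)) := by
  have h (U) (e : U = ⊤) : (Proj.basicOpen 𝒮 1).ι ≫ (Scheme.topIso _).inv ≫ (Scheme.isoOfEq _ e).inv =
      Scheme.homOfLE _ (le_top.trans_eq e.symm) := by
    simp only [← Category.assoc, Iso.comp_inv_eq]
    simp only [Scheme.topIso_hom, Category.assoc, Scheme.isoOfEq_hom_ι, Scheme.homOfLE_ι]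
  rw [Proj.toSpecZero, reassoc_of% h]
  simp

/-- The structure morphism of `Proj 𝒮` over `k` is glued on `D₊(1)`, which is everything; on functions over it,
a scalar is the corresponding fraction of degree zero. -/
theorem scalars_basicOpen_one (c : k) : scalars (projToSpec 𝒮) (Proj.basicOpen 𝒮 1) c =
    Proj.awayToSection 𝒮 1 (HomogeneousLocalization.fromZeroRingHom 𝒮 _ (algebraMap k (𝒮 0) c)) := by
  have h1 := congrArg Scheme.Hom.appTop (show (Proj.basicOpen 𝒮 1).ι ≫ projToSpec 𝒮 = _ by
    rw [projToSpec, reassoc_of% ι_toSpecZero 𝒮, ← Spec.map_comp])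
  rw [Scheme.Hom.comp_appTop, Scheme.Hom.comp_appTop] at h1
  have h2 := Proj.basicOpenToSpec_app_top 𝒮 1
  have h3 : (Scheme.ΓSpecIso (.of k)).inv ≫ (projToSpec 𝒮).appTop ≫ (Proj.basicOpen 𝒮 1).ι.appTop =
      CommRingCat.ofHom (algebraMap k (𝒮 0)) ≫
        CommRingCat.ofHom (HomogeneousLocalization.fromZeroRingHom 𝒮 _) ≫
        Proj.awayToSection 𝒮 1 ≫ (Proj.basicOpen 𝒮 1).topIso.inv := by
    rw [h1]
    have h4 := (Scheme.ΓSpecIso_inv_naturality_assoc (CommRingCat.ofHom (algebraMap k (𝒮 0)) ≫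
      CommRingCat.ofHom (HomogeneousLocalization.fromZeroRingHom 𝒮 _))
      ((Proj.basicOpenToSpec 𝒮 1).appTop)).symm
    refine h4.trans ?_
    rw [show (Proj.basicOpenToSpec 𝒮 1).appTop = _ from h2, Category.assoc, Iso.inv_hom_id_assoc]
  have h5 : (Proj.basicOpen 𝒮 1).ι.appTop = (Proj 𝒮).presheaf.map (homOfLE le_top :
      Proj.basicOpen 𝒮 1 ⟶ ⊤).op ≫ (Proj.basicOpen 𝒮 1).topIso.inv := by
    rw [Iso.eq_comp_inv]
    simp only [Scheme.Opens.topIso, Scheme.Opens.ι_appTop]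
    exact ((Proj 𝒮).presheaf.map_comp _ _).symm
  rw [h5] at h3
  simp only [← Category.assoc] at h3
  rw [cancel_mono] at h3
  exact congrArg (fun f ↦ f.hom c) h3

theorem evalAt_scalars {V : (Proj 𝒮).Opens} (x : V) (c : k) :
    evalAt 𝒮 x (scalars (projToSpec 𝒮) V c) = algebraMap S _ (algebraMap k S c) := by
  have h1 : V ≤ Proj.basicOpen 𝒮 1 := by simp
  rw [← map_scalars (projToSpec 𝒮) (homOfLE h1), scalars_basicOpen_one]
  refine (ProjectiveSpectrum.Proj.awayToSection_apply (𝒜 := 𝒮) 1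
    (HomogeneousLocalization.fromZeroRingHom 𝒮 _ (algebraMap k (𝒮 0) c)) ⟨x.1, h1 x.2⟩).trans ?_
  have h2 : (HomogeneousLocalization.fromZeroRingHom 𝒮 (Submonoid.powers 1)
      (algebraMap k (𝒮 0) c)).val = algebraMap S _ (algebraMap k S c) := rfl
  rw [h2]
  exact IsLocalization.map_eq _ _

end Scalars

section Model
open TopologicalSpace Opposite HahnSeries
variable {k A : Type u} [Field k] [NonUnitalNonAssocRing A] [Module k A]
  {O : Subalgebra k (HahnSeries ℤ k)} {W : Submodule k (HahnSeries ℤ A)}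

theorem hasFunctionValue_scalars (V : (latticeCurve O).Opens) (c : k) :
    HasFunctionValue (scalars (latticeCurveHom O) V c) (C c) := fun x ↦ by
  rw [evalAt_scalars]
  have hc : (C c : HahnSeries ℤ k) ∈ O := O.algebraMap_mem c
  have hc0 : (C c : HahnSeries ℤ k) ∈ poleLE k k (0 : ℕ) := (integralSubalgebra k).algebraMap_mem c
  have h := isFunctionValueAt_mk (isDenom_one x.1) hc hc0
  rw [inv_one, one_mul] at h
  convert h using 1
  rw [← Localization.mk_one_eq_algebraMap]
  have e : grMonomial O 0 1 O.one_mem (one_mem_poleLE le_rfl) = 1 :=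
    Subtype.ext (Polynomial.monomial_zero_one (R := HahnSeries ℤ k))
  exact congrArg₂ Localization.mk rfl (Subtype.ext e.symm)

theorem functionValue_scalars {V : (latticeCurve O).Opens} (hV : genericPt O ∈ V) (c : k) :
    functionValue hV (scalars (latticeCurveHom O) V c) = C c :=
  (functionValue_eq_iff hV).2 (hasFunctionValue_scalars V c)

/-- The sheaf of modules `F` is identified with the sheaf of the series that are regular with respect to
`W`. -/
structure LatticeModel (F : (latticeCurve O).Modules) (hOW : Stabilizes O W) where
  /-- The series given by a section over a nonempty open subset. -/
  val (V : (latticeCurve O).Opens) (hV : genericPt O ∈ V) : Γ(F, V) →+ HahnSeries ℤ A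
  injective (V : (latticeCurve O).Opens) (hV : genericPt O ∈ V) : Function.Injective (val V hV)
  res {U V : (latticeCurve O).Opens} (i : U ⟶ V) (hU : genericPt O ∈ U) (hV : genericPt O ∈ V)
    (s : Γ(F, V)) : val U hU (F.presheaf.map i.op s) = val V hV s
  range (V : (latticeCurve O).Opens) (hV : genericPt O ∈ V) (φ : HahnSeries ℤ A) :
    (∃ s, val V hV s = φ) ↔ φ ∈ regularOn hOW V
  smul (V : (latticeCurve O).Opens) (hV : genericPt O ∈ V) (r : Γ(latticeCurve O, V)) (s : Γ(F, V)) :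
    val V hV (r • s) = act (functionValue hV r) (val V hV s)

/-- The sheaf attached to `gr(W)` as a sheaf of series. -/
noncomputable def latticeModel [SMulCommClass k A A] [IsScalarTower k A A] (hOW : Stabilizes O W)
    (hW : IsLattice W) : LatticeModel (latticeSheaf hOW hW).toModules hOW where
  val _ hV := sectionValue hOW hV
  injective _ hV := sectionValue_injective hV
  res i hU hV s := sectionValue_res i hU hV s
  range _ hV _ := exists_sectionValue_eq_iff hV
  smul _ hV r s := sectionValue_smul hV r s

variable (O) in
/-- The structure sheaf as a sheaf of series. -/
noncomputable def structureModel :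
    LatticeModel (structureModule (latticeCurve O)) (stabilizes_toSubmodule O) where
  val _ hV := (functionValue hV).toAddMonoidHom
  injective _ hV := functionValue_injective hV
  res i hU hV s := functionValue_res i hU hV s
  range _ hV _ := exists_functionValue_eq_iff hV
  smul _ hV r s := map_mul (functionValue hV) r s

namespace LatticeModel
variable {F : (latticeCurve O).Modules} {hOW : Stabilizes O W} (D : LatticeModel F hOW)

/-- The underlying sheaf of vector spaces. -/
noncomputable def toSubspaceModel : SubspaceModel (abSheaf F) (genericPt O) (regularOn hOW) where
  val := D.val
  injective := D.injective
  res := D.res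
  range := D.range
  generic _ _ hx := genericPt_mem hx

theorem val_scalar {V : (latticeCurve O).Opens} (hV : genericPt O ∈ V) (c : k) (s : Γ(F, V)) :
    D.val V hV (scalars (latticeCurveHom O) V c • s) = c • D.val V hV s := by
  rw [D.smul, functionValue_scalars, act_C]

include D in
/-- The global sections are the power series in `W`. -/
theorem exists_H_zero_equiv (hO : IsLattice (Subalgebra.toSubmodule O)) :
    Nonempty (Cohomology (latticeCurveHom O) F 0 ≃ₗ[k] ↥(integralPart k A ⊓ W)) := by
  have hη : genericPt O ∈ (⊤ : (latticeCurve O).Opens) := trivial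
  let e : Cohomology (latticeCurveHom O) F 0 ≃+ Γ(F, ⊤) :=
    Sheaf.H.equiv₀ (abSheaf F) Limits.isTerminalTop
  have hmem (s : Γ(F, ⊤)) : D.val ⊤ hη s ∈ integralPart k A ⊓ W := by
    rw [← regularOn_top hO hOW]
    exact (D.range ⊤ hη _).1 ⟨s, rfl⟩
  have hsmul (c : k) (y : Cohomology (latticeCurveHom O) F 0) :
      e (c • y) = scalars (latticeCurveHom O) ⊤ c • e y :=
    (Sheaf.H.equiv₀_naturality (hT := Limits.isTerminalTop) (scalarEnd (latticeCurveHom O) F c) y).symm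
  let f : Cohomology (latticeCurveHom O) F 0 →ₗ[k] ↥(integralPart k A ⊓ W) :=
    { toFun := fun y ↦ ⟨D.val ⊤ hη (e y), hmem _⟩
      map_add' := fun y z ↦
        Subtype.ext ((congrArg (D.val ⊤ hη) (map_add e y z)).trans (map_add (D.val ⊤ hη) _ _))
      map_smul' := fun c y ↦
        Subtype.ext ((congrArg (D.val ⊤ hη) (hsmul c y)).trans (D.val_scalar hη c (e y))) }
  refine ⟨LinearEquiv.ofBijective f ⟨fun y z h ↦ ?_, fun w ↦ ?_⟩⟩
  · exact e.injective (D.injective ⊤ hη (congrArg Subtype.val h))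
  · obtain ⟨s, hs⟩ := (D.range ⊤ hη w.1).2 (by rw [regularOn_top hO hOW]; exact w.2)
    refine ⟨e.symm s, Subtype.ext ?_⟩
    change D.val ⊤ hη (e (e.symm s)) = _
    rw [AddEquiv.apply_symm_apply, hs]

end LatticeModel

end Model

section Cech
open TopologicalSpace Opposite HahnSeries
variable {k A : Type u} [Field k] [NonUnitalNonAssocRing A] [Module k A]
  {O : Subalgebra k (HahnSeries ℤ k)} {W : Submodule k (HahnSeries ℤ A)} (hOW : Stabilizes O W)

/-- A factor of an element that does not vanish at `x` does not vanish at `x`. -/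
theorem IsDenom.of_mul {x : latticeCurve O} {m n : ℕ} {α β : HahnSeries ℤ k} (hα : α ∈ O)
    (hm : α ∈ poleLE k k m) (h : IsDenom x (m + n) (α * β)) (hβ : β ∈ O) (hn : β ∈ poleLE k k n) :
    IsDenom x n β := by
  refine ⟨hβ, hn, fun h' ↦ h.2.2 ?_⟩
  rw [← grMonomial_mul m n α β hα hm hβ hn]
  exact Ideal.mul_mem_left _ _ h'

theorem mem_affinePart {x : latticeCurve O} : x ∈ affinePart O ↔ IsDenom x 1 1 := mem_basicOpenOf

/-- The sections over the affine open subset `D₊(t) ∩ D₊(tⁿ f)`. -/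
theorem mem_regularOn_inf_affinePart {n : ℕ} {f : HahnSeries ℤ k} (hf : f ∈ O)
    (hn : f ∈ poleLE k k n) {φ : HahnSeries ℤ A} :
    φ ∈ regularOn hOW (basicOpenOf n f hf hn ⊓ affinePart O) ↔ ∃ m : ℕ, act (f ^ m) φ ∈ W := by
  constructor
  · intro h
    have hn' : f ∈ poleLE k k (n + 1 : ℕ) := poleLE_mono (by omega) hn
    have hle : basicOpenOf (n + 1) f hf hn' ≤ basicOpenOf n f hf hn ⊓ affinePart O := fun x hx ↦ by
      rw [mem_basicOpenOf] at hx
      refine ⟨mem_basicOpenOf.2 ?_, mem_affinePart.2 ?_⟩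
      · refine IsDenom.of_mul (m := 1) O.one_mem (one_mem_poleLE (Int.natCast_nonneg 1)) ?_ hf hn
        rwa [one_mul, add_comm]
      · refine IsDenom.of_mul hf hn ?_ O.one_mem (one_mem_poleLE (Int.natCast_nonneg 1))
        rwa [mul_one]
    obtain ⟨m, hm, -⟩ := (mem_regularOn_basicOpenOf hOW (by omega) hf hn').1 (regularOn_anti hOW hle h)
    exact ⟨m, hm⟩
  · rintro ⟨m, hm⟩ x ⟨hx1, hx2⟩
    obtain ⟨e, he⟩ := exists_mem_poleLE (k := k) (act (f ^ m) φ)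
    have h1 := ((mem_basicOpenOf.1 hx1).pow m).mul ((mem_affinePart.1 hx2).pow e)
    rw [one_pow, mul_one, one_mul] at h1
    exact ⟨_, _, h1, hm, poleLE_mono (by push_cast; nlinarith) he⟩

/-- Setting `t = 1` in an element of `gr(O)`. -/
noncomputable def grEval : GrRing O →+* O :=
  ((Polynomial.evalRingHom 1).comp (grVal O).toRingHom).codRestrict O fun a ↦ by
    change Polynomial.eval 1 (grVal O a) ∈ O
    rw [Polynomial.eval_eq_sum_range]
    exact sum_mem fun n _ ↦ by
      rw [one_pow, mul_one]
      exact (a.coeff_mem n).1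

theorem grEval_grMonomial {n : ℕ} {f : HahnSeries ℤ k} (hf : f ∈ O) (hn : f ∈ poleLE k k n) :
    grEval (grMonomial O n f hf hn) = ⟨f, hf⟩ := by
  refine Subtype.ext ?_
  change Polynomial.eval 1 (Polynomial.monomial n f) = f
  rw [Polynomial.eval_monomial, one_pow, mul_one]

/-- The affine open subset `D₊(t)` has no first Čech cohomology with values in the sheaf attached to
`gr(W)`: a partition of unity by powers of the functions that define a finite basic cover glues the local
data. -/
theorem exists_glue_affinePart (N : affinePart O → (latticeCurve O).Opens)
    (φ : affinePart O → HahnSeries ℤ A) (hN : ∀ x, x.1 ∈ N x) (hNU : ∀ x, N x ≤ affinePart O)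
    (hφ : ∀ x y, φ x - φ y ∈ regularOn hOW (N x ⊓ N y)) :
    ∃ φ₀, ∀ x, φ₀ - φ x ∈ regularOn hOW (N x) := by
  classical
  choose n f hf hn hx hle using fun x ↦ exists_basicOpenOf_le (hN x)
  let g (x : affinePart O) : GrRing O := grMonomial O (n x) (f x) (hf x) (hn x)
  -- the functions `g x` have no common zero in `D₊(t)`
  have ht : grT O ∈ (Ideal.span (Set.range g)).radical := by
    have hhom : (Ideal.span (Set.range g)).IsHomogeneous (grPiece O) := by
      refine Ideal.homogeneous_span _ _ ?_
      rintro _ ⟨x, rfl⟩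
      exact ⟨n x, grMonomial_mem O _ _ _ _⟩
    rw [hhom.radical_eq, Ideal.mem_sInf]
    rintro J ⟨hJ1, hJ2, hJ3⟩
    by_contra hJ
    let y : latticeCurve O := ⟨⟨J, hJ1⟩, hJ3, fun hirr ↦ hJ (hirr
        (mem_irrelevant_of_pos one_pos (grMonomial_mem O _ _ _ _)))⟩
    have hy : y ∈ affinePart O := mem_affinePart.2 ⟨_, _, hJ⟩
    exact hx ⟨y, hy⟩ (hJ2 (Ideal.subset_span ⟨⟨y, hy⟩, rfl⟩))
  obtain ⟨L, hL⟩ := ht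
  obtain ⟨c, hc⟩ := Finsupp.mem_span_range_iff_exists_finsupp.1 hL
  have hcov (w : latticeCurve O) (hw : w ∈ affinePart O) : ∃ x ∈ c.support, IsDenom w (n x) (f x) := by
    by_contra! h
    refine (mem_affinePart.1 hw).2.2 (w.isPrime.mem_of_pow_mem L ?_)
    change grT O ^ L ∈ w.asHomogeneousIdeal.toIdeal
    rw [← hc]
    refine sum_mem fun x hx ↦ Ideal.mul_mem_left _ _ ?_
    by_contra h'
    exact h x hx ⟨hf x, hn x, h'⟩
  have hspan : Ideal.span (Set.range fun x : c.support ↦ (⟨f x, hf x⟩ : O)) = ⊤ := by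
    rw [Ideal.eq_top_iff_one]
    have h1 := congrArg grEval hc
    rw [map_pow, grT, grEval_grMonomial, Finsupp.sum, map_sum] at h1
    have h2 : (⟨1, O.one_mem⟩ : O) = 1 := rfl
    rw [h2, one_pow] at h1
    rw [← h1]
    refine sum_mem fun x hx ↦ ?_
    rw [smul_eq_mul, map_mul]
    refine Ideal.mul_mem_left _ _ ?_
    rw [grEval_grMonomial]
    exact Ideal.subset_span ⟨⟨x, hx⟩, rfl⟩
  -- a common exponent for the denominators of the differences
  have hm (x y : affinePart O) : ∃ m : ℕ, act ((f x * f y) ^ m) (φ x - φ y) ∈ W := by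
    have hp : f x * f y ∈ poleLE k k (n x + n y : ℕ) := by
      push_cast
      exact mul_mem_poleLE (hn x) (hn y)
    refine (mem_regularOn_inf_affinePart hOW (O.mul_mem (hf x) (hf y)) hp).1
      (regularOn_anti hOW (fun w hw ↦ show w ∈ N x ⊓ N y from ⟨hle x ?_, hle y ?_⟩) (hφ x y))
    · have := mem_basicOpenOf.1 hw.1
      rw [add_comm, mul_comm] at this
      exact mem_basicOpenOf.2 (this.of_mul (hf y) (hn y) (hf x) (hn x))
    · exact mem_basicOpenOf.2 ((mem_basicOpenOf.1 hw.1).of_mul (hf x) (hn x) (hf y) (hn y))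
  choose m hm using hm
  let M := (c.support ×ˢ c.support).sup fun xy ↦ m xy.1 xy.2
  have hM (x) (hx : x ∈ c.support) (y) (hy : y ∈ c.support) :
      act ((f x * f y) ^ M) (φ x - φ y) ∈ W := by
    have h1 : m x y ≤ M := Finset.le_sup (f := fun xy : _ × _ ↦ m xy.1 xy.2) (Finset.mk_mem_product hx hy)
    rw [← Nat.sub_add_cancel h1, _root_.pow_add, ← act_act]
    exact hOW _ (O.pow_mem (O.mul_mem (hf x) (hf y)) _) _ (hm x y)
  have hspan2 := Ideal.span_pow_eq_top _ hspan M
  rw [← Set.range_comp, Ideal.eq_top_iff_one, Ideal.mem_span_range_iff_exists_fun] at hspan2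
  obtain ⟨a, ha⟩ := hspan2
  have ha' : ∑ x : c.support, (a x : HahnSeries ℤ k) * f x ^ M = 1 := by
    have := congrArg Subtype.val ha
    simpa using this
  -- `∑ a x * f x ^ M = 1` is the partition of unity
  let φ₀ := ∑ x : c.support, act ((a x : HahnSeries ℤ k) * f x ^ M) (φ x)
  have key (y) (hy : y ∈ c.support) :
      φ₀ - φ y ∈ regularOn hOW (basicOpenOf (n y) (f y) (hf y) (hn y) ⊓ affinePart O) := by
    rw [mem_regularOn_inf_affinePart]
    refine ⟨M, ?_⟩
    have e : φ₀ - φ y = ∑ x : c.support, act ((a x : HahnSeries ℤ k) * f x ^ M) (φ x - φ y) := by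
      simp only [act_sub, Finset.sum_sub_distrib, φ₀]
      rw [← sum_act, ha', one_act]
    rw [e, act_sum]
    refine sum_mem fun x _ ↦ ?_
    rw [act_act, show f y ^ M * (a x * f x ^ M) = a x * (f x * f y) ^ M by ring, ← act_act]
    exact hOW _ (a x).2 _ (hM x x.2 y hy)
  refine ⟨φ₀, fun z w hw ↦ ?_⟩
  obtain ⟨y, hy, hwy⟩ := hcov w (hNU z hw)
  rw [← sub_add_sub_cancel φ₀ (φ y) (φ z)]
  exact (key y hy w ⟨mem_basicOpenOf.2 hwy, hNU z hw⟩).add hOW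
    (hφ y z w ⟨hle y (mem_basicOpenOf.2 hwy), hw⟩)

end Cech

section Genus
open TopologicalSpace Opposite HahnSeries
variable {k A : Type u} [Field k] [NonUnitalNonAssocRing A] [Module k A]
  {O : Subalgebra k (HahnSeries ℤ k)} {W : Submodule k (HahnSeries ℤ A)} {hOW : Stabilizes O W}
  {hO : IsLattice (Subalgebra.toSubmodule O)}

/-- The point at infinity has a basis of neighbourhoods `D₊(tⁿ f)` with `f` of pole order `n > 0`. -/
theorem exists_leading_basicOpenOf_le {V : (latticeCurve O).Opens} (hV : infinityPt hO ∈ V) :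
    ∃ (n : ℕ) (f : HahnSeries ℤ k) (hf : f ∈ O) (hn : f ∈ poleLE k k n), 0 < n ∧ f.coeff (-n) ≠ 0 ∧
      basicOpenOf n f hf hn ≤ V := by
  obtain ⟨n, f, hf, hn, hx, hle⟩ := exists_basicOpenOf_le hV
  obtain ⟨N, hN⟩ := hO.exists_pole
  obtain ⟨g, hg, hgN, hg1⟩ := hN (N + 1) (by omega)
  have h1 := (isDenom_infinityPt (hO := hO)).2 ⟨hg, hgN, by rw [hg1]; exact one_ne_zero⟩
  have h2 := h1.mul (mem_basicOpenOf.1 hx)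
  refine ⟨N + 1 + n, g * f, h2.1, h2.2.1, by omega, (isDenom_infinityPt.1 h2).2.2, fun x hx ↦ hle ?_⟩
  exact mem_basicOpenOf.2 ((mem_basicOpenOf.1 hx).of_mul hg hgN hf hn)

theorem basicOpenOf_infinityPt {n : ℕ} {f : HahnSeries ℤ k} {hf : f ∈ O} {hn : f ∈ poleLE k k n}
    (h0 : f.coeff (-n) ≠ 0) : infinityPt hO ∈ basicOpenOf n f hf hn :=
  mem_basicOpenOf.2 (isDenom_infinityPt.2 ⟨hf, hn, h0⟩)

/-- Every series is, up to a power series, a fraction `w / fᵐ`. -/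
theorem IsLattice.exists_fraction (hW : IsLattice W) {n : ℕ} (hn0 : 0 < n) {f : HahnSeries ℤ k}
    (hn : f ∈ poleLE k k n) (h0 : f.coeff (-n) ≠ 0) (φ : HahnSeries ℤ A) :
    ∃ a ∈ integralPart k A, ∃ m : ℕ, act (f ^ m) (φ - a) ∈ W := by
  obtain ⟨N, hN⟩ := hW.exists_sup_poleLE_eq_top
  have hf0 : f ≠ 0 := by
    rintro rfl
    exact h0 rfl
  obtain ⟨w, hw, b, hb, h⟩ := Submodule.mem_sup.1 (hN ▸ Submodule.mem_top : act (f ^ N) φ ∈ W ⊔ poleLE k A N)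
  have e : act (f ^ N) (act (f ^ N)⁻¹ b) = b := act_act_inv (pow_ne_zero _ hf0) b
  refine ⟨act (f ^ N)⁻¹ b, ?_, N, ?_⟩
  · rw [← act_pow_mem_iff hn h0 N, e]
    exact poleLE_mono (by exact_mod_cast Nat.le_mul_of_pos_left N hn0) hb
  · rw [act_sub, e, ← h, add_sub_cancel_right]
    exact hw

/-- The cover by `D₊(t)` and the point at infinity, where the regular elements are power series. -/
theorem LatticeModel.exists_H_one_equiv {F : (latticeCurve O).Modules} (D : LatticeModel F hOW)
    (hO : IsLattice (Subalgebra.toSubmodule O)) (hW : IsLattice W) :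
    Nonempty (Cohomology (latticeCurveHom O) F 1 ≃ₗ[k] HahnSeries ℤ A ⧸ (integralPart k A ⊔ W)) := by
  have hη {V : (latticeCurve O).Opens} {x : latticeCurve O} (h : x ∈ V) : genericPt O ∈ V := genericPt_mem h
  obtain ⟨n, f, hf, hn, hn0, h0, -⟩ :=
    exists_leading_basicOpenOf_le (show infinityPt hO ∈ (⊤ : (latticeCurve O).Opens) from trivial)
  have hU : genericPt O ∈ affinePart O :=
    mem_affinePart.2 (isDenom_genericPt O.one_mem (one_mem_poleLE (Int.natCast_nonneg 1)) one_ne_zero)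
  obtain ⟨E, hE⟩ := D.toSubspaceModel.exists_H_one_equiv (U := affinePart O) hU (p := infinityPt hO)
    (fun x ↦ or_iff_not_imp_left.2 eq_infinityPt_of_notMem) (P := integralPart k A)
    (exists_glue_affinePart hOW)
    (fun V hV φ hφ ↦ (hφ _ hV).mem_integralPart)
    (fun V hV φ hφ hφV ↦ by
      obtain ⟨n, f, hf, hn, hn0, h0, hle⟩ := exists_leading_basicOpenOf_le hV
      refine ⟨basicOpenOf n f hf hn, basicOpenOf_infinityPt h0,
        (mem_regularOn_of_leading hOW hn0 hf hn h0).2 ⟨?_, hφ⟩⟩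
      exact (mem_regularOn_inf_affinePart hOW hf hn).1
        (regularOn_anti hOW (inf_le_inf_right _ hle) hφV))
    ⟨basicOpenOf n f hf hn, basicOpenOf_infinityPt h0, fun φ ↦ by
      obtain ⟨a, ha, h⟩ := hW.exists_fraction hn0 hn h0 φ
      rw [inf_comm]
      exact ⟨a, ha, (mem_regularOn_inf_affinePart hOW hf hn).2 h⟩⟩
  have e1 : regularOn hOW (affinePart O) ⊔ integralPart k A = integralPart k A ⊔ W := by
    rw [regularOn_affinePart, sup_comm]
  let E' : Cohomology (latticeCurveHom O) F 1 ≃ₗ[k]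
      HahnSeries ℤ A ⧸ (regularOn hOW (affinePart O) ⊔ integralPart k A) :=
    { E with
      map_smul' := fun c y ↦ hE c (scalarEnd (latticeCurveHom O) F c)
        (fun V hV s ↦ D.val_scalar hV c s) y }
  exact ⟨E'.trans (Submodule.quotEquivOfEq _ _ e1)⟩

end Genus

/-! ### The curve and the complement of the point at infinity -/

section Curve
open TopologicalSpace Opposite HahnSeries
variable {k : Type u} [Field k] {O : Subalgebra k (HahnSeries ℤ k)}

theorem isIntegral_latticeCurve : IsIntegral (latticeCurve O) where
  nonempty := ⟨genericPt O⟩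
  component_integral U hU := by
    obtain ⟨x⟩ := hU
    exact (functionValue_injective (genericPt_mem x.2)).isDomain

theorem genericPt_mem_affinePart : genericPt O ∈ affinePart O :=
  mem_affinePart.2 (isDenom_genericPt O.one_mem (one_mem_poleLE (Int.natCast_nonneg 1)) one_ne_zero)

theorem isAffineOpen_affinePart : IsAffineOpen (affinePart O) :=
  Proj.isAffineOpen_basicOpen (grPiece O) _ (grMonomial_mem O 1 1 _ _) one_pos

theorem functionValue_affinePart_mem (s : Γ(latticeCurve O, affinePart O)) :
    functionValue genericPt_mem_affinePart s ∈ O := by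
  have h : functionValue genericPt_mem_affinePart s ∈
      regularOn (stabilizes_toSubmodule O) (affinePart O) := (exists_functionValue_eq_iff genericPt_mem_affinePart).1 ⟨s, rfl⟩
  exact (regularOn_affinePart (stabilizes_toSubmodule O)).le h

/-- The functions on the complement of the point at infinity are the elements of `O`. -/
noncomputable def affinePartRingEquiv : Γ(latticeCurve O, affinePart O) ≃+* O :=
  RingEquiv.ofBijective
    ((functionValue genericPt_mem_affinePart).codRestrict O functionValue_affinePart_mem)
    ⟨fun _ _ h ↦ functionValue_injective genericPt_mem_affinePart (congrArg Subtype.val h), fun f ↦ by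
      obtain ⟨s, hs⟩ := (exists_functionValue_eq_iff genericPt_mem_affinePart).2
        ((regularOn_affinePart (stabilizes_toSubmodule O)).ge f.2)
      exact ⟨s, Subtype.ext hs⟩⟩

theorem coe_affinePartRingEquiv (s : Γ(latticeCurve O, affinePart O)) :
    (affinePartRingEquiv s : HahnSeries ℤ k) = functionValue genericPt_mem_affinePart s := rfl

/-- `affinePartRingEquiv` in the category of rings. -/
noncomputable def affinePartRingIso : Γ(latticeCurve O, affinePart O) ≅ CommRingCat.of O where
  hom := CommRingCat.ofHom (R := Γ(latticeCurve O, affinePart O)) affinePartRingEquiv.toRingHom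
  inv := CommRingCat.ofHom (S := Γ(latticeCurve O, affinePart O)) affinePartRingEquiv.symm.toRingHom
  hom_inv_id := CommRingCat.hom_ext (RingHom.ext affinePartRingEquiv.symm_apply_apply)
  inv_hom_id := CommRingCat.hom_ext (RingHom.ext affinePartRingEquiv.apply_symm_apply)

variable (O) in
/-- The complement of the point at infinity is the spectrum of `O`. -/
noncomputable def specIsoAffinePart : Spec (.of O) ≅ (affinePart O).toScheme :=
  Scheme.Spec.mapIso affinePartRingIso.op ≪≫ isAffineOpen_affinePart.isoSpec.symm

theorem specIsoAffinePart_hom : (specIsoAffinePart O).hom =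
    Spec.map affinePartRingIso.hom ≫ isAffineOpen_affinePart.isoSpec.inv :=
  rfl

theorem specIsoAffinePart_hom_appTop : (specIsoAffinePart O).hom.appTop = (affinePart O).topIso.hom ≫
    affinePartRingIso.hom ≫ (Scheme.ΓSpecIso (.of O)).inv := by
  rw [specIsoAffinePart_hom, Scheme.Hom.comp_appTop, IsAffineOpen.isoSpec_inv_appTop, Category.assoc,
    Scheme.ΓSpecIso_inv_naturality]

/-- The isomorphism with the spectrum of `O` sends a function to its series. -/
theorem specIsoAffinePart_apply (s : Γ(latticeCurve O, affinePart O)) :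
    ((Scheme.ΓSpecIso (.of O)).hom ((specIsoAffinePart O).hom.appTop ((affinePart O).topIso.inv s)) : O) =
      affinePartRingEquiv s := by
  have h : (affinePart O).topIso.inv ≫ (specIsoAffinePart O).hom.appTop ≫ (Scheme.ΓSpecIso (.of O)).hom =
      affinePartRingIso.hom := by
    rw [specIsoAffinePart_hom_appTop]
    simp only [Category.assoc, Iso.inv_hom_id_assoc, Iso.inv_hom_id, Category.comp_id]
  exact congrArg (fun f ↦ f.hom s) h

theorem ι_appTop_eq {X : Scheme.{u}} (U : X.Opens) :
    U.ι.appTop = X.presheaf.map (homOfLE le_top : U ⟶ ⊤).op ≫ U.topIso.inv := by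
  rw [Iso.eq_comp_inv]
  simp only [Scheme.Opens.topIso, Scheme.Opens.ι_appTop]
  exact (X.presheaf.map_comp _ _).symm

theorem specIsoAffinePart_over : (specIsoAffinePart O).hom ≫ (affinePart O).ι ≫ latticeCurveHom O =
    Spec.map (CommRingCat.ofHom (algebraMap k O)) := by
  refine ext_to_Spec ?_
  change (Scheme.ΓSpecIso (.of k)).inv ≫ ((specIsoAffinePart O).hom ≫ (affinePart O).ι ≫
    latticeCurveHom O).appTop = (Scheme.ΓSpecIso (.of k)).inv ≫
      (Spec.map (CommRingCat.ofHom (algebraMap k O))).appTop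
  rw [← Scheme.ΓSpecIso_inv_naturality, Scheme.Hom.comp_appTop, Scheme.Hom.comp_appTop, ι_appTop_eq,
    specIsoAffinePart_hom_appTop]
  simp only [Category.assoc, Iso.inv_hom_id_assoc]
  simp only [← Category.assoc]
  congr 1
  exact CommRingCat.hom_ext (RingHom.ext fun c ↦
    Subtype.ext (functionValue_scalars genericPt_mem_affinePart c))

theorem specializes_genericPt (x : latticeCurve O) : genericPt O ⤳ x :=
  specializes_iff_forall_open.2 fun V hV hx ↦ genericPt_mem (V := ⟨V, hV⟩) hx

theorem IsDenom.of_specializes {x y : latticeCurve O} (h : x ⤳ y) {n : ℕ} {α : HahnSeries ℤ k}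
    (hα : IsDenom y n α) : IsDenom x n α :=
  mem_basicOpenOf.1 (h.mem_open (basicOpenOf n α hα.1 hα.2.1).2 (mem_basicOpenOf.2 hα))

/-- The point at infinity is only a specialization of itself and of the generic point: a prime ideal
without `t` that contains `tⁿ f ≠ 0` contains `tᵐ f`, where `m` is the pole order of `f`, and `tᵐ f` is not
in `(t)`. -/
theorem not_specializes_infinityPt {hO : IsLattice (Subalgebra.toSubmodule O)} {x : latticeCurve O}
    (hx : x ∈ affinePart O) (hη : x ≠ genericPt O) : ¬ x ⤳ infinityPt hO := fun h ↦ hη <| by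
  refine ((specializes_iff_forall_open.2 fun V hV hxV ↦ ?_).antisymm (specializes_genericPt x)).eq
  obtain ⟨n, f, hf, hn, hfη, hle⟩ := exists_basicOpenOf_le (V := ⟨V, hV⟩) hxV
  have hf0 := (mem_basicOpenOf.1 hfη).ne_zero
  obtain ⟨m, hm, hm0⟩ := hO.exists_pole_order hf hf0
  have hmn : m ≤ n := by
    by_contra! h'
    exact hm0 (hn _ (by omega))
  have h1 : IsDenom x m f := (isDenom_infinityPt.2 ⟨hf, hm, hm0⟩ : IsDenom (infinityPt hO) m f).of_specializes h
  have h2 := h1.mul ((mem_affinePart.1 hx).pow (n - m))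
  rw [one_pow, mul_one, one_mul, Nat.add_sub_cancel' hmn] at h2
  exact hle (mem_basicOpenOf.2 h2)

/-- Points of `D₊(t) = Spec(O)` other than the generic one are closed there, because nonzero primes of `O`
are maximal, and they do not specialize to the point at infinity. -/
theorem isClosed_singleton_of_ne_genericPt (hO : IsLattice (Subalgebra.toSubmodule O))
    {x : latticeCurve O} (hη : x ≠ genericPt O) : IsClosed {x} := by
  by_cases hx : x ∈ affinePart O
  swap
  · rw [eq_infinityPt_of_notMem (hO := hO) hx, ← isOpen_compl_iff, ← coe_affinePart]
    exact (affinePart O).2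
  rw [← closure_subset_iff_isClosed]
  intro y hy
  rw [← specializes_iff_mem_closure] at hy
  by_cases hyU : y ∈ affinePart O
  swap
  · rw [eq_infinityPt_of_notMem (hO := hO) hyU] at hy
    exact absurd hy (not_specializes_infinityPt hx hη)
  let e : Spec (.of O) ≃ₜ affinePart O := (specIsoAffinePart O).hom.homeomorph
  have h1 : (⟨x, hx⟩ : affinePart O) ⤳ ⟨y, hyU⟩ := Topology.IsInducing.subtypeVal.specializes_iff.1 hy
  have h2 := h1.map e.symm.continuous
  have h3 : (e.symm ⟨x, hx⟩).asIdeal ≠ ⊥ := by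
    intro h
    have h4 : e.symm ⟨x, hx⟩ ⤳ e.symm ⟨genericPt O, genericPt_mem_affinePart⟩ := by
      refine (PrimeSpectrum.le_iff_specializes _ _).1 ?_
      change (e.symm ⟨x, hx⟩).asIdeal ≤ _
      rw [h]
      exact bot_le
    have h5 := (h4.map e.continuous).map continuous_subtype_val
    erw [e.apply_symm_apply, e.apply_symm_apply] at h5
    exact hη (h5.antisymm (specializes_genericPt x)).eq
  have h6 : (e.symm ⟨x, hx⟩).asIdeal.IsMaximal := hO.isMaximal_of_isPrime (hP := (e.symm ⟨x, hx⟩).2) h3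
  have h7 : e.symm ⟨x, hx⟩ = e.symm ⟨y, hyU⟩ := PrimeSpectrum.ext
    (h6.eq_of_le (e.symm ⟨y, hyU⟩).2.ne_top ((PrimeSpectrum.le_iff_specializes _ _).2 h2))
  exact (congrArg Subtype.val (e.symm.injective h7)).symm

/-- Every irreducible closed subset is the whole curve or a point; the lower bound is the dimension of the open
subset `Spec(O)`. -/
theorem topologicalKrullDim_latticeCurve (hO : IsLattice (Subalgebra.toSubmodule O)) :
    topologicalKrullDim (latticeCurve O) = 1 := by
  refine le_antisymm ?_ ?_
  · refine Order.krullDim_le_one_iff.2 fun Z ↦ ?_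
    obtain ⟨x, hx⟩ := QuasiSober.sober Z.isIrreducible Z.isClosed
    by_cases hη : x = genericPt O
    · right
      intro Z' _ y _
      rw [← SetLike.mem_coe]
      change y ∈ Z.carrier
      rw [show Z.carrier = closure {x} from hx.symm, ← specializes_iff_mem_closure, hη]
      exact specializes_genericPt y
    · left
      intro Z' hZ'
      have hZ : Z.carrier = {x} := by
        rw [show Z.carrier = closure {x} from hx.symm]
        exact (isClosed_singleton_of_ne_genericPt hO hη).closure_eq
      obtain ⟨y, hy⟩ := Z'.isIrreducible.nonempty
      intro w hw
      have h1 : w = x := by simpa [hZ] using (show w ∈ Z.carrier from hw)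
      have h2 : y = x := by simpa [hZ] using (show y ∈ Z.carrier from hZ' hy)
      rw [h1, ← h2]
      exact hy
  · rw [← hO.ringKrullDim_eq_one, ← PrimeSpectrum.topologicalKrullDim_eq_ringKrullDim]
    let e : Spec (.of O) ≃ₜ affinePart O := (specIsoAffinePart O).hom.homeomorph
    exact (Topology.IsInducing.subtypeVal.comp e.isInducing).topologicalKrullDim_le

end Curve

/-! ### Completions as spaces of power series -/

section AdicModel
open HahnSeries
variable {k A R N : Type u} [Field k] [NonUnitalNonAssocRing A] [Module k A] [CommRing R]
  [AddCommGroup N] [Module R N] {I : Ideal R} {ψ : N →+ HahnSeries ℤ A}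

variable (k I ψ) in
/-- The map `ψ : N → A[[z]]` is compatible with the `I`-adic and the `z`-adic filtration and has dense image,
so that it identifies the completion of `N` with `A[[z]]`. -/
structure IsAdicModel : Prop where
  mem_iff (i : ℕ) (t : N) : ψ t ∈ poleLE k A (-i) ↔ t ∈ (I ^ i • ⊤ : Submodule R N)
  exists_approx (i : ℕ) (φ : HahnSeries ℤ A) (h : φ ∈ integralPart k A) :
    ∃ t, ψ t - φ ∈ poleLE k A (-i)

variable (k ψ) in
/-- The series `φ` is the `z`-adic limit of the images under `ψ` of representatives of `x`. -/
def IsLimit (x : AdicCompletion I N) (φ : HahnSeries ℤ A) : Prop :=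
  ∀ (i : ℕ) (t : N), Submodule.Quotient.mk t = x.1 i → ψ t - φ ∈ poleLE k A (-i)

theorem eq_zero_of_forall_mem_poleLE {φ : HahnSeries ℤ A} (h : ∀ i : ℕ, φ ∈ poleLE k A (-i)) : φ = 0 := by
  ext n
  exact h (n.natAbs + 1) n (by omega)

variable {x y : AdicCompletion I N} {φ χ : HahnSeries ℤ A}

theorem IsAdicModel.mem_integralPart (h : IsAdicModel k I ψ) (t : N) : ψ t ∈ integralPart k A := by
  simpa using (h.mem_iff 0 t).2 (by simp)

/-- It suffices to test one representative in each degree. -/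
theorem IsAdicModel.isLimit (h : IsAdicModel k I ψ)
    (hx : ∀ i : ℕ, ∃ t, Submodule.Quotient.mk t = x.1 i ∧ ψ t - φ ∈ poleLE k A (-i)) :
    IsLimit k ψ x φ := fun i t ht ↦ by
  obtain ⟨s, hs, hsφ⟩ := hx i
  rw [← sub_add_sub_cancel _ (ψ s), ← map_sub]
  refine add_mem ((h.mem_iff i _).2 ?_) hsφ
  rw [← Submodule.Quotient.mk_eq_zero, Submodule.Quotient.mk_sub, ht, hs, sub_self]

theorem IsAdicModel.isLimit_of (h : IsAdicModel k I ψ) (t : N) :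
    IsLimit k ψ (AdicCompletion.of I N t) (ψ t) :=
  h.isLimit fun i ↦ ⟨t, rfl, by rw [sub_self]; exact zero_mem _⟩

theorem IsLimit.unique (hφ : IsLimit k ψ x φ) (hχ : IsLimit k ψ x χ) : φ = χ := by
  refine sub_eq_zero.1 (eq_zero_of_forall_mem_poleLE (k := k) fun i ↦ ?_)
  obtain ⟨t, ht⟩ := Submodule.Quotient.mk_surjective _ (x.1 i)
  rw [← sub_sub_sub_cancel_left _ _ (ψ t)]
  exact sub_mem (hχ i t ht) (hφ i t ht)

theorem IsLimit.mem_integralPart (h : IsAdicModel k I ψ) (hφ : IsLimit k ψ x φ) :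
    φ ∈ integralPart k A := by
  obtain ⟨t, ht⟩ := Submodule.Quotient.mk_surjective _ (x.1 0)
  rw [← sub_sub_cancel (ψ t) φ]
  exact sub_mem (h.mem_integralPart t) (by simpa using hφ 0 t ht)

theorem IsLimit.add (h : IsAdicModel k I ψ) (hφ : IsLimit k ψ x φ) (hχ : IsLimit k ψ y χ) :
    IsLimit k ψ (x + y) (φ + χ) := by
  refine h.isLimit fun i ↦ ?_
  obtain ⟨s, hs⟩ := Submodule.Quotient.mk_surjective _ (x.1 i)
  obtain ⟨t, ht⟩ := Submodule.Quotient.mk_surjective _ (y.1 i)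
  refine ⟨s + t, ?_, ?_⟩
  · rw [Submodule.Quotient.mk_add, hs, ht]
    rfl
  · rw [map_add, add_sub_add_comm]
    exact add_mem (hφ i s hs) (hχ i t ht)

theorem IsLimit.eq (h : IsAdicModel k I ψ) (hφ : IsLimit k ψ x φ) (hχ : IsLimit k ψ y φ) : x = y := by
  refine AdicCompletion.ext fun i ↦ ?_
  obtain ⟨s, hs⟩ := Submodule.Quotient.mk_surjective _ (x.1 i)
  obtain ⟨t, ht⟩ := Submodule.Quotient.mk_surjective _ (y.1 i)
  rw [← hs, ← ht, Submodule.Quotient.eq, ← h.mem_iff, map_sub, ← sub_sub_sub_cancel_right _ _ φ]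
  exact sub_mem (hφ i s hs) (hχ i t ht)

/-- The coefficient of `zⁿ` in the limit is that of any representative modulo `I ^ (n + 1)`. -/
theorem IsAdicModel.exists_isLimit (h : IsAdicModel k I ψ) (x : AdicCompletion I N) :
    ∃ φ, IsLimit k ψ x φ := by
  choose t ht using fun i ↦ Submodule.Quotient.mk_surjective _ (x.1 i)
  have key (i j : ℕ) (hij : i ≤ j) : ψ (t j) - ψ (t i) ∈ poleLE k A (-i) := by
    rw [← map_sub, h.mem_iff, ← Submodule.Quotient.mk_eq_zero, Submodule.Quotient.mk_sub, ht,
      sub_eq_zero, ← x.2 hij, ← ht j]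
    rfl
  let φ : HahnSeries ℤ A := ofSuppBddBelow (fun n ↦ (ψ (t (n.toNat + 1))).coeff n)
    ⟨0, fun n hn ↦ by
      by_contra! hn'
      exact hn (h.mem_integralPart _ n (by simpa using hn'))⟩
  refine ⟨φ, h.isLimit fun i ↦ ⟨t i, ht i, fun n hn ↦ ?_⟩⟩
  have hn' : n < i := by simpa using hn
  rw [coeff_sub]
  change _ - (ψ (t (n.toNat + 1))).coeff n = 0
  rw [← coeff_sub]
  rcases lt_or_ge n 0 with h0 | h0
  · rw [coeff_sub, h.mem_integralPart _ n (by simpa using h0),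
      h.mem_integralPart _ n (by simpa using h0), sub_zero]
  · exact key _ _ (by omega) n (by omega)

/-- By density, a power series is approximated modulo `zⁱ` by an element of `N`, which is unique modulo `I ^ i`. -/
theorem IsAdicModel.exists_isLimit_of_mem (h : IsAdicModel k I ψ) (hφ : φ ∈ integralPart k A) :
    ∃ x : AdicCompletion I N, IsLimit k ψ x φ := by
  choose t ht using fun i ↦ h.exists_approx i φ hφ
  refine ⟨⟨fun i ↦ Submodule.Quotient.mk (t i), fun {i j} hij ↦ ?_⟩, h.isLimit fun i ↦ ⟨t i, rfl, ht i⟩⟩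
  refine (Submodule.Quotient.eq _).2 ((h.mem_iff i _).1 ?_)
  rw [map_sub, ← sub_sub_sub_cancel_right _ _ φ]
  exact sub_mem (poleLE_mono (by omega) (ht j)) (ht i)

/-- The completion of `N` is `A[[z]]`. -/
noncomputable def IsAdicModel.equiv (h : IsAdicModel k I ψ) : AdicCompletion I N ≃+ integralPart k A :=
  AddEquiv.ofBijective
    (AddMonoidHom.mk' (fun x ↦ ⟨(h.exists_isLimit x).choose,
        (h.exists_isLimit x).choose_spec.mem_integralPart h⟩) fun x y ↦ Subtype.ext <|
      (h.exists_isLimit (x + y)).choose_spec.unique <|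
        (h.exists_isLimit x).choose_spec.add h (h.exists_isLimit y).choose_spec)
    ⟨fun x y hxy ↦ (h.exists_isLimit x).choose_spec.eq h <| by
      rw [show (h.exists_isLimit x).choose = (h.exists_isLimit y).choose from congrArg Subtype.val hxy]
      exact (h.exists_isLimit y).choose_spec,
    fun φ ↦ (h.exists_isLimit_of_mem φ.2).imp fun x hx ↦ Subtype.ext <|
      (h.exists_isLimit x).choose_spec.unique hx⟩

theorem IsAdicModel.isLimit_equiv (h : IsAdicModel k I ψ) (x : AdicCompletion I N) :
    IsLimit k ψ x (h.equiv x) := (h.exists_isLimit x).choose_spec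

theorem IsAdicModel.equiv_eq_iff (h : IsAdicModel k I ψ) :
    (h.equiv x : HahnSeries ℤ A) = φ ↔ IsLimit k ψ x φ :=
  ⟨fun e ↦ e ▸ h.isLimit_equiv x, fun hx ↦ (h.isLimit_equiv x).unique hx⟩

theorem IsAdicModel.equiv_of (h : IsAdicModel k I ψ) (t : N) :
    (h.equiv (AdicCompletion.of I N t) : HahnSeries ℤ A) = ψ t :=
  h.equiv_eq_iff.2 (h.isLimit_of t)

theorem act_sub_act_mem {f g : HahnSeries ℤ k} {i : ℕ} (hg : g ∈ integralPart k k)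
    (hφ : φ ∈ integralPart k A) (hfg : f - g ∈ poleLE k k (-i)) (hχ : χ - φ ∈ poleLE k A (-i)) :
    act f χ - act g φ ∈ poleLE k A (-i) := by
  have e : act f χ - act g φ = act (f - g) (χ - φ) + act (f - g) φ + act g (χ - φ) := by
    rw [← act_add, sub_add_cancel, act_sub, sub_eq_add_neg f g, add_act,
      show act (-g) χ = -act g χ from neg_smul (M := HahnModule ℤ k A) g _]
    abel
  rw [e]
  refine add_mem (add_mem ?_ ?_) ?_
  · exact poleLE_mono (by omega) (act_mem_poleLE hfg hχ)
  · simpa using act_mem_poleLE hfg hφ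
  · simpa using act_mem_poleLE hg hχ

theorem mul_sub_mul_mem {φ' χ' : HahnSeries ℤ A} {i : ℕ} (hφ : φ ∈ integralPart k A)
    (hχ : χ ∈ integralPart k A) (h : φ' - φ ∈ poleLE k A (-i)) (h' : χ' - χ ∈ poleLE k A (-i)) :
    φ' * χ' - φ * χ ∈ poleLE k A (-i) := by
  have e : φ' * χ' - φ * χ = (φ' - φ) * (χ' - χ) + (φ' - φ) * χ + φ * (χ' - χ) := by
    simp only [mul_sub, sub_mul]
    abel
  rw [e]
  refine add_mem (add_mem ?_ ?_) ?_
  · exact poleLE_mono (by omega) (mul_mem_poleLE h h')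
  · simpa using mul_mem_poleLE h hχ
  · simpa using mul_mem_poleLE hφ h'

/-- The identification of the completions is equivariant if `ψ` is. -/
theorem IsAdicModel.equiv_smul (h : IsAdicModel k I ψ) {ρ : R →+ HahnSeries ℤ k}
    (hρ : IsAdicModel k I ρ) (hsmul : ∀ r t, ψ (r • t) = act (ρ r) (ψ t)) (r : AdicCompletion I R)
    (x : AdicCompletion I N) :
    (h.equiv (r • x) : HahnSeries ℤ A) = act (hρ.equiv r : HahnSeries ℤ k) (h.equiv x) := by
  refine h.equiv_eq_iff.2 (h.isLimit fun i ↦ ?_)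
  obtain ⟨s, hs⟩ := Submodule.Quotient.mk_surjective _ (r.1 i)
  obtain ⟨t, ht⟩ := Submodule.Quotient.mk_surjective _ (x.1 i)
  refine ⟨s • t, ?_, ?_⟩
  · have := AdicCompletion.smul_eval (I := I) i r x
    rw [this, ← hs, ← ht]
    rfl
  · rw [hsmul]
    exact act_sub_act_mem (hρ.equiv r).2 (h.equiv x).2 (hρ.isLimit_equiv r i s hs)
      (h.isLimit_equiv x i t ht)

/-- The identification of the completions is multiplicative if `ψ` is. -/
theorem IsAdicModel.equiv_completionMul (h : IsAdicModel k I ψ) {β : N →ₗ[R] N →ₗ[R] N}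
    (hβ : ∀ s t, ψ (β s t) = ψ s * ψ t) (x y : AdicCompletion I N) :
    (h.equiv (completionMul I β x y) : HahnSeries ℤ A) = h.equiv x * h.equiv y := by
  refine h.equiv_eq_iff.2 (h.isLimit fun i ↦ ?_)
  obtain ⟨s, hs⟩ := Submodule.Quotient.mk_surjective _ (x.1 i)
  obtain ⟨t, ht⟩ := Submodule.Quotient.mk_surjective _ (y.1 i)
  refine ⟨β s t, ?_, ?_⟩
  · change _ = quotMul β (I ^ i) (x.1 i) (y.1 i)
    rw [← hs, ← ht, quotMul_mk]
  · rw [hβ]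
    exact mul_sub_mul_mem (h.equiv x).2 (h.equiv y).2 (h.isLimit_equiv x i s hs)
      (h.isLimit_equiv y i t ht)

theorem IsAdicModel.equiv_mul {ρ : R →+ HahnSeries ℤ k} (hρ : IsAdicModel k I ρ)
    (hmul : ∀ r s, ρ (r * s) = ρ r * ρ s) (r s : AdicCompletion I R) :
    (hρ.equiv (r * s) : HahnSeries ℤ k) = hρ.equiv r * hρ.equiv s := by
  have h := hρ.equiv_smul hρ hmul r s
  exact h

variable (k) in
/-- `k[[z]]` as a ring of power series. -/
noncomputable def powerSeriesEquiv : integralPart k k ≃+ PowerSeries k :=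
  AddEquiv.symm <| AddEquiv.ofBijective
    ((ofPowerSeries ℤ k).toAddMonoidHom.codRestrict (integralPart k k) fun f n hn ↦ by
      refine embDomain_of_notMem_range ?_
      rintro ⟨m, rfl⟩
      have : (m : ℤ) < 0 := by simpa using hn
      omega)
    ⟨fun f g h ↦ ofPowerSeries_injective (congrArg Subtype.val h), fun φ ↦
      ⟨PowerSeries.mk fun n ↦ φ.1.coeff n, Subtype.ext <| HahnSeries.ext <| funext fun n ↦ by
        change (ofPowerSeries ℤ k _).coeff n = _
        rcases lt_or_ge n 0 with h | h
        · rw [φ.2 n (by simpa using h)]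
          refine embDomain_of_notMem_range ?_
          rintro ⟨m, rfl⟩
          have : (m : ℤ) < 0 := by simpa using h
          omega
        · lift n to ℕ using h
          rw [ofPowerSeries_apply_coeff, PowerSeries.coeff_mk]⟩⟩

theorem ofPowerSeries_powerSeriesEquiv (φ : integralPart k k) :
    ofPowerSeries ℤ k (powerSeriesEquiv k φ) = φ :=
  congrArg Subtype.val ((powerSeriesEquiv k).symm_apply_apply φ)

/-- The completion of the ring `R` is `k[[z]]`. -/
noncomputable def IsAdicModel.ringEquiv {ρ : R →+* HahnSeries ℤ k}
    (hρ : IsAdicModel k I (ρ : R →+ HahnSeries ℤ k)) : AdicCompletion I R ≃+* PowerSeries k :=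
  { hρ.equiv.trans (powerSeriesEquiv k) with
    map_mul' := fun r s ↦ ofPowerSeries_injective (Γ := ℤ) <| by
      change ofPowerSeries ℤ k (powerSeriesEquiv k _) =
        ofPowerSeries ℤ k (powerSeriesEquiv k _ * powerSeriesEquiv k _)
      rw [map_mul (ofPowerSeries ℤ k), ofPowerSeries_powerSeriesEquiv, ofPowerSeries_powerSeriesEquiv,
        ofPowerSeries_powerSeriesEquiv]
      exact hρ.equiv_mul (map_mul ρ) r s }

theorem IsAdicModel.ofPowerSeries_ringEquiv {ρ : R →+* HahnSeries ℤ k}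
    (hρ : IsAdicModel k I (ρ : R →+ HahnSeries ℤ k)) (r : AdicCompletion I R) :
    ofPowerSeries ℤ k (hρ.ringEquiv r) = hρ.equiv r := ofPowerSeries_powerSeriesEquiv _

theorem IsAdicModel.ofPowerSeries_ringEquiv_of {ρ : R →+* HahnSeries ℤ k}
    (hρ : IsAdicModel k I (ρ : R →+ HahnSeries ℤ k)) (r : R) :
    ofPowerSeries ℤ k (hρ.ringEquiv (AdicCompletion.of I R r)) = ρ r := by
  rw [hρ.ofPowerSeries_ringEquiv, hρ.equiv_of]
  rfl

end AdicModel

/-! ### The local ring and the stalk at infinity -/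

section Stalks
open TopologicalSpace Opposite HahnSeries
variable {k A : Type u} [Field k] [NonUnitalNonAssocRing A] [Module k A]
  {O : Subalgebra k (HahnSeries ℤ k)} {W : Submodule k (HahnSeries ℤ A)} {x : latticeCurve O}

/-- The series of a function depends only on its germ. -/
theorem functionValue_eq_of_germ_eq {U V : (latticeCurve O).Opens} (hU : x ∈ U) (hV : x ∈ V)
    {r : Γ(latticeCurve O, U)} {s : Γ(latticeCurve O, V)}
    (h : (latticeCurve O).presheaf.germ U x hU r = (latticeCurve O).presheaf.germ V x hV s) :
    functionValue (genericPt_mem hU) r = functionValue (genericPt_mem hV) s := by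
  obtain ⟨T, hT, i, j, e⟩ := TopCat.Presheaf.germ_eq _ x hU hV r s h
  rw [← functionValue_res i (genericPt_mem hT), ← functionValue_res j (genericPt_mem hT)]
  exact congrArg _ e

theorem exists_germ_eq_functionValue (r : (latticeCurve O).presheaf.stalk x) :
    ∃ (φ : HahnSeries ℤ k) (V : (latticeCurve O).Opens) (hx : x ∈ V) (s : Γ(latticeCurve O, V)),
      (latticeCurve O).presheaf.germ V x hx s = r ∧ functionValue (genericPt_mem hx) s = φ :=
  let ⟨V, hx, s, hs⟩ := TopCat.Presheaf.exists_germ_eq _ r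
  ⟨_, V, hx, s, hs, rfl⟩

/-- The series of the germ of a function. -/
noncomputable def germValueFun (r : (latticeCurve O).presheaf.stalk x) : HahnSeries ℤ k :=
  (exists_germ_eq_functionValue r).choose

theorem germValueFun_germ {V : (latticeCurve O).Opens} (hx : x ∈ V) (s : Γ(latticeCurve O, V)) :
    germValueFun ((latticeCurve O).presheaf.germ V x hx s) = functionValue (genericPt_mem hx) s := by
  obtain ⟨U, hU, t, ht, h⟩ :=
    (exists_germ_eq_functionValue ((latticeCurve O).presheaf.germ V x hx s)).choose_spec
  exact h.symm.trans (functionValue_eq_of_germ_eq hU hx ht)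

theorem exists_germ_eq₂ (r s : (latticeCurve O).presheaf.stalk x) :
    ∃ (V : (latticeCurve O).Opens) (hx : x ∈ V) (a b : Γ(latticeCurve O, V)),
      (latticeCurve O).presheaf.germ V x hx a = r ∧ (latticeCurve O).presheaf.germ V x hx b = s := by
  obtain ⟨U, hU, a, rfl⟩ := TopCat.Presheaf.exists_germ_eq _ r
  obtain ⟨V, hV, b, rfl⟩ := TopCat.Presheaf.exists_germ_eq _ s
  exact ⟨U ⊓ V, ⟨hU, hV⟩, (latticeCurve O).presheaf.map (homOfLE inf_le_left : U ⊓ V ⟶ U).op a,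
    (latticeCurve O).presheaf.map (homOfLE inf_le_right : U ⊓ V ⟶ V).op b,
    TopCat.Presheaf.germ_res_apply _ _ _ _ a, TopCat.Presheaf.germ_res_apply _ _ _ _ b⟩

variable (x) in
/-- The local ring at a point as a ring of series. -/
noncomputable def germValue : (latticeCurve O).presheaf.stalk x →+* HahnSeries ℤ k where
  toFun := germValueFun
  map_one' := by
    have h := germValueFun_germ (O := O) (x := x) (V := ⊤) trivial 1
    rwa [map_one, map_one] at h
  map_zero' := by
    have h := germValueFun_germ (O := O) (x := x) (V := ⊤) trivial 0
    rwa [map_zero, map_zero] at h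
  map_add' r s := by
    obtain ⟨V, hx, a, b, rfl, rfl⟩ := exists_germ_eq₂ r s
    rw [← map_add, germValueFun_germ, germValueFun_germ, germValueFun_germ, map_add]
  map_mul' r s := by
    obtain ⟨V, hx, a, b, rfl, rfl⟩ := exists_germ_eq₂ r s
    rw [← map_mul, germValueFun_germ, germValueFun_germ, germValueFun_germ, map_mul]

theorem germValue_germ {V : (latticeCurve O).Opens} (hx : x ∈ V) (s : Γ(latticeCurve O, V)) :
    germValue x ((latticeCurve O).presheaf.germ V x hx s) = functionValue (genericPt_mem hx) s :=
  germValueFun_germ hx s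

theorem germValue_injective : Function.Injective (germValue x) := by
  refine (injective_iff_map_eq_zero _).2 fun r hr ↦ ?_
  obtain ⟨V, hx, a, rfl⟩ := TopCat.Presheaf.exists_germ_eq _ r
  rw [germValue_germ] at hr
  rw [functionValue_injective (genericPt_mem hx) (hr.trans (map_zero _).symm), map_zero]

/-- A series that is regular at a point is regular near the point. -/
theorem IsRegularAt.exists_mem_regularOn (hOW : Stabilizes O W) {φ : HahnSeries ℤ A}
    (h : IsRegularAt O W x φ) : ∃ V : (latticeCurve O).Opens, x ∈ V ∧ φ ∈ regularOn hOW V := by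
  obtain ⟨n, α, hα, hw⟩ := h
  exact ⟨basicOpenOf n α hα.1 hα.2.1, mem_basicOpenOf.2 hα,
    fun y hy ↦ ⟨n, α, mem_basicOpenOf.1 hy, hw⟩⟩

theorem exists_germValue_eq_iff {φ : HahnSeries ℤ k} :
    (∃ r, germValue x r = φ) ↔ IsRegularAt O (Subalgebra.toSubmodule O) x φ := by
  constructor
  · rintro ⟨r, rfl⟩
    obtain ⟨V, hx, a, rfl⟩ := TopCat.Presheaf.exists_germ_eq _ r
    rw [germValue_germ]
    exact (exists_functionValue_eq_iff (genericPt_mem hx)).1 ⟨a, rfl⟩ x hx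
  · intro h
    obtain ⟨V, hx, hV⟩ := h.exists_mem_regularOn (stabilizes_toSubmodule O)
    obtain ⟨a, ha⟩ := (exists_functionValue_eq_iff (genericPt_mem hx)).2 hV
    exact ⟨(latticeCurve O).presheaf.germ V x hx a, by rw [germValue_germ, ha]⟩

namespace LatticeModel
variable {F : (latticeCurve O).Modules} {hOW : Stabilizes O W} (D : LatticeModel F hOW)

theorem val_eq_of_germAt_eq {U V : (latticeCurve O).Opens} (hU : x ∈ U) (hV : x ∈ V)
    {r : Γ(F, U)} {s : Γ(F, V)} (h : germAt F hU r = germAt F hV s) :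
    D.val U (genericPt_mem hU) r = D.val V (genericPt_mem hV) s := by
  obtain ⟨T, hT, i, j, e⟩ := germAt_eq F hU hV r s h
  rw [← D.res i (genericPt_mem hT), ← D.res j (genericPt_mem hT)]
  exact congrArg _ e

include D in
theorem exists_germAt_eq_val (t : stalkAb F x) :
    ∃ (φ : HahnSeries ℤ A) (V : (latticeCurve O).Opens) (hx : x ∈ V) (s : Γ(F, V)),
      germAt F hx s = t ∧ D.val V (genericPt_mem hx) s = φ :=
  let ⟨V, hx, s, hs⟩ := exists_germAt_eq F t
  ⟨_, V, hx, s, hs, rfl⟩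

/-- The series of the germ of a section. -/
noncomputable def germValueFun (t : stalkAb F x) : HahnSeries ℤ A := (D.exists_germAt_eq_val t).choose

theorem germValueFun_germAt {V : (latticeCurve O).Opens} (hx : x ∈ V) (s : Γ(F, V)) :
    D.germValueFun (germAt F hx s) = D.val V (genericPt_mem hx) s := by
  obtain ⟨U, hU, t, ht, h⟩ := (D.exists_germAt_eq_val (germAt F hx s)).choose_spec
  exact h.symm.trans (D.val_eq_of_germAt_eq hU hx ht)

variable (x) in
/-- The stalk at a point as a space of series. -/
noncomputable def germValue : stalkAb F x →+ HahnSeries ℤ A :=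
  AddMonoidHom.mk' D.germValueFun fun a b ↦ by
    obtain ⟨V, hx, s, t, rfl, rfl⟩ := exists_germAt_eq₂ F a b
    rw [← map_add, D.germValueFun_germAt, D.germValueFun_germAt, D.germValueFun_germAt, map_add]

theorem germValue_germAt {V : (latticeCurve O).Opens} (hx : x ∈ V) (s : Γ(F, V)) :
    D.germValue x (germAt F hx s) = D.val V (genericPt_mem hx) s :=
  D.germValueFun_germAt hx s

theorem germValue_smul (r : (latticeCurve O).presheaf.stalk x) (t : stalkAb F x) :
    D.germValue x (r • t) = act (GeomLattice.germValue x r) (D.germValue x t) := by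
  obtain ⟨V, hx, a, s, _, rfl, rfl, -⟩ := exists_germ_eq_germAt_eq₂ F r t 0
  rw [← germAt_smul, D.germValue_germAt, D.germValue_germAt, GeomLattice.germValue_germ, D.smul]

theorem germValue_injective : Function.Injective (D.germValue x) := by
  refine (injective_iff_map_eq_zero _).2 fun t ht ↦ ?_
  obtain ⟨V, hx, s, rfl⟩ := exists_germAt_eq F t
  rw [D.germValue_germAt] at ht
  rw [D.injective V (genericPt_mem hx) (ht.trans (map_zero _).symm), map_zero]

theorem exists_germValue_eq_iff {φ : HahnSeries ℤ A} :
    (∃ t, D.germValue x t = φ) ↔ IsRegularAt O W x φ := by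
  constructor
  · rintro ⟨t, rfl⟩
    obtain ⟨V, hx, s, rfl⟩ := exists_germAt_eq F t
    rw [D.germValue_germAt]
    exact (D.range V (genericPt_mem hx) _).1 ⟨s, rfl⟩ x hx
  · intro h
    obtain ⟨V, hx, hV⟩ := h.exists_mem_regularOn hOW
    obtain ⟨s, hs⟩ := (D.range V (genericPt_mem hx) _).2 hV
    exact ⟨germAt F hx s, by rw [D.germValue_germAt, hs]⟩

include D in
/-- The stalks are contained in `A((z))`, on which `k((z))` acts without torsion. -/
theorem isTorsionFree : IsTorsionFree F := fun x r m hr h ↦ by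
  have h1 : GeomLattice.germValue x r ≠ 0 := fun h0 ↦ by
    have h2 : r = 0 := GeomLattice.germValue_injective (h0.trans (map_zero _).symm)
    have h3 : (1 : (latticeCurve O).presheaf.stalk x) = 0 := by
      refine hr.1 1 ?_
      rw [h2, zero_mul]
    have h4 := congrArg (GeomLattice.germValue x) h3
    rw [map_one, map_zero] at h4
    exact one_ne_zero h4
  refine D.germValue_injective (act_injective h1 ?_)
  rw [← D.germValue_smul, h, map_zero, act_zero]

end LatticeModel

theorem germValue_stalkMul [SMulCommClass k A A] [IsScalarTower k A A] (hOW : Stabilizes O W)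
    (hW : IsLattice W) (s t : stalkAb (latticeSheaf hOW hW).toModules x) :
    (latticeModel hOW hW).germValue x (stalkMul (latticeSheaf hOW hW) x s t) =
      (latticeModel hOW hW).germValue x s * (latticeModel hOW hW).germValue x t := by
  obtain ⟨V, hx, a, b, rfl, rfl⟩ := exists_germAt_eq₂ (latticeSheaf hOW hW).toModules s t
  have h : stalkMul (latticeSheaf hOW hW) x (germAt _ hx a) (germAt _ hx b) =
      germAt _ hx ((latticeSheaf hOW hW).mul V a b) := stalkMulFun_germAt _ hx a b
  rw [h, LatticeModel.germValue_germAt, LatticeModel.germValue_germAt, LatticeModel.germValue_germAt]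
  exact sectionValue_mul hW.mul_mem (genericPt_mem hx) a b

end Stalks

section Infinity
open TopologicalSpace Opposite HahnSeries
variable {k A : Type u} [Field k] [NonUnitalNonAssocRing A] [Module k A]
  {O : Subalgebra k (HahnSeries ℤ k)} {W : Submodule k (HahnSeries ℤ A)}
  {hO : IsLattice (Subalgebra.toSubmodule O)}

/-- At infinity, the denominator of a power series can be taken with exact pole order, and then the pole
condition on the numerator is automatic. -/
theorem isRegularAt_infinityPt_iff {φ : HahnSeries ℤ A} : IsRegularAt O W (infinityPt hO) φ ↔
    φ ∈ integralPart k A ∧ ∃ α ∈ O, α ≠ 0 ∧ act α φ ∈ W := by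
  constructor
  · intro h
    refine ⟨h.mem_integralPart, ?_⟩
    obtain ⟨n, α, hα, hw, -⟩ := h
    exact ⟨α, hα.1, hα.ne_zero, hw⟩
  · rintro ⟨hφ, α, hα, hα0, hw⟩
    obtain ⟨n, hn, hn0⟩ := hO.exists_pole_order hα hα0
    exact ⟨n, α, isDenom_infinityPt.2 ⟨hα, hn, hn0⟩, hw, by simpa using act_mem_poleLE hn hφ⟩

/-- A uniformizer at infinity: a quotient of elements of `O` of consecutive pole orders. -/
theorem exists_uniformizer (hO : IsLattice (Subalgebra.toSubmodule O)) :
    ∃ f ∈ O, ∃ g ∈ O, f ≠ 0 ∧ g ≠ 0 ∧ g * f⁻¹ ∈ poleLE k k (-1) ∧ (g * f⁻¹).coeff 1 ≠ 0 := by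
  obtain ⟨N, hN⟩ := hO.exists_pole
  obtain ⟨g, hg, hgN, hg1⟩ := hN N le_rfl
  obtain ⟨f, hf, hfN, hf1⟩ := hN (N + 1) (by omega)
  have hf0 : f.coeff (-(N + 1 : ℕ)) ≠ 0 := by
    rw [hf1]
    exact one_ne_zero
  have h1 := inv_mem_poleLE hfN hf0
  have hfne : f ≠ 0 := by
    rintro rfl
    exact hf0 rfl
  have h2 : f⁻¹.coeff (N + 1 : ℕ) = 1 := by
    have := coeff_mul_leading hfN h1
    rw [mul_inv_cancel₀ hfne, hf1, one_mul, neg_neg, add_neg_cancel, neg_zero, coeff_one, if_pos rfl] at this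
    exact this.symm
  refine ⟨f, hf, g, hg, hfne, ?_, ?_, ?_⟩
  · rintro rfl
    rw [coeff_zero] at hg1
    exact zero_ne_one hg1
  · have := mul_mem_poleLE hgN h1
    rwa [show (N : ℤ) + -((N + 1 : ℕ) : ℤ) = -1 by push_cast; ring] at this
  · have := coeff_mul_leading hgN h1
    rw [show -((N : ℤ) + -((N + 1 : ℕ) : ℤ)) = 1 by push_cast; ring, hg1, neg_neg, h2, one_mul] at this
    rw [this]
    exact one_ne_zero

theorem exists_uniformizer_germ (hO : IsLattice (Subalgebra.toSubmodule O)) :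
    ∃ f ∈ O, ∃ g ∈ O, f ≠ 0 ∧ g ≠ 0 ∧ ∃ u : (latticeCurve O).presheaf.stalk (infinityPt hO),
      germValue _ u = g * f⁻¹ ∧ g * f⁻¹ ∈ poleLE k k (-1) ∧ (g * f⁻¹).coeff 1 ≠ 0 := by
  obtain ⟨f, hf, g, hg, hf0, hg0, h1, h2⟩ := exists_uniformizer hO
  obtain ⟨u, hu⟩ := (exists_germValue_eq_iff (x := infinityPt hO) (φ := g * f⁻¹)).2
    (isRegularAt_infinityPt_iff.2 ⟨poleLE_mono (by omega) h1, f, hf, hf0, by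
      rw [act_eq_mul, mul_comm, inv_mul_cancel_right₀ hf0]
      exact hg⟩)
  exact ⟨f, hf, g, hg, hf0, hg0, u, hu, h1, h2⟩

theorem germValue_infinityPt_mem (r : (latticeCurve O).presheaf.stalk (infinityPt hO)) :
    germValue _ r ∈ integralPart k k :=
  (isRegularAt_infinityPt_iff.1 (exists_germValue_eq_iff.1 ⟨r, rfl⟩)).1

/-- The maximal ideal at infinity consists of the series without constant term. -/
theorem mem_maximalIdeal_iff {r : (latticeCurve O).presheaf.stalk (infinityPt hO)} :
    r ∈ IsLocalRing.maximalIdeal ((latticeCurve O).presheaf.stalk (infinityPt hO)) ↔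
      (germValue _ r).coeff 0 = 0 := by
  rw [IsLocalRing.mem_maximalIdeal, mem_nonunits_iff, not_iff_comm]
  constructor
  · intro h
    have hr := germValue_infinityPt_mem r
    have h' : (germValue _ r).coeff (-0) ≠ 0 := by simpa using h
    have hne : germValue _ r ≠ 0 := by
      intro h0
      rw [h0] at h
      exact h rfl
    obtain ⟨-, α, hα, hα0, hα1⟩ :=
      isRegularAt_infinityPt_iff.1 (exists_germValue_eq_iff.1 ⟨r, rfl⟩)
    obtain ⟨s, hs⟩ := (exists_germValue_eq_iff (x := infinityPt hO) (φ := (germValue _ r)⁻¹)).2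
      (isRegularAt_infinityPt_iff.2 ⟨by simpa using inv_mem_poleLE hr h', α * germValue _ r, hα1,
        mul_ne_zero hα0 hne, by
          rw [act_eq_mul, mul_inv_cancel_right₀ hne]
          exact hα⟩)
    refine IsUnit.of_mul_eq_one s (germValue_injective ?_)
    rw [map_mul, hs, map_one, mul_inv_cancel₀ hne]
  · intro hr h0
    obtain ⟨s, h⟩ := hr.exists_right_inv
    have h1 := coeff_zero_mul_of_integral (germValue_infinityPt_mem r) (germValue_infinityPt_mem s)
    rw [← map_mul, h, map_one, h0, zero_mul, coeff_one, if_pos rfl] at h1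
    exact one_ne_zero h1

/-- Division by the `i`-th power of a uniformizer shifts orders by `i`. -/
theorem act_pow_inv_mem_iff {u : HahnSeries ℤ k} (hu : u ∈ poleLE k k (-1)) (hu1 : u.coeff 1 ≠ 0) (i : ℕ)
    {φ : HahnSeries ℤ A} : act (u ^ i)⁻¹ φ ∈ integralPart k A ↔ φ ∈ poleLE k A (-i) := by
  have hu0 : u ≠ 0 := by
    rintro rfl
    exact hu1 rfl
  have key (i : ℕ) : (u ^ i) ∈ poleLE k k (-i) ∧ (u ^ i).coeff (-(-i)) ≠ 0 := by
    induction i with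
    | zero => simp [one_mem_poleLE]
    | succ i ih =>
      rw [pow_succ]
      have h1 := mul_mem_poleLE ih.1 hu
      have h2 := coeff_mul_leading ih.1 hu
      rw [show (-(i : ℤ) + -1) = -((i + 1 : ℕ) : ℤ) by push_cast; ring] at h1 h2
      rw [h2]
      exact ⟨h1, mul_ne_zero ih.2 hu1⟩
  have h1 := act_mem_iff (a := act (u ^ i)⁻¹ φ) (n := 0) (key i).1 (key i).2
  rw [act_act_inv (pow_ne_zero i hu0), add_zero] at h1
  exact h1.symm

/-- Division by a power of a uniformizer. -/
theorem IsRegularAt.act_pow_inv {f g : HahnSeries ℤ k} (hOW : Stabilizes O W) (hf : f ∈ O) (hg : g ∈ O)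
    (hf0 : f ≠ 0) (hg0 : g ≠ 0) (hu : g * f⁻¹ ∈ poleLE k k (-1)) (hu1 : (g * f⁻¹).coeff 1 ≠ 0)
    {φ : HahnSeries ℤ A} {i : ℕ} (hφ : ∃ α ∈ O, α ≠ 0 ∧ GeomLattice.act α φ ∈ W)
    (hi : φ ∈ poleLE k A (-i)) :
    IsRegularAt O W (infinityPt hO) (GeomLattice.act ((g * f⁻¹) ^ i)⁻¹ φ) := by
  obtain ⟨α, hα, hα0, hw⟩ := hφ
  refine isRegularAt_infinityPt_iff.2 ⟨(act_pow_inv_mem_iff hu hu1 i).2 hi, α * g ^ i,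
    O.mul_mem hα (O.pow_mem hg i), mul_ne_zero hα0 (pow_ne_zero i hg0), ?_⟩
  have e : α * g ^ i * ((g * f⁻¹) ^ i)⁻¹ = f ^ i * α := by
    rw [mul_pow, inv_pow]
    field_simp
  rw [act_act, e, ← act_act]
  exact hOW _ (O.pow_mem hf i) _ hw

/-- A uniformizer generates the maximal ideal at infinity. -/
theorem maximalIdeal_eq_span {u : (latticeCurve O).presheaf.stalk (infinityPt hO)} {f g : HahnSeries ℤ k}
    (hf : f ∈ O) (hg : g ∈ O) (hf0 : f ≠ 0) (hg0 : g ≠ 0) (hu : germValue _ u = g * f⁻¹)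
    (hu0 : g * f⁻¹ ∈ poleLE k k (-1)) (hu1 : (g * f⁻¹).coeff 1 ≠ 0) :
    IsLocalRing.maximalIdeal ((latticeCurve O).presheaf.stalk (infinityPt hO)) = Ideal.span {u} := by
  have hne : g * f⁻¹ ≠ 0 := mul_ne_zero hg0 (inv_ne_zero hf0)
  refine le_antisymm (fun r hr ↦ ?_) ((Ideal.span_singleton_le_iff_mem _).2 ?_)
  · have h1 : germValue _ r ∈ poleLE k k (-(1 : ℕ)) :=
      mem_poleLE_pred (n := 0) (germValue_infinityPt_mem r) (by simpa using mem_maximalIdeal_iff.1 hr)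
    obtain ⟨s, hs⟩ := exists_germValue_eq_iff.2 (IsRegularAt.act_pow_inv (hO := hO)
      (stabilizes_toSubmodule O) hf hg hf0 hg0 hu0 hu1
      (isRegularAt_infinityPt_iff.1 (exists_germValue_eq_iff.1 ⟨r, rfl⟩)).2 h1)
    refine Ideal.mem_span_singleton'.2 ⟨s, germValue_injective ?_⟩
    rw [map_mul, hs, hu, act_eq_mul, pow_one, mul_right_comm, inv_mul_cancel₀ hne, one_mul]
  · rw [mem_maximalIdeal_iff, hu]
    exact hu0 0 (by norm_num)

/-- Every power series is a fraction `w / α` up to order `i`. -/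
theorem exists_isRegularAt_sub_mem (hO : IsLattice (Subalgebra.toSubmodule O)) (hOW : Stabilizes O W)
    (hW : IsLattice W) (i : ℕ) {φ : HahnSeries ℤ A} (hφ : φ ∈ integralPart k A) :
    ∃ χ, IsRegularAt O W (infinityPt hO) χ ∧ χ - φ ∈ poleLE k A (-i) := by
  obtain ⟨f, hf, g, hg, hf0, hg0, hu, hu1⟩ := exists_uniformizer hO
  have hne : (g * f⁻¹) ^ i ≠ 0 := pow_ne_zero i (mul_ne_zero hg0 (inv_ne_zero hf0))
  obtain ⟨n, q, hq, hn, hn0, h0, -⟩ :=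
    exists_leading_basicOpenOf_le (show infinityPt hO ∈ (⊤ : (latticeCurve O).Opens) from trivial)
  obtain ⟨a, ha, m, hm⟩ := hW.exists_fraction hn0 hn h0 (act ((g * f⁻¹) ^ i)⁻¹ φ)
  have hq0 : q ≠ 0 := by
    rintro rfl
    exact h0 rfl
  have h1 : act ((g * f⁻¹) ^ i) a ∈ poleLE k A (-i) := by
    rw [← act_pow_inv_mem_iff hu hu1, act_inv_act hne]
    exact ha
  refine ⟨φ - act ((g * f⁻¹) ^ i) a, isRegularAt_infinityPt_iff.2
    ⟨sub_mem hφ (poleLE_mono (by omega) h1), f ^ i * q ^ m,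
      O.mul_mem (O.pow_mem hf i) (O.pow_mem hq m), mul_ne_zero (pow_ne_zero i hf0) (pow_ne_zero m hq0), ?_⟩, ?_⟩
  · have e : φ - act ((g * f⁻¹) ^ i) a = act ((g * f⁻¹) ^ i) (act ((g * f⁻¹) ^ i)⁻¹ φ - a) := by
      rw [act_sub, act_act_inv hne]
    have e' : f ^ i * q ^ m * (g * f⁻¹) ^ i = g ^ i * q ^ m := by
      rw [mul_pow, inv_pow]
      field_simp
    rw [e, act_act, e', ← act_act]
    exact hOW _ (O.pow_mem hg i) _ hm
  · rw [sub_sub_cancel_left]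
    exact neg_mem h1

/-- The local ring at infinity is dense in `k[[z]]`, and its powers of the maximal ideal are cut out by the
order of vanishing. -/
theorem isAdicModel_germValue (hO : IsLattice (Subalgebra.toSubmodule O)) :
    IsAdicModel k (IsLocalRing.maximalIdeal ((latticeCurve O).presheaf.stalk (infinityPt hO)))
      (germValue (infinityPt hO) : (latticeCurve O).presheaf.stalk (infinityPt hO) →+ HahnSeries ℤ k) where
  mem_iff i r := by
    obtain ⟨f, hf, g, hg, hf0, hg0, u, hu, hu0, hu1⟩ := exists_uniformizer_germ hO
    have hne : (g * f⁻¹) ^ i ≠ 0 := pow_ne_zero i (mul_ne_zero hg0 (inv_ne_zero hf0))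
    rw [maximalIdeal_eq_span hf hg hf0 hg0 hu hu0 hu1, Ideal.span_singleton_pow,
      Submodule.ideal_span_singleton_smul, Submodule.mem_smul_pointwise_iff_exists]
    constructor
    · intro h
      obtain ⟨s, hs⟩ := exists_germValue_eq_iff.2 (IsRegularAt.act_pow_inv (hO := hO)
        (stabilizes_toSubmodule O) hf hg hf0 hg0 hu0 hu1
        (isRegularAt_infinityPt_iff.1 (exists_germValue_eq_iff.1 ⟨r, rfl⟩)).2 h)
      refine ⟨s, trivial, germValue_injective ?_⟩
      rw [smul_eq_mul, map_mul, map_pow, hu, hs]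
      exact act_act_inv hne _
    · rintro ⟨s, -, rfl⟩
      rw [← act_pow_inv_mem_iff hu0 hu1]
      have e : germValue (infinityPt hO) (u ^ i • s) = act ((g * f⁻¹) ^ i) (germValue _ s) := by
        rw [smul_eq_mul, map_mul, map_pow, hu, act_eq_mul]
      change act _ (germValue (infinityPt hO) (u ^ i • s)) ∈ _
      rw [e, act_inv_act hne]
      exact germValue_infinityPt_mem s
  exists_approx i φ hφ := by
    obtain ⟨χ, hχ, h⟩ := exists_isRegularAt_sub_mem hO (stabilizes_toSubmodule O) hO i hφ
    obtain ⟨r, rfl⟩ := exists_germValue_eq_iff.2 hχ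
    exact ⟨r, h⟩

/-- The stalk at infinity is dense in `A[[z]]`, and its adic filtration is given by the order of vanishing. -/
theorem LatticeModel.isAdicModel_germValue {F : (latticeCurve O).Modules} {hOW : Stabilizes O W}
    (D : LatticeModel F hOW) (hO : IsLattice (Subalgebra.toSubmodule O)) (hW : IsLattice W) :
    IsAdicModel k (IsLocalRing.maximalIdeal ((latticeCurve O).presheaf.stalk (infinityPt hO)))
      (D.germValue (infinityPt hO)) where
  mem_iff i t := by
    obtain ⟨f, hf, g, hg, hf0, hg0, u, hu, hu0, hu1⟩ := exists_uniformizer_germ hO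
    have hne : (g * f⁻¹) ^ i ≠ 0 := pow_ne_zero i (mul_ne_zero hg0 (inv_ne_zero hf0))
    rw [maximalIdeal_eq_span hf hg hf0 hg0 hu hu0 hu1, Ideal.span_singleton_pow,
      Submodule.ideal_span_singleton_smul, Submodule.mem_smul_pointwise_iff_exists]
    constructor
    · intro h
      obtain ⟨s, hs⟩ := D.exists_germValue_eq_iff.2 (IsRegularAt.act_pow_inv (hO := hO)
        hOW hf hg hf0 hg0 hu0 hu1
        (isRegularAt_infinityPt_iff.1 (D.exists_germValue_eq_iff.1 ⟨t, rfl⟩)).2 h)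
      refine ⟨s, trivial, D.germValue_injective ?_⟩
      rw [D.germValue_smul, map_pow, hu, hs]
      exact act_act_inv hne _
    · rintro ⟨s, -, rfl⟩
      rw [← act_pow_inv_mem_iff hu0 hu1, D.germValue_smul, map_pow, hu, act_inv_act hne]
      exact (isRegularAt_infinityPt_iff.1 (D.exists_germValue_eq_iff.1 ⟨s, rfl⟩)).1
  exists_approx i φ hφ := by
    obtain ⟨χ, hχ, h⟩ := exists_isRegularAt_sub_mem hO hOW hW i hφ
    obtain ⟨t, rfl⟩ := D.exists_germValue_eq_iff.2 hχ
    exact ⟨t, h⟩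

/-- The completed local ring at infinity is `k[[z]]`. -/
noncomputable def completedLocalRingEquiv (hO : IsLattice (Subalgebra.toSubmodule O)) :
    CompletedLocalRing (infinityPt hO) ≃+* PowerSeries k := (isAdicModel_germValue hO).ringEquiv

theorem ofPowerSeries_completedLocalRingEquiv {V : (latticeCurve O).Opens} (hV : infinityPt hO ∈ V)
    (b : Γ(latticeCurve O, V)) :
    ofPowerSeries ℤ k (completedLocalRingEquiv hO (completedGerm hV b)) =
      functionValue (genericPt_mem hV) b :=
  ((isAdicModel_germValue hO).ofPowerSeries_ringEquiv_of _).trans (germValue_germ hV b)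

theorem completedLocalRingEquiv_scalars (a : k) :
    completedLocalRingEquiv hO (completedGerm (Set.mem_univ _ : infinityPt hO ∈
      (⊤ : (latticeCurve O).Opens)) (scalars (latticeCurveHom O) ⊤ a)) = PowerSeries.C a := by
  refine ofPowerSeries_injective (Γ := ℤ) ?_
  rw [ofPowerSeries_completedLocalRingEquiv, functionValue_scalars, ofPowerSeries_C]

/-- Over a nonempty open subset, a power of a uniformizer turns a series into a regular one near infinity. -/
theorem exists_regular_multiple (hOW : Stabilizes O W) {φ : HahnSeries ℤ A}
    (hφ : ∃ α ∈ O, α ≠ 0 ∧ act α φ ∈ W) : ∃ (V : (latticeCurve O).Opens) (_ : infinityPt hO ∈ V)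
      (b : HahnSeries ℤ k), b ≠ 0 ∧ b ∈ regularOn (stabilizes_toSubmodule O) V ∧ act b φ ∈ regularOn hOW V := by
  obtain ⟨f, hf, g, hg, hf0, hg0, hu, hu1⟩ := exists_uniformizer hO
  obtain ⟨i, hi⟩ := exists_mem_poleLE (k := k) φ
  have hne : g * f⁻¹ ≠ 0 := mul_ne_zero hg0 (inv_ne_zero hf0)
  have hint : g * f⁻¹ ∈ integralPart k k := poleLE_mono (by omega) hu
  have e : f ^ i * (g * f⁻¹) ^ i = g ^ i := by
    rw [mul_pow, inv_pow]
    field_simp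
  have h1 : IsRegularAt O (Subalgebra.toSubmodule O) (infinityPt hO) ((g * f⁻¹) ^ i) :=
    isRegularAt_infinityPt_iff.2 ⟨(integralSubalgebra k).pow_mem hint i, f ^ i, O.pow_mem hf i,
      pow_ne_zero i hf0, by
        rw [act_eq_mul, e]
        exact O.pow_mem hg i⟩
  have h2 : IsRegularAt O W (infinityPt hO) (act ((g * f⁻¹) ^ i) φ) := by
    obtain ⟨α, hα, hα0, hw⟩ := hφ
    refine isRegularAt_infinityPt_iff.2 ⟨?_, f ^ i * α, O.mul_mem (O.pow_mem hf i) hα,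
      mul_ne_zero (pow_ne_zero i hf0) hα0, ?_⟩
    · have h3 : (g * f⁻¹) ^ i ∈ poleLE k k (-i) := by
        rw [← act_pow_inv_mem_iff hu hu1, act_eq_mul, inv_mul_cancel₀ (pow_ne_zero i hne)]
        exact one_mem_poleLE le_rfl
      simpa using act_mem_poleLE h3 hi
    · rw [act_act, mul_right_comm, e, ← act_act]
      exact hOW _ (O.pow_mem hg i) _ hw
  obtain ⟨V, hV, hb⟩ := h1.exists_mem_regularOn (stabilizes_toSubmodule O)
  obtain ⟨V', hV', ha⟩ := h2.exists_mem_regularOn hOW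
  exact ⟨V ⊓ V', ⟨hV, hV'⟩, _, pow_ne_zero i hne, regularOn_anti _ inf_le_left hb,
    regularOn_anti _ inf_le_right ha⟩

/-- The extension of the isomorphism of the completed local ring with `k[[z]]` to the fields of fractions
sends a function to its series. -/
theorem isExpansion_iff {U : (latticeCurve O).Opens} (hU : genericPt O ∈ U) {s : Γ(latticeCurve O, U)}
    {φ : HahnSeries ℤ k} :
    IsExpansion (completedLocalRingEquiv hO) s φ ↔ φ = functionValue hU s := by
  have hη {V : (latticeCurve O).Opens} (hV : infinityPt hO ∈ V) : genericPt O ∈ U ⊓ V :=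
    ⟨hU, genericPt_mem hV⟩
  constructor
  · rintro ⟨V, hV, a, b, hab, hb, h⟩
    rw [ofPowerSeries_completedLocalRingEquiv, ofPowerSeries_completedLocalRingEquiv] at h
    have hb' : functionValue (genericPt_mem hV) b ≠ 0 := by
      rw [← ofPowerSeries_completedLocalRingEquiv (hO := hO) hV]
      exact fun h0 ↦ hb (ofPowerSeries_injective (h0.trans (map_zero _).symm))
    refine mul_left_cancel₀ hb' (h.trans ?_)
    have h1 := congrArg (functionValue (hη hV)) hab
    rwa [map_mul, functionValue_res, functionValue_res, functionValue_res] at h1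
  · rintro rfl
    obtain ⟨n, α, hα, hα1, -⟩ := (exists_functionValue_eq_iff hU).1 ⟨s, rfl⟩ _ hU
    obtain ⟨V, hV, b, hb0, hb, ha⟩ := exists_regular_multiple (hO := hO) (stabilizes_toSubmodule O)
      ⟨α, hα.1, hα.ne_zero, hα1⟩
    obtain ⟨b, rfl⟩ := (exists_functionValue_eq_iff (genericPt_mem hV)).2 hb
    obtain ⟨a, ha⟩ := (exists_functionValue_eq_iff (genericPt_mem hV)).2 ha
    refine ⟨V, hV, a, b, functionValue_injective (hη hV) ?_, fun h0 ↦ hb0 ?_, ?_⟩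
    · rw [map_mul, functionValue_res _ _ (genericPt_mem hV), functionValue_res _ _ (genericPt_mem hV),
        functionValue_res _ _ hU, ha, act_eq_mul]
    · rw [← ofPowerSeries_completedLocalRingEquiv (hO := hO) hV, h0, map_zero]
    · rw [ofPowerSeries_completedLocalRingEquiv, ofPowerSeries_completedLocalRingEquiv, ha, act_eq_mul]

namespace LatticeModel
variable {F : (latticeCurve O).Modules} {hOW : Stabilizes O W} (D : LatticeModel F hOW) (hW : IsLattice W)

/-- The completed stalk at infinity is `A[[z]]`. -/
noncomputable def completedStalkEquiv (hO : IsLattice (Subalgebra.toSubmodule O)) :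
    CompletedStalk F (infinityPt hO) ≃+ integralPart k A := (D.isAdicModel_germValue hO hW).equiv

theorem completedStalkEquiv_germ {V : (latticeCurve O).Opens} (hV : infinityPt hO ∈ V) (a : Γ(F, V)) :
    (D.completedStalkEquiv hW hO (completedGermAt F hV a) : HahnSeries ℤ A) =
      D.val V (genericPt_mem hV) a :=
  ((D.isAdicModel_germValue hO hW).equiv_of _).trans (D.germValue_germAt hV a)

theorem completedStalkEquiv_smul (r : CompletedLocalRing (infinityPt hO))
    (m : CompletedStalk F (infinityPt hO)) :
    (D.completedStalkEquiv hW hO (r • m) : HahnSeries ℤ A) =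
      act (ofPowerSeries ℤ k (completedLocalRingEquiv hO r)) (D.completedStalkEquiv hW hO m) := by
  have h1 := (GeomLattice.isAdicModel_germValue hO).ofPowerSeries_ringEquiv r
  rw [show ofPowerSeries ℤ k (completedLocalRingEquiv hO r) = _ from h1]
  exact (D.isAdicModel_germValue hO hW).equiv_smul (GeomLattice.isAdicModel_germValue hO) D.germValue_smul r m

/-- The extension of the isomorphism of the completed stalk with `A[[z]]` sends a section to its series. -/
theorem isModExpansion_iff {U : (latticeCurve O).Opens} (hU : genericPt O ∈ U) {s : Γ(F, U)}
    {φ : HahnSeries ℤ A} :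
    IsModExpansion (completedLocalRingEquiv hO) (D.completedStalkEquiv hW hO) s φ ↔ φ = D.val U hU s := by
  have hη {V : (latticeCurve O).Opens} (hV : infinityPt hO ∈ V) : genericPt O ∈ U ⊓ V :=
    ⟨hU, genericPt_mem hV⟩
  constructor
  · rintro ⟨V, hV, a, b, hab, hb, h⟩
    rw [ofPowerSeries_completedLocalRingEquiv, completedStalkEquiv_germ] at h
    have hb' : functionValue (genericPt_mem hV) b ≠ 0 := by
      rw [← ofPowerSeries_completedLocalRingEquiv (hO := hO) hV]
      exact fun h0 ↦ hb (ofPowerSeries_injective (h0.trans (map_zero _).symm))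
    refine act_injective hb' (h.trans ?_)
    have h1 := congrArg (D.val _ (hη hV)) hab
    rwa [D.smul, D.res _ (hη hV) (genericPt_mem hV), D.res _ (hη hV) hU, functionValue_res] at h1
  · rintro rfl
    obtain ⟨n, α, hα, hα1, -⟩ := (D.range U hU _).1 ⟨s, rfl⟩ _ hU
    obtain ⟨V, hV, b, hb0, hb, ha⟩ := exists_regular_multiple (hO := hO) hOW
      ⟨α, hα.1, hα.ne_zero, hα1⟩
    obtain ⟨b, rfl⟩ := (exists_functionValue_eq_iff (genericPt_mem hV)).2 hb
    obtain ⟨a, ha⟩ := (D.range V (genericPt_mem hV) _).2 ha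
    refine ⟨V, hV, a, b, D.injective _ (hη hV) ?_, fun h0 ↦ hb0 ?_, ?_⟩
    · rw [D.smul, D.res _ (hη hV) (genericPt_mem hV), D.res _ (hη hV) hU, functionValue_res, ha]
    · rw [← ofPowerSeries_completedLocalRingEquiv (hO := hO) hV, h0, map_zero]
    · rw [ofPowerSeries_completedLocalRingEquiv, completedStalkEquiv_germ, ha]

end LatticeModel

theorem completedStalkEquiv_mul [SMulCommClass k A A] [IsScalarTower k A A] (hOW : Stabilizes O W)
    (hW : IsLattice W) (a b : CompletedStalk (latticeSheaf hOW hW).toModules (infinityPt hO)) :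
    ((latticeModel hOW hW).completedStalkEquiv hW hO (completedMul (latticeSheaf hOW hW) a b) :
      HahnSeries ℤ A) = (latticeModel hOW hW).completedStalkEquiv hW hO a *
        (latticeModel hOW hW).completedStalkEquiv hW hO b :=
  ((latticeModel hOW hW).isAdicModel_germValue hO hW).equiv_completionMul
    (germValue_stalkMul hOW hW) a b

end Infinity

/-! ### Charts of a morphism to a projective scheme -/

section ProjectiveChart
open TopologicalSpace Opposite HahnSeries HomogeneousLocalization
variable {k S : Type u} [Field k] [CommRing S] [Algebra k S] (𝒮 : ℕ → Submodule k S) [GradedAlgebra 𝒮]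
  (Φ : S →ₐ[k] HahnSeries ℤ k) {e : ℕ} {a : S}

/-- The homomorphism `s / aⁿ ↦ Φ(s) / Φ(a)ⁿ`. -/
noncomputable def awayValue (h0 : Φ a ≠ 0) : Away 𝒮 a →+* HahnSeries ℤ k :=
  (IsLocalization.Away.lift (S := Localization.Away a) a (g := Φ.toRingHom)
    (IsUnit.mk0 (Φ a) h0)).comp (algebraMap (Away 𝒮 a) (Localization.Away a))

variable {𝒮}

theorem awayValue_mk (h0 : Φ a ≠ 0) (ha : a ∈ 𝒮 e) (n : ℕ) (s : S) (hs : s ∈ 𝒮 (n • e)) :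
    awayValue 𝒮 Φ h0 (Away.mk 𝒮 ha n s hs) = Φ s / Φ a ^ n := by
  have h1 : awayValue 𝒮 Φ h0 (Away.mk 𝒮 ha n s hs) =
      IsLocalization.Away.lift (S := Localization.Away a) a (g := Φ.toRingHom) (IsUnit.mk0 (Φ a) h0)
        (Away.mk 𝒮 ha n s hs).val := rfl
  rw [h1, Away.val_mk, Localization.mk_eq_mk', IsLocalization.Away.lift, IsLocalization.lift_mk'_spec,
    eq_comm]
  have h2 : Φ a ^ n ≠ 0 := pow_ne_zero n h0
  change Φ (a ^ n) * (Φ s / Φ a ^ n) = Φ s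
  rw [map_pow]
  field_simp

theorem awayValue_awayMap {b x : S} {e' : ℕ} (hb : b ∈ 𝒮 e') (hx : x = a * b) (ha : a ∈ 𝒮 e)
    (h0 : Φ a ≠ 0) (h0' : Φ x ≠ 0) (q : Away 𝒮 a) :
    awayValue 𝒮 Φ h0' (awayMap 𝒮 hb hx q) = awayValue 𝒮 Φ h0 q := by
  obtain ⟨n, s, hs, rfl⟩ := Away.mk_surjective 𝒮 ha q
  rw [awayMap_mk, awayValue_mk, awayValue_mk, hx, map_mul, map_pow, map_mul, mul_pow]
  have h1 : Φ b ≠ 0 := by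
    rintro h
    exact h0' (by rw [hx, map_mul, h, mul_zero])
  field_simp

theorem awayValue_fromZero (h0 : Φ a ≠ 0) (c : k) :
    awayValue 𝒮 Φ h0 (fromZeroRingHom 𝒮 _ (algebraMap k (𝒮 0) c)) = C c := by
  have h1 : awayValue 𝒮 Φ h0 (fromZeroRingHom 𝒮 _ (algebraMap k (𝒮 0) c)) =
      IsLocalization.Away.lift (S := Localization.Away a) a (g := Φ.toRingHom) (IsUnit.mk0 (Φ a) h0)
        (Localization.mk (algebraMap k S c) 1) := rfl
  rw [h1, Localization.mk_one_eq_algebraMap, IsLocalization.Away.lift_eq]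
  exact Φ.commutes c

variable {O : Subalgebra k (HahnSeries ℤ k)} {d : ℕ}
  (hΦ : ∀ m, ∀ s ∈ 𝒮 m, Φ s ∈ O ∧ Φ s ∈ poleLE k k (d * m : ℕ))
  {V : (latticeCurve O).Opens} (hV : genericPt O ∈ V)
include hΦ hV

/-- If `Φ` maps degree `m` to pole order at most `d * m`, the values of fractions are regular where `Φ(a)`
does not vanish. -/
theorem awayValue_mem_range (ha : a ∈ 𝒮 e) (hden : ∀ x ∈ V, IsDenom x (d * e) (Φ a)) (q : Away 𝒮 a) :
    awayValue 𝒮 Φ (hden _ hV).ne_zero q ∈ (functionValue hV).range := by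
  refine (exists_functionValue_eq_iff hV).2 fun x hx ↦ ?_
  obtain ⟨n, s, hs, rfl⟩ := Away.mk_surjective 𝒮 ha q
  refine ⟨d * e * n, Φ a ^ n, (hden x hx).pow n, ?_⟩
  rw [awayValue_mk, act_eq_mul, mul_div_cancel₀ _ (pow_ne_zero n (hden _ hV).ne_zero)]
  refine ⟨(hΦ _ s hs).1, ?_⟩
  have := (hΦ _ s hs).2
  rwa [smul_eq_mul, mul_comm n, ← mul_assoc] at this

/-- The pullback of functions from `D₊(a)` along the morphism to `Proj 𝒮` that is given by `Φ`. -/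
noncomputable def chartRingHom (ha : a ∈ 𝒮 e) (hden : ∀ x ∈ V, IsDenom x (d * e) (Φ a)) :
    Away 𝒮 a →+* Γ(latticeCurve O, V) :=
  ((RingEquiv.ofBijective (functionValue hV).rangeRestrict
    ⟨fun _ _ h ↦ functionValue_injective hV (congrArg Subtype.val h),
      (functionValue hV).rangeRestrict_surjective⟩).symm.toRingHom.comp
    ((awayValue 𝒮 Φ (hden _ hV).ne_zero).codRestrict _ (awayValue_mem_range Φ hΦ hV ha hden)))

theorem functionValue_chartRingHom (ha : a ∈ 𝒮 e) (hden : ∀ x ∈ V, IsDenom x (d * e) (Φ a))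
    (q : Away 𝒮 a) : functionValue hV (chartRingHom Φ hΦ hV ha hden q) =
      awayValue 𝒮 Φ (hden _ hV).ne_zero q :=
  congrArg Subtype.val (RingEquiv.apply_symm_apply (RingEquiv.ofBijective (functionValue hV).rangeRestrict
    ⟨fun _ _ h ↦ functionValue_injective hV (congrArg Subtype.val h),
      (functionValue hV).rangeRestrict_surjective⟩) _)

/-- The morphism `V ⟶ Proj 𝒮` with image in `D₊(a)` that is given by `Φ`. -/
noncomputable def chart (ha : a ∈ 𝒮 e) (he : 0 < e) (hden : ∀ x ∈ V, IsDenom x (d * e) (Φ a)) :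
    V.toScheme ⟶ Proj 𝒮 :=
  V.toSpecΓ ≫ Spec.map (CommRingCat.ofHom (R := Away 𝒮 a) (S := Γ(latticeCurve O, V))
    (chartRingHom Φ hΦ hV ha hden)) ≫ Proj.awayι 𝒮 a ha he

/-- The chart attached to `a` restricts to the chart attached to a multiple of `a`. -/
theorem homOfLE_chart {V' : (latticeCurve O).Opens} (h : V' ≤ V) (hV' : genericPt O ∈ V')
    {b x : S} {e' : ℕ} (hb : b ∈ 𝒮 e') (hxab : x = a * b) (ha : a ∈ 𝒮 e) (he : 0 < e)
    (hden : ∀ x ∈ V, IsDenom x (d * e) (Φ a)) (hx : x ∈ 𝒮 (e + e'))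
    (hden' : ∀ y ∈ V', IsDenom y (d * (e + e')) (Φ x)) :
    (latticeCurve O).homOfLE h ≫ chart Φ hΦ hV ha he hden =
      chart Φ hΦ hV' hx (Nat.add_pos_left he e') hden' := by
  have h1 : (latticeCurve O).homOfLE h ≫ V.toSpecΓ =
      V'.toSpecΓ ≫ Spec.map ((latticeCurve O).presheaf.map (homOfLE h).op) :=
    (Scheme.Opens.toSpecΓ_SpecMap_presheaf_map V' V h).symm
  have h2 : CommRingCat.ofHom (R := Away 𝒮 a) (S := Γ(latticeCurve O, V))
      (chartRingHom Φ hΦ hV ha hden) ≫ (latticeCurve O).presheaf.map (homOfLE h).op =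
      CommRingCat.ofHom (awayMap 𝒮 hb hxab) ≫ CommRingCat.ofHom (R := Away 𝒮 x) (S := Γ(latticeCurve O, V'))
      (chartRingHom Φ hΦ hV' hx hden') := by
    refine CommRingCat.hom_ext (RingHom.ext fun q ↦ functionValue_injective hV' ?_)
    change functionValue hV' ((latticeCurve O).presheaf.map (homOfLE h).op
      (chartRingHom Φ hΦ hV ha hden q)) =
        functionValue hV' (chartRingHom Φ hΦ hV' hx hden' (awayMap 𝒮 hb hxab q))
    rw [functionValue_res (homOfLE h) hV' hV, functionValue_chartRingHom, functionValue_chartRingHom,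
      awayValue_awayMap Φ hb hxab ha (hden _ hV).ne_zero]
  rw [chart, chart, reassoc_of% h1, ← Spec.map_comp_assoc, h2, Spec.map_comp_assoc,
    Proj.SpecMap_awayMap_awayι]

omit hV hΦ in
/-- A morphism to `Spec k` is given on `U` by the scalars in the ring of functions on `U`. -/
theorem ι_comp_eq_scalars {X : Scheme.{u}} (f : X ⟶ Spec (.of k)) (U : X.Opens) :
    U.ι ≫ f = U.toSpecΓ ≫ Spec.map (CommRingCat.ofHom (R := k) (S := Γ(X, U)) (scalars f U)) := by
  refine ext_to_Spec ?_
  change (Scheme.ΓSpecIso (.of k)).inv ≫ (U.ι ≫ f).appTop = (Scheme.ΓSpecIso (.of k)).inv ≫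
      (U.toSpecΓ ≫ Spec.map (CommRingCat.ofHom (R := k) (S := Γ(X, U)) (scalars f U))).appTop
  rw [Scheme.Hom.comp_appTop, Scheme.Hom.comp_appTop, ← Scheme.ΓSpecIso_inv_naturality_assoc,
    Scheme.Opens.toSpecΓ_appTop, Iso.inv_hom_id_assoc, ι_appTop_eq]
  simp only [← Category.assoc]
  rfl

theorem chart_comp_projToSpec (ha : a ∈ 𝒮 e) (he : 0 < e) (hden : ∀ x ∈ V, IsDenom x (d * e) (Φ a)) :
    chart Φ hΦ hV ha he hden ≫ projToSpec 𝒮 = V.ι ≫ latticeCurveHom O := by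
  rw [ι_comp_eq_scalars, projToSpec, chart, Category.assoc, Category.assoc, Proj.awayι_toSpecZero_assoc,
    ← Spec.map_comp, ← Spec.map_comp]
  congr 2
  refine CommRingCat.hom_ext (RingHom.ext fun c ↦ functionValue_injective hV ?_)
  exact (functionValue_chartRingHom Φ hΦ hV ha hden _).trans
    ((awayValue_fromZero Φ _ c).trans (functionValue_scalars hV c).symm)

end ProjectiveChart

/-! ### Morphisms to projective schemes -/

section ToProj
open TopologicalSpace Opposite HahnSeries HomogeneousLocalization
variable {k S : Type u} [Field k] [CommRing S] [Algebra k S] {𝒮 : ℕ → Submodule k S} [GradedAlgebra 𝒮]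
  (Φ : S →ₐ[k] HahnSeries ℤ k) {ι : Type*} {a : ι → S}
  {O : Subalgebra k (HahnSeries ℤ k)} {d : ℕ}
  (hΦ : ∀ m, ∀ s ∈ 𝒮 m, Φ s ∈ O ∧ Φ s ∈ poleLE k k (d * m : ℕ))
  (ha : ∀ i, a i ∈ 𝒮 1) (h0 : ∀ i, Φ (a i) ≠ 0)

/-- The inverse image of `D₊(aᵢ)`. -/
noncomputable def chartOpen (i : ι) : (latticeCurve O).Opens :=
  basicOpenOf (d * 1) (Φ (a i)) (hΦ 1 _ (ha i)).1 (hΦ 1 _ (ha i)).2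

omit [GradedAlgebra 𝒮] in
theorem mem_chartOpen {i : ι} {x : latticeCurve O} :
    x ∈ chartOpen Φ hΦ ha i ↔ IsDenom x (d * 1) (Φ (a i)) := mem_basicOpenOf

omit [GradedAlgebra 𝒮] in
include h0 in
theorem genericPt_mem_chartOpen (i : ι) : genericPt O ∈ chartOpen Φ hΦ ha i :=
  (mem_chartOpen Φ hΦ ha).2 (isDenom_genericPt (hΦ 1 _ (ha i)).1 (hΦ 1 _ (ha i)).2 (h0 i))

/-- The restriction of `toProj` to the inverse image of `D₊(aᵢ)`. -/
noncomputable def chartAt (i : ι) : (chartOpen Φ hΦ ha i).toScheme ⟶ Proj 𝒮 :=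
  chart Φ hΦ (genericPt_mem_chartOpen Φ hΦ ha h0 i) (ha i) one_pos
    fun _ hx ↦ (mem_chartOpen Φ hΦ ha).1 hx

variable (hcov : IsOpenCover (chartOpen Φ hΦ ha))

include h0 in
/-- On overlaps, both charts are the chart attached to `aᵢ aⱼ`. -/
theorem homOfLE_chartAt (i j : ι) :
    (latticeCurve O).homOfLE (inf_le_left : chartOpen Φ hΦ ha i ⊓ chartOpen Φ hΦ ha j ≤ _) ≫
      chartAt Φ hΦ ha h0 i =
    (latticeCurve O).homOfLE (inf_le_right : chartOpen Φ hΦ ha i ⊓ chartOpen Φ hΦ ha j ≤ _) ≫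
      chartAt Φ hΦ ha h0 j := by
  have hη : genericPt O ∈ chartOpen Φ hΦ ha i ⊓ chartOpen Φ hΦ ha j :=
    ⟨genericPt_mem_chartOpen Φ hΦ ha h0 i, genericPt_mem_chartOpen Φ hΦ ha h0 j⟩
  have hden (y : latticeCurve O) (hy : y ∈ chartOpen Φ hΦ ha i ⊓ chartOpen Φ hΦ ha j) :
      IsDenom y (d * (1 + 1)) (Φ (a i * a j)) := by
    rw [map_mul, mul_add]
    exact ((mem_chartOpen Φ hΦ ha).1 hy.1).mul ((mem_chartOpen Φ hΦ ha).1 hy.2)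
  have hx : a i * a j ∈ 𝒮 (1 + 1) := SetLike.mul_mem_graded (ha i) (ha j)
  exact (homOfLE_chart Φ hΦ _ inf_le_left hη (ha j) rfl (ha i) one_pos _ hx hden).trans
    (homOfLE_chart Φ hΦ _ inf_le_right hη (ha i) (mul_comm _ _) (ha j) one_pos _ hx hden).symm

/-- The morphism to `Proj 𝒮` that is given by a graded homomorphism `Φ` from `𝒮` to the `d`-th Veronese
subalgebra of `gr(O)`. -/
noncomputable def toProj : latticeCurve O ⟶ Proj 𝒮 :=
  ((latticeCurve O).openCoverOfIsOpenCover _ hcov).glueMorphisms (chartAt Φ hΦ ha h0) fun i j ↦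
    (cancel_epi (isPullback_opens_inf (chartOpen Φ hΦ ha i) (chartOpen Φ hΦ ha j)).isoPullback.hom).1 <|
      (((isPullback_opens_inf (chartOpen Φ hΦ ha i) (chartOpen Φ hΦ ha j)).isoPullback_hom_fst_assoc _).trans
      (homOfLE_chartAt Φ hΦ ha h0 i j)).trans
      ((isPullback_opens_inf (chartOpen Φ hΦ ha i) (chartOpen Φ hΦ ha j)).isoPullback_hom_snd_assoc _).symm

theorem ι_toProj (i : ι) :
    (chartOpen Φ hΦ ha i).ι ≫ toProj Φ hΦ ha h0 hcov = chartAt Φ hΦ ha h0 i :=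
  ((latticeCurve O).openCoverOfIsOpenCover _ hcov).ι_glueMorphisms (chartAt Φ hΦ ha h0) _ i

theorem toProj_comp_projToSpec :
    toProj Φ hΦ ha h0 hcov ≫ projToSpec 𝒮 = latticeCurveHom O := by
  refine ((latticeCurve O).openCoverOfIsOpenCover _ hcov).hom_ext _ _ fun i ↦ ?_
  refine ((reassoc_of% ι_toProj Φ hΦ ha h0 hcov i) _).trans ?_
  exact chart_comp_projToSpec Φ hΦ _ (ha i) one_pos _

/-- On the inverse image of `D₊(aⱼ)`, the function `aᵢ / aⱼ` has the value `Φ(aᵢ) / Φ(aⱼ)`, and it is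
invertible exactly where `Φ(aᵢ)` is a denominator. -/
theorem toProj_preimage_basicOpen (i : ι) :
    toProj Φ hΦ ha h0 hcov ⁻¹ᵁ Proj.basicOpen 𝒮 (a i) = chartOpen Φ hΦ ha i := by
  refine le_antisymm (fun x hx ↦ ?_) fun x hx ↦ ?_
  · obtain ⟨j, hj⟩ := Opens.mem_iSup.1 (hcov.ge (Opens.mem_top x))
    have h1 : (chartAt Φ hΦ ha h0 j) ⟨x, hj⟩ ∈ Proj.basicOpen 𝒮 (a i) := by
      rw [← ι_toProj Φ hΦ ha h0 hcov j]
      exact hx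
    have hη := genericPt_mem_chartOpen Φ hΦ ha h0 j
    have h2 : (chartOpen Φ hΦ ha j).toSpecΓ ⟨x, hj⟩ ∈ Spec.map (CommRingCat.ofHom (R := Away 𝒮 (a j))
        (S := Γ(latticeCurve O, chartOpen Φ hΦ ha j)) (chartRingHom Φ hΦ hη (ha j)
          fun _ hx ↦ (mem_chartOpen Φ hΦ ha).1 hx)) ⁻¹ᵁ
        (Proj.awayι 𝒮 (a j) (ha j) one_pos ⁻¹ᵁ Proj.basicOpen 𝒮 (a i)) := h1
    rw [Proj.awayι_preimage_basicOpen 𝒮 (ha j) one_pos (ha i) one_pos] at h2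
    -- `q` is the function `aᵢ / aⱼ` and `r` its pullback, which is invertible at `x`
    let q := Away.isLocalizationElem (ha j) (ha i)
    let r := chartRingHom Φ hΦ hη (ha j) (fun _ hx ↦ (mem_chartOpen Φ hΦ ha).1 hx) q
    have h3 : (⟨x, hj⟩ : chartOpen Φ hΦ ha j) ∈
        (chartOpen Φ hΦ ha j).toSpecΓ ⁻¹ᵁ PrimeSpectrum.basicOpen r := h2
    rw [Scheme.Opens.toSpecΓ_preimage_basicOpen] at h3
    replace h3 : x ∈ (latticeCurve O).basicOpen r := h3
    have hr : functionValue hη r = Φ (a i) / Φ (a j) := by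
      refine (functionValue_chartRingHom Φ hΦ hη (ha j) _ q).trans ?_
      refine (awayValue_mk Φ _ (ha j) _ _ _).trans ?_
      simp only [pow_one]
    have hle := (latticeCurve O).basicOpen_le r
    obtain ⟨b, hb⟩ : ∃ b : Γ(latticeCurve O, (latticeCurve O).basicOpen r),
        ((latticeCurve O).presheaf.map (homOfLE hle).op r :
          Γ(latticeCurve O, (latticeCurve O).basicOpen r)) * b = 1 :=
      isUnit_iff_exists_inv.1 ((latticeCurve O).toRingedSpace.isUnit_res_basicOpen r)
    have h4 := ((functionValue (genericPt_mem h3)).map_mul _ _).symm.trans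
      ((congrArg (functionValue (genericPt_mem h3)) hb).trans (functionValue (genericPt_mem h3)).map_one)
    have h5 := functionValue_res (homOfLE hle) (genericPt_mem h3) hη r
    have h6 : Φ (a i) / Φ (a j) * functionValue (genericPt_mem h3) b = 1 := by
      rw [← hr, ← h5]
      exact h4
    obtain ⟨n, α, hα, h7, h8⟩ := (hasFunctionValue_functionValue (genericPt_mem h3) b ⟨x, h3⟩).isRegularAt
    rw [act_eq_mul] at h7 h8
    set β := functionValue (genericPt_mem h3) b
    -- `β` is the inverse of the value of `r`, so that the denominator `α * Φ (a j)` at `x` is a multiple of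
    -- `Φ (a i)`
    have h9 : α * Φ (a j) = α * β * Φ (a i) := by
      have := h0 i
      have := h0 j
      field_simp at h6
      rw [mul_assoc, mul_comm β, h6]
    have h10 := hα.mul ((mem_chartOpen Φ hΦ ha).1 hj)
    rw [h9] at h10
    exact (mem_chartOpen Φ hΦ ha).2 (h10.of_mul h7 h8 (hΦ 1 _ (ha i)).1 (hΦ 1 _ (ha i)).2)
  · change (toProj Φ hΦ ha h0 hcov) x ∈ Proj.basicOpen 𝒮 (a i)
    have h1 : (toProj Φ hΦ ha h0 hcov) x = chartAt Φ hΦ ha h0 i ⟨x, hx⟩ := by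
      rw [← ι_toProj Φ hΦ ha h0 hcov i]
      rfl
    rw [h1, ← Proj.opensRange_awayι 𝒮 (a i) (ha i) one_pos]
    exact ⟨_, rfl⟩

/-- A function on `D₊(t^d Φ(aᵢ))` is a fraction with denominator a power of `Φ(aᵢ)`, and its numerator is in the
image of `Φ`. The exponent is raised by one in order that the numerator have positive degree. -/
theorem chartRingHom_surjective (hd : 0 < d)
    (hsurj : ∀ m, 0 < m → ∀ f ∈ O, f ∈ poleLE k k (d * m : ℕ) → ∃ s ∈ 𝒮 m, Φ s = f) (i : ι) :
    Function.Surjective (chartRingHom Φ hΦ (genericPt_mem_chartOpen Φ hΦ ha h0 i) (ha i)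
      fun _ hx ↦ (mem_chartOpen Φ hΦ ha).1 hx) := fun r ↦ by
  have hη := genericPt_mem_chartOpen Φ hΦ ha h0 i
  have h1 : functionValue hη r ∈ regularOn (stabilizes_toSubmodule O) (chartOpen Φ hΦ ha i) :=
    (exists_functionValue_eq_iff hη).1 ⟨r, rfl⟩
  obtain ⟨m, h2, h3⟩ := (mem_regularOn_basicOpenOf _ (by omega) _ _).1 h1
  rw [act_eq_mul] at h2 h3
  have h4 : Φ (a i) ^ (m + 1) * functionValue hη r = Φ (a i) * (Φ (a i) ^ m * functionValue hη r) := by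
    ring
  have h5 : Φ (a i) ^ (m + 1) * functionValue hη r ∈ poleLE k k (d * (m + 1) : ℕ) := by
    rw [h4]
    have := mul_mem_poleLE (hΦ 1 _ (ha i)).2 h3
    convert this using 2
    push_cast
    ring
  obtain ⟨s, hs, h6⟩ := hsurj (m + 1) m.succ_pos _
    (h4 ▸ O.mul_mem (hΦ 1 _ (ha i)).1 h2) h5
  refine ⟨Away.mk 𝒮 (ha i) (m + 1) s (by rwa [smul_eq_mul, mul_one]), functionValue_injective hη ?_⟩
  refine (functionValue_chartRingHom Φ hΦ hη (ha i) _ _).trans ?_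
  refine (awayValue_mk Φ _ (ha i) _ _ _).trans ?_
  rw [h6, mul_div_cancel_left₀ _ (pow_ne_zero _ (h0 i))]

/-- If every element of positive degree of the Veronese subalgebra is in the image, the morphism is a closed
immersion. -/
theorem isClosedImmersion_toProj (hd : 0 < d)
    (hsurj : ∀ m, 0 < m → ∀ f ∈ O, f ∈ poleLE k k (d * m : ℕ) → ∃ s ∈ 𝒮 m, Φ s = f)
    (hD : ⨆ i, Proj.basicOpen 𝒮 (a i) = ⊤) : IsClosedImmersion (toProj Φ hΦ ha h0 hcov) := by
  refine (IsZariskiLocalAtTarget.iff_of_iSup_eq_top (P := @IsClosedImmersion) _ hD).2 fun i ↦ ?_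
  have hη := genericPt_mem_chartOpen Φ hΦ ha h0 i
  have haff : IsAffineOpen (chartOpen Φ hΦ ha i) :=
    Proj.isAffineOpen_basicOpen (grPiece O) _ (grMonomial_mem O _ _ _ _) (by omega)
  let φ := chartRingHom Φ hΦ hη (ha i) fun _ hx ↦ (mem_chartOpen Φ hΦ ha).1 hx
  have hφ : Function.Surjective (CommRingCat.ofHom (R := Away 𝒮 (a i))
      (S := Γ(latticeCurve O, chartOpen Φ hΦ ha i)) φ) := chartRingHom_surjective Φ hΦ ha h0 hd hsurj i
  have h1 : toProj Φ hΦ ha h0 hcov ∣_ Proj.basicOpen 𝒮 (a i) =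
      (Scheme.isoOfEq _ (toProj_preimage_basicOpen Φ hΦ ha h0 hcov i)).hom ≫ haff.isoSpec.hom ≫
        Spec.map (CommRingCat.ofHom (R := Away 𝒮 (a i))
      (S := Γ(latticeCurve O, chartOpen Φ hΦ ha i)) φ) ≫ (Proj.basicOpenIsoSpec 𝒮 (a i) (ha i) one_pos).inv := by
    rw [← cancel_mono (Proj.basicOpen 𝒮 (a i)).ι, morphismRestrict_ι]
    simp only [Category.assoc]
    rw [Proj.basicOpenIsoSpec_inv_ι]
    have h2 := ι_toProj Φ hΦ ha h0 hcov i
    rw [← Iso.inv_comp_eq, Scheme.isoOfEq_inv_ι_assoc, h2]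
    rfl
  rw [h1]
  have := IsClosedImmersion.spec_of_surjective _ hφ
  infer_instance

end ToProj

/-! ### Projectivity -/

section Projective
open TopologicalSpace Opposite HahnSeries
variable {k : Type u} [Field k] {O : Subalgebra k (HahnSeries ℤ k)}
attribute [local instance] MvPolynomial.gradedAlgebra

theorem prod_pow_mem_poleLE {n d : ℕ} {f : Fin n → HahnSeries ℤ k} (hf : ∀ i, f i ∈ poleLE k k d)
    (v : Fin n → ℕ) (s : Finset (Fin n)) : ∏ i ∈ s, f i ^ v i ∈ poleLE k k (d * ∑ i ∈ s, v i : ℕ) := by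
  induction s using Finset.induction_on with
  | empty => simpa using one_mem_poleLE (k := k) (n := 0) le_rfl
  | insert i s hi ih =>
    rw [Finset.prod_insert hi, Finset.sum_insert hi, mul_add]
    push_cast
    have := mul_mem_poleLE (pow_mem_poleLE (hf i) (v i)) ih
    push_cast at this
    exact this

/-- A form of degree `m` in elements of `O_d` lies in `O_{dm}`. -/
theorem aeval_mem_of_isHomogeneous {n d : ℕ} {f : Fin n → HahnSeries ℤ k} (hfO : ∀ i, f i ∈ O)
    (hf : ∀ i, f i ∈ poleLE k k d) (m : ℕ) (s : MvPolynomial (Fin n) k)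
    (hs : s ∈ MvPolynomial.homogeneousSubmodule (Fin n) k m) :
    MvPolynomial.aeval f s ∈ O ∧ MvPolynomial.aeval f s ∈ poleLE k k (d * m : ℕ) := by
  rw [MvPolynomial.mem_homogeneousSubmodule] at hs
  rw [MvPolynomial.aeval_def, MvPolynomial.eval₂_eq']
  simp_rw [← Algebra.smul_def]
  refine ⟨sum_mem fun v hv ↦ O.smul_mem (prod_mem fun i _ ↦ pow_mem (hfO i) _) _,
    sum_mem fun v hv ↦ Submodule.smul_mem _ _ ?_⟩
  have h1 : ∑ i, v i = m := by
    have := hs (MvPolynomial.mem_support_iff.1 hv)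
    rwa [Finsupp.weight_apply, Finsupp.sum_fintype _ _ (by simp), ← Finset.sum_congr rfl (fun i _ ↦ ?_)] at this
    simp
  have := prod_pow_mem_poleLE hf v Finset.univ
  rwa [h1] at this

/-- The Veronese subalgebra of degree `2N` is generated by its part of degree one: a pole order `e` with
`2Nm < e ≤ 2N(m + 1)` is the sum of pole orders in `[N, 2N]` and `[N, 2Nm]`, both of which occur in `O`. -/
theorem exists_aeval_eq {N : ℕ} (hN0 : 0 < N)
    (hN : ∀ e : ℕ, N ≤ e → ∃ f ∈ O, f ∈ poleLE k k e ∧ f.coeff (-e) = 1) {n : ℕ}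
    {f : Fin n → HahnSeries ℤ k}
    (hspan : ∀ w ∈ O, w ∈ poleLE k k (2 * N : ℕ) → w ∈ Submodule.span k (Set.range f)) (m : ℕ)
    (hm : 0 < m) : ∀ w ∈ O, w ∈ poleLE k k (2 * N * m : ℕ) →
      ∃ s ∈ MvPolynomial.homogeneousSubmodule (Fin n) k m, MvPolynomial.aeval f s = w := by
  have h1 : ∀ w ∈ O, w ∈ poleLE k k (2 * N : ℕ) →
      ∃ s ∈ MvPolynomial.homogeneousSubmodule (Fin n) k 1, MvPolynomial.aeval f s = w := by
    intro w hw hw'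
    have h2 : Submodule.span k (Set.range f) ≤ (MvPolynomial.homogeneousSubmodule (Fin n) k 1).map
        (MvPolynomial.aeval f).toLinearMap := by
      rw [Submodule.span_le]
      rintro _ ⟨i, rfl⟩
      exact ⟨MvPolynomial.X i, MvPolynomial.isHomogeneous_X k i, MvPolynomial.aeval_X f i⟩
    exact h2 (hspan w hw hw')
  induction m, hm using Nat.le_induction with
  | base =>
    intro w hw hw'
    exact h1 w hw (by simpa using hw')
  | succ m hm ih =>
    have hmul (u w : HahnSeries ℤ k) (hu : u ∈ O) (hu' : u ∈ poleLE k k (2 * N : ℕ)) (hw : w ∈ O)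
        (hw' : w ∈ poleLE k k (2 * N * m : ℕ)) :
        u * w ∈ (MvPolynomial.homogeneousSubmodule (Fin n) k (m + 1)).map
          (MvPolynomial.aeval f).toLinearMap := by
      obtain ⟨s, hs, rfl⟩ := h1 u hu hu'
      obtain ⟨s', hs', rfl⟩ := ih w hw hw'
      refine ⟨s * s', ?_, map_mul (MvPolynomial.aeval f) s s'⟩
      rw [add_comm]
      exact SetLike.mul_mem_graded hs hs'
    have key (j : ℕ) (hj : j ≤ 2 * N) : ∀ w ∈ O, w ∈ poleLE k k (2 * N * m + j : ℕ) →
        w ∈ (MvPolynomial.homogeneousSubmodule (Fin n) k (m + 1)).map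
          (MvPolynomial.aeval f).toLinearMap := by
      induction j with
      | zero =>
        intro w hw hw'
        rw [← one_mul w]
        exact hmul 1 w O.one_mem (one_mem_poleLE (Int.natCast_nonneg _)) hw hw'
      | succ j ihj =>
        intro w hw hw'
        have hle : 2 * N ≤ 2 * N * m := Nat.le_mul_of_pos_right _ hm
        -- `b` must not exceed `2Nm` and `a` must be at least `N`: if `j + 1 ≤ N`, one takes `a = N`
        obtain ⟨a, b, ha, ha', hb, hb', hab⟩ : ∃ a b : ℕ, N ≤ a ∧ a ≤ 2 * N ∧ N ≤ b ∧ b ≤ 2 * N * m ∧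
            a + b = 2 * N * m + (j + 1) := by
          rcases le_total (j + 1) N with h | h
          · exact ⟨N, 2 * N * m + (j + 1) - N, by omega⟩
          · exact ⟨j + 1, 2 * N * m, by omega⟩
        obtain ⟨u, hu, hua, hu1⟩ := hN a ha
        obtain ⟨v, hv, hvb, hv1⟩ := hN b hb
        have hcast : (a : ℤ) + b = (2 * N * m + (j + 1) : ℕ) := by exact_mod_cast hab
        have h3 := coeff_mul_leading hua hvb
        have h4 := mul_mem_poleLE hua hvb
        rw [hcast] at h3 h4
        rw [hu1, hv1, mul_one] at h3
        have h5 : w - w.coeff (-(2 * N * m + (j + 1) : ℕ)) • (u * v) ∈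
            poleLE k k (2 * N * m + j : ℕ) := by
          have := mem_poleLE_pred (sub_mem hw' (Submodule.smul_mem _
            (w.coeff (-(2 * N * m + (j + 1) : ℕ))) h4)) (by
              rw [coeff_sub, coeff_smul, h3, smul_eq_mul, mul_one, sub_self])
          convert this using 2
          push_cast
          ring
        have h6 := ihj (by omega) _ (sub_mem hw (O.smul_mem (O.mul_mem hu hv) _)) h5
        have h7 := hmul u v hu (poleLE_mono (by exact_mod_cast ha') hua) hv
          (poleLE_mono (by exact_mod_cast hb') hvb)
        have h8 := add_mem h6 (Submodule.smul_mem _ (w.coeff (-(2 * N * m + (j + 1) : ℕ))) h7)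
        rwa [sub_add_cancel] at h8
    intro w hw hw'
    exact key (2 * N) le_rfl w hw (by rwa [mul_add, mul_one] at hw')

/-- If all elements of a spanning set vanish at `x`, so do their linear combinations. -/
theorem IsDenom.exists_of_mem_span {x : latticeCurve O} {d : ℕ} {ι : Type*} {f : ι → HahnSeries ℤ k}
    (hfO : ∀ i, f i ∈ O) (hf : ∀ i, f i ∈ poleLE k k d) {w : HahnSeries ℤ k} (hw : IsDenom x d w)
    (hspan : w ∈ Submodule.span k (Set.range f)) : ∃ i, IsDenom x d (f i) := by
  by_contra! h
  have h1 : ∀ i, grMonomial O d (f i) (hfO i) (hf i) ∈ x.asHomogeneousIdeal.toIdeal := fun i ↦ by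
    by_contra h'
    exact h i ⟨hfO i, hf i, h'⟩
  have h2 : ∀ v ∈ Submodule.span k (Set.range f), ∃ (hv : v ∈ O) (hv' : v ∈ poleLE k k d),
      grMonomial O d v hv hv' ∈ x.asHomogeneousIdeal.toIdeal := by
    intro v hv
    induction hv using Submodule.span_induction with
    | mem v hv =>
      obtain ⟨i, rfl⟩ := hv
      exact ⟨hfO i, hf i, h1 i⟩
    | zero =>
      refine ⟨O.zero_mem, zero_mem _, ?_⟩
      convert zero_mem x.asHomogeneousIdeal.toIdeal
      exact GrRing.ext fun m ↦ by rw [coeff_grMonomial, ite_self, GrRing.coeff_zero]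
    | add u v _ _ hu hv =>
      obtain ⟨a, b, c⟩ := hu
      obtain ⟨a', b', c'⟩ := hv
      refine ⟨O.add_mem a a', add_mem b b', ?_⟩
      convert add_mem c c'
      refine GrRing.ext fun m ↦ ?_
      rw [GrRing.coeff_add, coeff_grMonomial, coeff_grMonomial, coeff_grMonomial]
      split_ifs <;> simp
    | smul c u _ hu =>
      obtain ⟨a, b, h⟩ := hu
      refine ⟨O.smul_mem a c, Submodule.smul_mem _ c b, ?_⟩
      have : grMonomial O d (c • u) (O.smul_mem a c) (Submodule.smul_mem _ c b) =
          algebraMap k (GrRing O) c * grMonomial O d u a b := by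
        rw [← Algebra.smul_def]
        refine GrRing.ext fun m ↦ ?_
        rw [GrRing.coeff_smul, coeff_grMonomial, coeff_grMonomial]
        split_ifs <;> simp
      rw [this]
      exact Ideal.mul_mem_left _ _ h
  exact hw.2.2 (h2 w hspan).2.2

/-- A basis of the finite-dimensional space `O_{2N}` generates the Veronese subalgebra of degree `2N`, and
hence defines a closed immersion in a projective space. -/
theorem isProjective_latticeCurveHom (hO : IsLattice (Subalgebra.toSubmodule O)) :
    IsProjective (latticeCurveHom O) := by
  obtain ⟨N₀, hN₀⟩ := hO.exists_pole
  obtain ⟨N, hN0, hN⟩ : ∃ N : ℕ, 0 < N ∧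
      ∀ e : ℕ, N ≤ e → ∃ f ∈ O, f ∈ poleLE k k e ∧ f.coeff (-e) = 1 :=
    ⟨N₀ + 1, N₀.succ_pos, fun e he ↦ hN₀ e (by omega)⟩
  have hfin : FiniteDimensional k ↥(Subalgebra.toSubmodule O ⊓ poleLE k k (2 * N : ℕ)) :=
    hO.finite_poleLE (2 * N)
  have h1 : (1 : HahnSeries ℤ k) ∈ Subalgebra.toSubmodule O ⊓ poleLE k k (2 * N : ℕ) :=
    ⟨O.one_mem, one_mem_poleLE (Int.natCast_nonneg _)⟩
  obtain ⟨n, hn⟩ : ∃ n, Module.finrank k ↥(Subalgebra.toSubmodule O ⊓ poleLE k k (2 * N : ℕ)) = n + 1 := by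
    have : Nontrivial ↥(Subalgebra.toSubmodule O ⊓ poleLE k k (2 * N : ℕ)) :=
      ⟨⟨1, h1⟩, 0, fun h ↦ one_ne_zero (congrArg Subtype.val h)⟩
    exact ⟨_, (Nat.succ_pred_eq_of_pos Module.finrank_pos).symm⟩
  let b := Module.finBasisOfFinrankEq k _ hn
  let f : Fin (n + 1) → HahnSeries ℤ k := fun i ↦ b i
  have hspan (w : HahnSeries ℤ k) (hw : w ∈ O) (hw' : w ∈ poleLE k k (2 * N : ℕ)) :
      w ∈ Submodule.span k (Set.range f) := by
    have h2 := Submodule.mem_map_of_mem (f := Submodule.subtype _) (b.mem_span ⟨w, hw, hw'⟩)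
    rw [Submodule.map_span, ← Set.range_comp] at h2
    exact h2
  have hfO (i) : f i ∈ O := (b i).2.1
  have hfd (i) : f i ∈ poleLE k k (2 * N : ℕ) := (b i).2.2
  have hΦ := aeval_mem_of_isHomogeneous (n := n + 1) hfO hfd
  have ha (i : Fin (n + 1)) : (MvPolynomial.X i : MvPolynomial (Fin (n + 1)) k) ∈
      MvPolynomial.homogeneousSubmodule (Fin (n + 1)) k 1 := MvPolynomial.isHomogeneous_X k i
  have h0 (i : Fin (n + 1)) : MvPolynomial.aeval f (MvPolynomial.X i : MvPolynomial (Fin (n + 1)) k) ≠ 0 := by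
    rw [MvPolynomial.aeval_X]
    exact fun h ↦ b.ne_zero i (Subtype.ext h)
  have hcov : IsOpenCover (chartOpen (MvPolynomial.aeval f) hΦ ha) := by
    refine Opens.ext (Set.eq_univ_of_forall fun x ↦ ?_)
    -- `t^{2N}` has no zero in `D₊(t)`, and an element of pole order `2N` does not vanish at infinity
    obtain ⟨w, hw⟩ : ∃ w, IsDenom x (2 * N) w := by
      by_cases hx : x ∈ affinePart O
      · exact ⟨_, by simpa using (mem_affinePart.1 hx).pow (2 * N)⟩
      · rw [eq_infinityPt_of_notMem (hO := hO) hx]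
        obtain ⟨w, h2, h3, h4⟩ := hN (2 * N) (by omega)
        exact ⟨w, isDenom_infinityPt.2 ⟨h2, h3, by rw [h4]; exact one_ne_zero⟩⟩
    obtain ⟨i, hi⟩ := hw.exists_of_mem_span hfO hfd (hspan w hw.1 hw.2.1)
    refine Opens.mem_iSup.2 ⟨i, (mem_chartOpen _ hΦ ha).2 ?_⟩
    rwa [MvPolynomial.aeval_X, mul_one]
  refine ⟨n, toProj (MvPolynomial.aeval f) hΦ ha h0 hcov, ?_, toProj_comp_projToSpec _ hΦ ha h0 hcov⟩
  refine isClosedImmersion_toProj _ hΦ ha h0 hcov (by omega) (exists_aeval_eq hN0 hN hspan) ?_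
  refine Proj.iSup_basicOpen_eq_top' _ _ (fun i ↦ ⟨1, ha i⟩) (eq_top_iff.2 fun p _ ↦ ?_)
  induction p using MvPolynomial.induction_on with
  | C c =>
    exact Subalgebra.algebraMap_mem (Algebra.adjoin _ _) (⟨MvPolynomial.C c, MvPolynomial.isHomogeneous_C _ c⟩ : MvPolynomial.homogeneousSubmodule (Fin (n + 1)) k 0)
  | add p q hp hq => exact add_mem (hp trivial) (hq trivial)
  | mul_X p i hp => exact mul_mem (hp trivial) (Algebra.subset_adjoin ⟨i, rfl⟩)

end Projective

/-! ### Rationality and smoothness of the point at infinity -/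

section EtaleCoordinate
open Polynomial
variable {k R S : Type u} [Field k] [CommRing R] [IsDomain R] [Algebra k R] [CommRing S]
  [IsLocalRing S] [Algebra R S]

/-- A local ring whose maximal ideal is generated by `u` and whose residue field is `k` is unramified over
`k[u]`: the module of differentials is `u` times itself. -/
theorem formallyUnramified_of_maximalIdeal_eq_span [Algebra k[X] S] [Algebra.EssFiniteType k[X] S]
    (hm : IsLocalRing.maximalIdeal S = Ideal.span {algebraMap k[X] S X})
    (hres : ∀ s : S, ∃ c : k, s - algebraMap k[X] S (C c) ∈ IsLocalRing.maximalIdeal S) :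
    Algebra.FormallyUnramified k[X] S := by
  rw [Algebra.formallyUnramified_iff]
  have h1 : (⊤ : Submodule S (Ω[S⁄k[X]])) ≤ IsLocalRing.maximalIdeal S • ⊤ := by
    rw [← KaehlerDifferential.span_range_derivation, Submodule.span_le]
    rintro _ ⟨s, rfl⟩
    obtain ⟨c, hc⟩ := hres s
    rw [hm, Ideal.mem_span_singleton'] at hc
    obtain ⟨t, ht⟩ := hc
    rw [eq_comm, sub_eq_iff_eq_add] at ht
    rw [ht, map_add, Derivation.map_algebraMap, add_zero, Derivation.leibniz, Derivation.map_algebraMap,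
      smul_zero, zero_add, KaehlerDifferential.span_range_derivation]
    refine Submodule.smul_mem_smul ?_ trivial
    rw [hm]
    exact Ideal.mem_span_singleton_self _
  have h2 := Submodule.eq_bot_of_le_smul_of_le_jacobson_bot _ _ Module.Finite.fg_top h1
    (IsLocalRing.maximalIdeal_le_jacobson ⊥)
  exact (Submodule.subsingleton_iff S).1 (subsingleton_of_bot_eq_top h2.symm)

/-- A domain of finite type is smooth at a point with residue field `k` and principal maximal ideal, because
a generator of the maximal ideal is an étale coordinate. -/
theorem exists_smooth_of_maximalIdeal_eq_span [Algebra.FiniteType k R] (q : Ideal R) [q.IsPrime]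
    [IsLocalization.AtPrime S q] (u : R) (hu : Function.Injective (aeval (R := k) u))
    (hm : IsLocalRing.maximalIdeal S = Ideal.span {algebraMap R S u})
    (hres : ∀ s : S, ∃ c : k, s - algebraMap R S (algebraMap k R c) ∈ IsLocalRing.maximalIdeal S) :
    ∃ r ∉ q, Algebra.Smooth k (Localization.Away r) := by
  algebraize [(aeval (R := k) u).toRingHom]
  have hX : algebraMap k[X] R X = u := aeval_X u
  have hC (c : k) : algebraMap k[X] R (C c) = algebraMap k R c := aeval_C u c
  have : IsScalarTower k k[X] R := IsScalarTower.of_algebraMap_eq fun c ↦ (hC c).symm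
  have h1 : Algebra.FinitePresentation k R := Algebra.FinitePresentation.of_finiteType.1 inferInstance
  have h2 : Algebra.FinitePresentation k[X] R :=
    Algebra.FinitePresentation.of_restrict_scalars_finitePresentation k k[X] R
  have h3 : Module.IsTorsionFree k[X] R := by
    have : FaithfulSMul k[X] R := (faithfulSMul_iff_algebraMap_injective _ _).2 hu
    infer_instance
  algebraize [(algebraMap R S).comp (algebraMap k[X] R)]
  have h4 : Algebra.EssFiniteType R S := Algebra.EssFiniteType.of_isLocalization S q.primeCompl
  have h5 : Algebra.EssFiniteType k[X] S := Algebra.EssFiniteType.comp k[X] R S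
  have h6 : Algebra.FormallyUnramified k[X] S := by
    refine formallyUnramified_of_maximalIdeal_eq_span (by rw [hm, ← hX]; rfl) fun s ↦ ?_
    obtain ⟨c, hc⟩ := hres s
    exact ⟨c, by rw [← hC] at hc; exact hc⟩
  have h7 : Algebra.IsUnramifiedAt k[X] q := Algebra.FormallyUnramified.of_equiv
    ((IsLocalization.algEquiv q.primeCompl S (Localization.AtPrime q)).restrictScalars k[X])
  -- a torsion-free algebra over `k[X]` is flat, and flat and unramified is étale
  have h8 : Algebra.IsEtaleAt k[X] q := Algebra.IsEtaleAt.of_isUnramifiedAt_of_flat q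
  have h9 : Algebra.FormallyEtale k[X] (Localization.AtPrime q) := h8
  have h10 : Algebra.IsSmoothAt k q := Algebra.FormallySmooth.comp k k[X] (Localization.AtPrime q)
  exact Algebra.IsSmoothAt.exists_notMem_smooth k q

end EtaleCoordinate

section Smooth
open TopologicalSpace Opposite HahnSeries
variable {k : Type u} [Field k] {O : Subalgebra k (HahnSeries ℤ k)}

/-- Modulo the maximal ideal, a germ equals its constant term. -/
theorem isRationalPoint_infinityPt (hO : IsLattice (Subalgebra.toSubmodule O)) :
    IsRationalPoint (latticeCurveHom O) (infinityPt hO) := by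
  refine ⟨((((latticeCurve O).Γevaluation (infinityPt hO)).hom.comp
    (scalars (latticeCurveHom O) ⊤)).injective), fun y ↦ ?_⟩
  obtain ⟨r, rfl⟩ := (latticeCurve O).residue_surjective _ y
  refine ⟨(germValue _ r).coeff 0, ?_⟩
  have hp : infinityPt hO ∈ (⊤ : (latticeCurve O).Opens) := trivial
  refine Ideal.Quotient.eq (x := (latticeCurve O).presheaf.germ ⊤ (infinityPt hO) hp
    (scalars (latticeCurveHom O) ⊤ ((germValue _ r).coeff 0))).2 (mem_maximalIdeal_iff.2 ?_)
  rw [map_sub, germValue_germ, functionValue_scalars]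
  simp

attribute [local instance] MvPolynomial.gradedAlgebra in
theorem IsProjective.locallyOfFiniteType {X : Scheme.{u}} {f : X ⟶ Spec (.of k)} (h : IsProjective f) :
    LocallyOfFiniteType f := by
  obtain ⟨n, i, hi, rfl⟩ := h
  let 𝒮 := MvPolynomial.homogeneousSubmodule (Fin (n + 1)) k
  have h1 : Function.Surjective (algebraMap k (𝒮 0)) := fun p ↦ by
    obtain ⟨c, hc⟩ : ∃ c, p.1 = MvPolynomial.C c := ⟨_, MvPolynomial.totalDegree_eq_zero_iff_eq_C.1
      ((MvPolynomial.totalDegree_zero_iff_isHomogeneous _).2 p.2)⟩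
    exact ⟨c, Subtype.ext hc.symm⟩
  have h2 : LocallyOfFiniteType (Spec.map (CommRingCat.ofHom (algebraMap k (𝒮 0)))) :=
    (HasRingHomProperty.Spec_iff (P := @LocallyOfFiniteType)).2 (RingHom.FiniteType.of_surjective _ h1)
  have h3 : Algebra.FiniteType (𝒮 0) (MvPolynomial (Fin (n + 1)) k) := RingHom.finiteType_algebraMap.1 <|
    RingHom.FiniteType.of_comp_finiteType (f := algebraMap k (𝒮 0)) <|
      (RingHom.finiteType_algebraMap (A := k)).2 inferInstance
  rw [projToSpec]
  infer_instance

/-- The inverse of an algebraic element of `k[[z]]` would again be a power series. -/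
theorem transcendental_of_order_one {v : HahnSeries ℤ k} (hv : v ∈ poleLE k k (-1)) (hv1 : v.coeff 1 ≠ 0) :
    Transcendental k v := fun h ↦ by
  have h1 : v⁻¹ ∈ integralSubalgebra k := Subalgebra.inv_mem_of_algebraic (integralSubalgebra k)
    (x := ⟨v, poleLE_mono (by omega) hv⟩) h
  have h2 := mul_mem_poleLE hv h1
  have hv0 : v ≠ 0 := by
    rintro rfl
    exact hv1 rfl
  rw [mul_inv_cancel₀ hv0] at h2
  have := h2 0 (by omega)
  simp at this

/-- The local ring at infinity has residue field `k`, and its maximal ideal is generated by a uniformizer. -/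
theorem isSmoothAt_infinityPt (hO : IsLattice (Subalgebra.toSubmodule O)) :
    IsSmoothAt (latticeCurveHom O) (infinityPt hO) := by
  have hft := (isProjective_latticeCurveHom hO).locallyOfFiniteType
  obtain ⟨f, hf, g, hg, hf0, hg0, w, hw, hw0, hw1⟩ := exists_uniformizer_germ hO
  obtain ⟨V₀, hV₀, u₀, rfl⟩ := TopCat.Presheaf.exists_germ_eq _ w
  obtain ⟨n, q, hq, hn, hn0, hq0, hle⟩ := exists_leading_basicOpenOf_le hV₀
  set V := basicOpenOf n q hq hn
  have hpV : infinityPt hO ∈ V := mem_basicOpenOf.2 (isDenom_infinityPt.2 ⟨hq, hn, hq0⟩)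
  have hV : IsAffineOpen V := Proj.isAffineOpen_basicOpen (grPiece O) _ (grMonomial_mem O _ _ _ _) hn0
  let u : Γ(latticeCurve O, V) := (latticeCurve O).presheaf.map (homOfLE hle).op u₀
  have hu : (latticeCurve O).presheaf.germ V _ hpV u = (latticeCurve O).presheaf.germ V₀ _ hV₀ u₀ :=
    TopCat.Presheaf.germ_res_apply _ _ _ _ _
  rw [← hu] at hw
  have hm := maximalIdeal_eq_span hf hg hf0 hg0 hw hw0 hw1
  have hdom : IsDomain Γ(latticeCurve O, V) := (functionValue_injective (genericPt_mem hpV)).isDomain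
  let : Algebra k Γ(latticeCurve O, V) := (scalars (latticeCurveHom O) V).toAlgebra
  have heq {U : (latticeCurve O).Opens} (hU : IsAffineOpen U) : U.ι ≫ latticeCurveHom O =
      hU.isoSpec.hom ≫ Spec.map (CommRingCat.ofHom (R := k)
        (S := Γ(latticeCurve O, U)) (scalars (latticeCurveHom O) U)) := ι_comp_eq_scalars _ U
  have hR : Algebra.FiniteType k Γ(latticeCurve O, V) := by
    have h1 : LocallyOfFiniteType (hV.isoSpec.inv ≫ V.ι ≫ latticeCurveHom O) := inferInstance
    rw [heq hV, Iso.inv_hom_id_assoc] at h1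
    have h2 : (scalars (latticeCurveHom O) V).FiniteType :=
      (HasRingHomProperty.Spec_iff (P := @LocallyOfFiniteType)).1 h1
    exact h2
  let : Algebra Γ(latticeCurve O, V) ((latticeCurve O).presheaf.stalk (infinityPt hO)) :=
    ((latticeCurve O).presheaf.germ V _ hpV).hom.toAlgebra
  have hloc : IsLocalization.AtPrime ((latticeCurve O).presheaf.stalk (infinityPt hO))
    (hV.primeIdealOf ⟨_, hpV⟩).asIdeal := hV.isLocalization_stalk ⟨_, hpV⟩
  have hinj : Function.Injective (Polynomial.aeval (R := k) u) := by
    have h1 := transcendental_iff_injective.1 (transcendental_of_order_one hw0 hw1)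
    let F : Γ(latticeCurve O, V) →ₐ[k] HahnSeries ℤ k :=
      { functionValue (genericPt_mem hpV) with
        commutes' := functionValue_scalars (genericPt_mem hpV) }
    have h2 : F u = g * f⁻¹ := (germValue_germ hpV u).symm.trans hw
    rw [← h2, Polynomial.aeval_algHom] at h1
    exact Function.Injective.of_comp (f := F) h1
  -- the constant term of the series of a germ is its residue
  obtain ⟨r, hrq, hr⟩ := exists_smooth_of_maximalIdeal_eq_span (k := k)
    (S := (latticeCurve O).presheaf.stalk (infinityPt hO)) (hV.primeIdealOf ⟨_, hpV⟩).asIdeal u hinj hm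
    fun s ↦ ⟨(germValue _ s).coeff 0, mem_maximalIdeal_iff.2 (by
      have h1 : germValue (infinityPt hO) ((latticeCurve O).presheaf.germ V _ hpV
          (scalars (latticeCurveHom O) V ((germValue _ s).coeff 0))) = C ((germValue _ s).coeff 0) :=
        (germValue_germ hpV _).trans (functionValue_scalars _ _)
      rw [map_sub]
      refine (congrArg (fun φ ↦ (germValue _ s - φ).coeff 0) h1).trans ?_
      simp)⟩
  have hpr : infinityPt hO ∈ (latticeCurve O).basicOpen r := by
    have h1 : hV.primeIdealOf ⟨_, hpV⟩ ∈ hV.fromSpec ⁻¹ᵁ (latticeCurve O).basicOpen r := by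
      rw [hV.fromSpec_preimage_basicOpen]
      exact hrq
    have h2 : hV.fromSpec (hV.primeIdealOf ⟨_, hpV⟩) ∈ (latticeCurve O).basicOpen r := h1
    rwa [hV.fromSpec_primeIdealOf] at h2
  have hres := hV.isLocalization_basicOpen r
  have hsm : (scalars (latticeCurveHom O) ((latticeCurve O).basicOpen r)).Smooth := by
    rw [← RingHom.smooth_algebraMap] at hr
    convert RingHom.Smooth.propertyIsLocal.respectsIso.1 _
      (IsLocalization.algEquiv (.powers r) _ Γ(latticeCurve O, (latticeCurve O).basicOpen r)).toRingEquiv hr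
    refine RingHom.ext fun c ↦ ?_
    exact (map_scalars (latticeCurveHom O) (homOfLE ((latticeCurve O).basicOpen_le r)) c).symm.trans
      ((IsLocalization.algEquiv (.powers r) (Localization.Away r)
        Γ(latticeCurve O, (latticeCurve O).basicOpen r)).commutes (scalars (latticeCurveHom O) V c)).symm
  have h1 : Smooth (Spec.map (CommRingCat.ofHom (R := k)
      (S := Γ(latticeCurve O, (latticeCurve O).basicOpen r)) (scalars (latticeCurveHom O) _))) :=
    (HasRingHomProperty.Spec_iff (P := @Smooth)).2 hsm
  refine ⟨(latticeCurve O).basicOpen r, hpr, ?_⟩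
  rw [heq (hV.basicOpen r)]
  infer_instance

end Smooth

/-! ### Generators and localization of sections -/

section Generators
open HahnSeries TopologicalSpace
variable {k A : Type u} [Field k] [NonUnitalNonAssocRing A] [Module k A]
  {O : Subalgebra k (HahnSeries ℤ k)} {W : Submodule k (HahnSeries ℤ A)}

theorem coeff_pow_leading {f : HahnSeries ℤ k} {d : ℕ} (hf : f ∈ poleLE k k d) (m : ℕ) :
    (f ^ m).coeff (-(d * m : ℕ)) = f.coeff (-d) ^ m := by
  induction m with
  | zero => simp
  | succ m ih =>
    have h := coeff_act_leading hf (pow_mem_poleLE hf m)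
    rw [act_eq_mul, ← pow_succ', ih, smul_eq_mul, ← pow_succ'] at h
    rw [← h]
    congr 1
    push_cast
    ring

/-- Multiplication by the powers of a series `f` with a pole of order `d > 0` produces all the elements of
a lattice from those of small pole order: they produce all leading coefficients. The powers that are
needed do not increase the pole order. -/
theorem IsLattice.exists_generators (hOW : Stabilizes O W) (hW : IsLattice W) {d : ℕ} (hd : 0 < d)
    {f : HahnSeries ℤ k} (hf : f ∈ O) (hfd : f ∈ poleLE k k d) (h0 : f.coeff (-d) ≠ 0) :
    ∃ q : ℕ, ∀ (m : ℕ) (T : Submodule k (HahnSeries ℤ A)),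
      (∀ j ≤ m, ∀ w ∈ W, w ∈ poleLE k A (d * q : ℕ) → GeomLattice.act (f ^ j) w ∈ T) →
        W ⊓ poleLE k A (d * (q + m) : ℕ) ≤ T := by
  obtain ⟨N, hN⟩ := hW.exists_leading
  refine ⟨N + 1, fun m T hT ↦ ?_⟩
  set q := N + 1 with hq
  have hdq : N + d ≤ d * q := by
    rw [hq]
    nlinarith
  have h1 := le_sup_of_leading (W := W ⊓ poleLE k A (d * (q + m) : ℕ))
    (T := T ⊓ (W ⊓ poleLE k A (d * (q + m) : ℕ))) inf_le_right (d * q) ?_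
  · refine h1.trans (sup_le inf_le_left fun w hw ↦ ?_)
    have := hT 0 (Nat.zero_le m) w hw.1.1 hw.2
    rwa [pow_zero, one_act] at this
  · intro e he w hw hwe
    by_cases hem : d * (q + m) < e
    · refine ⟨0, zero_mem _, zero_mem _, ?_⟩
      rw [hw.2 (-e) (by push_cast at hem ⊢; exact_mod_cast neg_lt_neg (by exact_mod_cast hem))]
      rfl
    -- the exponent is the largest one that leaves a pole order for which all coefficients occur
    obtain ⟨j, hjm, hj1, hj2⟩ : ∃ j ≤ m, d * j + N ≤ e ∧ e ≤ d * j + d * q := by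
      have h2 : d * ((e - N) / d) ≤ e - N := Nat.mul_div_le _ _
      have h3 : e - N < d * ((e - N) / d) + d := by
        have := Nat.lt_mul_div_succ (e - N) hd
        rwa [mul_add_one] at this
      by_cases hm : (e - N) / d ≤ m
      · exact ⟨_, hm, by omega, by omega⟩
      · have h4 : d * m ≤ d * ((e - N) / d) := Nat.mul_le_mul_left d (by omega)
        rw [mul_add] at hem
        exact ⟨m, le_rfl, by omega, by omega⟩
    obtain ⟨v, hv, hve, hvc⟩ := hN (e - (d * j : ℕ)) (by omega)
      ((f.coeff (-d) ^ j)⁻¹ • w.coeff (-e))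
    have hfj := pow_mem_poleLE hfd j
    have h5 := act_mem_poleLE hfj hve
    rw [add_sub_cancel] at h5
    refine ⟨GeomLattice.act (f ^ j) v, ⟨hT j hjm v hv (poleLE_mono (by omega) hve),
      hOW _ (O.pow_mem hf j) _ hv, poleLE_mono (by omega) h5⟩, h5, ?_⟩
    have h6 := coeff_act_leading hfj hve
    rw [add_sub_cancel, coeff_pow_leading hfd, hvc, smul_inv_smul₀ (pow_ne_zero _ h0)] at h6
    exact h6

/-- A finite-dimensional space of sections over `V` generates the sections over `V` as a module over the
functions on `V`. Sections and functions are replaced by their series, and the generated submodule is described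
as the smallest subspace that is stable under the functions. -/
def IsGenerating (hOW : Stabilizes O W) (V : (latticeCurve O).Opens) : Prop :=
  ∃ T₀ : Submodule k (HahnSeries ℤ A), FiniteDimensional k T₀ ∧ T₀ ≤ regularOn hOW V ∧
    ∀ T : Submodule k (HahnSeries ℤ A), T₀ ≤ T →
      (∀ r ∈ regularOn (stabilizes_toSubmodule O) V, ∀ φ ∈ T, act r φ ∈ T) → regularOn hOW V ≤ T

/-- If `f ∈ O` has a pole, `W` is generated over `k[f]` by elements of bounded pole order. -/
theorem isGenerating_affinePart [FiniteDimensional k A] (hO : IsLattice (Subalgebra.toSubmodule O))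
    (hOW : Stabilizes O W) (hW : IsLattice W) : IsGenerating hOW (affinePart O) := by
  obtain ⟨N, hN⟩ := hO.exists_pole
  obtain ⟨f, hf, hfd, h0⟩ := hN (N + 1) (by omega)
  obtain ⟨q, hq⟩ := hW.exists_generators hOW N.succ_pos hf hfd (by rw [h0]; exact one_ne_zero)
  refine ⟨W ⊓ poleLE k A ((N + 1) * q : ℕ), hW.finite_poleLE _, ?_, fun T hT hr ↦ ?_⟩
  · rw [regularOn_affinePart]
    exact inf_le_left
  · rw [regularOn_affinePart] at hr ⊢
    intro w hw
    obtain ⟨m, hm⟩ := exists_mem_poleLE (k := k) w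
    refine hq m T (fun j _ v hv hvq ↦ hr _ (O.pow_mem hf j) _ (hT ⟨hv, hvq⟩)) ⟨hw, poleLE_mono ?_ hm⟩
    push_cast
    nlinarith

/-- If `f` has pole order exactly `d`, the fractions `w / f ^ q` with `w ∈ W_{dq}` for some fixed `q` generate the
sections over `D₊(tᵈ f)` over `k[1 / f]`. -/
theorem isGenerating_basicOpenOf [FiniteDimensional k A] (hOW : Stabilizes O W) (hW : IsLattice W)
    {d : ℕ} (hd : 0 < d) {f : HahnSeries ℤ k} (hf : f ∈ O) (hfd : f ∈ poleLE k k d)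
    (h0 : f.coeff (-d) ≠ 0) : IsGenerating hOW (basicOpenOf d f hf hfd) := by
  obtain ⟨q, hq⟩ := hW.exists_generators hOW hd hf hfd h0
  have hf0 : f ≠ 0 := by
    rintro rfl
    exact h0 rfl
  let μ (g : HahnSeries ℤ k) : Module.End k (HahnSeries ℤ A) :=
    { toFun := act g
      map_add' := act_add g
      map_smul' := fun c a ↦ by
        rw [RingHom.id_apply, ← act_C, ← act_C, act_act, act_act, mul_comm] }
  have := hW.finite_poleLE (d * q)
  refine ⟨(W ⊓ poleLE k A (d * q : ℕ)).map (μ (f ^ q)⁻¹), inferInstance, ?_, fun T hT hr φ hφ ↦ ?_⟩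
  · rintro _ ⟨w, hw, rfl⟩
    rw [mem_regularOn_basicOpenOf hOW hd]
    exact ⟨q, by rw [show μ (f ^ q)⁻¹ w = act (f ^ q)⁻¹ w from rfl,
      act_act_inv (pow_ne_zero _ hf0)]; exact hw⟩
  · obtain ⟨m, h1, h2⟩ := (mem_regularOn_basicOpenOf hOW hd hf hfd).1 hφ
    have h3 := hq m (T.comap (μ (f ^ (q + m))⁻¹)) (fun j hj w hw hwq ↦ ?_)
      (x := act (f ^ q) (act (f ^ m) φ)) ⟨hOW _ (O.pow_mem hf q) _ h1, ?_⟩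
    · have h4 : act (f ^ (q + m))⁻¹ (act (f ^ q) (act (f ^ m) φ)) ∈ T := h3
      rwa [act_act (f ^ q), ← _root_.pow_add, act_inv_act (pow_ne_zero _ hf0)] at h4
    · change act (f ^ (q + m))⁻¹ (act (f ^ j) w) ∈ T
      have e : (f ^ (q + m))⁻¹ * f ^ j = (f ^ (m - j))⁻¹ * (f ^ q)⁻¹ := by
        have h5 : f ^ (q + m) = f ^ (m - j) * f ^ q * f ^ j := by
          rw [← _root_.pow_add, ← _root_.pow_add]
          congr 1
          omega
        rw [h5, mul_inv, mul_inv, mul_assoc, inv_mul_cancel₀ (pow_ne_zero _ hf0), mul_one]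
      rw [act_act, e, ← act_act]
      refine hr _ ?_ _ (hT ⟨w, ⟨hw, hwq⟩, rfl⟩)
      rw [mem_regularOn_basicOpenOf _ hd]
      refine ⟨m - j, ?_⟩
      rw [act_eq_mul, mul_inv_cancel₀ (pow_ne_zero _ hf0)]
      exact ⟨O.one_mem, one_mem_poleLE (Int.natCast_nonneg _)⟩
    · have h4 := act_mem_poleLE (pow_mem_poleLE hfd q) h2
      rwa [← Nat.cast_add, ← mul_add] at h4

end Generators

section Localization
open HahnSeries TopologicalSpace
variable {k A : Type u} [Field k] [NonUnitalNonAssocRing A] [Module k A]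
  {O : Subalgebra k (HahnSeries ℤ k)} {W : Submodule k (HahnSeries ℤ A)}

/-- A section over the locus of `D₊(tᵈ f)` where a function is invertible becomes a section over
`D₊(tᵈ f)` after multiplication by a power of that function. -/
theorem exists_pow_act_mem_regularOn (hOW : Stabilizes O W) {d : ℕ} (hd : 0 < d) {f : HahnSeries ℤ k}
    (hf : f ∈ O) (hfd : f ∈ poleLE k k d) (hη : genericPt O ∈ basicOpenOf d f hf hfd)
    (g : Γ(latticeCurve O, basicOpenOf d f hf hfd)) (hg : functionValue hη g ≠ 0) {φ : HahnSeries ℤ A}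
    (hφ : φ ∈ regularOn hOW ((latticeCurve O).basicOpen g)) :
    ∃ n : ℕ, act (functionValue hη g ^ n) φ ∈ regularOn hOW (basicOpenOf d f hf hfd) := by
  set γ := functionValue hη g with hγ
  obtain ⟨m, h1, h2⟩ := (mem_regularOn_basicOpenOf (stabilizes_toSubmodule O) hd hf hfd).1
    ((exists_functionValue_eq_iff hη).1 ⟨g, rfl⟩)
  rw [← hγ, act_eq_mul] at h1 h2
  have h1' : f * (f ^ m * γ) ∈ O := O.mul_mem hf h1
  have h2' : f * (f ^ m * γ) ∈ poleLE k k (d * (m + 1) : ℕ) := by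
    have := mul_mem_poleLE hfd h2
    rwa [← Nat.cast_add, add_comm, ← mul_add_one] at this
  -- the locus contains the set where the element `f ^ (m + 1) γ` of degree `d (m + 1)` does not vanish
  have hle : basicOpenOf (d * (m + 1)) _ h1' h2' ≤ (latticeCurve O).basicOpen g := fun x hx ↦ by
    set V := basicOpenOf (d * (m + 1)) _ h1' h2' with hV
    have hle' : V ≤ basicOpenOf d f hf hfd := fun y hy ↦ by
      refine mem_basicOpenOf.2 (IsDenom.of_mul (m := d * m) h1 h2 ?_ hf hfd)
      rw [mul_comm _ f]
      exact mem_basicOpenOf.1 hy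
    have hηV : genericPt O ∈ V := genericPt_mem hx
    obtain ⟨s, hs⟩ := (exists_functionValue_eq_iff (φ := γ⁻¹) hηV).2 <| by
      refine (mem_regularOn_basicOpenOf (stabilizes_toSubmodule O) (by positivity) h1' h2').2 ⟨1, ?_⟩
      have e : act ((f * (f ^ m * γ)) ^ 1) γ⁻¹ = f ^ (m + 1) := by
        rw [act_eq_mul, pow_one, ← mul_assoc, mul_inv_cancel_right₀ hg, pow_succ']
      rw [e, mul_one]
      exact ⟨O.pow_mem hf _, pow_mem_poleLE hfd _⟩
    have hu : IsUnit ((latticeCurve O).presheaf.map (homOfLE hle').op g) := by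
      refine IsUnit.of_mul_eq_one s (functionValue_injective hηV ?_)
      rw [map_mul, functionValue_res, hs, map_one]
      exact mul_inv_cancel₀ hg
    have h3 := (latticeCurve O).basicOpen_res g (homOfLE hle').op
    rw [Scheme.basicOpen_of_isUnit _ hu] at h3
    have h4 : x ∈ V ⊓ (latticeCurve O).basicOpen g := h3 ▸ hx
    exact h4.2
  obtain ⟨n, h3, h4⟩ := (mem_regularOn_basicOpenOf hOW (by positivity) h1' h2').1
    (regularOn_anti hOW hle hφ)
  have e : GeomLattice.act ((f * (f ^ m * γ)) ^ n) φ = GeomLattice.act (f ^ ((m + 1) * n))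
      (GeomLattice.act (γ ^ n) φ) := by
    rw [act_act]
    congr 1
    rw [← mul_assoc, ← pow_succ', mul_pow, pow_mul]
  rw [e] at h3 h4
  rw [mul_assoc] at h4
  exact ⟨n, (mem_regularOn_basicOpenOf hOW hd hf hfd).2 ⟨_, h3, h4⟩⟩

end Localization

/-! ### Coherence -/

section AffineRestriction
open TopologicalSpace
variable {X : Scheme.{u}} {U : X.Opens} (hU : IsAffineOpen U)

theorem fromSpec_image_le (V : (Spec Γ(X, U)).Opens) : hU.fromSpec ''ᵁ V ≤ U :=
  (hU.fromSpec.image_le_opensRange V).trans hU.opensRange_fromSpec.le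

/-- Functions on an affine open subset, viewed as elements of the ring that it is the spectrum of. -/
theorem fromSpec_appIso_inv (V : (Spec Γ(X, U)).Opens) :
    (Scheme.ΓSpecIso Γ(X, U)).inv ≫ (Spec Γ(X, U)).presheaf.map V.leTop.op ≫ (hU.fromSpec.appIso V).inv =
      X.presheaf.map (homOfLE (fromSpec_image_le hU V)).op := by
  have h1 : (Scheme.ΓSpecIso Γ(X, U)).inv = hU.fromSpec.app U ≫
      (Spec Γ(X, U)).presheaf.map (eqToHom hU.fromSpec_preimage_self.symm).op := by
    rw [hU.fromSpec_app_self, Category.assoc, ← Functor.map_comp, ← op_comp, eqToHom_trans, eqToHom_refl,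
      op_id, CategoryTheory.Functor.map_id, Category.comp_id]
  rw [h1, Scheme.Hom.appIso_inv_naturality, Category.assoc, Scheme.Hom.appIso_inv_naturality_assoc,
    Scheme.Hom.app_appIso_inv_assoc, ← Functor.map_comp, ← Functor.map_comp]
  exact (X.presheaf.map_comp _ _).symm

end AffineRestriction

section Coherence
open HahnSeries TopologicalSpace PrimeSpectrum
variable {k A : Type u} [Field k] [NonUnitalNonAssocRing A] [Module k A]
  {O : Subalgebra k (HahnSeries ℤ k)} {W : Submodule k (HahnSeries ℤ A)} {hOW : Stabilizes O W}
  {F : (latticeCurve O).Modules} (D : LatticeModel F hOW)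
  {U : (latticeCurve O).Opens} (hU : IsAffineOpen U)

/-- The value map is equivariant for the action of `Γ(U)` on sections over open subsets of `Spec Γ(U)`. -/
theorem LatticeModel.val_smul_fromSpec (hη : genericPt O ∈ U)
    {V : (Spec Γ(latticeCurve O, U)).Opens} (hV : genericPt O ∈ hU.fromSpec ''ᵁ V)
    (r : Γ(latticeCurve O, U)) (s : Γ(F.restrict hU.fromSpec, V)) :
    D.val (hU.fromSpec ''ᵁ V) hV (r • s : Γ(F.restrict hU.fromSpec, V)) =
      act (functionValue hη r) (D.val (hU.fromSpec ''ᵁ V) hV s) := by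
  refine (D.smul _ hV ((hU.fromSpec.appIso V).inv ((Spec Γ(latticeCurve O, U)).presheaf.map V.leTop.op
    ((Scheme.ΓSpecIso Γ(latticeCurve O, U)).inv r))) s).trans ?_
  refine congrArg (fun x ↦ act x _) ((congrArg (functionValue hV)
    (ConcreteCategory.congr_hom (fromSpec_appIso_inv hU V) r)).trans ?_)
  exact functionValue_res _ hV hη r

include D in
/-- If sections over the basic open subsets of an affine open `U` extend to `U` after multiplication by a
power of the function, the sheaf is over `U` the sheaf attached to a module. -/
theorem LatticeModel.isIso_fromTildeΓ (hη : genericPt O ∈ U)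
    (h : ∀ g : Γ(latticeCurve O, U), functionValue hη g ≠ 0 →
      ∀ φ ∈ regularOn hOW ((latticeCurve O).basicOpen g),
        ∃ n : ℕ, GeomLattice.act (functionValue hη g ^ n) φ ∈ regularOn hOW U) :
    IsIso (Scheme.Modules.fromTildeΓ (R := Γ(latticeCurve O, U)) (F.restrict hU.fromSpec)) := by
  refine (isIso_fromTildeΓ_iff_isLocalizing (R := Γ(latticeCurve O, U)) _).2 ?_
  intro g
  let N := F.restrict hU.fromSpec
  have htop : hU.fromSpec ''ᵁ ⊤ = U := by
    rw [Scheme.Hom.image_top_eq_opensRange, hU.opensRange_fromSpec]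
  have hη' : genericPt O ∈ hU.fromSpec ''ᵁ ⊤ := htop.ge hη
  -- the locus of `g = 0` is empty and does not contain the generic point, so that sections over it have no value
  by_cases hg : functionValue hη g = 0
  · have hg0 (s : Γ(N, ⊤)) : g • s = 0 := by
      refine D.injective _ hη' ?_
      refine (D.val_smul_fromSpec hU hη hη' g s).trans ?_
      rw [hg, zero_act]
      exact (map_zero (D.val _ hη')).symm
    have hu := N.isUnit_algebraMap_end_of_le_basicOpen g (U := basicOpen g) le_rfl
    have hg1 : g = 0 := functionValue_injective hη (hg.trans (map_zero _).symm)
    refine IsLocalizedModule.Away.mk_of_addCommGroup hu (fun x ↦ ⟨1, 0, ?_⟩) fun s _ ↦ ⟨1, ?_⟩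
    · rw [pow_one, map_zero]
      exact (congrArg (fun r ↦ (r • x : Γ(N, basicOpen g))) hg1).trans (zero_smul _ x)
    · rw [pow_one]
      exact hg0 s
  · have hηg : genericPt O ∈ hU.fromSpec ''ᵁ basicOpen g := by
      rw [hU.fromSpec_image_basicOpen]
      have := isIntegral_latticeCurve (O := O)
      have hne : (latticeCurve O).basicOpen g ≠ ⊥ := fun h0 ↦ by
        exact hg (by rw [(AlgebraicGeometry.basicOpen_eq_bot_iff g).1 h0, map_zero])
      obtain ⟨x, hx⟩ := (Opens.ne_bot_iff_nonempty _).1 hne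
      exact genericPt_mem hx
    refine IsLocalizedModule.Away.mk_of_addCommGroup
      (N.isUnit_algebraMap_end_of_le_basicOpen g (U := basicOpen g) le_rfl) (fun x ↦ ?_) fun s hs ↦ ⟨0, ?_⟩
    · obtain ⟨n, hn⟩ := h g hg (D.val _ hηg x)
        (regularOn_anti hOW (hU.fromSpec_image_basicOpen g).ge ((D.range _ hηg _).1 ⟨x, rfl⟩))
      obtain ⟨s, hs⟩ := (D.range (hU.fromSpec ''ᵁ ⊤) hη' _).2 (by rwa [htop])
      refine ⟨n, s, D.injective _ hηg ?_⟩
      refine (D.val_smul_fromSpec hU hη hηg (g ^ n) x).trans ?_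
      rw [map_pow, ← hs]
      exact (D.res (hU.fromSpec.opensFunctor.map (homOfLE le_top)) hηg hη' s).symm
    · rw [pow_zero, one_smul]
      refine D.injective _ hη' ?_
      refine (D.res (hU.fromSpec.opensFunctor.map (homOfLE le_top)) hηg hη' s).symm.trans ?_
      refine (congrArg (D.val _ hηg) hs).trans ?_
      exact (map_zero (D.val _ hηg)).trans (map_zero (D.val _ hη')).symm

include D in
/-- A generating space of series gives a finite generating set of sections. -/
theorem LatticeModel.finite_sections (hη : genericPt O ∈ U) (h : IsGenerating hOW U) :
    Module.Finite Γ(latticeCurve O, U) Γ(F.restrict hU.fromSpec, ⊤) := by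
  obtain ⟨T₀, hT₀, hle, hT⟩ := h
  let N := F.restrict hU.fromSpec
  have htop : hU.fromSpec ''ᵁ ⊤ = U := by
    rw [Scheme.Hom.image_top_eq_opensRange, hU.opensRange_fromSpec]
  have hη' : genericPt O ∈ hU.fromSpec ''ᵁ ⊤ := htop.ge hη
  have hex (φ : HahnSeries ℤ A) (hφ : φ ∈ regularOn hOW U) : ∃ s : Γ(N, ⊤), D.val _ hη' s = φ :=
    (D.range (hU.fromSpec ''ᵁ ⊤) hη' φ).2 (by rwa [htop])
  obtain ⟨S, hS⟩ := (Submodule.fg_iff_finiteDimensional T₀).2 hT₀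
  have hSr (φ : S) : φ.1 ∈ regularOn hOW U := hle (hS ▸ Submodule.subset_span φ.2)
  choose σ hσ using fun φ : S ↦ hex φ.1 (hSr φ)
  have hk (c : k) (φ : HahnSeries ℤ A) :
      c • φ = GeomLattice.act (functionValue hη (scalars (latticeCurveHom O) U c)) φ := by
    rw [functionValue_scalars, act_C]
  let P : Submodule Γ(latticeCurve O, U) Γ(N, ⊤) := Submodule.span _ (Set.range σ)
  let T : Submodule k (HahnSeries ℤ A) :=
    { carrier := {φ | ∃ s ∈ P, D.val _ hη' s = φ}
      zero_mem' := ⟨0, P.zero_mem, map_zero (D.val _ hη')⟩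
      add_mem' := by
        rintro _ _ ⟨s, hs, rfl⟩ ⟨t, ht, rfl⟩
        exact ⟨s + t, P.add_mem hs ht, map_add (D.val _ hη') s t⟩
      smul_mem' := by
        rintro c _ ⟨s, hs, rfl⟩
        refine ⟨_, P.smul_mem (scalars (latticeCurveHom O) U c) hs, ?_⟩
        rw [hk]
        exact D.val_smul_fromSpec hU hη hη' _ s }
  have h1 : T₀ ≤ T := by
    rw [← hS, Submodule.span_le]
    exact fun φ hφ ↦ ⟨σ ⟨φ, hφ⟩, Submodule.subset_span ⟨_, rfl⟩, hσ _⟩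
  have h2 := hT T h1 <| by
    rintro r hr _ ⟨s, hs, rfl⟩
    obtain ⟨ρ, rfl⟩ := (exists_functionValue_eq_iff hη).2 hr
    exact ⟨ρ • s, P.smul_mem ρ hs, D.val_smul_fromSpec hU hη hη' ρ s⟩
  refine ⟨Submodule.fg_def.2 ⟨Set.range σ, Set.finite_range σ, eq_top_iff.2 fun s _ ↦ ?_⟩⟩
  obtain ⟨t, ht, hts⟩ := h2 (regularOn_anti hOW htop.ge ((D.range _ hη' _).1 ⟨s, rfl⟩))
  exact D.injective _ hη' hts ▸ ht

end Coherence

section Coherent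
open HahnSeries TopologicalSpace
variable {k A : Type u} [Field k] [NonUnitalNonAssocRing A] [Module k A] [FiniteDimensional k A]
  {O : Subalgebra k (HahnSeries ℤ k)} {W : Submodule k (HahnSeries ℤ A)} {hOW : Stabilizes O W}
  {F : (latticeCurve O).Modules} (D : LatticeModel F hOW)

include D in
/-- Every point lies in `D₊(t)` or, if it is the point at infinity, in `D₊(tᵈ f)` for some `f` of pole order
`d > 0`. -/
theorem LatticeModel.isCoherent (hO : IsLattice (Subalgebra.toSubmodule O)) (hW : IsLattice W) :
    IsCoherent F := fun x ↦ by
  obtain ⟨d, f, hf, hfd, hd, hx, hgen⟩ : ∃ (d : ℕ) (f : HahnSeries ℤ k) (hf : f ∈ O)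
      (hfd : f ∈ poleLE k k d), 0 < d ∧ x ∈ basicOpenOf d f hf hfd ∧
        IsGenerating hOW (basicOpenOf d f hf hfd) := by
    by_cases hx : x ∈ affinePart O
    · exact ⟨1, 1, _, _, one_pos, hx, isGenerating_affinePart hO hOW hW⟩
    · obtain ⟨d, f, hf, hfd, hd, h0, -⟩ := exists_leading_basicOpenOf_le (hO := hO)
        (V := ⊤) trivial
      exact ⟨d, f, hf, hfd, hd, eq_infinityPt_of_notMem (hO := hO) hx ▸ basicOpenOf_infinityPt h0,
        isGenerating_basicOpenOf hOW hW hd hf hfd h0⟩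
  have hU : IsAffineOpen (basicOpenOf d f hf hfd) :=
    Proj.isAffineOpen_basicOpen (grPiece O) _ (grMonomial_mem O d f hf hfd) hd
  have hη := genericPt_mem hx
  have := D.isIso_fromTildeΓ hU hη fun g hg φ hφ ↦
    exists_pow_act_mem_regularOn hOW hd hf hfd hη g hg hφ
  exact ⟨_, hx, hU, _, D.finite_sections hU hη hgen,
    ⟨(asIso (Scheme.Modules.fromTildeΓ (R := Γ(latticeCurve O, basicOpenOf d f hf hfd))
      (F.restrict hU.fromSpec))).symm⟩⟩

end Coherent

/-! ### The grading and the sections on the affine part -/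

section Grading
variable {k A : Type u} [Field k] [NonUnitalNonAssocRing A] [Module k A]
  {O : Subalgebra k (HahnSeries ℤ k)} {W : Submodule k (HahnSeries ℤ A)} (hOW : Stabilizes O W)

theorem GrMod.coeff_coeAddMonoidHom (x : DirectSum ℤ fun j ↦ grModPiece hOW j) (j : ℤ) :
    (DirectSum.coeAddMonoidHom (grModPiece hOW) x).coeff j = (x j : GrMod hOW).coeff j := by
  induction x using DirectSum.induction_on with
  | zero => simp
  | of i m =>
    rw [DirectSum.coeAddMonoidHom_of]
    by_cases h : j = i
    · subst h
      rw [DirectSum.of_eq_same]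
    · rw [DirectSum.of_eq_of_ne _ _ _ h, m.2 j h]
      rfl
  | add x y hx hy =>
    rw [map_add, GrMod.coeff_add, hx, hy, DirectSum.add_apply, AddMemClass.coe_add, GrMod.coeff_add]

/-- The pieces `tⁿ Wₙ` of `gr(W)`, for all integers `n`, form a direct sum decomposition. -/
theorem isInternal_grModPiece : DirectSum.IsInternal (grModPiece hOW) := by
  refine ⟨fun x y h ↦ DFinsupp.ext fun j ↦ Subtype.ext (GrMod.ext fun i ↦ ?_), fun m ↦ ?_⟩
  · by_cases hij : i = j
    · subst hij
      rw [← GrMod.coeff_coeAddMonoidHom, h, GrMod.coeff_coeAddMonoidHom]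
    · rw [(x j).2 i hij, (y j).2 i hij]
  · let S : Finset ℤ := Finsupp.support (M := HahnModule ℤ k A) (grModVal hOW m)
    refine ⟨DirectSum.mk (fun j ↦ grModPiece hOW j) S fun j ↦ ⟨grModMonomial hOW j _
      (m.coeff_mem j).1 (m.coeff_mem j).2, grModMonomial_mem hOW j _ (m.coeff_mem j).1 (m.coeff_mem j).2⟩,
      GrMod.ext fun j ↦ ?_⟩
    rw [GrMod.coeff_coeAddMonoidHom]
    by_cases h : j ∈ S
    · rw [DirectSum.mk_apply_of_mem h, coeff_grModMonomial, if_pos rfl]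
    · rw [DirectSum.mk_apply_of_notMem h]
      exact ((HahnModule.of k).symm_apply_eq.2 (Finsupp.notMem_support_iff.1 h)).symm

end Grading

section AffineSections
open HahnSeries TopologicalSpace
variable {k A : Type u} [Field k] [NonUnitalNonAssocRing A] [Module k A]
  {O : Subalgebra k (HahnSeries ℤ k)} {W : Submodule k (HahnSeries ℤ A)} (hOW : Stabilizes O W)
  {hO : IsLattice (Subalgebra.toSubmodule O)}

theorem grT_pow (n : ℕ) : grT O ^ n = grMonomial O n 1 O.one_mem (one_mem_poleLE (Int.natCast_nonneg n)) := by
  rw [grT, grMonomial_pow 1 n 1 O.one_mem (one_mem_poleLE (Int.natCast_nonneg 1))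
    (O.pow_mem O.one_mem n) (pow_mem_poleLE (one_mem_poleLE (Int.natCast_nonneg 1)) n)]
  exact grMonomial_congr (one_mul n) (one_pow n) _ _ _ _

theorem isDenom_one_of_mem_affinePart {x : latticeCurve O} (hx : x ∈ affinePart O) (n : ℕ) :
    IsDenom x n (1 : HahnSeries ℤ k) := by
  have := (mem_affinePart.1 hx).pow n
  rwa [one_mul, one_pow] at this

/-- Every `f ∈ O` is a function on the complement of the point at infinity, with denominator a power
of `t`. -/
theorem exists_function_affinePart (n : ℕ) (f : HahnSeries ℤ k) (hf : f ∈ O) (hn : f ∈ poleLE k k n) :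
    ∃ s : Γ(latticeCurve O, affinePart O), functionValue genericPt_mem_affinePart s = f ∧
      ∀ x : affinePart O, algebraMap (GrRing O) (Localization (complAt (grPiece O) x.1)) (grT O ^ n) *
        evalAt (grPiece O) x s = algebraMap (GrRing O) _ (grMonomial O n f hf hn) := by
  obtain ⟨s, hs⟩ := (exists_functionValue_eq_iff (φ := f) genericPt_mem_affinePart).2
    ((regularOn_affinePart (stabilizes_toSubmodule O)).ge hf)
  refine ⟨s, hs, fun x ↦ ?_⟩
  have h := isDenom_one_of_mem_affinePart x.2 n
  have h1 := isFunctionValueAt_mk h hf hn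
  rw [inv_one, one_mul] at h1
  rw [((functionValue_eq_iff genericPt_mem_affinePart).1 hs x).eq h1, grT_pow, Localization.mk_eq_mk']
  exact IsLocalization.mk'_spec' _ _ (⟨grMonomial O n 1 h.1 h.2.1, h.2.2⟩ : complAt (grPiece O) x.1)

/-- Every `w ∈ W` is a section on the complement of the point at infinity, with denominator a power of `t`. -/
theorem exists_section_affinePart (n : ℕ) (w : HahnSeries ℤ A) (hw : w ∈ W) (hn : w ∈ poleLE k A n) :
    ∃ s : LatticeSections hOW (affinePart O), sectionValue hOW genericPt_mem_affinePart s = w ∧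
      ∀ x : affinePart O, algebraMap (GrRing O) (Localization (complAt (grPiece O) x.1)) (grT O ^ n) •
        s.1 x = LocalizedModule.mk (grModMonomial hOW n w hw hn) 1 := by
  obtain ⟨s, hs⟩ := (exists_sectionValue_eq_iff (φ := w) genericPt_mem_affinePart).2
    ((regularOn_affinePart hOW).ge hw)
  refine ⟨s, hs, fun x ↦ ?_⟩
  have h := isDenom_one_of_mem_affinePart x.2 n
  have h1 := isValueAt_mk h hw hn (hOW := hOW)
  rw [inv_one, one_act] at h1
  rw [((sectionValue_eq_iff genericPt_mem_affinePart s).1 hs x).eq h1, grT_pow]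
  refine (algebraMap_smul _ _ _).trans ?_
  rw [LocalizedModule.smul'_mk]
  exact LocalizedModule.mk_cancel (⟨grMonomial O n 1 h.1 h.2.1, h.2.2⟩ : complAt (grPiece O) x.1) _

variable {F : (latticeCurve O).Modules} {hOW} (D : LatticeModel F hOW)

/-- The sections over the complement of the point at infinity are the elements of `W`. -/
noncomputable def LatticeModel.affinePartEquiv : Γ(F, affinePart O) ≃+ W :=
  AddEquiv.ofBijective
    ((D.val (affinePart O) genericPt_mem_affinePart).codRestrict W.toAddSubgroup fun s ↦
      (regularOn_affinePart hOW).le ((D.range _ genericPt_mem_affinePart _).1 ⟨s, rfl⟩))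
    ⟨fun s t h ↦ D.injective _ genericPt_mem_affinePart (congrArg Subtype.val h), fun w ↦ by
      obtain ⟨s, hs⟩ := (D.range _ genericPt_mem_affinePart w.1).2 ((regularOn_affinePart hOW).ge w.2)
      exact ⟨s, Subtype.ext hs⟩⟩

theorem setOf_isExpansion : {φ | ∃ s : Γ(latticeCurve O, affinePart O),
    IsExpansion (completedLocalRingEquiv hO) s φ} = O := by
  ext φ
  simp only [isExpansion_iff genericPt_mem_affinePart, Set.mem_ofPred_eq, eq_comm (a := φ)]
  exact (exists_functionValue_eq_iff genericPt_mem_affinePart).trans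
    (SetLike.ext_iff.1 (regularOn_affinePart (stabilizes_toSubmodule O)) φ)

theorem LatticeModel.setOf_isModExpansion [FiniteDimensional k A] (hW : IsLattice W) :
    {φ | ∃ s : Γ(F, affinePart O),
      IsModExpansion (completedLocalRingEquiv hO) (D.completedStalkEquiv hW hO) s φ} = W := by
  ext φ
  simp only [D.isModExpansion_iff hW genericPt_mem_affinePart, Set.mem_ofPred_eq, eq_comm (a := φ)]
  rw [D.range, regularOn_affinePart]
  rfl

include D in
theorem LatticeModel.finite_cohomology (hO : IsLattice (Subalgebra.toSubmodule O)) (hW : IsLattice W) :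
    Module.Finite k (Cohomology (latticeCurveHom O) F 0) ∧
      Module.Finite k (Cohomology (latticeCurveHom O) F 1) ∧
      Module.finrank k (Cohomology (latticeCurveHom O) F 0) = index₀ W ∧
      Module.finrank k (Cohomology (latticeCurveHom O) F 1) = index₁ W := by
  obtain ⟨e₀⟩ := D.exists_H_zero_equiv hO
  obtain ⟨e₁⟩ := D.exists_H_one_equiv hO hW
  have := hW.finite_inter
  have := hW.finite_quotient
  exact ⟨.equiv e₀.symm, .equiv e₁.symm, e₀.finrank_eq, e₁.finrank_eq⟩

end AffineSections

end GeomLattice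

open AlgebraicGeometry CategoryTheory GeomLattice
theorem mainTheorem7 {k : Type u} [Field k] [CharZero k] (O : Subalgebra k (HahnSeries ℤ k))
    (hO : IsLattice (Subalgebra.toSubmodule O)) :
    -- `O` has Krull dimension one, and `O ∩ k[[z]] = k`
    (ringKrullDim O = 1 ∧ index₀ (Subalgebra.toSubmodule O) = 1 ∧
      integralPart k k ⊓ Subalgebra.toSubmodule O = Subalgebra.toSubmodule ⊥) ∧
    -- `X = Proj(gr(O))` is an integral projective curve, of arithmetic genus `dim k((z)) / (k[[z]] + O)`
    (IsIntegral (latticeCurve O) ∧ IsProjective (latticeCurveHom O) ∧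
      topologicalKrullDim (latticeCurve O) = 1 ∧
      Module.Finite k (Cohomology (latticeCurveHom O) (structureModule (latticeCurve O)) 0) ∧
      Module.Finite k (Cohomology (latticeCurveHom O) (structureModule (latticeCurve O)) 1) ∧
      Module.finrank k (Cohomology (latticeCurveHom O) (structureModule (latticeCurve O)) 1) =
        index₁ (Subalgebra.toSubmodule O) ∧
      arithmeticGenus (latticeCurveHom O) = index₁ (Subalgebra.toSubmodule O)) ∧
    -- the point `p`, its complement `U`, the isomorphism `c` and the induced isomorphism `e`
    ∃ (p : latticeCurve O) (U : (latticeCurve O).Opens)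
      (c : CompletedLocalRing p ≃+* PowerSeries k) (e : Spec (.of O) ≅ U.toScheme),
      (ProjectiveSpectrum.asHomogeneousIdeal (𝒜 := grPiece O) p).toIdeal = Ideal.span {grT O} ∧
      (U : Set (latticeCurve O)) = {p}ᶜ ∧
      IsRationalPoint (latticeCurveHom O) p ∧ IsSmoothAt (latticeCurveHom O) p ∧
      -- `c` and `e` are defined over `k`
      (∀ a : k, c (completedGerm (Set.mem_univ p : p ∈ (⊤ : (latticeCurve O).Opens))
        (scalars (latticeCurveHom O) ⊤ a)) = PowerSeries.C a) ∧
      e.hom ≫ U.ι ≫ latticeCurveHom O = Spec.map (CommRingCat.ofHom (algebraMap k O)) ∧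
      -- on functions on `U`, the extension of `c` to fields of fractions is the pullback along `e`
      (∀ (s : Γ(latticeCurve O, U)) (φ : HahnSeries ℤ k), IsExpansion c s φ ↔
        φ = ((Scheme.ΓSpecIso (.of O)).hom (e.hom.appTop (U.topIso.inv s)) : O)) ∧
      {φ | ∃ s : Γ(latticeCurve O, U), IsExpansion c s φ} = O ∧
      -- it maps the function `tⁿ f / tⁿ` to `f`
      (∀ (n : ℕ) (f : HahnSeries ℤ k) (hf : f ∈ O) (hn : f ∈ poleLE k k n),
        ∃ s : Γ(latticeCurve O, U), IsExpansion c s f ∧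
          ∀ x : U, algebraMap (GrRing O) (Localization (complAt (grPiece O) x.1)) (grT O ^ n) *
            evalAt (grPiece O) x s = algebraMap (GrRing O) _ (grMonomial O n f hf hn)) ∧
      ∀ (A : Type u) [NonUnitalNonAssocRing A] [Module k A] [SMulCommClass k A A]
        [IsScalarTower k A A] [FiniteDimensional k A] (W : Submodule k (HahnSeries ℤ A))
        (hW : IsLattice W) (hOW : Stabilizes O W),
        -- `gr(W)` is graded, and its sheaf of algebras is coherent and torsion-free
        (DirectSum.IsInternal (grModPiece hOW) ∧
          IsCoherent (latticeSheaf hOW hW).toModules ∧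
          IsTorsionFree (latticeSheaf hOW hW).toModules) ∧
        -- the isomorphism `ζ` of the completed stalk at `p`
        (∃ (ζ : CompletedStalk (latticeSheaf hOW hW).toModules p ≃+ integralPart k A)
          (ζ' : Γ((latticeSheaf hOW hW).toModules, U) ≃+ W),
          (∀ (r : CompletedLocalRing p) (m : CompletedStalk (latticeSheaf hOW hW).toModules p),
            (ζ (r • m) : HahnSeries ℤ A) = act (HahnSeries.ofPowerSeries ℤ k (c r)) (ζ m)) ∧
          (∀ a b : CompletedStalk (latticeSheaf hOW hW).toModules p,
            (ζ (completedMul (latticeSheaf hOW hW) a b) : HahnSeries ℤ A) = ζ a * ζ b) ∧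
          -- the extension of `ζ` maps the sections over `U` bijectively onto `W`
          (∀ (s : Γ((latticeSheaf hOW hW).toModules, U)) (φ : HahnSeries ℤ A),
            IsModExpansion c ζ s φ ↔ φ = ζ' s) ∧
          {φ | ∃ s : Γ((latticeSheaf hOW hW).toModules, U), IsModExpansion c ζ s φ} = W ∧
          -- it maps the section `tⁿ w / tⁿ` to `w`
          (∀ (n : ℕ) (w : HahnSeries ℤ A) (hw : w ∈ W) (hn : w ∈ poleLE k A n),
            ∃ s : projSections (𝒮 := grPiece O) (ℳ := grModPiece hOW)
                (fun _ _ _ _ ↦ grPiece_smul_mem hOW) U,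
              IsModExpansion (F := (latticeSheaf hOW hW).toModules) (U := U) c ζ s w ∧
              ∀ x : U, algebraMap (GrRing O) (Localization (complAt (grPiece O) x.1)) (grT O ^ n) •
                s.1 x = LocalizedModule.mk (grModMonomial hOW n w hw hn) 1)) ∧
        -- the cohomology of the sheaf of algebras is given by the index of `W`
        (Module.Finite k (Cohomology (latticeCurveHom O) (latticeSheaf hOW hW).toModules 0) ∧
          Module.Finite k (Cohomology (latticeCurveHom O) (latticeSheaf hOW hW).toModules 1) ∧
          Module.finrank k (Cohomology (latticeCurveHom O) (latticeSheaf hOW hW).toModules 0) =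
            index₀ W ∧
          Module.finrank k (Cohomology (latticeCurveHom O) (latticeSheaf hOW hW).toModules 1) =
            index₁ W) := by
  have hO₀ : index₀ (Subalgebra.toSubmodule O) = 1 := hO.index₀_eq_one
  obtain ⟨fin₀, fin₁, dim₀, dim₁⟩ := (structureModel O).finite_cohomology hO hO
  refine ⟨⟨hO.ringKrullDim_eq_one, hO₀, hO.inf_eq_bot⟩,
    ⟨isIntegral_latticeCurve, isProjective_latticeCurveHom hO, topologicalKrullDim_latticeCurve hO,
      fin₀, fin₁, dim₁, ?_⟩,
    infinityPt hO, affinePart O, completedLocalRingEquiv hO, specIsoAffinePart O,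
    infinityIdeal_eq hO, coe_affinePart, isRationalPoint_infinityPt hO, isSmoothAt_infinityPt hO,
    completedLocalRingEquiv_scalars, specIsoAffinePart_over, fun s φ ↦ ?_, setOf_isExpansion,
    fun n f hf hn ↦ ?_, fun A _ _ _ _ _ W hW hOW ↦ ?_⟩
  · rw [arithmeticGenus, dim₀, dim₁, hO₀]
    simp
  · rw [isExpansion_iff genericPt_mem_affinePart, specIsoAffinePart_apply, coe_affinePartRingEquiv]
  · obtain ⟨s, hs, h⟩ := exists_function_affinePart n f hf hn
    exact ⟨s, (isExpansion_iff genericPt_mem_affinePart).2 hs.symm, h⟩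
  · let D := latticeModel hOW hW
    refine ⟨⟨isInternal_grModPiece hOW, D.isCoherent hO hW, D.isTorsionFree⟩,
      ⟨D.completedStalkEquiv hW hO, D.affinePartEquiv, D.completedStalkEquiv_smul hW,
        completedStalkEquiv_mul hOW hW, fun s φ ↦ D.isModExpansion_iff hW genericPt_mem_affinePart,
        D.setOf_isModExpansion hW, fun n w hw hn ↦ ?_⟩, D.finite_cohomology hO hW⟩
    obtain ⟨s, hs, h⟩ := exists_section_affinePart hOW n w hw hn
    exact ⟨s, (D.isModExpansion_iff hW genericPt_mem_affinePart).2 hs.symm, h⟩
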